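/- Let $p\neq 2$ be a prime, $F$ a finite extension of $\mathbb{Q}_p$ with residue field of cardinality $q$, and $P_F\subset I_F\subset W_F$ the wild inertia group, the inertia group and the Weil group of $F$. Fix an element $s\in I_F$ whose image topologically generates $I_F/P_F$, and a lift $Fr\in W_F$ of the Frobenius automorphism. Let $n\ge 0$. By a Langlands parameter we mean a continuous homomorphism $\psi:W_F\times SL(2,\mathbb{C})\to Sp(2n,\mathbb{C})$ such that $\psi(w)$ is semisimple for all $w\in W_F$ and $\psi|_{SL(2,\mathbb{C})}$ is algebraic. It has level $0$ if it is trivial on $P_F$, and it is discrete if its image is not contained in a proper Levi subgroup of $Sp(2n,\mathbb{C})$. Let $\chi:I_F\to Sp(2n,\mathbb{C})$ be a continuous homomorphism trivial on $P_F$. Let $VP(\chi)$ be the set of eigenvalues of $\chi(s)$ and $mult(u)$ the multiplicity of $u\in VP(\chi)$. For $u\in VP(\chi)$ let $[u]$ be its class for the equivalence relation on $VP(\chi)$ generated by $u\sim u^q$, and let $[VP(\chi)]$ be the set of classes. Assume that for every $u\in VP(\chi)$ one has $u^q\in VP(\chi)$, $mult(u^q)=mult(u)$, and $u^{-1}\in[u]$.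 Put $m([u])=mult(u)$, and for $u\ne\pm1$ let $\ell_{[u]}$ be the least integer $\ell \geq 0$ with $u^{-1}=u^{q^{\ell}}$. A unipotent orbit of $GL(M,\mathbb{C})$ is called symplectic (resp. orthogonal) if all its Jordan blocks have even (resp. odd) size, and discrete if it has at most one Jordan block of each size. Proposition. The set of $Sp(2n,\mathbb{C})$-conjugacy classes of discrete Langlands parameters $\psi$ of level $0$ whose restriction to $I_F$ is conjugate to $\chi$ is in bijection with the set of collections of integers $m([u],\zeta)\ge 0$ and unipotent orbits $U_{[u],\zeta}$ of $GL(m([u],\zeta),\mathbb{C})$, for $[u]\in[VP(\chi)]$ and $\zeta\in\{\pm1\}$, such that $$m([u],+)+m([u],-)=m([u])\quad\text{for all }[u]\in[VP(\chi)],$$ for $u\neq\pm1$ the orbit $U_{[u],+}$ is discrete symplectic and the orbit $U_{[u],-}$ is discrete orthogonal, and for $u=\pm1$ both orbits $U_{[u],+}$ and $U_{[u],-}$ are discrete symplectic. More precisely, there is such a bijection with the following property: if the class of $\psi$ corresponds to $(U_{[u],\zeta})$, then for every $u\in VP(\chi)$ and $\zeta\in\{\pm1\}$, $U_{[u],\zeta}$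 is the orbit of the action of $\psi\begin{pmatrix}1&1\\0&1\end{pmatrix}$ on the space $V[u,\zeta]$ of vectors $v\in\mathbb{C}^{2n}$ with $\psi(s)v=uv$ and $F_uv=\zeta v$, where $F_u=\psi(Fr)$ if $u=\pm1$ and $F_u=\psi(Fr)^{2\ell_{[u]}}$ otherwise. -/

import Mathlib

open Matrix

noncomputable section

/-! ### The local field, its Galois group, inertia and the Weil group

`F` is a finite extension of `ℚ_[p]`; `spectralNorm ℚ_[p] L` is the unique extension of the `p`-adic
absolute value to an algebraic extension `L` of `ℚ_[p]`. -/

section LocalField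

set_option linter.unusedSectionVars false

variable (p : ℕ) [Fact p.Prime]

section Integers

variable (L : Type*) [Field L] [Algebra ℚ_[p] L] [Algebra.IsAlgebraic ℚ_[p] L]

/-- The valuation ring of an algebraic extension of `ℚ_[p]`. -/
def padicIntegers : ValuationSubring L where
  carrier := {x | spectralNorm ℚ_[p] L x ≤ 1}
  mul_mem' {x y} hx hy := by
    have h : spectralNorm ℚ_[p] L (x * y) = _ := spectralAlgNorm_mul x y
    rw [Set.mem_ofPred_eq, h]
    exact mul_le_one₀ hx (spectralNorm_nonneg _) hy
  one_mem' := (spectralNorm_one (K := ℚ_[p]) (L := L)).le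
  add_mem' {x y} hx hy := (isNonarchimedean_spectralNorm x y).trans (max_le hx hy)
  zero_mem' := by simp [spectralNorm_zero]
  neg_mem' {x} hx := by
    rw [Set.mem_ofPred_eq, spectralNorm_neg (Algebra.IsAlgebraic.isAlgebraic x)]
    exact hx
  mem_or_inv_mem' x := by
    by_cases hx : spectralNorm ℚ_[p] L x ≤ 1
    · exact Or.inl hx
    · right
      have hx0 : x ≠ 0 := by
        rintro rfl
        exact hx (by simp [spectralNorm_zero])
      have h : spectralNorm ℚ_[p] L (x * x⁻¹) = _ := spectralAlgNorm_mul x x⁻¹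
      rw [mul_inv_cancel₀ hx0, spectralNorm_one] at h
      change spectralNorm ℚ_[p] L x⁻¹ ≤ 1
      by_contra hlt
      push Not at hx hlt
      have h' : (1 : ℝ) = spectralNorm ℚ_[p] L x * spectralNorm ℚ_[p] L x⁻¹ := h
      nlinarith

/-- The cardinality of the residue field. -/
def residueCard : ℕ := Nat.card (IsLocalRing.ResidueField (padicIntegers p L))

end Integers

variable (F : Type*) [Field F] [Algebra ℚ_[p] F] [FiniteDimensional ℚ_[p] F]

instance algebraicClosure_isAlgebraic_padic : Algebra.IsAlgebraic ℚ_[p] (AlgebraicClosure F) :=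
  Algebra.IsAlgebraic.trans ℚ_[p] F (AlgebraicClosure F)

/-- The absolute value on the algebraic closure of `F`. -/
def absBar (x : AlgebraicClosure F) : ℝ := spectralNorm ℚ_[p] (AlgebraicClosure F) x

variable {p F} in
theorem absBar_galois (σ : Gal(AlgebraicClosure F/F)) (x : AlgebraicClosure F) :
    absBar p F (σ x) = absBar p F x :=
  (spectralNorm_eq_of_equiv (σ.restrictScalars ℚ_[p]) x).symm

variable {p F} in
theorem absBar_add_lt {x y : AlgebraicClosure F} {r : ℝ} (hx : absBar p F x < r)
    (hy : absBar p F y < r) : absBar p F (x + y) < r :=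
  (isNonarchimedean_spectralNorm x y).trans_lt (max_lt hx hy)

variable {p F} in
theorem absBar_neg (x : AlgebraicClosure F) : absBar p F (-x) = absBar p F x :=
  spectralNorm_neg (Algebra.IsAlgebraic.isAlgebraic x)

variable {p F} in
theorem absBar_mul (x y : AlgebraicClosure F) :
    absBar p F (x * y) = absBar p F x * absBar p F y :=
  spectralAlgNorm_mul x y

variable {p F} in
theorem absBar_sub_comm (x y : AlgebraicClosure F) :
    absBar p F (x - y) = absBar p F (y - x) := by
  rw [← absBar_neg, neg_sub]

variable {p F} in
theorem absBar_sub_trans {x y z : AlgebraicClosure F} {r : ℝ} (h : absBar p F (x - y) < r)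
    (h' : absBar p F (y - z) < r) : absBar p F (x - z) < r := by
  have := absBar_add_lt h h'
  rwa [sub_add_sub_cancel] at this

variable {p F} in
theorem absBar_pow_le_one {x : AlgebraicClosure F} (hx : absBar p F x ≤ 1) (k : ℕ) :
    absBar p F (x ^ k) ≤ 1 :=
  (padicIntegers p (AlgebraicClosure F)).toSubring.pow_mem hx k

variable {p F} in
theorem absBar_pow_sub_pow_lt {x y : AlgebraicClosure F} (hx : absBar p F x ≤ 1)
    (hy : absBar p F y ≤ 1) (h : absBar p F (x - y) < 1) (k : ℕ) :
    absBar p F (x ^ k - y ^ k) < 1 := by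
  have hs : (∑ i ∈ Finset.range k, x ^ i * y ^ (k - 1 - i)) ∈
      (padicIntegers p (AlgebraicClosure F)).toSubring :=
    sum_mem fun i _ => mul_mem (pow_mem hx i) (pow_mem hy _)
  have hs' : absBar p F (∑ i ∈ Finset.range k, x ^ i * y ^ (k - 1 - i)) ≤ 1 := hs
  rw [← Commute.geom_sum₂_mul (Commute.all x y) k, absBar_mul]
  exact mul_lt_one_of_nonneg_of_lt_one_right hs' (spectralNorm_nonneg _) h

/-- The inertia group `I_F`: the automorphisms acting trivially on the residue field. -/
def inertiaGroup : Subgroup Gal(AlgebraicClosure F/F) where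
  carrier := {σ | ∀ x, absBar p F x ≤ 1 → absBar p F (σ x - x) < 1}
  one_mem' x _ := by simp [absBar, spectralNorm_zero]
  mul_mem' {σ τ} hσ hτ x hx := by
    refine absBar_sub_trans (hσ (τ x) ?_) (hτ x hx)
    rwa [absBar_galois]
  inv_mem' {σ} hσ x hx := by
    have h := hσ (σ⁻¹ x) (by rwa [absBar_galois])
    rw [← AlgEquiv.mul_apply, mul_inv_cancel, AlgEquiv.one_apply] at h
    rwa [absBar_sub_comm]

/-- The wild inertia group `P_F`: the automorphisms `σ` with `σ x / x` in `1 + 𝔪` for all nonzero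
`x` in the algebraic closure. -/
def wildInertiaGroup : Subgroup Gal(AlgebraicClosure F/F) where
  carrier := {σ | ∀ x, x ≠ 0 → absBar p F (σ x - x) < absBar p F x}
  one_mem' x hx := by
    have : 0 < spectralNorm ℚ_[p] (AlgebraicClosure F) x :=
      spectralNorm_zero_lt hx (Algebra.IsAlgebraic.isAlgebraic x)
    simpa [absBar, spectralNorm_zero] using this
  mul_mem' {σ τ} hσ hτ x hx := by
    refine absBar_sub_trans ?_ (hτ x hx)
    have h := hσ (τ x) (by simpa using hx)
    rwa [absBar_galois τ x] at h
  inv_mem' {σ} hσ x hx := by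
    have h := hσ (σ⁻¹ x) (by simpa using hx)
    rw [← AlgEquiv.mul_apply, mul_inv_cancel, AlgEquiv.one_apply, absBar_galois] at h
    rwa [absBar_sub_comm]

/-- The underlying subgroup of the Weil group: the automorphisms which act on the residue field
of the algebraic closure as an integral power `Frob ^ (b - a)` of `x ↦ x ^ q`. -/
def weilSubgroup : Subgroup Gal(AlgebraicClosure F/F) where
  carrier := {σ | ∃ a b : ℕ, ∀ x, absBar p F x ≤ 1 →
    absBar p F ((σ x) ^ (residueCard p F ^ a) - x ^ (residueCard p F ^ b)) < 1}
  one_mem' := ⟨0, 0, fun x _ => by simp [absBar, spectralNorm_zero]⟩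
  mul_mem' := by
    rintro σ τ ⟨a, b, hσ⟩ ⟨c, d, hτ⟩
    refine ⟨a + c, d + b, fun x hx => ?_⟩
    have hx' : absBar p F (τ x) ≤ 1 := by rwa [absBar_galois]
    have hx'' : absBar p F (σ (τ x)) ≤ 1 := by rwa [absBar_galois]
    have h1 := absBar_pow_sub_pow_lt (absBar_pow_le_one hx'' _) (absBar_pow_le_one hx' _)
      (hσ (τ x) hx') (residueCard p F ^ c)
    have h2 := absBar_pow_sub_pow_lt (absBar_pow_le_one hx' _) (absBar_pow_le_one hx _)
      (hτ x hx) (residueCard p F ^ b)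
    simp only [← pow_mul, ← pow_add] at h1 h2
    rw [add_comm c b] at h2
    exact absBar_sub_trans h1 h2
  inv_mem' := by
    rintro σ ⟨a, b, hσ⟩
    refine ⟨b, a, fun x hx => ?_⟩
    have h := hσ (σ⁻¹ x) (by rwa [absBar_galois])
    rw [← AlgEquiv.mul_apply, mul_inv_cancel, AlgEquiv.one_apply] at h
    rwa [absBar_sub_comm]

theorem inertiaGroup_le_weilSubgroup : inertiaGroup p F ≤ weilSubgroup p F :=
  fun _ hσ => ⟨0, 0, fun x hx => by simpa using hσ x hx⟩

/-- The Weil group `W_F`. -/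
def WeilGroup : Type _ := ↥(weilSubgroup p F)

instance : Group (WeilGroup p F) := inferInstanceAs (Group ↥(weilSubgroup p F))

/-- The inclusion of the Weil group in the Galois group. -/
def WeilGroup.toGal : WeilGroup p F →* Gal(AlgebraicClosure F/F) := (weilSubgroup p F).subtype

/-- The inclusion of the inertia group in the Weil group. -/
def inertiaToWeil : ↥(inertiaGroup p F) →* WeilGroup p F :=
  Subgroup.inclusion (inertiaGroup_le_weilSubgroup p F)

/-- The topology of the Weil group, in which the inertia group with its profinite topology is an
open subgroup: the coarsest topology for which both the inclusion in the Galois group and the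
projection to the discrete set `W_F / I_F` are continuous. -/
instance : TopologicalSpace (WeilGroup p F) :=
  TopologicalSpace.induced (WeilGroup.toGal p F) inferInstance ⊓
    TopologicalSpace.induced
      (fun w : WeilGroup p F => (QuotientGroup.mk w : WeilGroup p F ⧸ (inertiaToWeil p F).range)) ⊥

variable {p F}

/-- `w` is a lift of the Frobenius automorphism `x ↦ x ^ q` of the residue field. -/
def IsFrobeniusLift (w : WeilGroup p F) : Prop :=
  ∀ x, absBar p F x ≤ 1 → absBar p F (WeilGroup.toGal p F w x - x ^ residueCard p F) < 1

/-- The image of `s` in the profinite group `I_F / P_F` is a topological generator. -/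
def IsTameGenerator (s : ↥(inertiaGroup p F)) : Prop :=
  (Subgroup.zpowers (s : Gal(AlgebraicClosure F/F)) ⊔ wildInertiaGroup p F).topologicalClosure =
    inertiaGroup p F

end LocalField

/-! ### Symplectic groups and their Levi subgroups -/

/-- `Sp(2n, ℂ)`. -/
abbrev Sp (n : ℕ) : Type := ↥(symplecticGroup (Fin n) ℂ)

/-- `SL(2, ℂ)`. -/
abbrev SL2C : Type := SpecialLinearGroup (Fin 2) ℂ

/-- The linear automorphism of `ℂ ^ (2n)` given by an element of `Sp(2n, ℂ)`. -/
def Sp.toEnd {n : ℕ} (g : Sp n) : Module.End ℂ (Fin n ⊕ Fin n → ℂ) :=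
  Matrix.toLin' (g : Matrix (Fin n ⊕ Fin n) (Fin n ⊕ Fin n) ℂ)

/-- The standard symplectic form on `ℂ ^ (2n)`, preserved by `Sp(2n, ℂ)`. -/
def sympForm {n : ℕ} (v w : Fin n ⊕ Fin n → ℂ) : ℂ := v ⬝ᵥ (J (Fin n) ℂ *ᵥ w)

theorem sympForm_toEnd {n : ℕ} (g : Sp n) (v w : Fin n ⊕ Fin n → ℂ) :
    sympForm (g.toEnd v) (g.toEnd w) = sympForm v w := by
  have h := SymplecticGroup.mem_iff'.1 g.2
  simp only [sympForm, Sp.toEnd, toLin'_apply]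
  conv_rhs => rw [← h]
  rw [← mulVec_mulVec, ← mulVec_mulVec, dotProduct_mulVec v, vecMul_transpose]

/-- Levi subgroups of `Sp(2n, ℂ)`: there are nonzero subspaces `W i`, `W' i` of `ℂ ^ (2n)`,
`i < r`, such that `⨁ W i` and `⨁ W' i` are totally isotropic, `W i` is orthogonal to `W' j` for
`i ≠ j`, and `W i`, `W' i` are in perfect duality, and the subgroup is the stabilizer of all these
subspaces. It is isomorphic to `∏ GL(W i) × Sp(V₀)`, where `V₀` is the orthogonal of all of
them; the case `r = 0` is the whole group. -/
def IsLeviSubgroup {n : ℕ} (H : Subgroup (Sp n)) : Prop :=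
  ∃ (r : ℕ) (W W' : Fin r → Submodule ℂ (Fin n ⊕ Fin n → ℂ)),
    (∀ i, W i ≠ ⊥) ∧
    (∀ i j, ∀ v ∈ W i, ∀ w ∈ W j, sympForm v w = 0) ∧
    (∀ i j, ∀ v ∈ W' i, ∀ w ∈ W' j, sympForm v w = 0) ∧
    (∀ i j, i ≠ j → ∀ v ∈ W i, ∀ w ∈ W' j, sympForm v w = 0) ∧
    (∀ i, ∀ v ∈ W i, (∀ w ∈ W' i, sympForm v w = 0) → v = 0) ∧
    (∀ i, ∀ w ∈ W' i, (∀ v ∈ W i, sympForm v w = 0) → w = 0) ∧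
    ∀ g : Sp n, g ∈ H ↔ ∀ i, (∀ v ∈ W i, g.toEnd v ∈ W i) ∧ (∀ w ∈ W' i, g.toEnd w ∈ W' i)

/-! ### Langlands parameters -/

section Parameters

variable (p : ℕ) [Fact p.Prime] (F : Type*) [Field F] [Algebra ℚ_[p] F]
  [FiniteDimensional ℚ_[p] F] (n : ℕ)

variable {p F n} in
/-- `ψ` is a Langlands parameter: it is continuous, `ψ(w)` is semisimple for `w ∈ W_F`, and the
restriction of `ψ` to `SL(2, ℂ)` is a morphism of algebraic groups. -/
structure IsLanglandsParameter (ψ : WeilGroup p F × SL2C →* Sp n) : Prop where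
  continuous : Continuous ψ
  semisimple : ∀ w : WeilGroup p F, (ψ (w, 1)).toEnd.IsSemisimple
  algebraic : ∃ P : Fin n ⊕ Fin n → Fin n ⊕ Fin n → MvPolynomial (Fin 2 × Fin 2) ℂ,
    ∀ (g : SL2C) (i j : Fin n ⊕ Fin n),
      (ψ (1, g) : Matrix (Fin n ⊕ Fin n) (Fin n ⊕ Fin n) ℂ) i j =
        MvPolynomial.eval (fun k => (g : Matrix (Fin 2) (Fin 2) ℂ) k.1 k.2) (P i j)

variable {p F n} in
/-- `ψ` has level zero: it is trivial on wild inertia. -/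
def IsLevelZero (ψ : WeilGroup p F × SL2C →* Sp n) : Prop :=
  ∀ i : ↥(inertiaGroup p F), (i : Gal(AlgebraicClosure F/F)) ∈ wildInertiaGroup p F →
    ψ (inertiaToWeil p F i, 1) = 1

variable {p F n} in
/-- `ψ` is discrete: its image is not contained in a proper Levi subgroup of `Sp(2n, ℂ)`. -/
def IsDiscreteParameter (ψ : WeilGroup p F × SL2C →* Sp n) : Prop :=
  ∀ H : Subgroup (Sp n), IsLeviSubgroup H → ψ.range ≤ H → H = ⊤

variable {p F n} in
/-- The restriction of `ψ` to the inertia group is conjugate to `χ` in `Sp(2n, ℂ)`. -/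
def RestrictsTo (ψ : WeilGroup p F × SL2C →* Sp n) (χ : ↥(inertiaGroup p F) →* Sp n) : Prop :=
  ∃ g : Sp n, ∀ i, ψ (inertiaToWeil p F i, 1) = g * χ i * g⁻¹

variable {p F n}

/-- The discrete Langlands parameters of level zero whose restriction to inertia is conjugate
to `χ`. -/
def DiscreteParameter (χ : ↥(inertiaGroup p F) →* Sp n) : Type _ :=
  {ψ : WeilGroup p F × SL2C →* Sp n //
    IsLanglandsParameter ψ ∧ IsLevelZero ψ ∧ IsDiscreteParameter ψ ∧ RestrictsTo ψ χ}

/-- Conjugacy of parameters under `Sp(2n, ℂ)`. -/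
instance DiscreteParameter.setoid (χ : ↥(inertiaGroup p F) →* Sp n) :
    Setoid (DiscreteParameter χ) where
  r ψ ψ' := ∃ g : Sp n, ∀ x, ψ'.1 x = g * ψ.1 x * g⁻¹
  iseqv :=
    { refl := fun ψ => ⟨1, fun x => by simp⟩
      symm := by
        rintro ψ ψ' ⟨g, hg⟩
        exact ⟨g⁻¹, fun x => by rw [hg]; group⟩
      trans := by
        rintro ψ ψ' ψ'' ⟨g, hg⟩ ⟨h, hh⟩
        exact ⟨h * g, fun x => by rw [hh, hg]; group⟩ }

/-- Conjugacy classes of discrete parameters of level zero with restriction `χ` to inertia. -/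
abbrev DiscreteParameterClass (χ : ↥(inertiaGroup p F) →* Sp n) : Type _ :=
  Quotient (DiscreteParameter.setoid χ)

end Parameters

/-! ### Eigenvalues of the restriction to inertia -/

section Eigenvalues

variable {n : ℕ} (q : ℕ) (A : Sp n)

/-- The set of eigenvalues of `A`. -/
def VP : Set ℂ := {u | A.toEnd.HasEigenvalue u}

/-- The multiplicity of the eigenvalue `u` of `A` (used for semisimple `A`). -/
def eigMult (u : ℂ) : ℕ := Module.finrank ℂ (A.toEnd.eigenspace u)

/-- The set of classes `[u]` for the equivalence relation on the eigenvalues of `A` generated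
by `u ∼ u ^ q`. -/
def VPClass : Type := Quot (fun u v : VP A => (v : ℂ) = (u : ℂ) ^ q)

/-- The class `[u]`. -/
def VPClass.mk (u : VP A) : VPClass q A := Quot.mk _ u

/-- The least `ℓ` with `u⁻¹ = u ^ (q ^ ℓ)`. -/
def ell (u : ℂ) : ℕ := sInf {l : ℕ | u⁻¹ = u ^ (q ^ l)}

end Eigenvalues

/-! ### Unipotent orbits -/

/-- A unipotent orbit of `GL(M, ℂ)`: a conjugacy class of unipotent elements. -/
def UnipotentOrbit (M : ℕ) : Type :=
  {c : ConjClasses (GL (Fin M) ℂ) //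
    ∃ x : GL (Fin M) ℂ, ConjClasses.mk x = c ∧
      IsNilpotent ((x : Matrix (Fin M) (Fin M) ℂ) - 1)}

/-- The unipotent Jordan block of size `d`. -/
def unipotentJordanBlock (d : ℕ) : Matrix (Fin d) (Fin d) ℂ :=
  fun i j => if i = j ∨ (i : ℕ) + 1 = (j : ℕ) then 1 else 0

/-- `D` is the multiset of the sizes of the Jordan blocks of the orbit `U`. -/
def UnipotentOrbit.HasJordanBlocks {M : ℕ} (U : UnipotentOrbit M) (D : Multiset ℕ) : Prop :=
  ∃ (r : ℕ) (d : Fin r → ℕ), (∀ i, 0 < d i) ∧ D = Finset.univ.val.map d ∧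
    ∃ (e : (Σ i, Fin (d i)) ≃ Fin M) (x : GL (Fin M) ℂ), ConjClasses.mk x = U.1 ∧
      (x : Matrix (Fin M) (Fin M) ℂ) =
        Matrix.reindex e e (Matrix.blockDiagonal' fun i => unipotentJordanBlock (d i))

/-- All Jordan blocks are even. -/
def UnipotentOrbit.IsSymplectic {M : ℕ} (U : UnipotentOrbit M) : Prop :=
  ∃ D, U.HasJordanBlocks D ∧ ∀ d ∈ D, Even d

/-- All Jordan blocks are odd. -/
def UnipotentOrbit.IsOrthogonal {M : ℕ} (U : UnipotentOrbit M) : Prop :=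
  ∃ D, U.HasJordanBlocks D ∧ ∀ d ∈ D, Odd d

/-- There is at most one Jordan block of any given size. -/
def UnipotentOrbit.IsDiscrete {M : ℕ} (U : UnipotentOrbit M) : Prop :=
  ∃ D, U.HasJordanBlocks D ∧ D.Nodup

/-- The collections of unipotent orbits `U_{[u], ζ}` of `GL(m([u], ζ), ℂ)`, for `[u]` a class of
eigenvalues of `A` and `ζ = ±1`. -/
structure OrbitCollection {n : ℕ} (q : ℕ) (A : Sp n) where
  /-- the integers `m([u], ζ)` -/
  m : VPClass q A → ℤˣ → ℕ
  /-- the orbits `U_{[u], ζ}` -/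
  U : ∀ (c : VPClass q A) (ζ : ℤˣ), UnipotentOrbit (m c ζ)
  m_add : ∀ u : VP A, m (VPClass.mk q A u) 1 + m (VPClass.mk q A u) (-1) = eigMult A u
  discrete : ∀ c ζ, (U c ζ).IsDiscrete
  symplectic_pos : ∀ u : VP A, (u : ℂ) ≠ 1 → (u : ℂ) ≠ -1 →
    (U (VPClass.mk q A u) 1).IsSymplectic
  orthogonal_neg : ∀ u : VP A, (u : ℂ) ≠ 1 → (u : ℂ) ≠ -1 →
    (U (VPClass.mk q A u) (-1)).IsOrthogonal
  symplectic_pm_one : ∀ u : VP A, (u : ℂ) = 1 ∨ (u : ℂ) = -1 →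
    ∀ ζ, (U (VPClass.mk q A u) ζ).IsSymplectic

/-! ### The orbits attached to a parameter -/

section Correspondence

variable {p : ℕ} [Fact p.Prime] {F : Type*} [Field F] [Algebra ℚ_[p] F]
  [FiniteDimensional ℚ_[p] F] {n : ℕ}

/-- The operator `F_u`: it is `ψ(Fr)` if `u = ±1` and `ψ(Fr) ^ (2 ℓ_[u])` otherwise. -/
def frobOperator (ψ : WeilGroup p F × SL2C →* Sp n) (Fr : WeilGroup p F) (u : ℂ) :
    Module.End ℂ (Fin n ⊕ Fin n → ℂ) :=
  open Classical in
  (ψ (Fr, 1)).toEnd ^ (if u = 1 ∨ u = -1 then 1 else 2 * ell (residueCard p F) u)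

/-- The space `V[u, ζ]`: the eigenspace of `F_u` for `ζ` in the eigenspace of `ψ(s)` for `u`. -/
def jointEigenspace (ψ : WeilGroup p F × SL2C →* Sp n) (s : ↥(inertiaGroup p F))
    (Fr : WeilGroup p F) (u : ℂ) (ζ : ℤˣ) : Submodule ℂ (Fin n ⊕ Fin n → ℂ) :=
  (ψ (inertiaToWeil p F s, 1)).toEnd.eigenspace u ⊓
    (frobOperator ψ Fr u).eigenspace (((ζ : ℤ) : ℂ))

/-- The unipotent element `(1 1; 0 1)` of `SL(2, ℂ)`. -/
def unipotentSL2 : SL2C := ⟨!![1, 1; 0, 1], by simp [Matrix.det_fin_two]⟩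

/-- `U` is the orbit of the action of a nontrivial unipotent element of `SL(2, ℂ)` on `V[u, ζ]`:
in some basis of `V[u, ζ]` its matrix is an element of `U`. -/
def IsOrbitOf (ψ : WeilGroup p F × SL2C →* Sp n) (s : ↥(inertiaGroup p F))
    (Fr : WeilGroup p F) (u : ℂ) (ζ : ℤˣ) {M : ℕ} (U : UnipotentOrbit M) : Prop :=
  ∃ (f : (Fin M → ℂ) →ₗ[ℂ] (Fin n ⊕ Fin n → ℂ)) (x : GL (Fin M) ℂ),
    Function.Injective f ∧ LinearMap.range f = jointEigenspace ψ s Fr u ζ ∧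
    ConjClasses.mk x = U.1 ∧
    ∀ v, (ψ (1, unipotentSL2)).toEnd (f v) = f ((x : Matrix (Fin M) (Fin M) ℂ) *ᵥ v)

end Correspondence

end

noncomputable section

set_option linter.unusedSectionVars false
set_option linter.unusedSimpArgs false

/-! ### Square roots of operators, isometries, invariant projections. -/

section LinearAlgebra

open Polynomial Module

variable {V V' : Type*} [AddCommGroup V] [Module ℂ V] [FiniteDimensional ℂ V]
  [AddCommGroup V'] [Module ℂ V'] [FiniteDimensional ℂ V']

/-! Put A = ψ(s), Φ = ψ(Fr), Ψ = Φ⁻¹, let ρ be the action of SL(2, ℂ) and ω the symplectic form.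
Level zero gives ΦAΦ⁻¹ = A^q, so Ψ carries the u-eigenspace of A onto the u^q-eigenspace: a class
[u] is a cycle of eigenspaces, and F_u is the first power of Frobenius that returns to the starting
one. A compactness argument (`IsFrobeniusLift.tendsto_pow`, `Sp.exists_pow_eq_one_of_tendsto`) shows
that χ(s) has finite order, so ψ is determined by A, Φ and ρ (`IsTameParameter.exists_factor`). Its
image acts completely reducibly, and then lying in no proper Levi subgroup means having no nonzero
stable isotropic subspace (`IsTameParameter.isDiscreteParameter_iff`).

On a joint eigenspace V[u, μ] of A and of the power of Ψ belonging to u, the twisted form b(x, y) =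
ω(x, Ψ^ℓ y) is invariant under SL(2, ℂ). A stable subspace isotropic for b spreads along the cycle
to a stable subspace isotropic for ω (`TameRep.Anisotropic.eq_bot`), so in the discrete case b
admits none. This forces μ = ζ = ±1. The form b has symmetry sign -ζ, or -1 if u = ±1. An algebraic
representation of SL(2, ℂ) with an invariant form and no stable isotropic subspace is multiplicity
free, and Sym^k occurs in it only if (-1)^k is the sign of the form
(`injective_and_parity_of_no_isotropic`). As Sym^k contributes one Jordan block of size k + 1, these
are the stated conditions on the orbits.

Injectivity: the Jordan type determines the representation of SL(2, ℂ). Isomorphisms on V[u, ±1] for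
one u in each class extend to V by summing over the cycle (`TameRep.exists_equivariant_equiv`), and
an equivariant isomorphism becomes isometric after division by a polynomial square root
(`exists_isometry_of_equivariant`). Surjectivity: `ModelData.rep` realizes prescribed orbits on
twisted periodic functions from ℤ to symmetric powers, an induced representation; it is anisotropic
and can be transported to ℂ^(2n) with its inertia operator matched to χ(s). -/

theorem Module.End.IsSemisimple.exists_aeval_sq {s : End ℂ V} (hs : s.IsSemisimple) :
    ∃ P : ℂ[X], aeval s P * aeval s P = s := by
  classical
  let E : Finset ℂ := s.finite_hasEigenvalue.toFinset
  choose r hr using fun z : ℂ => IsAlgClosed.exists_eq_mul_self z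
  -- Interpolate a chosen square root at each eigenvalue; on a semisimple operator nothing else
  -- matters.
  let P := Lagrange.interpolate E id r
  refine ⟨P, ?_⟩
  have key : ∀ μ : ℂ, s.eigenspace μ ≤ LinearMap.ker (aeval s P * aeval s P - s) := by
    intro μ v hv
    by_cases h0 : v = 0
    · simp [h0]
    have hμ : s.HasEigenvector μ v := ⟨hv, h0⟩
    have hPμ : P.eval μ = r μ :=
      Lagrange.eval_interpolate_at_node (v := id) r (Function.injective_id.injOn)
        (by
          refine s.finite_hasEigenvalue.mem_toFinset.2 ?_
          exact s.hasEigenvalue_of_hasEigenvector hμ)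
    rw [LinearMap.mem_ker, LinearMap.sub_apply, Module.End.mul_apply,
      End.aeval_apply_of_hasEigenvector hμ, map_smul, End.aeval_apply_of_hasEigenvector hμ,
      smul_smul, hPμ, hμ.apply_eq_smul, ← hr μ, sub_self]
  have := iSup_le key
  rw [hs.iSup_eigenspace_eq_top, top_le_iff, LinearMap.ker_eq_top, sub_eq_zero] at this
  exact this

/-- Newton's method: `x` is a root of X² - S modulo nilpotents and the derivative 2x is a unit
there, so `x` can be corrected to an exact root. -/
theorem exists_mul_self_eq_of_isNilpotent_sub {R : Type*} [CommRing R] [Algebra ℂ R] {x n S : R}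
    (hx : IsUnit x) (hn : IsNilpotent n) (h : S = n + x * x) : ∃ r : R, r * r = S := by
  let Q : R[X] := X ^ 2 - C S
  have h1 : IsNilpotent (aeval x Q) := by
    have : aeval x Q = -n := by
      simp only [Q, map_sub, map_pow, aeval_X, aeval_C, h, Algebra.algebraMap_self,
        RingHom.id_apply]
      ring
    rw [this]
    exact hn.neg
  have h2 : IsUnit (aeval x (derivative Q)) := by
    have : aeval x (derivative Q) = algebraMap ℂ R 2 * x := by
      simp [Q, map_ofNat, one_add_one_eq_two]
    rw [this]
    exact ((isUnit_iff_ne_zero.2 two_ne_zero).map _).mul hx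
  obtain ⟨r, ⟨-, hr⟩, -⟩ := existsUnique_nilpotent_sub_and_aeval_eq_zero h1 h2
  refine ⟨r, ?_⟩
  simp only [Q, map_sub, map_pow, aeval_X, aeval_C] at hr
  rw [← pow_two]
  exact sub_eq_zero.1 hr

/-- Work in the commutative algebra ℂ[S]: the semisimple part of S has a square root by
interpolation, and the nilpotent part is absorbed by Newton's method. The root has to be a
polynomial in S so that it inherits self-adjointness and commutes with whatever commutes with S. -/
theorem Module.End.exists_aeval_sq_of_injective {S : End ℂ V} (hS : Function.Injective S) :
    ∃ P : ℂ[X], aeval S P * aeval S P = S := by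
  obtain ⟨n, hn, s, hs, hnil, hss, hsum⟩ := S.exists_isNilpotent_isSemisimple
  obtain ⟨P, hP⟩ := hss.exists_aeval_sq
  let R := Algebra.adjoin ℂ {S}
  have hSmem : S ∈ R := Algebra.self_mem_adjoin_singleton ℂ S
  let S' : R := ⟨S, hSmem⟩
  let s' : R := ⟨s, hs⟩
  let n' : R := ⟨n, hn⟩
  let x : R := aeval s' P
  have hx : x * x = s' := by
    apply Subtype.ext
    simpa [x, s'] using hP
  have hn' : IsNilpotent n' := by
    obtain ⟨k, hk⟩ := hnil
    exact ⟨k, Subtype.ext (by simpa [n'] using hk)⟩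
  have hsum' : S' = n' + s' := Subtype.ext hsum
  have : IsArtinianRing R := .of_finite ℂ R
  have hSu : IsUnit S' := by
    apply IsArtinianRing.isUnit_of_mem_nonZeroDivisors
    rw [mem_nonZeroDivisors_iff_right]
    intro z hz
    rw [mul_comm] at hz
    apply Subtype.ext
    ext v
    have h1 : S ((z : End ℂ V) v) = 0 := by
      have := congrArg (fun t : R => (t : End ℂ V) v) hz
      simpa [S'] using this
    exact hS (by simpa using h1)
  have hsu : IsUnit s' := by
    have : s' = S' + -n' := by rw [hsum']; ring
    rw [this]
    exact hn'.neg.isUnit_add_left_of_commute hSu (Commute.all _ _)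
  have hxu : IsUnit x := isUnit_of_mul_isUnit_left (hx ▸ hsu)
  obtain ⟨r, hr'⟩ := exists_mul_self_eq_of_isNilpotent_sub (S := S') hxu (n := n') hn' (by rw [hx, hsum'])
  have hrm : (r : End ℂ V) ∈ (aeval (R := ℂ) S).range := by
    rw [← Algebra.adjoin_singleton_eq_range_aeval]
    exact r.2
  obtain ⟨p, hp⟩ := hrm
  refine ⟨p, ?_⟩
  have hp' : aeval S p = (r : End ℂ V) := hp
  rw [hp']
  exact congrArg Subtype.val hr'

/-- Nondegeneracy on the left gives every functional as a pairing on the left. -/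
theorem exists_eq_apply_of_nondegenerate {ω : V →ₗ[ℂ] V →ₗ[ℂ] ℂ}
    (hnd : ∀ x, (∀ y, ω x y = 0) → x = 0) (φ : V →ₗ[ℂ] ℂ) : ∃ x, ω x = φ := by
  have hinj : Function.Injective ω := by
    rw [← LinearMap.ker_eq_bot, LinearMap.ker_eq_bot']
    intro x hx
    exact hnd x fun y => by rw [hx]; rfl
  have : Function.Surjective ω :=
    (LinearMap.injective_iff_surjective_of_finrank_eq_finrank
      (Subspace.dual_finrank_eq (K := ℂ) (V := V)).symm).1 hinj
  exact this φ

theorem injective_of_isometry {ω : V →ₗ[ℂ] V →ₗ[ℂ] ℂ} {ω' : V' →ₗ[ℂ] V' →ₗ[ℂ] ℂ}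
    (hnd : ∀ x, (∀ y, ω x y = 0) → x = 0) {a : V →ₗ[ℂ] V'}
    (ha : ∀ x y, ω' (a x) (a y) = ω x y) : Function.Injective a := by
  rw [← LinearMap.ker_eq_bot, LinearMap.ker_eq_bot']
  intro x hx
  exact hnd x fun y => by rw [← ha, hx, map_zero, LinearMap.zero_apply]

theorem apply_aeval_right {ω : V →ₗ[ℂ] V →ₗ[ℂ] ℂ} {S : End ℂ V}
    (hS : ∀ x y, ω (S x) y = ω x (S y)) (P : ℂ[X]) (x y : V) :
    ω (aeval S P x) y = ω x (aeval S P y) := by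
  induction P using Polynomial.induction_on' generalizing x y with
  | add p q hp hq => simp [hp, hq]
  | monomial n c =>
    have : ∀ n x y, ω ((S ^ n) x) y = ω x ((S ^ n) y) := by
      intro n
      induction n with
      | zero => simp
      | succ n ih =>
        intro x y
        rw [pow_succ, End.mul_apply, ih, hS, ← End.mul_apply, ← pow_succ', pow_succ]
    simp [aeval_monomial, Module.algebraMap_end_eq_smul_id, this]

/-- An equivariant isomorphism of symplectic representations can be made isometric. -/
theorem exists_isometry_of_equivariant {ω : V →ₗ[ℂ] V →ₗ[ℂ] ℂ} {ω' : V' →ₗ[ℂ] V' →ₗ[ℂ] ℂ}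
    (hskew : ∀ x y, ω y x = -ω x y) (hskew' : ∀ x y, ω' y x = -ω' x y)
    (hnd : ∀ x, (∀ y, ω x y = 0) → x = 0) (hnd' : ∀ x, (∀ y, ω' x y = 0) → x = 0)
    {ι : Type*} (a : ι → End ℂ V) (a' : ι → End ℂ V')
    (ha : ∀ i x y, ω (a i x) (a i y) = ω x y) (ha' : ∀ i x y, ω' (a' i x) (a' i y) = ω' x y)
    (T : V ≃ₗ[ℂ] V') (hT : ∀ i x, T (a i x) = a' i (T x)) :
    ∃ T' : V ≃ₗ[ℂ] V', (∀ i x, T' (a i x) = a' i (T' x)) ∧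
      ∀ x y, ω' (T' x) (T' y) = ω x y := by
  have hinj : Function.Injective ω := by
    rw [← LinearMap.ker_eq_bot, LinearMap.ker_eq_bot']
    intro x hx
    exact hnd x fun y => by rw [hx]; rfl
  have hsurj : Function.Surjective ω := exists_eq_apply_of_nondegenerate hnd
  let D : V ≃ₗ[ℂ] (V →ₗ[ℂ] ℂ) := LinearEquiv.ofBijective ω ⟨hinj, hsurj⟩
  -- S measures the failure of T to be an isometry: ω(Sx, y) = ω'(Tx, Ty). It is self-adjoint
  -- because both forms are skew, and it commutes with every `a i` because T is equivariant and the
  -- `a i` are isometries.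
  let S : End ℂ V := D.symm.toLinearMap ∘ₗ (ω'.compl₁₂ T.toLinearMap T.toLinearMap)
  have hS : ∀ x y, ω (S x) y = ω' (T x) (T y) := by
    intro x y
    have : D (S x) = (ω'.compl₁₂ T.toLinearMap T.toLinearMap) x := D.apply_symm_apply _
    exact congrArg (fun f => f y) this
  have hSadj : ∀ x y, ω (S x) y = ω x (S y) := by
    intro x y
    rw [hskew (S y) x, hS, hS, hskew' (T y) (T x)]
  have hSinj : Function.Injective S := by
    rw [← LinearMap.ker_eq_bot, LinearMap.ker_eq_bot']
    intro x hx
    apply T.injective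
    rw [map_zero]
    refine hnd' _ fun y => ?_
    obtain ⟨y, rfl⟩ := T.surjective y
    rw [← hS, hx, map_zero, LinearMap.zero_apply]
  have hSa : ∀ i, Commute S (a i) := by
    intro i
    have hai : Function.Surjective (a i) :=
      LinearMap.injective_iff_surjective.1 (injective_of_isometry hnd (ha i))
    ext x
    apply hinj
    ext y
    obtain ⟨y, rfl⟩ := hai y
    rw [End.mul_apply, End.mul_apply, hS, hT, hT, ha', ha, hS]
  obtain ⟨P, hP⟩ := End.exists_aeval_sq_of_injective hSinj
  set R := aeval S P with hR
  have hRadj : ∀ x y, ω (R x) y = ω x (R y) := apply_aeval_right hSadj P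
  have hRa : ∀ i, Commute R (a i) := fun i => by
    have : R ∈ Algebra.adjoin ℂ {S} := by
      rw [Algebra.adjoin_singleton_eq_range_aeval]
      exact ⟨P, rfl⟩
    exact (Algebra.commute_of_mem_adjoin_singleton_of_commute this (hSa i).symm).symm
  have hRinj : Function.Injective R := by
    intro x y hxy
    apply hSinj
    rw [← hP, End.mul_apply, End.mul_apply, hxy]
  let Re : V ≃ₗ[ℂ] V := LinearEquiv.ofInjectiveEndo R hRinj
  have hRe : ∀ x, R (Re.symm x) = x := fun x => Re.apply_symm_apply x
  -- With R² = S, the map T R⁻¹ is isometric: ω'(TR⁻¹x, TR⁻¹y) = ω(R²R⁻¹x, R⁻¹y) = ω(x, y).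
  refine ⟨Re.symm.trans T, fun i x => ?_, fun x y => ?_⟩
  · rw [LinearEquiv.trans_apply, LinearEquiv.trans_apply, ← hT]
    congr 1
    apply hRinj
    rw [hRe]
    have := congrArg (fun f : End ℂ V => f (Re.symm x)) (hRa i).eq
    simp only [End.mul_apply, hRe] at this
    exact this.symm
  · rw [LinearEquiv.trans_apply, LinearEquiv.trans_apply, ← hS, ← hP, End.mul_apply, hRadj,
      hRe, hRe]

theorem exists_linearEquiv_of_finrank_eigenspace_eq {A : End ℂ V} {A' : End ℂ V'}
    (hA : ⨆ μ, A.eigenspace μ = ⊤) (hA' : ⨆ μ, A'.eigenspace μ = ⊤)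
    (h : ∀ μ, finrank ℂ (A.eigenspace μ) = finrank ℂ (A'.eigenspace μ)) :
    ∃ T : V ≃ₗ[ℂ] V', ∀ x, T (A x) = A' (T x) := by
  classical
  have hi : DirectSum.IsInternal A.eigenspace :=
    DirectSum.isInternal_submodule_of_iSupIndep_of_iSup_eq_top A.eigenspaces_iSupIndep hA
  have hi' : DirectSum.IsInternal A'.eigenspace :=
    DirectSum.isInternal_submodule_of_iSupIndep_of_iSup_eq_top A'.eigenspaces_iSupIndep hA'
  let e := LinearEquiv.ofBijective (DirectSum.coeLinearMap A.eigenspace) hi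
  let e' := LinearEquiv.ofBijective (DirectSum.coeLinearMap A'.eigenspace) hi'
  have f : ∀ μ, A.eigenspace μ ≃ₗ[ℂ] A'.eigenspace μ := fun μ => LinearEquiv.ofFinrankEq _ _ (h μ)
  let T : V ≃ₗ[ℂ] V' := e.symm.trans ((DFinsupp.mapRange.linearEquiv f).trans e')
  have hT : ∀ μ (v : A.eigenspace μ), T v = f μ v := by
    intro μ v
    have : e.symm (v : V) = DirectSum.lof ℂ ℂ (fun μ => A.eigenspace μ) μ v := by
      rw [LinearEquiv.symm_apply_eq]
      exact (DirectSum.coeLinearMap_lof A.eigenspace μ v).symm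
    change e' (DFinsupp.mapRange.linearEquiv f (e.symm (v : V))) = _
    rw [this]
    have h2 : DFinsupp.mapRange.linearEquiv f (DirectSum.lof ℂ ℂ (fun μ => A.eigenspace μ) μ v) =
        DirectSum.lof ℂ ℂ (fun μ => A'.eigenspace μ) μ (f μ v) :=
      DFinsupp.mapRange_single (hf := fun i => map_zero (f i))
    rw [h2]
    exact DirectSum.coeLinearMap_lof A'.eigenspace μ (f μ v)
  refine ⟨T, fun x => ?_⟩
  have key : (⊤ : Submodule ℂ V) ≤ LinearMap.eqLocus (T.toLinearMap ∘ₗ A) (A' ∘ₗ T.toLinearMap) := by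
    rw [← hA]
    refine iSup_le fun μ v hv => ?_
    have hv' := End.mem_eigenspace_iff.1 hv
    have h1 := hT μ ⟨v, hv⟩
    have h2 := End.mem_eigenspace_iff.1 (f μ ⟨v, hv⟩).2
    rw [← h1] at h2
    simp only [LinearMap.mem_eqLocus, LinearMap.comp_apply, LinearEquiv.coe_coe, hv', map_smul]
    exact h2.symm
  exact key (Submodule.mem_top (x := x))

/-- Takes the place of averaging over a group. Choose a stable complement D' of D; the D'-component
of x is moved by an element of D ∩ D' = 0, so it is fixed, and it differs from x by an element of D.
-/
theorem Module.End.IsSemisimple.exists_fixed {E : Type*} [AddCommGroup E] [Module ℂ E]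
    {c : End ℂ E} (hc : c.IsSemisimple) (D : Submodule ℂ E) (hD : ∀ x ∈ D, c x ∈ D) (x : E)
    (hx : c x - x ∈ D) : ∃ y, c y = y ∧ y - x ∈ D := by
  have hc' := End.isSemisimple_iff.1 hc D hD
  obtain ⟨D', hD', hDD'⟩ := hc'
  have hE : (c - 1) x ∈ D := hx
  obtain ⟨d, hd, d', hd', rfl⟩ := Submodule.mem_sup.1 (hDD'.sup_eq_top ▸ Submodule.mem_top (x := x))
  refine ⟨d', ?_, by simpa using hd⟩
  have h1 : c d' - d' ∈ D := by
    have : c d' - d' = (c (d + d') - (d + d')) - (c d - d) := by rw [map_add]; abel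
    rw [this]
    exact D.sub_mem hx (D.sub_mem (hD d hd) hd)
  have h2 : c d' - d' ∈ D' := D'.sub_mem (hD' hd') hd'
  exact sub_eq_zero.1 (Submodule.disjoint_def.1 hDD'.disjoint _ h1 h2)

theorem Module.End.IsSemisimple.mulLeft {f : End ℂ V} (hf : f.IsSemisimple) :
    End.IsSemisimple (LinearMap.mulLeft ℂ f : End ℂ (End ℂ V)) := by
  refine End.isSemisimple_of_squarefree_aeval_eq_zero hf.minpoly_squarefree ?_
  have h : ∀ P : ℂ[X], aeval (Algebra.lmul ℂ (End ℂ V) f) P =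
      Algebra.lmul ℂ (End ℂ V) (aeval f P) := fun P => aeval_algHom_apply _ _ _
  have := h (minpoly ℂ f)
  rw [minpoly.aeval, map_zero] at this
  exact this

theorem Module.End.IsSemisimple.mulRight {f : End ℂ V} (hf : f.IsSemisimple) :
    End.IsSemisimple (LinearMap.mulRight ℂ f : End ℂ (End ℂ V)) := by
  refine End.isSemisimple_of_squarefree_aeval_eq_zero hf.minpoly_squarefree ?_
  have h : ∀ P : ℂ[X], aeval (LinearMap.mulRight ℂ f : End ℂ (End ℂ V)) P =
      LinearMap.mulRight ℂ (aeval f P) := by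
    intro P
    induction P using Polynomial.induction_on' with
    | add p q hp hq => rw [map_add, hp, hq, map_add]; ext; simp [mul_add]
    | monomial n c =>
      ext x : 1
      rw [aeval_monomial, aeval_monomial, End.mul_apply, LinearMap.pow_mulRight]
      simp [Algebra.algebraMap_eq_smul_one]
  rw [h, minpoly.aeval, LinearMap.mulRight_zero_eq_zero]

/-- Projections onto W that commute with 𝒮 form an affine space, and P ↦ ΨPΦ acts on it. This action
is semisimple, being a product of commuting semisimple left and right multiplications, so it has a
fixed point by `Module.End.IsSemisimple.exists_fixed`. Thus invariance under one more semisimple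
operator is gained at a time. -/
theorem exists_invariant_projection {W : Submodule ℂ V} (𝒮 : Set (End ℂ V)) {Φ Ψ : End ℂ V}
    (hΦ : Φ.IsSemisimple) (hΨ : Ψ.IsSemisimple) (hΦΨ : Φ * Ψ = 1) (hΨΦ : Ψ * Φ = 1)
    (h𝒮 : ∀ P : End ℂ V, (∀ a ∈ 𝒮, Commute P a) → ∀ a ∈ 𝒮, Commute (Ψ * P * Φ) a)
    (hWΦ : ∀ v ∈ W, Φ v ∈ W) (hWΨ : ∀ v ∈ W, Ψ v ∈ W)
    {P : End ℂ V} (hP : ∀ v, P v ∈ W) (hP' : ∀ v ∈ W, P v = v) (hPS : ∀ a ∈ 𝒮, Commute P a) :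
    ∃ Q : End ℂ V, (∀ v, Q v ∈ W) ∧ (∀ v ∈ W, Q v = v) ∧ (∀ a ∈ 𝒮, Commute Q a) ∧
      Commute Q Φ := by
  let c : End ℂ (End ℂ V) := LinearMap.mulLeft ℂ Ψ * LinearMap.mulRight ℂ Φ
  have hc : c.IsSemisimple := hΨ.mulLeft.mul_of_commute (by
    ext x : 1
    simp [End.mul_apply, mul_assoc]) hΦ.mulRight
  have hca : ∀ X, c X = Ψ * X * Φ := fun X => by simp [c, mul_assoc]
  let D : Submodule ℂ (End ℂ V) :=
    { carrier := {X | (∀ v, X v ∈ W) ∧ (∀ v ∈ W, X v = 0) ∧ ∀ a ∈ 𝒮, Commute X a}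
      add_mem' := fun {X Y} hX hY => ⟨fun v => W.add_mem (hX.1 v) (hY.1 v),
        fun v hv => by simp [hX.2.1 v hv, hY.2.1 v hv],
        fun a ha => (hX.2.2 a ha).add_left (hY.2.2 a ha)⟩
      zero_mem' := ⟨fun v => W.zero_mem, fun v _ => rfl, fun a _ => Commute.zero_left a⟩
      smul_mem' := fun t X hX => ⟨fun v => W.smul_mem t (hX.1 v),
        fun v hv => by simp [hX.2.1 v hv], fun a ha => (hX.2.2 a ha).smul_left t⟩ }
  obtain ⟨Q, hQ, hQP⟩ := hc.exists_fixed D (fun X hX => by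
      rw [hca]
      exact ⟨fun v => hWΨ _ (hX.1 _), fun v hv => by
        rw [End.mul_apply, End.mul_apply, hX.2.1 _ (hWΦ v hv), map_zero], h𝒮 X hX.2.2⟩) P (by
      rw [hca]
      refine ⟨fun v => W.sub_mem (hWΨ _ (hP _)) (hP _), fun v hv => ?_,
        fun a ha => (h𝒮 P hPS a ha).sub_left (hPS a ha)⟩
      rw [LinearMap.sub_apply, End.mul_apply, End.mul_apply, hP' _ (hWΦ v hv), hP' v hv,
        ← End.mul_apply, hΨΦ, End.one_apply, sub_self])
  refine ⟨Q, fun v => ?_, fun v hv => ?_, fun a ha => ?_, ?_⟩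
  · have := W.add_mem (hQP.1 v) (hP v)
    simpa using this
  · have := hQP.2.1 v hv
    rw [LinearMap.sub_apply, hP' v hv] at this
    exact sub_eq_zero.1 this
  · have := (hQP.2.2 a ha).add_left (hPS a ha)
    simpa using this
  · rw [hca] at hQ
    have : Φ * (Ψ * Q * Φ) = Φ * Q := by rw [hQ]
    rw [← mul_assoc, ← mul_assoc, hΦΨ, one_mul] at this
    exact this

end LinearAlgebra

/-! ### Isotropic subspaces, Levi subgroups and discreteness. -/

section Symplectic

open Module

variable {n : ℕ}

/-- The standard symplectic form as a bilinear map. -/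
def sympBilin (n : ℕ) :
    (Fin n ⊕ Fin n → ℂ) →ₗ[ℂ] (Fin n ⊕ Fin n → ℂ) →ₗ[ℂ] ℂ :=
  LinearMap.mk₂ ℂ (fun v w => sympForm v w)
    (fun v v' w => by simp [sympForm, add_dotProduct])
    (fun c v w => by simp [sympForm, smul_dotProduct])
    (fun v w w' => by simp [sympForm, mulVec_add, dotProduct_add])
    (fun c v w => by simp [sympForm, mulVec_smul, dotProduct_smul])

theorem sympBilin_apply (v w : Fin n ⊕ Fin n → ℂ) : sympBilin n v w = sympForm v w := rfl

theorem sympBilin_toEnd (g : Sp n) (v w : Fin n ⊕ Fin n → ℂ) :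
    sympBilin n (g.toEnd v) (g.toEnd w) = sympBilin n v w := sympForm_toEnd g v w

theorem sympBilin_skew (v w : Fin n ⊕ Fin n → ℂ) : sympBilin n w v = -sympBilin n v w := by
  rw [sympBilin_apply, sympBilin_apply, sympForm, sympForm, dotProduct_comm, ← vecMul_transpose,
    J_transpose, vecMul_neg, neg_dotProduct, ← dotProduct_mulVec]

theorem sympBilin_nondegenerate (v : Fin n ⊕ Fin n → ℂ) (h : ∀ w, sympBilin n v w = 0) :
    v = 0 := by
  have h1 : ∀ w, v ⬝ᵥ w = 0 := by
    intro w
    have := h (-(J (Fin n) ℂ) *ᵥ w)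
    rw [sympBilin_apply, sympForm, mulVec_mulVec, mul_neg, J_squared, neg_neg, one_mulVec] at this
    exact this
  exact dotProduct_eq_zero v h1

theorem Sp.toEnd_mul (g h : Sp n) : (g * h).toEnd = g.toEnd * h.toEnd :=
  Matrix.toLin'_mul _ _

theorem Sp.toEnd_one : (1 : Sp n).toEnd = 1 := Matrix.toLin'_one

theorem Sp.toEnd_injective : Function.Injective (Sp.toEnd (n := n)) := fun _ _ h =>
  Subtype.ext (Matrix.toLin'.injective h)

theorem Sp.toEnd_pow (g : Sp n) (k : ℕ) : (g ^ k).toEnd = g.toEnd ^ k := by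
  induction k with
  | zero => exact Sp.toEnd_one
  | succ k ih => rw [pow_succ, pow_succ, Sp.toEnd_mul, ih]

theorem Sp.toEnd_inv_mul (g : Sp n) : (g⁻¹).toEnd * g.toEnd = 1 := by
  rw [← Sp.toEnd_mul, inv_mul_cancel, Sp.toEnd_one]

theorem Sp.toEnd_mul_inv (g : Sp n) : g.toEnd * (g⁻¹).toEnd = 1 := by
  rw [← Sp.toEnd_mul, mul_inv_cancel, Sp.toEnd_one]

theorem Sp.toEnd_inv_apply (g : Sp n) (v : Fin n ⊕ Fin n → ℂ) : (g⁻¹).toEnd (g.toEnd v) = v := by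
  rw [← Module.End.mul_apply, Sp.toEnd_inv_mul, Module.End.one_apply]

theorem Sp.toEnd_apply_inv (g : Sp n) (v : Fin n ⊕ Fin n → ℂ) : g.toEnd ((g⁻¹).toEnd v) = v := by
  rw [← Module.End.mul_apply, Sp.toEnd_mul_inv, Module.End.one_apply]

theorem Sp.toEnd_injective_apply (g : Sp n) : Function.Injective g.toEnd :=
  Function.LeftInverse.injective g.toEnd_inv_apply

theorem exists_toEnd_eq (T : End ℂ (Fin n ⊕ Fin n → ℂ))
    (hT : ∀ v w, sympBilin n (T v) (T w) = sympBilin n v w) : ∃ g : Sp n, g.toEnd = T := by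
  refine ⟨⟨LinearMap.toMatrix' T, ?_⟩, Matrix.toLin'_toMatrix' T⟩
  rw [SymplecticGroup.mem_iff']
  refine Matrix.ext_of_mulVec_single fun i => ?_
  refine dotProduct_eq _ _ fun v => ?_
  have h := hT v (Pi.single i 1)
  rw [sympBilin_apply, sympBilin_apply, sympForm, sympForm, ← LinearMap.toMatrix'_mulVec,
    ← LinearMap.toMatrix'_mulVec] at h
  rw [dotProduct_comm, dotProduct_comm _ v, ← h, ← mulVec_mulVec, ← mulVec_mulVec,
    dotProduct_mulVec v, vecMul_transpose]

theorem Sp.mem_of_inv_mem {W : Submodule ℂ (Fin n ⊕ Fin n → ℂ)} {g : Sp n}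
    (h : ∀ v ∈ W, g.toEnd v ∈ W) : ∀ v ∈ W, (g⁻¹).toEnd v ∈ W := by
  have h1 : W.map g.toEnd ≤ W := by
    rintro _ ⟨v, hv, rfl⟩
    exact h v hv
  have h2 : W.map g.toEnd = W :=
    Submodule.eq_of_le_of_finrank_eq h1
      (LinearEquiv.finrank_eq (Submodule.equivMapOfInjective _ g.toEnd_injective_apply W)).symm
  intro v hv
  rw [← h2] at hv
  obtain ⟨w, hw, rfl⟩ := hv
  rw [Sp.toEnd_inv_apply]
  exact hw

/-- The stabilizer of a pair of subspaces. -/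
def stabilizerPair (W W' : Submodule ℂ (Fin n ⊕ Fin n → ℂ)) : Subgroup (Sp n) where
  carrier := {g | (∀ v ∈ W, g.toEnd v ∈ W) ∧ ∀ w ∈ W', g.toEnd w ∈ W'}
  one_mem' := ⟨fun v hv => by rwa [Sp.toEnd_one], fun v hv => by rwa [Sp.toEnd_one]⟩
  mul_mem' {g h} hg hh :=
    ⟨fun v hv => by rw [Sp.toEnd_mul]; exact hg.1 _ (hh.1 v hv),
      fun v hv => by rw [Sp.toEnd_mul]; exact hg.2 _ (hh.2 v hv)⟩
  inv_mem' {g} hg := ⟨Sp.mem_of_inv_mem hg.1, Sp.mem_of_inv_mem hg.2⟩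

/-- An isotropic stable subspace has a stable isotropic dual when complements exist. -/
theorem exists_isotropic_dual {V : Type*} [AddCommGroup V] [Module ℂ V] [FiniteDimensional ℂ V]
    {ω : V →ₗ[ℂ] V →ₗ[ℂ] ℂ} (hskew : ∀ x y, ω y x = -ω x y)
    (hnd : ∀ x, (∀ y, ω x y = 0) → x = 0) (𝒮 : Set (End ℂ V))
    (h𝒮 : ∀ a ∈ 𝒮, ∃ b ∈ 𝒮, a * b = 1)
    (hω : ∀ a ∈ 𝒮, ∀ x y, ω (a x) (a y) = ω x y)
    (hcr : ∀ W : Submodule ℂ V, (∀ a ∈ 𝒮, ∀ v ∈ W, a v ∈ W) →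
      ∃ C : Submodule ℂ V, (∀ a ∈ 𝒮, ∀ v ∈ C, a v ∈ C) ∧ IsCompl W C)
    (W : Submodule ℂ V) (hW : ∀ a ∈ 𝒮, ∀ v ∈ W, a v ∈ W) (hiso : ∀ v ∈ W, ∀ w ∈ W, ω v w = 0) :
    ∃ W' : Submodule ℂ V, (∀ a ∈ 𝒮, ∀ v ∈ W', a v ∈ W') ∧ (∀ v ∈ W', ∀ w ∈ W', ω v w = 0) ∧
      (∀ v ∈ W, (∀ w ∈ W', ω v w = 0) → v = 0) ∧ (∀ w ∈ W', (∀ v ∈ W, ω v w = 0) → w = 0) := by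
  -- A stable complement C of the orthogonal of W is in perfect duality with W, but C need not be
  -- isotropic; it will be corrected by elements of W.
  let Wp : Submodule ℂ V :=
    { carrier := {x | ∀ w ∈ W, ω w x = 0}
      add_mem' := fun {x y} hx hy w hw => by rw [map_add, hx w hw, hy w hw, add_zero]
      zero_mem' := fun w _ => map_zero _
      smul_mem' := fun c x hx w hw => by rw [map_smul, hx w hw, smul_zero] }
  have hWp : ∀ a ∈ 𝒮, ∀ v ∈ Wp, a v ∈ Wp := by
    intro a ha v hv w hw
    obtain ⟨b, hb, hab⟩ := h𝒮 a ha
    have : w = a (b w) := by rw [← End.mul_apply, hab, End.one_apply]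
    rw [this, hω a ha]
    exact hv _ (hW b hb w hw)
  obtain ⟨C, hC, hWC⟩ := hcr Wp hWp
  -- the pairing of `W` and `C` is perfect
  have hp1 : ∀ w ∈ W, (∀ c ∈ C, ω w c = 0) → w = 0 := by
    intro w hw h
    refine hnd w fun y => ?_
    obtain ⟨d, hd, c, hc, rfl⟩ := Submodule.mem_sup.1
      (hWC.sup_eq_top ▸ Submodule.mem_top (x := y))
    rw [map_add, hd w hw, h c hc, add_zero]
  have hp2 : ∀ c ∈ C, (∀ w ∈ W, ω w c = 0) → c = 0 := fun c hc h =>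
    Submodule.disjoint_def.1 hWC.disjoint c h hc
  have hφ : ∀ x : V, ∃ w ∈ W, ∀ y ∈ C, ω w y = -(1 / 2) * ω x y := by
    let B : W →ₗ[ℂ] C →ₗ[ℂ] ℂ := ω.domRestrict₁₂ W C
    have hinj1 : Function.Injective B := by
      rw [← LinearMap.ker_eq_bot, LinearMap.ker_eq_bot']
      intro w hw
      exact Subtype.ext (hp1 w w.2 fun c hc => by
        have := congrArg (fun f => f ⟨c, hc⟩) hw
        exact this)
    have hinj2 : Function.Injective B.flip := by
      rw [← LinearMap.ker_eq_bot, LinearMap.ker_eq_bot']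
      intro c hc
      exact Subtype.ext (hp2 c c.2 fun w hw => by
        have := congrArg (fun f => f ⟨w, hw⟩) hc
        exact this)
    have h1 := LinearMap.finrank_le_finrank_of_injective hinj1
    have h2 := LinearMap.finrank_le_finrank_of_injective hinj2
    rw [Module.finrank_linearMap_self] at h1 h2
    have hsurj : Function.Surjective B :=
      (LinearMap.injective_iff_surjective_of_finrank_eq_finrank
        (by rw [Module.finrank_linearMap_self]; omega)).1 hinj1
    intro x
    obtain ⟨w, hw⟩ := hsurj ((-(1 / 2 : ℂ)) • (ω x).domRestrict C)
    refine ⟨w, w.2, fun y hy => ?_⟩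
    have := congrArg (fun f => f ⟨y, hy⟩) hw
    exact this
  -- The set of c + w(c), where w(c) ∈ W is defined by ω(w(c), ·) = -½ ω(c, ·) on C. The two
  -- corrections in ω(c + w(c), c' + w(c')) contribute -½ ω(c, c') each and cancel ω(c, c').
  let W' : Submodule ℂ V :=
    { carrier := {z | ∃ c ∈ C, z - c ∈ W ∧ ∀ y ∈ C, ω (z - c) y = -(1 / 2) * ω c y}
      add_mem' := by
        rintro z z' ⟨c, hc, h1, h2⟩ ⟨c', hc', h1', h2'⟩
        refine ⟨c + c', C.add_mem hc hc', ?_, fun y hy => ?_⟩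
        · rw [add_sub_add_comm]
          exact W.add_mem h1 h1'
        · rw [add_sub_add_comm, map_add, map_add, LinearMap.add_apply, LinearMap.add_apply,
            h2 y hy, h2' y hy]
          ring
      zero_mem' := ⟨0, C.zero_mem, by simp, by simp⟩
      smul_mem' := by
        rintro t z ⟨c, hc, h1, h2⟩
        refine ⟨t • c, C.smul_mem t hc, ?_, fun y hy => ?_⟩
        · rw [← smul_sub]
          exact W.smul_mem t h1
        · rw [← smul_sub, map_smul, map_smul, LinearMap.smul_apply, LinearMap.smul_apply, h2 y hy,
            smul_eq_mul, smul_eq_mul]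
          ring }
  refine ⟨W', ?_, ?_, ?_, ?_⟩
  · rintro a ha z ⟨c, hc, h1, h2⟩
    refine ⟨a c, hC a ha c hc, ?_, fun y hy => ?_⟩
    · rw [← map_sub]
      exact hW a ha _ h1
    · obtain ⟨b, hb, hab⟩ := h𝒮 a ha
      have : y = a (b y) := by rw [← End.mul_apply, hab, End.one_apply]
      rw [this, ← map_sub, hω a ha, hω a ha]
      exact h2 _ (hC b hb y hy)
  · rintro z ⟨c, hc, h1, h2⟩ z' ⟨c', hc', h1', h2'⟩
    obtain ⟨w, rfl⟩ : ∃ w, z = w + c := ⟨z - c, by abel⟩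
    obtain ⟨w', rfl⟩ : ∃ w', z' = w' + c' := ⟨z' - c', by abel⟩
    rw [add_sub_cancel_right] at h1 h2 h1' h2'
    simp only [map_add, LinearMap.add_apply]
    rw [hiso w h1 w' h1', h2 c' hc', hskew w' c, h2' c hc, hskew c c']
    ring
  · intro v hv h
    refine hp1 v hv fun c hc => ?_
    obtain ⟨w, hw, hw'⟩ := hφ c
    have := h (w + c) ⟨c, hc, by simpa using hw, fun y hy => by simpa using hw' y hy⟩
    rwa [map_add, hiso v hv w hw, zero_add] at this
  · rintro z ⟨c, hc, h1, h2⟩ h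
    have hc0 : c = 0 := by
      refine hp2 c hc fun w hw => ?_
      have := h w hw
      rw [show z = (z - c) + c by abel, map_add, hiso w hw _ h1, zero_add] at this
      exact this
    subst hc0
    rw [sub_zero] at h1 h2
    exact hp1 z h1 fun y hy => by rw [h2 y hy, map_zero, LinearMap.zero_apply, mul_zero]

/-- A nonzero stable isotropic W together with a stable isotropic dual W' places the group in the
Levi subgroup stabilizing both. That Levi subgroup is proper, since a symplectic transvection along
a vector of W' moves W. -/
theorem eq_bot_of_isotropic_of_discrete {H₀ : Subgroup (Sp n)}
    (hdisc : ∀ H : Subgroup (Sp n), IsLeviSubgroup H → H₀ ≤ H → H = ⊤)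
    (hcr : ∀ W : Submodule ℂ (Fin n ⊕ Fin n → ℂ), (∀ g ∈ H₀, ∀ v ∈ W, g.toEnd v ∈ W) →
      ∃ C : Submodule ℂ (Fin n ⊕ Fin n → ℂ), (∀ g ∈ H₀, ∀ v ∈ C, g.toEnd v ∈ C) ∧ IsCompl W C)
    (W : Submodule ℂ (Fin n ⊕ Fin n → ℂ)) (hW : ∀ g ∈ H₀, ∀ v ∈ W, g.toEnd v ∈ W)
    (hiso : ∀ v ∈ W, ∀ w ∈ W, sympForm v w = 0) : W = ⊥ := by
  by_contra hne
  obtain ⟨W', hW', hiso', hp1, hp2⟩ := exists_isotropic_dual sympBilin_skew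
    sympBilin_nondegenerate (Sp.toEnd '' (H₀ : Set (Sp n)))
    (by
      rintro _ ⟨g, hg, rfl⟩
      exact ⟨_, ⟨g⁻¹, H₀.inv_mem hg, rfl⟩, g.toEnd_mul_inv⟩)
    (by
      rintro _ ⟨g, hg, rfl⟩ x y
      exact sympBilin_toEnd g x y)
    (by
      intro U hU
      obtain ⟨C, hC, hUC⟩ := hcr U fun g hg => hU _ ⟨g, hg, rfl⟩
      refine ⟨C, ?_, hUC⟩
      rintro _ ⟨g, hg, rfl⟩
      exact hC g hg) W
    (by
      rintro _ ⟨g, hg, rfl⟩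
      exact hW g hg) hiso
  have hLevi : IsLeviSubgroup (stabilizerPair W W') := by
    refine ⟨1, fun _ => W, fun _ => W', fun _ => hne, fun _ _ => hiso, fun _ _ => hiso',
      fun i j hij => absurd (Subsingleton.elim i j) hij, fun _ => hp1, fun _ => hp2, fun g => ?_⟩
    exact ⟨fun h _ => h, fun h => h 0⟩
  have htop := hdisc _ hLevi fun g hg => ⟨hW g hg, hW' _ ⟨g, hg, rfl⟩⟩
  obtain ⟨w, hw, hw0⟩ := Submodule.exists_mem_ne_zero_of_ne_bot hne
  obtain ⟨w', hw', hww'⟩ : ∃ w' ∈ W', sympForm w w' ≠ 0 := by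
    by_contra h
    push Not at h
    exact hw0 (hp1 w hw h)
  -- a transvection moving `w` out of `W`
  let T : End ℂ (Fin n ⊕ Fin n → ℂ) := LinearMap.id + ((sympBilin n).flip w').smulRight w'
  have hTa : ∀ v, T v = v + sympBilin n v w' • w' := fun v => rfl
  obtain ⟨g, hg⟩ := exists_toEnd_eq T (by
    intro v u
    simp only [hTa, map_add, LinearMap.add_apply, map_smul, LinearMap.smul_apply, smul_eq_mul]
    rw [show sympBilin n w' w' = 0 from hiso' w' hw' w' hw', sympBilin_skew u w']
    ring)
  have hgm : g ∈ stabilizerPair W W' := by rw [htop]; trivial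
  have h1 := hgm.1 w hw
  rw [hg, hTa] at h1
  have h2 : w' ∈ W := by
    have := W.sub_mem h1 hw
    rw [add_sub_cancel_left] at this
    have h3 := W.smul_mem (sympBilin n w w')⁻¹ this
    rwa [smul_smul, sympBilin_apply, inv_mul_cancel₀ hww', one_smul] at h3
  exact hww' (hiso w hw w' h2)

/-- Each `W i` in the data of a Levi subgroup is itself nonzero, stable and isotropic; if no such
subspace exists, then there is no index and the stabilizer condition is empty. -/
theorem eq_top_of_isLeviSubgroup {H₀ : Subgroup (Sp n)}
    (h : ∀ W : Submodule ℂ (Fin n ⊕ Fin n → ℂ), (∀ g ∈ H₀, ∀ v ∈ W, g.toEnd v ∈ W) →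
      (∀ v ∈ W, ∀ w ∈ W, sympForm v w = 0) → W = ⊥)
    (H : Subgroup (Sp n)) (hH : IsLeviSubgroup H) (hle : H₀ ≤ H) : H = ⊤ := by
  obtain ⟨r, W, W', hne, hiso, -, -, -, -, hmem⟩ := hH
  rw [eq_top_iff]
  intro g _
  rw [hmem]
  intro i
  exact absurd (h (W i) (fun g hg => ((hmem g).1 (hle hg) i).1) (hiso i i)) (hne i)

end Symplectic

/-! ### Symmetric powers through the rational normal curve. -/

section SymmetricPower

open Polynomial

/-- The point of the rational normal curve of degree `k` attached to a vector of `ℂ²`. -/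
def veronese (k : ℕ) (v : Fin 2 → ℂ) : Fin (k + 1) → ℂ := fun i => v 0 ^ (k - i) * v 1 ^ (i : ℕ)

theorem veronese_smul (k : ℕ) (c : ℂ) (v : Fin 2 → ℂ) :
    veronese k (c • v) = c ^ k • veronese k v := by
  ext i
  have hi : k = (k - i) + i := by omega
  simp only [veronese, Pi.smul_apply, smul_eq_mul, mul_pow]
  conv_rhs => rw [show c ^ k = c ^ (k - i) * c ^ (i : ℕ) by rw [← pow_add, ← hi]]
  ring

/-- The points (1 : t) of the curve span even after finitely many are removed, since a polynomial
with infinitely many roots vanishes. Identities about symmetric powers thereby become computations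
in ℂ². The exceptional set absorbs the t whose image under a group element leaves the chart with
nonzero first coordinate. -/
theorem linearMap_ext_veronese {k : ℕ} {E : Type*} [AddCommGroup E] [Module ℂ E]
    {f f' : (Fin (k + 1) → ℂ) →ₗ[ℂ] E} {Z : Set ℂ} (hZ : Z.Finite)
    (h : ∀ t ∉ Z, f (veronese k ![1, t]) = f' (veronese k ![1, t])) : f = f' := by
  have hv : ∀ t : ℂ, veronese k ![1, t] = ∑ i : Fin (k + 1), t ^ (i : ℕ) • Pi.single i (1 : ℂ) := by
    intro t
    ext j
    simp [veronese, Finset.sum_apply, Pi.single_apply]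
  refine LinearMap.pi_ext' fun i => LinearMap.ext_ring ?_
  rw [← sub_eq_zero]
  refine (Module.forall_dual_apply_eq_zero_iff ℂ _).1 fun φ => ?_
  let p : ℂ[X] := ∑ i : Fin (k + 1),
    monomial (i : ℕ) (φ (f (Pi.single i 1) - f' (Pi.single i 1)))
  have hp : p = 0 := by
    refine Polynomial.eq_zero_of_infinite_isRoot p (hZ.infinite_compl.mono fun t ht => ?_)
    have := h t ht
    rw [hv, map_sum, map_sum, ← sub_eq_zero, ← Finset.sum_sub_distrib] at this
    have h2 := congrArg φ this
    simp only [map_smul, ← smul_sub, map_sum, map_zero] at h2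
    simp only [Set.mem_ofPred_eq, IsRoot.def, p, eval_finsetSum, eval_monomial]
    rw [← h2]
    exact Finset.sum_congr rfl fun i _ => by rw [smul_eq_mul, mul_comm]
  have hc := congrArg (fun q => q.coeff (i : ℕ)) hp
  simp only [p, finsetSum_coeff, coeff_monomial, coeff_zero] at hc
  rw [Finset.sum_eq_single i (fun j _ hj => if_neg fun h => hj (Fin.ext h)) (by simp),
    if_pos rfl] at hc
  simpa using hc

/-- The polynomial whose coefficients are a row of the symmetric power of `g`. -/
def symPoly {R : Type*} [CommRing R] (k : ℕ) (g : Matrix (Fin 2) (Fin 2) R) (i : ℕ) : R[X] :=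
  (C (g 0 0) + C (g 0 1) * X) ^ (k - i) * (C (g 1 0) + C (g 1 1) * X) ^ i

theorem natDegree_symPoly_lt {k : ℕ} (g : Matrix (Fin 2) (Fin 2) ℂ) (i : Fin (k + 1)) :
    (symPoly k g i).natDegree < k + 1 := by
  have h : ∀ a b : ℂ, (C a + C b * X).natDegree ≤ 1 := fun a b => by compute_degree
  have h1 := natDegree_pow_le_of_le (k - i) (h (g 0 0) (g 0 1))
  have h2 := natDegree_pow_le_of_le i (h (g 1 0) (g 1 1))
  have h3 : (symPoly k g i).natDegree ≤ _ := natDegree_mul_le_of_le h1 h2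
  omega

/-- The matrix of the `k`-th symmetric power. -/
def symMatrix {R : Type*} [CommRing R] (k : ℕ) (g : Matrix (Fin 2) (Fin 2) R) :
    Matrix (Fin (k + 1)) (Fin (k + 1)) R :=
  Matrix.of fun i j => (symPoly k g i).coeff j

theorem symMatrix_mulVec_one (k : ℕ) (g : Matrix (Fin 2) (Fin 2) ℂ) (t : ℂ) :
    symMatrix k g *ᵥ veronese k ![1, t] = veronese k (g *ᵥ ![1, t]) := by
  ext i
  have h : (symPoly k g i).eval t = veronese k (g *ᵥ ![1, t]) i := by
    simp [symPoly, veronese, Matrix.mulVec, dotProduct, Fin.sum_univ_two]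
  rw [← h, eval_eq_sum_range' (natDegree_symPoly_lt g i), Finset.sum_range]
  simp [symMatrix, veronese, Matrix.mulVec, dotProduct]

theorem symMatrix_mulVec (k : ℕ) (g : Matrix (Fin 2) (Fin 2) ℂ) {v : Fin 2 → ℂ} (hv : v 0 ≠ 0) :
    symMatrix k g *ᵥ veronese k v = veronese k (g *ᵥ v) := by
  have h : v = v 0 • ![1, v 1 / v 0] := by
    ext i
    fin_cases i
    · simp
    · simp [mul_div_cancel₀ _ hv]
  rw [h, veronese_smul, mulVec_smul, symMatrix_mulVec_one, mulVec_smul, veronese_smul]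

theorem finite_mulVec_eq_zero (g : SL2C) : {t : ℂ | (g.1 *ᵥ ![1, t]) 0 = 0}.Finite := by
  have hdet := g.2
  rw [det_fin_two] at hdet
  refine Set.Subsingleton.finite fun t ht s hs => ?_
  simp only [Set.mem_ofPred_eq, Matrix.mulVec, dotProduct, Fin.sum_univ_two, Matrix.cons_val_zero,
    Matrix.cons_val_one, mul_one] at ht hs
  have hb : g.1 0 1 ≠ 0 := by
    intro hb
    rw [hb] at ht hdet
    simp only [zero_mul, add_zero, sub_zero] at ht hdet
    rw [ht, zero_mul] at hdet
    exact zero_ne_one hdet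
  exact mul_left_cancel₀ hb (by linear_combination ht - hs)

/-- The `k`-th symmetric power of the standard representation of `SL(2, ℂ)`. -/
def symRep (k : ℕ) : SL2C →* Module.End ℂ (Fin (k + 1) → ℂ) where
  toFun g := Matrix.toLin' (symMatrix k g.1)
  map_one' := by
    refine linearMap_ext_veronese Set.finite_empty fun t _ => ?_
    rw [Matrix.toLin'_apply, symMatrix_mulVec_one]
    simp
  map_mul' g h := by
    refine linearMap_ext_veronese (finite_mulVec_eq_zero h) fun t ht => ?_
    rw [Module.End.mul_apply, Matrix.toLin'_apply, Matrix.toLin'_apply, Matrix.toLin'_apply,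
      symMatrix_mulVec_one, symMatrix_mulVec_one, symMatrix_mulVec k _ ht, mulVec_mulVec]
    rfl

theorem symRep_apply (k : ℕ) (g : SL2C) (x : Fin (k + 1) → ℂ) :
    symRep k g x = symMatrix k g.1 *ᵥ x := rfl

theorem symRep_veronese (k : ℕ) (g : SL2C) {v : Fin 2 → ℂ} (hv : v 0 ≠ 0) :
    symRep k g (veronese k v) = veronese k (g.1 *ᵥ v) := symMatrix_mulVec k g.1 hv

/-- The invariant bilinear form on the symmetric power. -/
def symForm (k : ℕ) : (Fin (k + 1) → ℂ) →ₗ[ℂ] (Fin (k + 1) → ℂ) →ₗ[ℂ] ℂ :=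
  LinearMap.mk₂ ℂ (fun x y => ∑ i : Fin (k + 1), (-1) ^ (i : ℕ) * (k.choose i : ℂ) * x i * y i.rev)
    (fun x x' y => by simp [mul_add, add_mul, Finset.sum_add_distrib])
    (fun c x y => by
      simp only [Pi.smul_apply, smul_eq_mul, Finset.mul_sum]
      exact Finset.sum_congr rfl fun i _ => by ring)
    (fun x y y' => by simp [mul_add, Finset.sum_add_distrib])
    (fun c x y => by
      simp only [Pi.smul_apply, smul_eq_mul, Finset.mul_sum]
      exact Finset.sum_congr rfl fun i _ => by ring)

theorem symForm_apply (k : ℕ) (x y : Fin (k + 1) → ℂ) :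
    symForm k x y = ∑ i : Fin (k + 1), (-1) ^ (i : ℕ) * (k.choose i : ℂ) * x i * y i.rev := rfl

/-- The binomial theorem: on the curve the form is the k-th power of the determinant of ℂ².
Invariance and the sign (-1)^k under exchange of arguments follow from this formula. -/
theorem symForm_veronese (k : ℕ) (v w : Fin 2 → ℂ) :
    symForm k (veronese k v) (veronese k w) = (v 0 * w 1 - v 1 * w 0) ^ k := by
  rw [symForm_apply, show v 0 * w 1 - v 1 * w 0 = -(v 1 * w 0) + v 0 * w 1 by ring, add_pow,
    Finset.sum_range]
  refine Finset.sum_congr rfl fun i _ => ?_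
  have h : k - (k - (i : ℕ)) = i := by omega
  simp only [veronese, Fin.val_rev, Nat.add_sub_add_right, h]
  rw [neg_pow (v 1 * w 0), mul_pow, mul_pow]
  ring

theorem symForm_single (k : ℕ) (x : Fin (k + 1) → ℂ) (i : Fin (k + 1)) :
    symForm k x (Pi.single i.rev 1) = (-1) ^ (i : ℕ) * (k.choose i : ℂ) * x i := by
  rw [symForm_apply, Finset.sum_eq_single i]
  · simp
  · intro j _ hj
    rw [Pi.single_eq_of_ne (fun h => hj (Fin.rev_injective h)), mul_zero]
  · simp

theorem symForm_nondegenerate (k : ℕ) (x : Fin (k + 1) → ℂ) (h : ∀ y, symForm k x y = 0) :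
    x = 0 := by
  ext i
  have := h (Pi.single i.rev 1)
  rw [symForm_single] at this
  have hc : (k.choose i : ℂ) ≠ 0 := by
    exact_mod_cast (Nat.choose_pos (by omega)).ne'
  simpa [hc] using this

/-- Since one more point may always be excluded, the two parameters can be taken distinct; this is
what makes the transitivity of SL(2, ℂ) on pairs of lines available. -/
theorem bilin_ext_veronese {k : ℕ} {B B' : (Fin (k + 1) → ℂ) →ₗ[ℂ] (Fin (k + 1) → ℂ) →ₗ[ℂ] ℂ}
    {Z : Set ℂ} (hZ : Z.Finite)
    (h : ∀ t ∉ Z, ∀ s ∉ Z, t ≠ s → B (veronese k ![1, t]) (veronese k ![1, s]) =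
      B' (veronese k ![1, t]) (veronese k ![1, s])) : B = B' := by
  refine linearMap_ext_veronese hZ fun t ht => ?_
  refine linearMap_ext_veronese (hZ.insert t) fun s hs => ?_
  rw [Set.mem_insert_iff, not_or] at hs
  exact h t ht s hs.2 (Ne.symm hs.1)

theorem symForm_symRep (k : ℕ) (g : SL2C) (x y : Fin (k + 1) → ℂ) :
    symForm k (symRep k g x) (symRep k g y) = symForm k x y := by
  have : (symForm k).compl₁₂ (symRep k g) (symRep k g) = symForm k := by
    refine bilin_ext_veronese Set.finite_empty fun t _ s _ _ => ?_
    rw [LinearMap.compl₁₂_apply, symRep_veronese _ _ (by simp), symRep_veronese _ _ (by simp),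
      symForm_veronese, symForm_veronese]
    have hdet := g.2
    rw [det_fin_two] at hdet
    congr 1
    simp only [Matrix.mulVec, dotProduct, Fin.sum_univ_two, Matrix.cons_val_zero,
      Matrix.cons_val_one]
    linear_combination (s - t) * hdet
  exact congrArg (fun B => B x y) this

theorem symForm_comm (k : ℕ) (x y : Fin (k + 1) → ℂ) :
    symForm k y x = (-1) ^ k * symForm k x y := by
  have : (symForm k).flip = (-1 : ℂ) ^ k • symForm k := by
    refine bilin_ext_veronese Set.finite_empty fun t _ s _ _ => ?_
    rw [LinearMap.flip_apply, LinearMap.smul_apply, LinearMap.smul_apply, symForm_veronese,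
      symForm_veronese, smul_eq_mul, ← mul_pow]
    congr 1
    ring
  rw [← LinearMap.flip_apply, this, LinearMap.smul_apply, LinearMap.smul_apply, smul_eq_mul]

/-- Plays the part of Schur's lemma. SL(2, ℂ) moves the pair (1, 0), (1, 1) to any pair of distinct
points of the chart up to scaling, so an invariant form is determined by a single value. -/
theorem exists_eq_smul_symForm {k : ℕ} (B : (Fin (k + 1) → ℂ) →ₗ[ℂ] (Fin (k + 1) → ℂ) →ₗ[ℂ] ℂ)
    (hB : ∀ g x y, B (symRep k g x) (symRep k g y) = B x y) : ∃ c : ℂ, B = c • symForm k := by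
  refine ⟨B (veronese k ![1, 0]) (veronese k ![1, 1]), ?_⟩
  refine bilin_ext_veronese Set.finite_empty fun t _ s _ hts => ?_
  have hd : s - t ≠ 0 := sub_ne_zero.2 (Ne.symm hts)
  -- Chosen to send (1, 0) to (1, t) and (1, 1) to (s - t)⁻¹ (1, s).
  let g : SL2C := ⟨!![1, 1 / (s - t) - 1; t, s / (s - t) - t], by
    rw [det_fin_two_of]
    field_simp
    ring⟩
  have h1 : veronese k ![1, t] = symRep k g (veronese k ![1, 0]) := by
    rw [symRep_veronese _ _ (by simp)]
    congr 1
    ext i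
    fin_cases i <;> simp [g, Matrix.mulVec, dotProduct, Fin.sum_univ_two]
  have h2 : veronese k ![1, s] = (s - t) ^ k • symRep k g (veronese k ![1, 1]) := by
    rw [symRep_veronese _ _ (by simp), ← veronese_smul]
    congr 1
    ext i
    fin_cases i <;> simp [g, Matrix.mulVec, dotProduct, Fin.sum_univ_two] <;> field_simp
  conv_lhs => rw [h1, h2, map_smul, hB]
  rw [LinearMap.smul_apply, LinearMap.smul_apply, symForm_veronese]
  simp [mul_comm]

theorem exists_symForm_ne_zero (k : ℕ) : ∃ x y, symForm k x y ≠ 0 := by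
  refine ⟨veronese k ![1, 0], veronese k ![0, 1], ?_⟩
  rw [symForm_veronese]
  simp

/-- A representation of `SL(2, ℂ)` with polynomial matrix coefficients. -/
def IsAlgebraicRep {X : Type*} [AddCommGroup X] [Module ℂ X] (ρ : SL2C →* Module.End ℂ X) : Prop :=
  ∀ (ξ : X →ₗ[ℂ] ℂ) (x : X), ∃ P : MvPolynomial (Fin 2 × Fin 2) ℂ,
    ∀ g : SL2C, ξ (ρ g x) = MvPolynomial.eval (fun k => g.1 k.1 k.2) P

theorem exists_mvPolynomial_symMatrix (k : ℕ) (i j : Fin (k + 1)) :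
    ∃ P : MvPolynomial (Fin 2 × Fin 2) ℂ, ∀ g : Matrix (Fin 2) (Fin 2) ℂ,
      symMatrix k g i j = MvPolynomial.eval (fun k => g k.1 k.2) P := by
  -- The entry of the symmetric power of the generic matrix; for this reason `symMatrix` is defined
  -- over any commutative ring.
  refine ⟨symMatrix k (Matrix.of fun a b => MvPolynomial.X (a, b)) i j, fun g => ?_⟩
  simp only [symMatrix, Matrix.of_apply]
  rw [← Polynomial.coeff_map]
  congr 1
  simp [symPoly, Polynomial.map_mul, Polynomial.map_pow]

end SymmetricPower

/-! ### Weights of algebraic representations of SL(2, ℂ). -/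

section Weights

open Module

/-- The upper triangular unipotent one-parameter subgroup. -/
def sl2Upper (t : ℂ) : SL2C := ⟨!![1, t; 0, 1], by simp [det_fin_two]⟩

/-- The lower triangular unipotent one-parameter subgroup. -/
def sl2Lower (t : ℂ) : SL2C := ⟨!![1, 0; t, 1], by simp [det_fin_two]⟩

/-- The diagonal torus. -/
def sl2Torus (z : ℂˣ) : SL2C := ⟨!![(z : ℂ), 0; 0, (z : ℂ)⁻¹], by simp [det_fin_two]⟩

/-- The Weyl element. -/
def sl2Weyl : SL2C := ⟨!![0, 1; -1, 0], by simp [det_fin_two]⟩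

theorem SL2C_ext {g h : SL2C} (h00 : g.1 0 0 = h.1 0 0) (h01 : g.1 0 1 = h.1 0 1)
    (h10 : g.1 1 0 = h.1 1 0) (h11 : g.1 1 1 = h.1 1 1) : g = h := by
  apply Subtype.ext
  ext i j
  fin_cases i <;> fin_cases j <;> assumption

theorem SL2C_mul_apply (g h : SL2C) (i j : Fin 2) :
    (g * h).1 i j = g.1 i 0 * h.1 0 j + g.1 i 1 * h.1 1 j := by
  change (g.1 * h.1) i j = _
  rw [Matrix.mul_apply, Fin.sum_univ_two]

theorem SL2C_one_apply : (1 : SL2C).1 = 1 := rfl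

theorem sl2Upper_val (t : ℂ) : (sl2Upper t).1 = !![1, t; 0, 1] := rfl

theorem sl2Lower_val (t : ℂ) : (sl2Lower t).1 = !![1, 0; t, 1] := rfl

theorem sl2Torus_val (z : ℂˣ) : (sl2Torus z).1 = !![(z : ℂ), 0; 0, (z : ℂ)⁻¹] := rfl

theorem sl2Weyl_val : sl2Weyl.1 = !![0, 1; -1, 0] := rfl

theorem sl2Torus_mul (z w : ℂˣ) : sl2Torus (z * w) = sl2Torus z * sl2Torus w := by
  apply SL2C_ext <;> simp only [SL2C_mul_apply, sl2Torus_val] <;> simp [mul_comm]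

theorem sl2Torus_one : sl2Torus 1 = 1 := by
  apply SL2C_ext <;> simp only [SL2C_one_apply, sl2Torus_val] <;> simp

theorem sl2Upper_zero : sl2Upper 0 = 1 := by
  apply SL2C_ext <;> simp only [SL2C_one_apply, sl2Upper_val] <;> simp

theorem sl2Lower_zero : sl2Lower 0 = 1 := by
  apply SL2C_ext <;> simp only [SL2C_one_apply, sl2Lower_val] <;> simp

theorem sl2Torus_mul_upper (z : ℂˣ) (t : ℂ) :
    sl2Torus z * sl2Upper t = sl2Upper ((z : ℂ) ^ (2 : ℤ) * t) * sl2Torus z := by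
  have hz := z.ne_zero
  apply SL2C_ext <;> simp only [SL2C_mul_apply, sl2Torus_val, sl2Upper_val] <;> simp
  field_simp

theorem sl2Torus_mul_lower (z : ℂˣ) (t : ℂ) :
    sl2Torus z * sl2Lower t = sl2Lower ((z : ℂ) ^ (-2 : ℤ) * t) * sl2Torus z := by
  have hz := z.ne_zero
  apply SL2C_ext <;> simp only [SL2C_mul_apply, sl2Torus_val, sl2Lower_val] <;> simp
  field_simp

theorem sl2Torus_mul_weyl (z : ℂˣ) : sl2Torus z * sl2Weyl = sl2Weyl * sl2Torus z⁻¹ := by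
  apply SL2C_ext <;> simp only [SL2C_mul_apply, sl2Torus_val, sl2Weyl_val] <;> simp

/-- Gauss decomposition on the open cell. A highest weight vector is fixed by the upper factor and
scaled by the torus, so only the lower factor acts in an essential way. -/
theorem eq_lower_mul_torus_mul_upper (g : SL2C) (a : ℂˣ) (ha : (a : ℂ) = g.1 0 0) :
    g = sl2Lower (g.1 1 0 / a) * sl2Torus a * sl2Upper (g.1 0 1 / a) := by
  have hdet := g.2
  rw [det_fin_two, ← ha] at hdet
  have ha0 := a.ne_zero
  apply SL2C_ext <;> simp only [SL2C_mul_apply, sl2Torus_val, sl2Upper_val, sl2Lower_val, ← ha] <;>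
    simp <;> field_simp
  linear_combination hdet

theorem eq_upper_mul_torus_mul_lower (g : SL2C) (d : ℂˣ) (hd : (d : ℂ) = g.1 1 1) :
    g = sl2Upper (g.1 0 1 / d) * sl2Torus d⁻¹ * sl2Lower (g.1 1 0 / d) := by
  have hdet := g.2
  rw [det_fin_two, ← hd] at hdet
  have hd0 := d.ne_zero
  apply SL2C_ext <;> simp only [SL2C_mul_apply, sl2Torus_val, sl2Upper_val, sl2Lower_val, ← hd] <;>
    simp <;> field_simp
  linear_combination hdet

/-- Linear independence of characters, tested against every functional. It compares coefficients of
vector valued Laurent polynomials and replaces the Lie algebra in the weight arguments. -/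
theorem eq_zero_of_sum_character_smul {ι E : Type*} [AddCommGroup E] [Module ℂ E]
    {e : ι → (ℂˣ →* ℂ)} (he : Function.Injective e) {s : Finset ι} {A : ι → E}
    (h : ∀ z : ℂˣ, ∑ i ∈ s, e i z • A i = 0) : ∀ i ∈ s, A i = 0 := by
  intro i hi
  refine (Module.forall_dual_apply_eq_zero_iff ℂ _).1 fun φ => ?_
  have hli : LinearIndependent ℂ (fun i => (e i : ℂˣ → ℂ)) :=
    (linearIndependent_monoidHom ℂˣ ℂ).comp e he
  refine linearIndependent_iff'.1 hli s (fun i => φ (A i)) ?_ i hi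
  ext z
  have := congrArg φ (h z)
  rw [map_sum, map_zero] at this
  rw [Finset.sum_apply, Pi.zero_apply, ← this]
  exact Finset.sum_congr rfl fun i _ => by
    rw [map_smul, Pi.smul_apply, smul_eq_mul, smul_eq_mul, mul_comm]

/-- The character `z ↦ z ^ m` of the multiplicative group. -/
def zpowCharacter (m : ℤ) : ℂˣ →* ℂ := (Units.coeHom ℂ).comp (zpowGroupHom m)

theorem zpowCharacter_apply (m : ℤ) (z : ℂˣ) : zpowCharacter m z = (z : ℂ) ^ m := by
  simp [zpowCharacter]

theorem zpowCharacter_injective : Function.Injective zpowCharacter := by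
  intro m m' h
  have h2 := congrArg (fun f => f (Units.mk0 (2 : ℂ) two_ne_zero)) h
  simp only [zpowCharacter_apply, Units.val_mk0] at h2
  have h3 : (2 : ℝ) ^ m = (2 : ℝ) ^ m' := by
    have := congrArg norm h2
    simpa using this
  exact zpow_right_injective₀ (by norm_num) (by norm_num) h3

variable {X : Type*} [AddCommGroup X] [Module ℂ X]

/-- In a basis there are only finitely many matrix coefficients, so their separate expansions merge
into one expansion with operator coefficients. -/
theorem exists_operator_coeff [FiniteDimensional ℂ X] {Z ι : Type*} (f : Z → End ℂ X)
    (e : ι → Z → ℂ)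
    (h : ∀ (ξ : X →ₗ[ℂ] ℂ) (x : X), ∃ (s : Finset ι) (c : ι → ℂ), (∀ i ∉ s, c i = 0) ∧
      ∀ z, ξ (f z x) = ∑ i ∈ s, c i * e i z) :
    ∃ (s : Finset ι) (E : ι → End ℂ X), (∀ i ∉ s, E i = 0) ∧ ∀ z, f z = ∑ i ∈ s, e i z • E i := by
  classical
  let b := Module.finBasis ℂ X
  choose s c hc hs using fun j k => h (b.coord j) (b k)
  let S : Finset ι := Finset.univ.biUnion fun j => Finset.univ.biUnion fun k => s j k
  have hS : ∀ j k, s j k ⊆ S := fun j k i hi => by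
    simp only [S, Finset.mem_biUnion, Finset.mem_univ, true_and]
    exact ⟨j, k, hi⟩
  refine ⟨S, fun i => Matrix.toLin b b (Matrix.of fun j k => c j k i), fun i hi => ?_,
    fun z => ?_⟩
  · have : (Matrix.of fun j k => c j k i) = 0 := by
      ext j k
      exact hc j k i fun h => hi (hS j k h)
    change Matrix.toLin b b (Matrix.of fun j k => c j k i) = 0
    rw [this, map_zero]
  · refine b.ext fun k => b.ext_elem fun j => ?_
    have h1 : b.repr (f z (b k)) j = ∑ i ∈ S, c j k i * e i z := by
      rw [← Finset.sum_subset (hS j k) fun i _ hi => by rw [hc j k i hi, zero_mul], ← hs j k z]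
      rfl
    rw [h1, LinearMap.sum_apply, map_sum, Finset.sum_apply']
    refine Finset.sum_congr rfl fun i _ => ?_
    rw [LinearMap.smul_apply, map_smul, Matrix.toLin_self, map_sum, Finsupp.smul_apply,
      Finset.sum_apply', Finset.sum_eq_single j]
    · simp [mul_comm]
    · intro j' _ hj
      simp [hj]
    · simp

variable {ρ : SL2C →* End ℂ X}

/-- `x` is a vector of weight `m` for the diagonal torus. -/
def HasWeight (ρ : SL2C →* End ℂ X) (m : ℤ) (x : X) : Prop :=
  ∀ z : ℂˣ, ρ (sl2Torus z) x = (z : ℂ) ^ m • x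

theorem HasWeight.smul {m : ℤ} {x : X} (h : HasWeight ρ m x) (c : ℂ) : HasWeight ρ m (c • x) :=
  fun z => by rw [map_smul, h z, smul_comm]

theorem HasWeight.weyl {m : ℤ} {x : X} (h : HasWeight ρ m x) : HasWeight ρ (-m) (ρ sl2Weyl x) := by
  intro z
  rw [← End.mul_apply, ← map_mul, sl2Torus_mul_weyl, map_mul, End.mul_apply, h, map_smul]
  simp

theorem exists_weight_projections [FiniteDimensional ℂ X] (hρ : IsAlgebraicRep ρ) :
    ∃ (s : Finset ℤ) (π : ℤ → End ℂ X), (∀ m ∉ s, π m = 0) ∧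
      ∀ z : ℂˣ, ρ (sl2Torus z) = ∑ m ∈ s, (z : ℂ) ^ m • π m := by
  classical
  refine exists_operator_coeff (fun z : ℂˣ => ρ (sl2Torus z)) (fun (m : ℤ) z => (z : ℂ) ^ m) ?_
  intro ξ x
  obtain ⟨P, hP⟩ := hρ ξ x
  -- On diag(z, z⁻¹) a monomial restricts to z to this power.
  let w : (Fin 2 × Fin 2 →₀ ℕ) → ℤ := fun d => d (0, 0) - d (1, 1)
  -- The off-diagonal entries are zero: the factors 0 ^ d remove every monomial involving them and
  -- keep the others, because 0 ^ 0 = 1.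
  let a : (Fin 2 × Fin 2 →₀ ℕ) → ℂ := fun d => P.coeff d * 0 ^ d (0, 1) * 0 ^ d (1, 0)
  refine ⟨P.support.image w, fun m => ∑ d ∈ P.support with w d = m, a d, fun m hm => ?_,
    fun z => ?_⟩
  · refine Finset.sum_eq_zero fun d hd => ?_
    rw [Finset.mem_filter] at hd
    exact absurd (Finset.mem_image.2 ⟨d, hd.1, hd.2⟩) hm
  · rw [hP, MvPolynomial.eval_eq', ← Finset.sum_fiberwise_of_maps_to
      (g := w) (t := P.support.image w) fun d hd => Finset.mem_image_of_mem w hd]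
    refine Finset.sum_congr rfl fun m _ => ?_
    rw [Finset.sum_mul]
    refine Finset.sum_congr rfl fun d hd => ?_
    rw [Finset.mem_filter] at hd
    rw [← hd.2, Fintype.prod_prod_type, Fin.prod_univ_two, Fin.prod_univ_two, Fin.prod_univ_two]
    simp only [w, a, sl2Torus, Matrix.of_apply, Matrix.cons_val_zero, Matrix.cons_val_one,
      zpow_sub₀ z.ne_zero, zpow_natCast, inv_pow]
    ring

/-- The coefficients `E i` play the role of the divided powers e^i / i!. Comparing powers of t in
the commutation relation with the torus shows that `E i` shifts weights by δ i. -/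
theorem exists_unipotent_expansion [FiniteDimensional ℂ X] (hρ : IsAlgebraicRep ρ) {u : ℂ → SL2C}
    (hu0 : u 0 = 1) (a : Fin 2 × Fin 2 → Polynomial ℂ)
    (ha : ∀ t k, (u t).1 k.1 k.2 = (a k).eval t) {δ : ℤ}
    (hδ : ∀ z t, sl2Torus z * u t = u ((z : ℂ) ^ δ * t) * sl2Torus z) :
    ∃ (s : Finset ℕ) (E : ℕ → End ℂ X), (∀ i ∉ s, E i = 0) ∧ E 0 = 1 ∧
      (∀ t, ρ (u t) = ∑ i ∈ s, t ^ i • E i) ∧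
      ∀ m x, HasWeight ρ m x → ∀ i : ℕ, HasWeight ρ (m + δ * i) (E i x) := by
  obtain ⟨s, E, hE, hs⟩ := exists_operator_coeff (fun t : ℂ => ρ (u t)) (fun (i : ℕ) t => t ^ i) (by
    intro ξ x
    obtain ⟨P, hP⟩ := hρ ξ x
    let Q : Polynomial ℂ := MvPolynomial.aeval a P
    refine ⟨Q.support, Q.coeff, fun i hi => Polynomial.notMem_support_iff.1 hi, fun t => ?_⟩
    have h1 : Q.eval t = ∑ i ∈ Q.support, Q.coeff i * t ^ i := Polynomial.eval_eq_sum
    rw [← h1, hP]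
    have h2 : (Polynomial.evalRingHom t) (MvPolynomial.aeval a P) = _ :=
      MvPolynomial.map_aeval a (Polynomial.evalRingHom t) P
    rw [Polynomial.coe_evalRingHom] at h2
    rw [h2]
    simp only [ha, MvPolynomial.eval, Polynomial.coe_evalRingHom]
    congr 2
    ext c
    simp)
  refine ⟨s, E, hE, ?_, hs, fun m x hx i z => ?_⟩
  · have h := hs 0
    simp only [hu0, map_one] at h
    rw [h]
    by_cases h0 : 0 ∈ s
    · rw [Finset.sum_eq_single 0 (fun i _ hi => by rw [zero_pow hi, zero_smul])
        (fun h => absurd h0 h), pow_zero, one_smul]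
    · rw [hE 0 h0]
      exact (Finset.sum_eq_zero fun i hi => by
        rw [zero_pow (fun h => h0 (h ▸ hi)), zero_smul]).symm
  · by_cases hi : i ∈ s
    swap
    · rw [hE i hi]; simp
    have key : ∀ t : ℂˣ, ∑ i ∈ s, zpowCharacter (i : ℤ) t •
        (ρ (sl2Torus z) (E i x) - (z : ℂ) ^ (m + δ * i) • E i x) = 0 := by
      intro t
      have h1 : ρ (sl2Torus z) (ρ (u t) x) = ρ (u ((z : ℂ) ^ δ * t)) (ρ (sl2Torus z) x) := by
        rw [← End.mul_apply, ← map_mul, hδ, map_mul, End.mul_apply]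
      rw [hx z, show ρ (u t) = _ from hs t, show ρ (u ((z : ℂ) ^ δ * t)) = _ from hs _] at h1
      rw [LinearMap.sum_apply, LinearMap.sum_apply, map_sum, ← sub_eq_zero,
        ← Finset.sum_sub_distrib] at h1
      rw [← h1]
      refine Finset.sum_congr rfl fun i _ => ?_
      rw [zpowCharacter_apply, LinearMap.smul_apply, LinearMap.smul_apply, map_smul, map_smul,
        smul_sub, smul_smul, smul_smul, zpow_natCast, mul_pow, zpow_add₀ z.ne_zero, _root_.zpow_mul,
        zpow_natCast]
      congr 2
      ring
    exact sub_eq_zero.1 (eq_zero_of_sum_character_smul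
      (e := fun i : ℕ => zpowCharacter (i : ℤ))
      (zpowCharacter_injective.comp Nat.cast_injective) key i hi)

theorem exists_upper_expansion [FiniteDimensional ℂ X] (hρ : IsAlgebraicRep ρ) :
    ∃ (s : Finset ℕ) (E : ℕ → End ℂ X), (∀ i ∉ s, E i = 0) ∧ E 0 = 1 ∧
      (∀ t, ρ (sl2Upper t) = ∑ i ∈ s, t ^ i • E i) ∧
      ∀ m x, HasWeight ρ m x → ∀ i : ℕ, HasWeight ρ (m + 2 * i) (E i x) := by
  refine exists_unipotent_expansion hρ sl2Upper_zero
    (fun k => !![1, Polynomial.X; 0, 1] k.1 k.2) ?_ sl2Torus_mul_upper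
  rintro t ⟨i, j⟩
  fin_cases i <;> fin_cases j <;> simp [sl2Upper]

theorem exists_lower_expansion [FiniteDimensional ℂ X] (hρ : IsAlgebraicRep ρ) :
    ∃ (s : Finset ℕ) (E : ℕ → End ℂ X), (∀ i ∉ s, E i = 0) ∧ E 0 = 1 ∧
      (∀ t, ρ (sl2Lower t) = ∑ i ∈ s, t ^ i • E i) ∧
      ∀ m x, HasWeight ρ m x → ∀ i : ℕ, HasWeight ρ (m + -2 * i) (E i x) := by
  refine exists_unipotent_expansion hρ sl2Lower_zero
    (fun k => !![1, 0; Polynomial.X, 1] k.1 k.2) ?_ sl2Torus_mul_lower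
  rintro t ⟨i, j⟩
  fin_cases i <;> fin_cases j <;> simp [sl2Lower]

theorem sum_eq_sum_fin {E : Type*} [AddCommMonoid E] {s : Finset ℕ} {f : ℕ → E} (K : ℕ)
    (hs : ∀ i ∉ s, f i = 0) (hK : ∀ i, K ≤ i → f i = 0) :
    ∑ i ∈ s, f i = ∑ i : Fin K, f i := by
  rw [← Finset.sum_range (fun i => f i)]
  trans ∑ i ∈ s ∪ Finset.range K, f i
  · exact Finset.sum_subset Finset.subset_union_left fun i _ hi => hs i hi
  · exact (Finset.sum_subset Finset.subset_union_right fun i _ hi =>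
      hK i (by simpa using hi)).symm

section Projections

variable {s : Finset ℤ} {π : ℤ → End ℂ X}
  (hπ : ∀ z : ℂˣ, ρ (sl2Torus z) = ∑ m ∈ s, (z : ℂ) ^ m • π m)
include hπ

theorem sum_weight_projections (x : X) : ∑ m ∈ s, π m x = x := by
  have := hπ 1
  rw [sl2Torus_one, map_one] at this
  have h2 := congrArg (fun f => f x) this
  simp only [Units.val_one, _root_.one_zpow, one_smul, LinearMap.sum_apply, End.one_apply] at h2
  exact h2.symm

theorem hasWeight_projection {m : ℤ} (hm : m ∈ s) (x : X) : HasWeight ρ m (π m x) := by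
  intro z
  have key : ∀ w : ℂˣ, ∑ i ∈ s, zpowCharacter i w •
      (ρ (sl2Torus z) (π i x) - (z : ℂ) ^ i • π i x) = 0 := by
    intro w
    have h1 : ρ (sl2Torus z) (ρ (sl2Torus w) x) = ρ (sl2Torus (z * w)) x := by
      rw [sl2Torus_mul, map_mul, End.mul_apply]
    rw [hπ w, hπ (z * w), LinearMap.sum_apply, LinearMap.sum_apply, map_sum, ← sub_eq_zero,
        ← Finset.sum_sub_distrib] at h1
    rw [← h1]
    refine Finset.sum_congr rfl fun i _ => ?_
    rw [zpowCharacter_apply, LinearMap.smul_apply, LinearMap.smul_apply, map_smul, smul_sub,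
      smul_smul, Units.val_mul, mul_zpow, mul_comm]
  exact sub_eq_zero.1 (eq_zero_of_sum_character_smul zpowCharacter_injective key m hm)

theorem weight_projection_apply {m : ℤ} {x : X} (hx : HasWeight ρ m x) {i : ℤ} (hi : i ∈ s) :
    π i x = if i = m then x else 0 := by
  classical
  have key : ∀ z : ℂˣ, ∑ i ∈ insert m s, zpowCharacter i z •
      ((if i ∈ s then π i x else 0) - (if i = m then x else 0)) = 0 := by
    intro z
    have h1 := hx z
    rw [hπ z, LinearMap.sum_apply] at h1
    simp only [smul_sub, Finset.sum_sub_distrib, zpowCharacter_apply]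
    rw [sub_eq_zero]
    trans (z : ℂ) ^ m • x
    · rw [← h1]
      symm
      refine Finset.sum_subset_zero_on_sdiff (Finset.subset_insert m s) (fun i hi => ?_)
        fun i hi => ?_
      · rw [if_neg (Finset.mem_sdiff.1 hi).2, smul_zero]
      · rw [if_pos hi, LinearMap.smul_apply]
    · rw [Finset.sum_eq_single m (fun i _ h => by rw [if_neg h, smul_zero])
        (fun h => absurd (Finset.mem_insert_self m s) h), if_pos rfl]
  have := eq_zero_of_sum_character_smul zpowCharacter_injective key i (Finset.mem_insert_of_mem hi)
  rw [if_pos hi] at this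
  exact sub_eq_zero.1 this

theorem linearMap_ext_weight {E : Type*} [AddCommGroup E] [Module ℂ E] {f f' : X →ₗ[ℂ] E}
    (h : ∀ m x, HasWeight ρ m x → f x = f' x) : f = f' := by
  ext x
  rw [← sum_weight_projections hπ x, map_sum, map_sum]
  exact Finset.sum_congr rfl fun m hm => h m _ (hasWeight_projection hπ hm x)

theorem mem_of_hasWeight {m : ℤ} {x : X} (hx : HasWeight ρ m x) (hx0 : x ≠ 0) : m ∈ s := by
  by_contra hm
  apply hx0
  rw [← sum_weight_projections hπ x]
  refine Finset.sum_eq_zero fun i hi => ?_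
  rw [weight_projection_apply hπ hx hi, if_neg]
  rintro rfl
  exact hm hi

end Projections

/-- The Weyl element exchanges the weights m and -m, so the largest weight k is nonnegative and -k
is a lower bound. -/
theorem exists_highest_weight [FiniteDimensional ℂ X] [Nontrivial X] (hρ : IsAlgebraicRep ρ) :
    ∃ (k : ℕ) (x : X), x ≠ 0 ∧ HasWeight ρ k x ∧
      ∀ m : ℤ, ((k : ℤ) < m ∨ m < -k) → ∀ y, HasWeight ρ m y → y = 0 := by
  classical
  obtain ⟨s, π, -, hπ⟩ := exists_weight_projections hρ
  let S := s.filter fun m => ∃ x : X, x ≠ 0 ∧ HasWeight ρ m x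
  have hS : S.Nonempty := by
    obtain ⟨x, hx⟩ := exists_ne (0 : X)
    rw [← sum_weight_projections hπ x] at hx
    obtain ⟨m, hm, hmx⟩ := Finset.exists_ne_zero_of_sum_ne_zero hx
    exact ⟨m, Finset.mem_filter.2 ⟨hm, _, hmx, hasWeight_projection hπ hm x⟩⟩
  have hinj : Function.Injective (ρ sl2Weyl) := by
    refine Function.LeftInverse.injective (g := ρ sl2Weyl⁻¹) fun x => ?_
    rw [← End.mul_apply, ← map_mul, inv_mul_cancel, map_one, End.one_apply]
  have hmax : ∀ m x, HasWeight ρ m x → x ≠ 0 → m ≤ S.max' hS := fun m x hx hx0 =>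
    S.le_max' m (Finset.mem_filter.2 ⟨mem_of_hasWeight hπ hx hx0, x, hx0, hx⟩)
  have hmin : ∀ m x, HasWeight ρ m x → x ≠ 0 → -m ≤ S.max' hS := fun m x hx hx0 =>
    hmax _ _ hx.weyl ((map_ne_zero_iff _ hinj).2 hx0)
  obtain ⟨x, hx0, hx⟩ := (Finset.mem_filter.1 (S.max'_mem hS)).2
  have hk := hmin _ _ hx hx0
  obtain ⟨k, hk⟩ := Int.eq_ofNat_of_zero_le (show 0 ≤ S.max' hS by omega)
  rw [hk] at hx hmax hmin
  refine ⟨k, x, hx0, hx, fun m hm y hy => ?_⟩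
  by_contra hy0
  have h1 := hmax _ _ hy hy0
  have h2 := hmin _ _ hy hy0
  omega

/-- In the expansion the term of degree i ≥ 1 has weight k + 2i > k and so vanishes. -/
theorem upper_fixes_of_highest [FiniteDimensional ℂ X] (hρ : IsAlgebraicRep ρ) {k : ℤ}
    (hk : ∀ m : ℤ, k < m → ∀ y, HasWeight ρ m y → y = 0) {x : X} (hx : HasWeight ρ k x) (t : ℂ) :
    ρ (sl2Upper t) x = x := by
  obtain ⟨s, E, hE, hE0, hs, hw⟩ := exists_upper_expansion hρ
  rw [hs, LinearMap.sum_apply, sum_eq_sum_fin (f := fun i => (t ^ i • E i) x) 1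
    (fun i hi => by simp only [hE i hi, smul_zero, LinearMap.zero_apply]) (fun i hi => by
      rw [LinearMap.smul_apply, hk _ _ _ (hw k x hx i), smul_zero]
      omega)]
  simp [hE0]

end Weights

/-! ### Decomposition into symmetric powers. -/

section CompleteReducibility

open Module

variable {X : Type*} [AddCommGroup X] [Module ℂ X] [FiniteDimensional ℂ X]
  {ρ : SL2C →* End ℂ X}

/-- Send the i-th coordinate vector to `F i x`, with F the coefficients of the lower unipotent
subgroup; those with i > k vanish, having weight below -k. On the open cell the orbit of x is then
the image of the rational normal curve, which suffices for equivariance. -/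
theorem exists_embedding_of_highest_weight (hρ : IsAlgebraicRep ρ) {k : ℕ} {x : X}
    (hx : HasWeight ρ k x)
    (hk : ∀ m : ℤ, ((k : ℤ) < m ∨ m < -k) → ∀ y, HasWeight ρ m y → y = 0) :
    ∃ f : (Fin (k + 1) → ℂ) →ₗ[ℂ] X, (∀ g c, f (symRep k g c) = ρ g (f c)) ∧
      f (veronese k ![1, 0]) = x := by
  obtain ⟨s, F, hF, hF0, hs, hw⟩ := exists_lower_expansion hρ
  let f : (Fin (k + 1) → ℂ) →ₗ[ℂ] X :=
    ∑ i : Fin (k + 1), (LinearMap.proj i).smulRight (F i x)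
  have hf : ∀ c, f c = ∑ i : Fin (k + 1), c i • F i x := fun c => by
    simp [f, LinearMap.sum_apply]
  have hFk : ∀ i : ℕ, k + 1 ≤ i → F i x = 0 := fun i hi =>
    hk _ (Or.inr (by omega)) _ (hw _ _ hx i)
  -- The translate of x by g depends only on the first column of g.
  have key : ∀ (g : SL2C) (v : Fin 2 → ℂ), (∀ i, v i = g.1 i 0) → v 0 ≠ 0 →
      ρ g x = f (veronese k v) := by
    intro g v hv hv0
    have h1 := eq_lower_mul_torus_mul_upper g (Units.mk0 (v 0) hv0) (hv 0)
    rw [h1, map_mul, map_mul, End.mul_apply, End.mul_apply,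
      upper_fixes_of_highest hρ (fun m hm => hk m (Or.inl hm)) hx, hx, map_smul, hs, hf,
      LinearMap.sum_apply, sum_eq_sum_fin (f := fun i =>
        ((g.1 1 0 / ((Units.mk0 (v 0) hv0 : ℂˣ) : ℂ)) ^ i • F i) x) (k + 1)
      (fun i hi => by simp only [hF i hi, smul_zero, LinearMap.zero_apply])
      (fun i hi => by simp only [LinearMap.smul_apply, hFk i hi, smul_zero]), Finset.smul_sum]
    refine Finset.sum_congr rfl fun i _ => ?_
    rw [LinearMap.smul_apply, smul_smul, ← hv 1]
    congr 1
    rw [Units.val_mk0, zpow_natCast, div_pow, veronese, pow_sub₀ _ hv0 (by omega)]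
    field_simp
  refine ⟨f, fun g c => ?_, ?_⟩
  · have : f ∘ₗ symRep k g = ρ g ∘ₗ f := by
      refine linearMap_ext_veronese (finite_mulVec_eq_zero g) fun t ht => ?_
      rw [LinearMap.comp_apply, LinearMap.comp_apply, symRep_veronese _ _ (by simp),
        ← key (sl2Lower t) ![1, t] (by intro i; fin_cases i <;> simp [sl2Lower_val]) (by simp),
        ← key (g * sl2Lower t) _ _ ht, map_mul, End.mul_apply]
      intro i
      rw [SL2C_mul_apply, sl2Lower_val]
      simp [Matrix.mulVec, dotProduct, Fin.sum_univ_two]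
    exact congrArg (fun f => f c) this
  · rw [← key 1 ![1, 0] (by intro i; fin_cases i <;> simp [SL2C_one_apply]) (by simp), map_one,
      End.one_apply]

/-- Dual to the embedding of a symmetric power: the functional ξ picking out the lowest weight
vector x is fixed by the upper unipotents, so y ↦ ξ(hy) depends only on the second row of h. The
kernel of the resulting pairing will provide a stable complement to an embedded symmetric power,
without any averaging. -/
theorem exists_pairing_of_highest_weight (hρ : IsAlgebraicRep ρ) {k : ℕ} {x : X} (hx0 : x ≠ 0)
    (hx : HasWeight ρ (-k) x)
    (hk : ∀ m : ℤ, ((k : ℤ) < m ∨ m < -k) → ∀ y, HasWeight ρ m y → y = 0) :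
    ∃ L : X →ₗ[ℂ] (Fin (k + 1) → ℂ) →ₗ[ℂ] ℂ, (∀ g y c, L (ρ g y) (symRep k g c) = L y c) ∧
      L x (veronese k ![1, 0]) = 1 := by
  obtain ⟨s, F, hF, hF0, hs, hw⟩ := exists_lower_expansion hρ
  obtain ⟨s', E, hE, hE0, hs', hw'⟩ := exists_upper_expansion hρ
  obtain ⟨S, π, -, hπ⟩ := exists_weight_projections hρ
  obtain ⟨η, hη⟩ : ∃ η : X →ₗ[ℂ] ℂ, η x = 1 := by
    obtain ⟨φ, hφ⟩ : ∃ φ : X →ₗ[ℂ] ℂ, φ x ≠ 0 := by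
      by_contra h
      push Not at h
      exact hx0 ((Module.forall_dual_apply_eq_zero_iff ℂ x).1 h)
    exact ⟨(φ x)⁻¹ • φ, inv_mul_cancel₀ hφ⟩
  let ξ : X →ₗ[ℂ] ℂ := η ∘ₗ π (-k)
  have hmS : (-k : ℤ) ∈ S := mem_of_hasWeight hπ hx hx0
  have hξx : ξ x = 1 := by
    change η (π (-k) x) = 1
    rw [weight_projection_apply hπ hx hmS, if_pos rfl, hη]
  have hξ : ∀ m y, HasWeight ρ m y → m ≠ -k → ξ y = 0 := by
    intro m y hy hm
    change η (π (-k) y) = 0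
    rw [weight_projection_apply hπ hy hmS, if_neg (Ne.symm hm), map_zero]
  have hξU : ∀ t y, ξ (ρ (sl2Upper t) y) = ξ y := by
    intro t y
    have : ξ ∘ₗ ρ (sl2Upper t) = ξ := by
      refine linearMap_ext_weight hπ fun m y hy => ?_
      by_cases hm : m < -k
      · rw [hk m (Or.inr hm) y hy, map_zero, map_zero]
      rw [LinearMap.comp_apply, hs', LinearMap.sum_apply, map_sum,
        sum_eq_sum_fin (f := fun i => ξ ((t ^ i • E i) y)) 1
        (fun i hi => by simp only [hE i hi, smul_zero, LinearMap.zero_apply, map_zero])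
        (fun i hi => by
          rw [LinearMap.smul_apply, map_smul, hξ _ _ (hw' m y hy i) (by omega), smul_zero])]
      simp [hE0]
    exact congrArg (fun f => f y) this
  have hξT : ∀ z y, ξ (ρ (sl2Torus z) y) = (z : ℂ) ^ (-k : ℤ) * ξ y := by
    intro z y
    have : ξ ∘ₗ ρ (sl2Torus z) = ((z : ℂ) ^ (-k : ℤ)) • ξ := by
      refine linearMap_ext_weight hπ fun m y hy => ?_
      rw [LinearMap.comp_apply, hy, map_smul, LinearMap.smul_apply]
      by_cases hm : m = -k
      · rw [hm]
      · rw [hξ m y hy hm, smul_zero, smul_zero]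
    exact congrArg (fun f => f y) this
  have hξF : ∀ i : ℕ, k + 1 ≤ i → ξ ∘ₗ F i = 0 := by
    intro i hi
    refine linearMap_ext_weight hπ fun m y hy => ?_
    by_cases hm : (k : ℤ) < m
    · rw [hk m (Or.inl hm) y hy, map_zero, map_zero]
    · exact hξ _ _ (hw m y hy i) (by omega)
  -- The signs come from the inverse matrix: the second row of g⁻¹ is (-g₁₀, g₀₀), where g₀₀ and g₁₀
  -- form the first column of g.
  let L : X →ₗ[ℂ] (Fin (k + 1) → ℂ) →ₗ[ℂ] ℂ :=
    ∑ i : Fin (k + 1), (ξ ∘ₗ F i).smulRight ((-1 : ℂ) ^ (i : ℕ) • LinearMap.proj i)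
  have hL : ∀ y c, L y c = ∑ i : Fin (k + 1), ξ (F i y) * ((-1) ^ (i : ℕ) * c i) := by
    intro y c
    simp only [L, LinearMap.sum_apply, LinearMap.smulRight_apply, LinearMap.smul_apply,
      LinearMap.comp_apply, LinearMap.proj_apply, smul_eq_mul]
  have key : ∀ (h : SL2C) (v : Fin 2 → ℂ) y, h.1 1 0 = -v 1 → v 0 = h.1 1 1 → v 0 ≠ 0 →
      ξ (ρ h y) = L y (veronese k v) := by
    intro h v y h10 h11 hv0
    have h1 := eq_upper_mul_torus_mul_lower h (Units.mk0 (v 0) hv0) h11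
    rw [h1, map_mul, map_mul, End.mul_apply, End.mul_apply, hξU, hξT, hs, LinearMap.sum_apply,
      map_sum, sum_eq_sum_fin (f := fun i => ξ
        (((h.1 1 0 / ((Units.mk0 (v 0) hv0 : ℂˣ) : ℂ)) ^ i • F i) y)) (k + 1)
      (fun i hi => by simp only [hF i hi, smul_zero, LinearMap.zero_apply, map_zero])
      (fun i hi => by
        have := congrArg (fun f => f y) (hξF i hi)
        simp only [LinearMap.comp_apply, LinearMap.zero_apply] at this
        rw [LinearMap.smul_apply, map_smul, this, smul_zero]), hL, Finset.mul_sum]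
    refine Finset.sum_congr rfl fun i _ => ?_
    rw [LinearMap.smul_apply, map_smul, h10, smul_eq_mul, Units.val_inv_eq_inv_val, Units.val_mk0,
      _root_.inv_zpow, ← _root_.zpow_neg, neg_neg, zpow_natCast, div_pow, veronese,
      pow_sub₀ _ hv0 (by omega), neg_pow (v 1)]
    field_simp
  refine ⟨L, fun g y c => ?_, ?_⟩
  · have : L (ρ g y) ∘ₗ symRep k g = L y := by
      refine linearMap_ext_veronese (finite_mulVec_eq_zero g) fun t ht => ?_
      have e1 : (sl2Lower (-t)).1 1 0 = -t := by simp [sl2Lower_val]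
      have e2 : (sl2Lower (-t)).1 1 1 = 1 := by simp [sl2Lower_val]
      have e3 : ∀ i j, g⁻¹.1 i j = !![g.1 1 1, -g.1 0 1; -g.1 1 0, g.1 0 0] i j := by
        intro i j
        rw [SpecialLinearGroup.SL2_inv_expl g]
        rfl
      rw [LinearMap.comp_apply, symRep_veronese _ _ (by simp),
        ← key (sl2Lower (-t)) ![1, t] y (by simp [e1]) (by simp [e2]) (by simp),
        ← key (sl2Lower (-t) * g⁻¹) _ _ _ _ ht, ← End.mul_apply, ← map_mul,
        inv_mul_cancel_right]
      · rw [SL2C_mul_apply, e1, e2, e3, e3]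
        simp [Matrix.mulVec, dotProduct, Fin.sum_univ_two]
        ring
      · rw [SL2C_mul_apply, e1, e2, e3, e3]
        simp [Matrix.mulVec, dotProduct, Fin.sum_univ_two]
        ring
    exact congrArg (fun f => f c) this
  · rw [← key 1 ![1, 0] x (by simp [SL2C_one_apply]) (by simp [SL2C_one_apply]) (by simp),
      map_one, End.one_apply, hξx]

/-- The restriction of a representation to a stable subspace. -/
def subRep (ρ : SL2C →* End ℂ X) (Y : Submodule ℂ X) (hY : ∀ g, ∀ y ∈ Y, ρ g y ∈ Y) :
    SL2C →* End ℂ Y where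
  toFun g := (ρ g).restrict (hY g)
  map_one' := by
    ext y
    simp
  map_mul' g h := by
    ext y
    simp

theorem subRep_coe (ρ : SL2C →* End ℂ X) (Y : Submodule ℂ X) (hY : ∀ g, ∀ y ∈ Y, ρ g y ∈ Y)
    (g : SL2C) (y : Y) : (subRep ρ Y hY g y : X) = ρ g y := rfl

theorem IsAlgebraicRep.subRep (hρ : IsAlgebraicRep ρ) (Y : Submodule ℂ X)
    (hY : ∀ g, ∀ y ∈ Y, ρ g y ∈ Y) : IsAlgebraicRep (subRep ρ Y hY) := by
  intro ξ y
  obtain ⟨ξ', hξ'⟩ := LinearMap.exists_extend ξ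
  obtain ⟨P, hP⟩ := hρ ξ' y
  refine ⟨P, fun g => ?_⟩
  rw [← hP, ← subRep_coe ρ Y hY, ← hξ']
  rfl

/-- Algebraic representations of `SL(2, ℂ)` are direct sums of symmetric powers. -/
theorem IsAlgebraicRep.exists_equiv_pi {X : Type*} [AddCommGroup X] [Module ℂ X]
    [FiniteDimensional ℂ X] {ρ : SL2C →* End ℂ X} (hρ : IsAlgebraicRep ρ) :
    ∃ (I : Type) (_ : Fintype I) (k : I → ℕ) (e : (∀ i, Fin (k i + 1) → ℂ) ≃ₗ[ℂ] X),
      ∀ g c, e (fun i => symRep (k i) g (c i)) = ρ g (e c) := by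
  induction hd : finrank ℂ X using Nat.strong_induction_on generalizing X with
  | _ d ih =>
  subst hd
  rcases subsingleton_or_nontrivial X with hX | hX
  · refine ⟨PEmpty, inferInstance, fun i => i.elim, ?_, fun g c => Subsingleton.elim _ _⟩
    exact { toFun := 0, map_add' := by simp, map_smul' := by simp, invFun := 0,
            left_inv := fun _ => Subsingleton.elim _ _,
            right_inv := fun _ => Subsingleton.elim _ _ }
  obtain ⟨k, x, hx0, hx, hk⟩ := exists_highest_weight hρ
  obtain ⟨f, hf, hfx⟩ := exists_embedding_of_highest_weight hρ hx hk
  have hx0' : ρ sl2Weyl x ≠ 0 := by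
    intro h
    apply hx0
    have : ρ sl2Weyl⁻¹ (ρ sl2Weyl x) = x := by
      rw [← End.mul_apply, ← map_mul, inv_mul_cancel, map_one, End.one_apply]
    rw [← this, h, map_zero]
  obtain ⟨L, hL, hLx⟩ := exists_pairing_of_highest_weight hρ hx0' hx.weyl hk
  -- the pairing restricted to the image of `f` is nondegenerate
  obtain ⟨c, hc⟩ := exists_eq_smul_symForm (L ∘ₗ f) (fun g a b => by
    rw [LinearMap.comp_apply, hf, hL, LinearMap.comp_apply])
  -- The pairing takes the value 1 at the Weyl translate of the highest weight vector, which lies in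
  -- the image of f.
  have hc0 : c ≠ 0 := by
    rintro rfl
    rw [zero_smul] at hc
    have h1 : (L ∘ₗ f) (symRep k sl2Weyl (veronese k ![1, 0])) (veronese k ![1, 0]) = 1 := by
      rw [LinearMap.comp_apply, hf, hfx, hLx]
    rw [hc] at h1
    simp at h1
  have hnd : ∀ a, (∀ b, (L ∘ₗ f) a b = 0) → a = 0 := by
    intro a ha
    refine symForm_nondegenerate k a fun b => ?_
    have := ha b
    rw [hc, LinearMap.smul_apply, LinearMap.smul_apply, smul_eq_mul] at this
    exact (mul_eq_zero.1 this).resolve_left hc0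
  have hfinj : Function.Injective f := by
    rw [← LinearMap.ker_eq_bot, LinearMap.ker_eq_bot']
    intro a ha
    exact hnd a fun b => by rw [LinearMap.comp_apply, ha, map_zero, LinearMap.zero_apply]
  -- Nondegeneracy on the image of f makes this kernel a complement of that image, and invariance of
  -- L makes it stable; the induction continues on it.
  let Y : Submodule ℂ X := LinearMap.ker L
  have hY : ∀ g, ∀ y ∈ Y, ρ g y ∈ Y := by
    intro g y hy
    rw [LinearMap.mem_ker] at hy ⊢
    refine LinearMap.ext fun b => ?_
    obtain ⟨b, rfl⟩ : ∃ b', b = symRep k g b' := ⟨symRep k g⁻¹ b, by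
      rw [← End.mul_apply, ← map_mul, mul_inv_cancel, map_one, End.one_apply]⟩
    rw [hL, hy, LinearMap.zero_apply, LinearMap.zero_apply]
  have hcompl : IsCompl (LinearMap.range f) Y := by
    constructor
    · rw [Submodule.disjoint_def]
      rintro _ ⟨a, rfl⟩ ha
      rw [hnd a fun b => by rw [LinearMap.comp_apply, LinearMap.mem_ker.1 ha]; rfl, map_zero]
    · rw [codisjoint_iff, eq_top_iff]
      intro y _
      obtain ⟨a, ha⟩ := exists_eq_apply_of_nondegenerate hnd (L y)
      rw [Submodule.mem_sup]
      refine ⟨f a, ⟨a, rfl⟩, y - f a, ?_, by abel⟩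
      rw [LinearMap.mem_ker, map_sub, ← ha, LinearMap.comp_apply, sub_self]
  have hlt : finrank ℂ Y < finrank ℂ X := by
    refine Submodule.finrank_lt fun htop => hx0 ?_
    have : x ∈ LinearMap.range f ⊓ Y := ⟨⟨_, hfx⟩, by rw [htop]; trivial⟩
    rw [hcompl.inf_eq_bot] at this
    simpa using this
  obtain ⟨I, hI, k', e, he⟩ := ih _ hlt (hρ.subRep Y hY) rfl
  let k'' : Option I → ℕ := fun i => i.elim k k'
  let e'' : (∀ i, Fin (k'' i + 1) → ℂ) ≃ₗ[ℂ] X :=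
    ((LinearEquiv.piOptionEquivProd ℂ).trans
      ((LinearEquiv.ofInjective f hfinj).prodCongr e)).trans
      (Submodule.prodEquivOfIsCompl _ _ hcompl)
  refine ⟨Option I, inferInstance, k'', e'', fun g c => ?_⟩
  have h1 : ∀ c, e'' c = f (c none) + (e (fun i => c (some i)) : X) := fun c => rfl
  rw [h1, h1, map_add]
  congr 1
  · exact hf g (c none)
  · exact congrArg Subtype.val (he g fun i => c (some i))

end CompleteReducibility

/-! ### Invariant forms without stable isotropic subspaces. -/

section InvariantForms

open Module

variable {X : Type*} [AddCommGroup X] [Module ℂ X] {ρ : SL2C →* End ℂ X}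

/-- On two copies of Sym^k all four blocks of b are multiples of the invariant form, so the
restriction of b to the copy s f + t f' is governed by a binary quadratic form in (s, t). Over ℂ
this has a nontrivial zero, which gives an isotropic copy. -/
theorem no_pair_of_no_isotropic {b : X →ₗ[ℂ] X →ₗ[ℂ] ℂ}
    (hb : ∀ g x y, b (ρ g x) (ρ g y) = b x y)
    (hno : ∀ Y : Submodule ℂ X, (∀ g, ∀ y ∈ Y, ρ g y ∈ Y) → (∀ x ∈ Y, ∀ y ∈ Y, b x y = 0) → Y = ⊥)
    {k : ℕ} {f f' : (Fin (k + 1) → ℂ) →ₗ[ℂ] X} (hf : ∀ g c, f (symRep k g c) = ρ g (f c))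
    (hf' : ∀ g c, f' (symRep k g c) = ρ g (f' c))
    (hff' : ∀ x y, f x + f' y = 0 → x = 0 ∧ y = 0) : False := by
  have hform : ∀ f f' : (Fin (k + 1) → ℂ) →ₗ[ℂ] X, (∀ g c, f (symRep k g c) = ρ g (f c)) →
      (∀ g c, f' (symRep k g c) = ρ g (f' c)) → ∃ c : ℂ, ∀ x y, b (f x) (f' y) =
        c * symForm k x y := by
    intro f f' hf hf'
    obtain ⟨c, hc⟩ := exists_eq_smul_symForm (b.compl₁₂ f f') (fun g x y => by
      rw [LinearMap.compl₁₂_apply, LinearMap.compl₁₂_apply, hf, hf', hb])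
    exact ⟨c, fun x y => by rw [← LinearMap.compl₁₂_apply, hc]; rfl⟩
  obtain ⟨c11, h11⟩ := hform f f hf hf
  obtain ⟨c12, h12⟩ := hform f f' hf hf'
  obtain ⟨c21, h21⟩ := hform f' f hf' hf
  obtain ⟨c22, h22⟩ := hform f' f' hf' hf'
  obtain ⟨s, t, hst, hq⟩ : ∃ s t : ℂ, (s ≠ 0 ∨ t ≠ 0) ∧
      s * s * c11 + s * t * (c12 + c21) + t * t * c22 = 0 := by
    by_cases h : c22 = 0
    · exact ⟨0, 1, Or.inr one_ne_zero, by rw [h]; ring⟩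
    · obtain ⟨r, hr⟩ := IsAlgClosed.exists_eq_mul_self (discrim c22 (c12 + c21) c11)
      obtain ⟨t, ht⟩ := exists_quadratic_eq_zero h ⟨r, hr⟩
      exact ⟨1, t, Or.inl one_ne_zero, by rw [← ht]; ring⟩
  let F : (Fin (k + 1) → ℂ) →ₗ[ℂ] X := s • f + t • f'
  have hF : ∀ c, F c = s • f c + t • f' c := fun c => rfl
  have hbot := hno (LinearMap.range F) (by
    rintro g _ ⟨c, rfl⟩
    refine ⟨symRep k g c, ?_⟩
    rw [hF, hF, hf, hf', map_add, map_smul, map_smul]) (by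
    rintro _ ⟨x, rfl⟩ _ ⟨y, rfl⟩
    simp only [hF, map_add, map_smul, LinearMap.add_apply, LinearMap.smul_apply, h11, h12, h21,
      h22, smul_eq_mul]
    linear_combination (symForm k x y) * hq)
  rw [LinearMap.range_eq_bot] at hbot
  have hx : F (veronese k ![1, 0]) = 0 := by rw [hbot]; rfl
  rw [hF, ← map_smul, ← map_smul] at hx
  have hv : veronese k ![1, 0] ≠ 0 := by
    intro h
    have := congrFun h 0
    simp [veronese] at this
  obtain ⟨h1, h2⟩ := hff' _ _ hx
  rcases hst with h | h
  · exact (smul_ne_zero h hv) h1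
  · exact (smul_ne_zero h hv) h2

theorem symRep_single {I : Type*} [DecidableEq I] (k : I → ℕ) (i : I) (g : SL2C)
    (c : Fin (k i + 1) → ℂ) :
    (fun j => symRep (k j) g (Pi.single (M := fun i => Fin (k i + 1) → ℂ) i c j)) =
      Pi.single (M := fun i => Fin (k i + 1) → ℂ) i (symRep (k i) g c) := by
  funext j
  by_cases h : j = i
  · subst h
    rw [Pi.single_eq_same, Pi.single_eq_same]
  · rw [Pi.single_eq_of_ne h, Pi.single_eq_of_ne h, map_zero]

/-- Multiplicity one and parity of the constituents of a representation with an invariant form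
admitting no stable isotropic subspace. -/
theorem injective_and_parity_of_no_isotropic {b : X →ₗ[ℂ] X →ₗ[ℂ] ℂ}
    (hb : ∀ g x y, b (ρ g x) (ρ g y) = b x y) {ε : ℂ} (hε : ∀ x y, b y x = ε * b x y)
    (hno : ∀ Y : Submodule ℂ X, (∀ g, ∀ y ∈ Y, ρ g y ∈ Y) → (∀ x ∈ Y, ∀ y ∈ Y, b x y = 0) → Y = ⊥)
    {I : Type*} [Fintype I] {k : I → ℕ} {e : (∀ i, Fin (k i + 1) → ℂ) ≃ₗ[ℂ] X}
    (he : ∀ g c, e (fun i => symRep (k i) g (c i)) = ρ g (e c)) :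
    Function.Injective k ∧ ∀ i, (-1) ^ k i = ε := by
  classical
  let f : ∀ i, (Fin (k i + 1) → ℂ) →ₗ[ℂ] X := fun i =>
    e.toLinearMap ∘ₗ LinearMap.single ℂ (fun i => Fin (k i + 1) → ℂ) i
  have hf : ∀ i g c, f i (symRep (k i) g c) = ρ g (f i c) := by
    intro i g c
    change e (Pi.single i (symRep (k i) g c)) = ρ g (e (Pi.single i c))
    rw [← he, symRep_single]
  have hff : ∀ i j, i ≠ j → ∀ x y, f i x + f j y = 0 → x = 0 ∧ y = 0 := by
    intro i j hij x y h
    have h1 : e (Pi.single (M := fun i => Fin (k i + 1) → ℂ) i x +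
      Pi.single (M := fun i => Fin (k i + 1) → ℂ) j y) = 0 := by
      rw [map_add]; exact h
    rw [LinearEquiv.map_eq_zero_iff] at h1
    have hi := congrFun h1 i
    have hj := congrFun h1 j
    rw [Pi.add_apply, Pi.single_eq_same, Pi.single_eq_of_ne hij, add_zero] at hi
    rw [Pi.add_apply, Pi.single_eq_same, Pi.single_eq_of_ne hij.symm, zero_add] at hj
    exact ⟨hi, hj⟩
  have hfinj : ∀ i, Function.Injective (f i) := fun i x y h =>
    Pi.single_injective i (e.injective h)
  constructor
  · intro i j hij
    by_contra hne
    -- The degree is made a variable so that the equality of the two highest weights can be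
    -- substituted in the types.
    have aux : ∀ (m : ℕ) (f' : (Fin (m + 1) → ℂ) →ₗ[ℂ] X), m = k i →
        (∀ g c, f' (symRep m g c) = ρ g (f' c)) →
        (∀ x y, f i x + f' y = 0 → x = 0 ∧ y = 0) → False := by
      rintro m f' rfl h1 h2
      exact no_pair_of_no_isotropic hb hno (hf i) h1 h2
    exact aux (k j) (f j) hij.symm (hf j) (hff i j hne)
  · intro i
    -- On one copy b is a multiple of the invariant form, a nonzero one since the copy is not
    -- isotropic; so ε must be the sign (-1)^k of that form.
    obtain ⟨c, hc⟩ := exists_eq_smul_symForm (b.compl₁₂ (f i) (f i)) (fun g x y => by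
      rw [LinearMap.compl₁₂_apply, LinearMap.compl₁₂_apply, hf, hf, hb])
    have hc' : ∀ x y, b (f i x) (f i y) = c * symForm (k i) x y := fun x y => by
      rw [← LinearMap.compl₁₂_apply, hc]; rfl
    obtain ⟨x, y, hxy⟩ := exists_symForm_ne_zero (k i)
    have hc0 : c ≠ 0 := by
      rintro rfl
      have hbot := hno (LinearMap.range (f i)) (by
        rintro g _ ⟨c, rfl⟩
        exact ⟨symRep (k i) g c, hf i g c⟩) (by
        rintro _ ⟨x, rfl⟩ _ ⟨y, rfl⟩
        rw [hc', zero_mul])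
      rw [LinearMap.range_eq_bot] at hbot
      have : x = 0 := hfinj i (by rw [hbot]; rfl)
      rw [this, map_zero, LinearMap.zero_apply] at hxy
      exact hxy rfl
    have h1 := hε (f i x) (f i y)
    rw [hc', hc', symForm_comm] at h1
    exact mul_right_cancel₀ (mul_ne_zero hc0 hxy) (by linear_combination h1)

/-- Pairing y with the point (x, 1) of the curve gives a polynomial in x whose coefficients are the
y i up to nonzero factors. An upper unipotent moves (x, 1) to (1, 1), so the polynomial is constant
away from x = 0 and only y 0 survives. -/
theorem eq_smul_of_upper_fixed {k : ℕ} {y : Fin (k + 1) → ℂ}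
    (hy : ∀ t, symRep k (sl2Upper t) y = y) : y = y 0 • veronese k ![1, 0] := by
  let p : Polynomial ℂ := ∑ i : Fin (k + 1),
    Polynomial.monomial (i : ℕ) ((-1) ^ (i : ℕ) * (k.choose i : ℂ) * y i)
  have hp : ∀ x, p.eval x = symForm k y (veronese k ![x, 1]) := by
    intro x
    rw [symForm_apply, Polynomial.eval_finsetSum]
    refine Finset.sum_congr rfl fun i _ => ?_
    have h : k - (k - (i : ℕ)) = i := by omega
    simp [Polynomial.eval_monomial, veronese, Fin.val_rev, h]
  have hc : p - Polynomial.C (p.eval 1) = 0 := by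
    refine Polynomial.eq_zero_of_infinite_isRoot _
      ((Set.finite_singleton (0 : ℂ)).infinite_compl.mono fun x hx => ?_)
    have hx0 : x ≠ 0 := hx
    rw [Set.mem_ofPred_eq, Polynomial.IsRoot.def, Polynomial.eval_sub, Polynomial.eval_C, hp, hp,
      ← symForm_symRep k (sl2Upper (1 - x)) y (veronese k ![x, 1]), hy,
      symRep_veronese _ _ (by simpa using hx0)]
    have : (sl2Upper (1 - x)).1 *ᵥ ![x, 1] = ![1, 1] := by
      rw [sl2Upper_val]
      ext i
      fin_cases i <;> simp [Matrix.mulVec, dotProduct, Fin.sum_univ_two]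
    rw [this, sub_self]
  ext i
  by_cases hi : i = 0
  · subst hi
    simp [veronese]
  · have hi' : (i : ℕ) ≠ 0 := fun h => hi (Fin.ext h)
    have h1 := congrArg (fun q => q.coeff (i : ℕ)) hc
    simp only [p, Polynomial.coeff_sub, Polynomial.finsetSum_coeff, Polynomial.coeff_monomial,
      Polynomial.coeff_C, if_neg hi', Polynomial.coeff_zero, sub_zero] at h1
    rw [Finset.sum_eq_single i (fun j _ hj => if_neg fun h => hj (Fin.ext h)) (by simp),
      if_pos rfl] at h1
    have hc : (k.choose i : ℂ) ≠ 0 := by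
      exact_mod_cast (Nat.choose_pos (by omega)).ne'
    have hyi : y i = 0 := by simpa [hc] using h1
    simp [veronese, hi', hyi]

theorem hasWeight_veronese (k : ℕ) : HasWeight (symRep k) k (veronese k ![1, 0]) := by
  intro z
  rw [symRep_veronese _ _ (by simp), zpow_natCast, ← veronese_smul]
  congr 1
  rw [sl2Torus_val]
  ext i
  fin_cases i <;> simp [Matrix.mulVec, dotProduct, Fin.sum_univ_two]

theorem HasWeight.eq_of_ne_zero {m m' : ℤ} {x : X} (h : HasWeight ρ m x) (h' : HasWeight ρ m' x)
    (hx : x ≠ 0) : m = m' := by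
  have h1 := h (Units.mk0 2 two_ne_zero)
  rw [h' (Units.mk0 2 two_ne_zero)] at h1
  have h2 : ((2 : ℂ) ^ m') = 2 ^ m := smul_left_injective ℂ hx h1
  have h3 : (2 : ℝ) ^ m' = (2 : ℝ) ^ m := by
    have := congrArg norm h2
    simpa using this
  exact (zpow_right_injective₀ (by norm_num) (by norm_num) h3).symm

end InvariantForms

/-! ### The unipotent element on a symmetric power. -/

section Jordan

open Module

/-- The nilpotent operator attached to the standard unipotent element. -/
def symNil (k : ℕ) : End ℂ (Fin (k + 1) → ℂ) := symRep k unipotentSL2 - 1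

theorem symMatrix_unipotent (k : ℕ) (i j : Fin (k + 1)) :
    symMatrix k unipotentSL2.1 i j =
      if (i : ℕ) ≤ j then ((k - i : ℕ).choose (j - i : ℕ) : ℂ) else 0 := by
  have : symPoly k unipotentSL2.1 i =
      (1 + Polynomial.X) ^ (k - i : ℕ) * Polynomial.X ^ (i : ℕ) := by
    simp [symPoly, unipotentSL2]
  rw [symMatrix, Matrix.of_apply, this, Polynomial.coeff_mul_X_pow', Polynomial.coeff_one_add_X_pow]

theorem symNil_apply (k : ℕ) (w : Fin (k + 1) → ℂ) (i : Fin (k + 1)) :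
    symNil k w i = ∑ j : Fin (k + 1),
      if (i : ℕ) < j then ((k - i : ℕ).choose (j - i : ℕ) : ℂ) * w j else 0 := by
  rw [symNil, LinearMap.sub_apply, End.one_apply, symRep_apply, Pi.sub_apply, Matrix.mulVec,
    dotProduct, sub_eq_iff_eq_add]
  have : w i = ∑ j : Fin (k + 1), if j = i then w j else 0 := by simp
  rw [this, ← Finset.sum_add_distrib]
  refine Finset.sum_congr rfl fun j _ => ?_
  rw [symMatrix_unipotent]
  rcases lt_trichotomy (i : ℕ) j with h | h | h
  · rw [if_pos h.le, if_pos h, if_neg (fun hji => by rw [hji] at h; omega), add_zero]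
  · rw [if_pos h.le, if_neg (by omega), if_pos (Fin.ext h.symm), ← h]
    simp
  · rw [if_neg (by omega), if_neg (by omega), if_neg (fun hji => by rw [hji] at h; omega)]
    simp

/-- The matrix is strictly upper triangular with nonzero superdiagonal entries k - i, so each
application lowers the largest index of a nonzero coordinate by exactly one. This gives the kernels
of all powers and shows that there is a single Jordan block. -/
theorem symNil_pow_apply {k : ℕ} {w : Fin (k + 1) → ℂ} {J : ℕ} (hw : ∀ i : Fin (k + 1), J < i → w i = 0)
    (m : ℕ) :
    (∀ i : Fin (k + 1), J < i + m → (symNil k ^ m) w i = 0) ∧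
      ∀ i j : Fin (k + 1), (i : ℕ) + m = J → (j : ℕ) = J → w j ≠ 0 → (symNil k ^ m) w i ≠ 0 := by
  induction m with
  | zero =>
    refine ⟨fun i hi => hw i hi, fun i j hi hj h => ?_⟩
    have : i = j := Fin.ext (by omega)
    rw [this]
    exact h
  | succ m ih =>
    rw [pow_succ']
    refine ⟨fun i hi => ?_, fun i j hi hj h => ?_⟩
    · rw [End.mul_apply, symNil_apply]
      refine Finset.sum_eq_zero fun l _ => ?_
      by_cases hl : (i : ℕ) < l
      · rw [if_pos hl, ih.1 l (by omega), mul_zero]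
      · rw [if_neg hl]
    · rw [End.mul_apply, symNil_apply]
      have hik : (i : ℕ) + 1 < k + 1 := by omega
      rw [Finset.sum_eq_single (⟨i + 1, hik⟩ : Fin (k + 1))]
      · rw [if_pos (by simp)]
        refine mul_ne_zero ?_ (ih.2 _ j (by simp; omega) hj h)
        simp only [Nat.add_sub_cancel_left, Nat.choose_one_right]
        exact_mod_cast (by omega : k - (i : ℕ) ≠ 0)
      · intro l _ hl
        by_cases hil : (i : ℕ) < l
        · have : (l : ℕ) ≠ i + 1 := fun h => hl (Fin.ext h)
          rw [if_pos hil, ih.1 l (by omega), mul_zero]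
        · rw [if_neg hil]
      · simp

theorem mem_ker_symNil_pow {k m : ℕ} {w : Fin (k + 1) → ℂ} :
    (symNil k ^ m) w = 0 ↔ ∀ i : Fin (k + 1), m ≤ i → w i = 0 := by
  constructor
  · intro h
    by_contra! hne
    obtain ⟨i₀, hi₀, hwi₀⟩ := hne
    let S : Finset (Fin (k + 1)) := Finset.univ.filter fun i => w i ≠ 0
    have hS : S.Nonempty := ⟨i₀, by simp [S, hwi₀]⟩
    have hmax := S.max'_mem hS
    have hle := S.le_max' i₀ (by simp [S, hwi₀])
    set J := S.max' hS
    have hJ : ∀ i : Fin (k + 1), (J : ℕ) < i → w i = 0 := by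
      intro i hi
      by_contra h0
      have := S.le_max' i (by simp [S, h0])
      exact absurd hi (not_lt.2 this)
    have hle' : (i₀ : ℕ) ≤ J := hle
    refine (symNil_pow_apply hJ m).2 ⟨J - m, by omega⟩ J (by simp; omega) rfl
      (by simpa [S] using hmax) ?_
    rw [h]; rfl
  · intro h
    cases m with
    | zero =>
      ext i
      simpa using h i (Nat.zero_le _)
    | succ m =>
      ext i
      exact (symNil_pow_apply (J := m) (fun i hi => h i (by omega)) (m + 1)).1 i (by omega)

theorem finrank_ker_symNil_pow (k m : ℕ) :
    finrank ℂ (LinearMap.ker (symNil k ^ m)) = min m (k + 1) := by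
  obtain ⟨d, hd⟩ : ∃ d, d = min m (k + 1) := ⟨_, rfl⟩
  rw [← hd]
  let F : (Fin d → ℂ) →ₗ[ℂ] (Fin (k + 1) → ℂ) :=
    { toFun := fun v i => if h : (i : ℕ) < d then v ⟨i, h⟩ else 0
      map_add' := fun v w => by ext i; by_cases h : (i : ℕ) < d <;> simp [h]
      map_smul' := fun c v => by ext i; by_cases h : (i : ℕ) < d <;> simp [h] }
  have hF : Function.Injective F := by
    intro v w h
    ext i
    have := congrFun h ⟨i, by omega⟩
    simpa [F] using this
  have hr : LinearMap.range F = LinearMap.ker (symNil k ^ m) := by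
    ext w
    rw [LinearMap.mem_ker, mem_ker_symNil_pow]
    constructor
    · rintro ⟨v, rfl⟩ i hi
      exact dif_neg (by omega)
    · intro h
      refine ⟨fun i => w ⟨i, by omega⟩, ?_⟩
      ext i
      by_cases hi : (i : ℕ) < d
      · exact dif_pos hi
      · rw [h i (by omega)]
        exact dif_neg hi
  rw [← hr, LinearMap.finrank_range_of_inj hF, finrank_fin_fun]

/-- The Jordan chain starting at the last basis vector, written with the last vector in position k,
has a triangular matrix with nonzero diagonal, so it is a basis. -/
theorem exists_jordan_equiv (k : ℕ) : ∃ j : (Fin (k + 1) → ℂ) ≃ₗ[ℂ] (Fin (k + 1) → ℂ),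
    ∀ v, j (unipotentJordanBlock (k + 1) *ᵥ v) = symRep k unipotentSL2 (j v) := by
  let y : Fin (k + 1) → (Fin (k + 1) → ℂ) := fun j => (symNil k ^ (k - j : ℕ)) (Pi.single (Fin.last k) 1)
  have hlast : ∀ i : Fin (k + 1), k < i → (Pi.single (Fin.last k) (1 : ℂ) : Fin (k + 1) → ℂ) i = 0 :=
    fun i hi => absurd hi (by omega)
  have hy0 : ∀ i j : Fin (k + 1), j < i → y j i = 0 := fun i j hij =>
    (symNil_pow_apply hlast (k - j : ℕ)).1 i (by
      have : (j : ℕ) < i := hij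
      omega)
  have hy1 : ∀ j, y j j ≠ 0 := fun j =>
    (symNil_pow_apply hlast (k - j : ℕ)).2 j (Fin.last k) (by omega) (by simp) (by simp)
  let Y : Matrix (Fin (k + 1)) (Fin (k + 1)) ℂ := Matrix.of fun i j => y j i
  have hdet : IsUnit Y.det := by
    rw [Matrix.det_of_isUpperTriangular (M := Y) fun i j hij => hy0 i j hij, isUnit_iff_ne_zero]
    exact Finset.prod_ne_zero_iff.2 fun i _ => hy1 i
  have hYu : IsUnit Y := (Matrix.isUnit_iff_isUnit_det Y).2 hdet
  have hYb : Function.Bijective (Matrix.toLin' Y) :=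
    ⟨Matrix.mulVec_injective_iff_isUnit.2 hYu, Matrix.mulVec_surjective_iff_isUnit.2 hYu⟩
  have hYs : ∀ j, Y *ᵥ Pi.single j 1 = y j := fun j => by
    rw [Matrix.mulVec_single_one]; rfl
  let e := LinearEquiv.ofBijective (Matrix.toLin' Y) hYb
  refine ⟨e, fun v => ?_⟩
  have key : e.toLinearMap ∘ₗ Matrix.toLin' (unipotentJordanBlock (k + 1)) =
      symRep k unipotentSL2 ∘ₗ e.toLinearMap := by
    refine LinearMap.pi_ext' fun j => LinearMap.ext_ring ?_
    change Y *ᵥ (unipotentJordanBlock (k + 1) *ᵥ Pi.single j 1) =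
      symRep k unipotentSL2 (Y *ᵥ Pi.single j 1)
    have h1 : symRep k unipotentSL2 (y j) = symNil k (y j) + y j := by simp [symNil]
    rw [hYs, h1]
    by_cases hj : (j : ℕ) = 0
    · have hJ : unipotentJordanBlock (k + 1) *ᵥ Pi.single j 1 = Pi.single j 1 := by
        rw [Matrix.mulVec_single_one]
        ext i
        simp only [Matrix.col_apply, unipotentJordanBlock, Pi.single_apply]
        congr 1
        simp [hj]
      have h2 : symNil k (y j) = 0 := by
        have : symNil k (y j) = (symNil k ^ (k + 1)) (Pi.single (Fin.last k) 1) := by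
          rw [pow_succ', End.mul_apply]
          simp [y, hj]
        rw [this, mem_ker_symNil_pow]
        intro i hi
        omega
      rw [hJ, hYs, h2, zero_add]
    · let j' : Fin (k + 1) := ⟨j - 1, by omega⟩
      have hJ : unipotentJordanBlock (k + 1) *ᵥ Pi.single j 1 =
          Pi.single j' 1 + Pi.single j 1 := by
        rw [Matrix.mulVec_single_one]
        ext i
        simp only [Matrix.col_apply, unipotentJordanBlock, Pi.single_apply, Pi.add_apply]
        by_cases h1 : i = j
        · subst h1
          have h3 : i ≠ j' := fun h => by
            have := congrArg Fin.val h
            simp only [j'] at this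
            omega
          simp [h3]
        · by_cases h2 : i = j'
          · subst h2
            have : (j' : ℕ) + 1 = j := by simp only [j']; omega
            simp [h1, this]
          · have : (i : ℕ) + 1 ≠ j := fun h => h2 (Fin.ext (by simp only [j']; omega))
            simp [h1, h2, this]
      have h2 : symNil k (y j) = y j' := by
        change symNil k ((symNil k ^ (k - j : ℕ)) _) = (symNil k ^ (k - (j' : ℕ))) _
        rw [← End.mul_apply, ← pow_succ']
        congr 2
        simp only [j']
        omega
      rw [hJ, mulVec_add, hYs, hYs, h2]
  exact congrArg (fun f => f v) key

end Jordan

/-! ### Jordan blocks of unipotent orbits. -/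

section JordanBlocks

open Module

/-- The action of the standard unipotent element on a direct sum of symmetric powers. -/
def piUnipotent {I : Type*} (k : I → ℕ) : End ℂ (∀ i, Fin (k i + 1) → ℂ) :=
  LinearMap.pi fun i => symRep (k i) unipotentSL2 ∘ₗ LinearMap.proj i

theorem piUnipotent_sub_one_pow {I : Type*} (k : I → ℕ) (m : ℕ) (c : ∀ i, Fin (k i + 1) → ℂ)
    (i : I) : ((piUnipotent k - 1) ^ m) c i = (symNil (k i) ^ m) (c i) := by
  induction m generalizing c with
  | zero => rfl
  | succ m ih => rw [pow_succ, pow_succ, End.mul_apply, End.mul_apply, ih]; rfl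

theorem finrank_ker_piUnipotent {I : Type*} [Fintype I] (k : I → ℕ) (m : ℕ) :
    finrank ℂ (LinearMap.ker ((piUnipotent k - 1) ^ m)) = ∑ i, min m (k i + 1) := by
  let e : LinearMap.ker ((piUnipotent k - 1) ^ m) ≃ₗ[ℂ] ∀ i, LinearMap.ker (symNil (k i) ^ m) :=
    { toFun := fun c i => ⟨c.1 i, by
        rw [LinearMap.mem_ker, ← piUnipotent_sub_one_pow, LinearMap.mem_ker.1 c.2]; rfl⟩
      map_add' := fun _ _ => rfl
      map_smul' := fun _ _ => rfl
      invFun := fun c => ⟨fun i => c i, by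
        rw [LinearMap.mem_ker]
        funext i
        rw [piUnipotent_sub_one_pow, LinearMap.mem_ker.1 (c i).2]; rfl⟩
      left_inv := fun _ => rfl
      right_inv := fun _ => rfl }
  rw [e.finrank_eq, finrank_pi_fintype]
  exact Finset.sum_congr rfl fun i _ => finrank_ker_symNil_pow _ _

/-- Take differences in m twice: the first difference of ∑ min(m, k i + 1) counts the i with m ≤ k
i, and the difference of these counts is the number of i with k i = m. -/
theorem card_filter_eq_of_sum_min {I I' : Type*} [Fintype I] [Fintype I'] {k : I → ℕ} {k' : I' → ℕ}
    (h : ∀ m, ∑ i, min m (k i + 1) = ∑ i, min m (k' i + 1)) (d : ℕ) :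
    (Finset.univ.filter fun i => k i = d).card = (Finset.univ.filter fun i => k' i = d).card := by
  have h1 : ∀ {J : Type _} [Fintype J] (l : J → ℕ) (m : ℕ),
      ∑ i, min (m + 1) (l i + 1) = ∑ i, min m (l i + 1) +
        (Finset.univ.filter fun i => m ≤ l i).card := by
    intro J _ l m
    rw [Finset.card_filter, ← Finset.sum_add_distrib]
    refine Finset.sum_congr rfl fun i _ => ?_
    split_ifs <;> omega
  have h1' : ∀ {J : Type _} [Fintype J] (l : J → ℕ) (m : ℕ),
      ∑ i, min (m + 1) (l i + 1) = ∑ i, min m (l i + 1) +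
        (Finset.univ.filter fun i => m ≤ l i).card := by
    intro J _ l m
    rw [Finset.card_filter, ← Finset.sum_add_distrib]
    refine Finset.sum_congr rfl fun i _ => ?_
    split_ifs <;> omega
  have h2 : ∀ m, (Finset.univ.filter fun i => m ≤ k i).card =
      (Finset.univ.filter fun i => m ≤ k' i).card := by
    intro m
    have := h1 k m
    have := h1' k' m
    have := h m
    have := h (m + 1)
    omega
  have h3 : ∀ {J : Type _} [Fintype J] (l : J → ℕ) (m : ℕ),
      (Finset.univ.filter fun i => m ≤ l i).card = (Finset.univ.filter fun i => m + 1 ≤ l i).card +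
        (Finset.univ.filter fun i => l i = m).card := by
    intro J _ l m
    rw [Finset.card_filter, Finset.card_filter, Finset.card_filter, ← Finset.sum_add_distrib]
    refine Finset.sum_congr rfl fun i _ => ?_
    split_ifs <;> omega
  have h3' : ∀ {J : Type _} [Fintype J] (l : J → ℕ) (m : ℕ),
      (Finset.univ.filter fun i => m ≤ l i).card = (Finset.univ.filter fun i => m + 1 ≤ l i).card +
        (Finset.univ.filter fun i => l i = m).card := by
    intro J _ l m
    rw [Finset.card_filter, Finset.card_filter, Finset.card_filter, ← Finset.sum_add_distrib]
    refine Finset.sum_congr rfl fun i _ => ?_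
    split_ifs <;> omega
  have := h3 k d
  have := h3' k' d
  have := h2 d
  have := h2 (d + 1)
  omega

/-- Conjugate sums of unipotent Jordan blocks have the same blocks. -/
theorem exists_equiv_of_piUnipotent {I I' : Type*} [Fintype I] [Fintype I'] {k : I → ℕ}
    {k' : I' → ℕ} (T : (∀ i, Fin (k i + 1) → ℂ) ≃ₗ[ℂ] (∀ i, Fin (k' i + 1) → ℂ))
    (hT : ∀ c, T (piUnipotent k c) = piUnipotent k' (T c)) : ∃ σ : I ≃ I', ∀ i, k' (σ i) = k i := by
  classical
  have hN : ∀ (m : ℕ) (c : ∀ i, Fin (k i + 1) → ℂ), T (((piUnipotent k - 1) ^ m) c) = ((piUnipotent k' - 1) ^ m) (T c) := by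
    intro m
    induction m with
    | zero => intro c; rfl
    | succ m ih =>
      intro c
      rw [pow_succ, pow_succ, End.mul_apply, End.mul_apply, ih]
      simp [hT]
  have hfr : ∀ m, ∑ i, min m (k i + 1) = ∑ i, min m (k' i + 1) := by
    intro m
    rw [← finrank_ker_piUnipotent, ← finrank_ker_piUnipotent]
    have : LinearMap.ker ((piUnipotent k' - 1) ^ m) =
        (LinearMap.ker ((piUnipotent k - 1) ^ m)).map T.toLinearMap := by
      ext c
      constructor
      · intro hc
        refine ⟨T.symm c, ?_, T.apply_symm_apply c⟩
        change ((piUnipotent k - 1) ^ m) (T.symm c) = 0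
        apply T.injective
        rw [hN, T.apply_symm_apply, LinearMap.mem_ker.1 hc, map_zero]
      · rintro ⟨c, hc, rfl⟩
        change ((piUnipotent k' - 1) ^ m) (T c) = 0
        rw [← hN, LinearMap.mem_ker.1 hc, map_zero]
    rw [this]
    exact (LinearEquiv.finrank_map_eq T _).symm
  have hcard := card_filter_eq_of_sum_min hfr
  have hcard' : ∀ d, Fintype.card {i // k i = d} = Fintype.card {i // k' i = d} := fun d => by
    rw [Fintype.card_subtype, Fintype.card_subtype, hcard]
  let σ : ∀ d, {i // k i = d} ≃ {i // k' i = d} := fun d => Fintype.equivOfCardEq (hcard' d)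
  let τ : I ≃ I' := (Equiv.sigmaFiberEquiv k).symm.trans
    ((Equiv.sigmaCongrRight σ).trans (Equiv.sigmaFiberEquiv k'))
  exact ⟨τ, fun i => (σ (k i) ⟨i, rfl⟩).2⟩

theorem exists_pi_symRep_equiv {I I' : Type*} {k : I → ℕ} {k' : I' → ℕ} (σ : I ≃ I')
    (hσ : ∀ i, k' (σ i) = k i) :
    ∃ T : (∀ i, Fin (k i + 1) → ℂ) ≃ₗ[ℂ] (∀ i, Fin (k' i + 1) → ℂ),
      ∀ g c, T (fun i => symRep (k i) g (c i)) = fun i => symRep (k' i) g (T c i) := by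
  obtain rfl : k = fun i => k' (σ i) := funext fun i => (hσ i).symm
  refine ⟨LinearEquiv.piCongrLeft ℂ (fun i => Fin (k' i + 1) → ℂ) σ, fun g c => ?_⟩
  funext i
  obtain ⟨i, rfl⟩ := σ.surjective i
  have h : ∀ c : ∀ i, Fin (k' (σ i) + 1) → ℂ,
      LinearEquiv.piCongrLeft ℂ (fun i => Fin (k' i + 1) → ℂ) σ c (σ i) = c i := fun c =>
    Equiv.piCongrLeft_apply_apply (fun i => Fin (k' i + 1) → ℂ) σ c i
  rw [h, h]

theorem blockDiagonal'_mulVec_apply {I : Type*} [Fintype I] [DecidableEq I] {d : I → ℕ}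
    (A : ∀ i, Matrix (Fin (d i)) (Fin (d i)) ℂ) (v : (Σ i, Fin (d i)) → ℂ) (i : I) (a : Fin (d i)) :
    (blockDiagonal' A *ᵥ v) ⟨i, a⟩ = (A i *ᵥ fun b => v ⟨i, b⟩) a := by
  simp only [Matrix.mulVec, dotProduct]
  rw [Fintype.sum_sigma, Finset.sum_eq_single i]
  · simp [blockDiagonal'_apply_eq]
  · intro j _ hj
    refine Finset.sum_eq_zero fun b _ => ?_
    rw [blockDiagonal'_apply_ne _ _ _ (Ne.symm hj), zero_mul]
  · simp

/-- A matrix made of unipotent Jordan blocks acts as a sum of symmetric powers. -/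
theorem exists_pi_equiv_blockDiagonal {I : Type*} [Fintype I] [DecidableEq I] (k : I → ℕ) {M : ℕ}
    (e : (Σ i, Fin (k i + 1)) ≃ Fin M) :
    ∃ T : (∀ i, Fin (k i + 1) → ℂ) ≃ₗ[ℂ] (Fin M → ℂ), ∀ c, T (piUnipotent k c) =
      Matrix.reindex e e (blockDiagonal' fun i => unipotentJordanBlock (k i + 1)) *ᵥ T c := by
  choose j hj using exists_jordan_equiv
  let T₁ : (∀ i, Fin (k i + 1) → ℂ) ≃ₗ[ℂ] (∀ i, Fin (k i + 1) → ℂ) :=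
    LinearEquiv.piCongrRight fun i => (j (k i)).symm
  let T₂ : (∀ i, Fin (k i + 1) → ℂ) ≃ₗ[ℂ] (Fin M → ℂ) :=
    { toFun := fun c m => c (e.symm m).1 (e.symm m).2
      map_add' := fun _ _ => rfl
      map_smul' := fun _ _ => rfl
      invFun := fun v i a => v (e ⟨i, a⟩)
      left_inv := fun c => by
        funext i a
        exact congrArg (fun m : Σ i, Fin (k i + 1) => c m.1 m.2) (e.symm_apply_apply ⟨i, a⟩)
      right_inv := fun v => by funext m; simp }
  have h1 : ∀ c i, T₁ (piUnipotent k c) i = unipotentJordanBlock (k i + 1) *ᵥ T₁ c i := by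
    intro c i
    change (j (k i)).symm (symRep (k i) unipotentSL2 (c i)) = _ *ᵥ ((j (k i)).symm (c i))
    rw [LinearEquiv.symm_apply_eq, hj, LinearEquiv.apply_symm_apply]
  refine ⟨T₁.trans T₂, fun c => ?_⟩
  funext m
  obtain ⟨⟨i, a⟩, rfl⟩ := e.surjective m
  have h2 : (T₁.trans T₂) (piUnipotent k c) (e ⟨i, a⟩) = T₁ (piUnipotent k c) i a := by
    change T₁ (piUnipotent k c) (e.symm (e ⟨i, a⟩)).1 (e.symm (e ⟨i, a⟩)).2 = _
    rw [e.symm_apply_apply]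
  rw [h2, h1, Matrix.reindex_apply, Matrix.submatrix_mulVec_equiv, Function.comp_apply,
    e.symm_apply_apply, blockDiagonal'_mulVec_apply]
  congr 1
  funext b
  change _ = T₁ c (e.symm (e ⟨i, b⟩)).1 (e.symm (e ⟨i, b⟩)).2
  rw [e.symm_apply_apply]

theorem exists_conj_of_linearEquiv {M : ℕ} (T : (Fin M → ℂ) ≃ₗ[ℂ] (Fin M → ℂ)) (x : GL (Fin M) ℂ)
    (y : Matrix (Fin M) (Fin M) ℂ) (h : ∀ v, T (x.1 *ᵥ v) = y *ᵥ T v) :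
    ∃ y' : GL (Fin M) ℂ, y'.1 = y ∧ ConjClasses.mk y' = ConjClasses.mk x := by
  let Q : GL (Fin M) ℂ := ⟨LinearMap.toMatrix' T.toLinearMap, LinearMap.toMatrix' T.symm.toLinearMap,
    by rw [← LinearMap.toMatrix'_comp]; simp, by rw [← LinearMap.toMatrix'_comp]; simp⟩
  have hQ : ∀ v, Q.1 *ᵥ v = T v := fun v => LinearMap.toMatrix'_mulVec _ _
  refine ⟨Q * x * Q⁻¹, ?_, ?_⟩
  · have h1 : Q.1 * x.1 = y * Q.1 := by
      refine Matrix.ext_of_mulVec_single fun i => ?_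
      rw [← mulVec_mulVec, ← mulVec_mulVec, hQ, hQ, h]
    have h2 : (Q * x * Q⁻¹).1 = y * (Q * Q⁻¹).1 := by
      rw [Units.val_mul, Units.val_mul, h1, mul_assoc]; rfl
    rw [h2, mul_inv_cancel, Units.val_one, mul_one]
  · rw [ConjClasses.mk_eq_mk_iff_isConj, isConj_comm, isConj_iff]
    exact ⟨Q, rfl⟩

/-- Replaces explicit block matrices by the action of the unipotent element on a sum of symmetric
powers, a block of size d corresponding to Sym^(d-1). Later arguments about orbits use this
description. -/
theorem hasJordanBlocks_iff {M : ℕ} (U : UnipotentOrbit M) (D : Multiset ℕ) :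
    U.HasJordanBlocks D ↔ ∃ (I : Type) (_ : Fintype I) (k : I → ℕ) (x : GL (Fin M) ℂ)
      (T : (∀ i, Fin (k i + 1) → ℂ) ≃ₗ[ℂ] (Fin M → ℂ)),
      D = Finset.univ.val.map (fun i => k i + 1) ∧ ConjClasses.mk x = U.1 ∧
        ∀ c, T (piUnipotent k c) = x.1 *ᵥ T c := by
  classical
  constructor
  · rintro ⟨r, d, hd, rfl, e, x, hx, hxe⟩
    obtain ⟨k, rfl⟩ : ∃ k : Fin r → ℕ, d = fun i => k i + 1 :=
      ⟨fun i => d i - 1, funext fun i => (Nat.succ_pred_eq_of_pos (hd i)).symm⟩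
    obtain ⟨T, hT⟩ := exists_pi_equiv_blockDiagonal k e
    refine ⟨Fin r, inferInstance, k, x, T, rfl, hx, fun c => ?_⟩
    rw [hT, hxe]
  · rintro ⟨I, hI, k, x, T, rfl, hx, hT⟩
    let ε : Fin (Fintype.card I) ≃ I := (Fintype.equivFin I).symm
    obtain ⟨S, hS⟩ := exists_pi_symRep_equiv (k := fun i => k (ε i)) (k' := k) ε fun _ => rfl
    have hcard : Fintype.card (Σ i, Fin (k (ε i) + 1)) = Fintype.card (Fin M) := by
      have h1 := (S.trans T).finrank_eq
      rw [finrank_pi_fintype] at h1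
      simpa using h1
    let e := Fintype.equivOfCardEq hcard
    obtain ⟨T', hT'⟩ := exists_pi_equiv_blockDiagonal (fun i => k (ε i)) e
    obtain ⟨R, hR⟩ : ∃ R : (∀ i, Fin (k (ε i) + 1) → ℂ) ≃ₗ[ℂ] (Fin M → ℂ),
        ∀ c, R (piUnipotent (fun i => k (ε i)) c) = x.1 *ᵥ R c := by
      refine ⟨S.trans T, fun c => ?_⟩
      rw [LinearEquiv.trans_apply, LinearEquiv.trans_apply, ← hT]
      exact congrArg T (hS unipotentSL2 c)
    obtain ⟨y, hy, hyx⟩ := exists_conj_of_linearEquiv (R.symm.trans T') x _ (fun v => by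
      obtain ⟨c, rfl⟩ := R.surjective v
      rw [← hR, LinearEquiv.trans_apply, LinearEquiv.trans_apply, LinearEquiv.symm_apply_apply,
        LinearEquiv.symm_apply_apply, hT'])
    refine ⟨Fintype.card I, fun i => k (ε i) + 1, fun i => Nat.succ_pos _, ?_, e, y,
      hyx.trans hx, hy⟩
    conv_lhs => rw [← Multiset.map_univ_val_equiv ε, Multiset.map_map]
    rfl

/-- The block sizes can be read off from the kernel dimensions. Discreteness and parity of an orbit,
each asserted for some multiset of blocks, therefore speak of the same multiset. -/
theorem UnipotentOrbit.HasJordanBlocks.unique {M : ℕ} {U : UnipotentOrbit M} {D D' : Multiset ℕ}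
    (h : U.HasJordanBlocks D) (h' : U.HasJordanBlocks D') : D = D' := by
  obtain ⟨I, _, k, x, T, rfl, hx, hT⟩ := (hasJordanBlocks_iff U D).1 h
  obtain ⟨I', _, k', x', T', rfl, hx', hT'⟩ := (hasJordanBlocks_iff U D').1 h'
  obtain ⟨Q, hQ⟩ := isConj_iff.1 (ConjClasses.mk_eq_mk_iff_isConj.1 (hx.trans hx'.symm))
  let S : (Fin M → ℂ) ≃ₗ[ℂ] (Fin M → ℂ) := LinearEquiv.ofBijective (Matrix.toLin' Q.1)
    ⟨Matrix.mulVec_injective_iff_isUnit.2 Q.isUnit, Matrix.mulVec_surjective_iff_isUnit.2 Q.isUnit⟩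
  have hS : ∀ v, S (x.1 *ᵥ v) = x'.1 *ᵥ S v := by
    intro v
    change Q.1 *ᵥ (x.1 *ᵥ v) = x'.1 *ᵥ (Q.1 *ᵥ v)
    rw [mulVec_mulVec, mulVec_mulVec, ← hQ, ← Units.val_mul, ← Units.val_mul, inv_mul_cancel_right]
  obtain ⟨σ, hσ⟩ := exists_equiv_of_piUnipotent ((T.trans S).trans T'.symm) (fun c => by
    rw [LinearEquiv.trans_apply, LinearEquiv.trans_apply, hT, hS, LinearEquiv.trans_apply,
      LinearEquiv.trans_apply, LinearEquiv.symm_apply_eq, hT', LinearEquiv.apply_symm_apply])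
  rw [← Multiset.map_univ_val_equiv σ, Multiset.map_map]
  exact Multiset.map_congr rfl fun i _ => by rw [Function.comp_apply, hσ]

end JordanBlocks

/-! ### Tame inertia and Frobenius. -/

section Arithmetic

variable {p : ℕ} [Fact p.Prime] {F : Type*} [Field F] [Algebra ℚ_[p] F] [FiniteDimensional ℚ_[p] F]

theorem absBar_pos {x : AlgebraicClosure F} (hx : x ≠ 0) : 0 < absBar p F x :=
  spectralNorm_zero_lt hx (Algebra.IsAlgebraic.isAlgebraic x)

theorem absBar_one : absBar p F 1 = 1 := spectralNorm_one

theorem absBar_zero : absBar p F 0 = 0 := spectralNorm_zero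

theorem absBar_pow (x : AlgebraicClosure F) (k : ℕ) : absBar p F (x ^ k) = absBar p F x ^ k := by
  induction k with
  | zero => rw [pow_zero, pow_zero, absBar_one]
  | succ k ih => rw [pow_succ, pow_succ, absBar_mul, ih]

theorem absBar_div (x : AlgebraicClosure F) {y : AlgebraicClosure F} (hy : y ≠ 0) :
    absBar p F (x / y) = absBar p F x / absBar p F y := by
  rw [eq_div_iff (absBar_pos hy).ne', ← absBar_mul, div_mul_cancel₀ _ hy]

theorem absBar_galois_div (σ : Gal(AlgebraicClosure F/F)) {y : AlgebraicClosure F} (hy : y ≠ 0) :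
    absBar p F (σ y / y) = 1 := by
  rw [absBar_div _ hy, absBar_galois, div_self (absBar_pos hy).ne']

theorem absBar_mul_sub_mul_lt {a b c d : AlgebraicClosure F} (ha : absBar p F a ≤ 1)
    (hd : absBar p F d ≤ 1) (h : absBar p F (a - c) < 1) (h' : absBar p F (b - d) < 1) :
    absBar p F (a * b - c * d) < 1 := by
  have : a * b - c * d = a * (b - d) + (a - c) * d := by ring
  rw [this]
  refine absBar_add_lt ?_ ?_
  · rw [absBar_mul]
    exact mul_lt_one_of_nonneg_of_lt_one_right ha (spectralNorm_nonneg _) h'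
  · rw [absBar_mul]
    exact mul_lt_one_of_nonneg_of_lt_one_left (spectralNorm_nonneg _) h hd

/-- Modulo the maximal ideal σ ↦ σ y / y is multiplicative on inertia, because σ fixes the residue
class of the unit τ y / y. These are the tame characters. -/
theorem absBar_mul_div_lt {σ : Gal(AlgebraicClosure F/F)} (hσ : σ ∈ inertiaGroup p F)
    (τ : Gal(AlgebraicClosure F/F)) {y : AlgebraicClosure F} (hy : y ≠ 0) :
    absBar p F ((σ * τ) y / y - σ y / y * (τ y / y)) < 1 := by
  have hσy : σ y ≠ 0 := by simpa using hy
  have : (σ * τ) y / y - σ y / y * (τ y / y) = σ y / y * (σ (τ y / y) - τ y / y) := by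
    rw [AlgEquiv.mul_apply, map_div₀]
    field_simp
  rw [this, absBar_mul, absBar_galois_div _ hy, one_mul]
  exact hσ _ (absBar_galois_div τ hy).le

theorem absBar_pow_div_lt {σ : Gal(AlgebraicClosure F/F)} (hσ : σ ∈ inertiaGroup p F)
    {y : AlgebraicClosure F} (hy : y ≠ 0) (N : ℕ) :
    absBar p F ((σ ^ N) y / y - (σ y / y) ^ N) < 1 := by
  induction N with
  | zero => simp [hy, absBar_zero]
  | succ N ih =>
    rw [pow_succ' σ, pow_succ']
    refine absBar_sub_trans (absBar_mul_div_lt hσ _ hy) ?_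
    refine absBar_mul_sub_mul_lt (absBar_galois_div σ hy).le ?_ (by simp [absBar_zero]) ih
    exact absBar_pow_le_one (absBar_galois_div σ hy).le N

/-- Wild inertia is the common kernel of the tame characters σ ↦ σ y / y, so equality of all tame
characters is equality modulo P_F. -/
theorem mul_inv_mem_wildInertiaGroup {σ τ : Gal(AlgebraicClosure F/F)}
    (h : ∀ y : AlgebraicClosure F, y ≠ 0 → absBar p F (σ y / y - τ y / y) < 1) :
    σ * τ⁻¹ ∈ wildInertiaGroup p F := by
  intro z hz
  have hy : τ⁻¹ z ≠ 0 := by simpa using hz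
  have h1 := h _ hy
  rw [← sub_div, absBar_div _ hy, div_lt_one (absBar_pos hy), ← AlgEquiv.mul_apply τ,
    mul_inv_cancel, AlgEquiv.one_apply, absBar_galois] at h1
  exact h1

theorem wildInertiaGroup_le_inertiaGroup : wildInertiaGroup p F ≤ inertiaGroup p F := by
  intro σ hσ x hx
  rcases eq_or_ne x 0 with rfl | h0
  · simp [absBar_zero]
  · exact (hσ x h0).trans_le hx

theorem conj_mem_inertiaGroup (φ : Gal(AlgebraicClosure F/F)) {σ : Gal(AlgebraicClosure F/F)}
    (hσ : σ ∈ inertiaGroup p F) : φ * σ * φ⁻¹ ∈ inertiaGroup p F := by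
  intro x hx
  have h := hσ (φ⁻¹ x) (by rwa [absBar_galois])
  rw [← absBar_galois φ, map_sub, ← AlgEquiv.mul_apply φ φ⁻¹, mul_inv_cancel] at h
  exact h

section Frobenius

variable {Fr : WeilGroup p F} (hFr : IsFrobeniusLift Fr)
include hFr

/-- Conjugation by Frobenius is raising to the power `q` on tame inertia. -/
theorem IsFrobeniusLift.conj_mul_inv_mem {σ : Gal(AlgebraicClosure F/F)}
    (hσ : σ ∈ inertiaGroup p F) :
    WeilGroup.toGal p F Fr * σ * (WeilGroup.toGal p F Fr)⁻¹ * (σ ^ residueCard p F)⁻¹ ∈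
      wildInertiaGroup p F := by
  set φ := WeilGroup.toGal p F Fr
  refine mul_inv_mem_wildInertiaGroup fun y hy => ?_
  set z := φ⁻¹ y with hz
  have hφz : φ z = y := by rw [hz, ← AlgEquiv.mul_apply, mul_inv_cancel, AlgEquiv.one_apply]
  have hz0 : z ≠ 0 := by simpa [hz] using hy
  have h1 : (φ * σ * φ⁻¹) y / y = φ (σ z / z) := by
    rw [map_div₀, hφz, AlgEquiv.mul_apply, AlgEquiv.mul_apply]
  -- Replacing z by y does not change the tame character of σ, since z / y is a unit and σ fixes its
  -- residue class.
  have h2 : absBar p F (σ z / z - σ y / y) < 1 := by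
    have hv : z / y ≠ 0 := div_ne_zero hz0 hy
    have hv1 : absBar p F (z / y) = 1 := absBar_galois_div φ⁻¹ hy
    have hσy : σ y ≠ 0 := by simpa using hy
    have h3 : σ z / z - σ y / y = σ y / y * ((σ (z / y) - z / y) / (z / y)) := by
      rw [map_div₀]
      field_simp
    rw [h3, absBar_mul, absBar_galois_div _ hy, one_mul, absBar_div _ hv, hv1, div_one]
    exact hσ _ hv1.le
  rw [h1]
  refine absBar_sub_trans (hFr _ (absBar_galois_div σ hz0).le) ?_
  refine absBar_sub_trans (absBar_pow_sub_pow_lt (absBar_galois_div σ hz0).le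
    (absBar_galois_div σ hy).le h2 _) ?_
  rw [absBar_sub_comm]
  exact absBar_pow_div_lt hσ hy _

/-- For an infinite residue field `Nat.card` would be 0 and the Frobenius congruence at x = 0 would
read |0 - 1| < 1. Finiteness of the residue field is thus drawn from the existence of a Frobenius
lift. -/
theorem IsFrobeniusLift.residueCard_ne_zero : residueCard p F ≠ 0 := by
  intro h
  have := hFr 0 (by rw [absBar_zero]; exact zero_le_one)
  rw [h, map_zero, pow_zero, zero_sub, absBar_neg, absBar_one] at this
  exact lt_irrefl _ this

theorem IsFrobeniusLift.finite_residueField :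
    Finite (IsLocalRing.ResidueField (padicIntegers p F)) :=
  Nat.finite_of_card_ne_zero hFr.residueCard_ne_zero

theorem IsFrobeniusLift.two_le_residueCard : 2 ≤ residueCard p F := by
  have := hFr.finite_residueField
  exact Finite.one_lt_card

theorem IsFrobeniusLift.odd_residueCard (hp : p ≠ 2) : Odd (residueCard p F) := by
  have := hFr.finite_residueField
  have := Fintype.ofFinite (IsLocalRing.ResidueField (padicIntegers p F))
  have hp0 : ((p : ℕ) : IsLocalRing.ResidueField (padicIntegers p F)) = 0 := by
    rw [← map_natCast (IsLocalRing.residue (padicIntegers p F)), IsLocalRing.residue_eq_zero_iff,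
      IsLocalRing.mem_maximalIdeal, mem_nonunits_iff]
    intro hu
    obtain ⟨v, hv⟩ := hu.exists_right_inv
    have h1 : (p : F) * (v : F) = 1 := congrArg Subtype.val hv
    have h2 : spectralNorm ℚ_[p] F (p * v) = _ := spectralAlgNorm_mul (p : F) (v : F)
    have h3 : spectralNorm ℚ_[p] F (p : F) < 1 := by
      rw [← map_natCast (algebraMap ℚ_[p] F), spectralNorm_extends]
      exact Padic.norm_p_lt_one
    have h4 : spectralNorm ℚ_[p] F (v : F) ≤ 1 := v.2
    rw [h1, spectralNorm_one] at h2
    have h5 : spectralNorm ℚ_[p] F (p : F) * spectralNorm ℚ_[p] F (v : F) < 1 :=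
      mul_lt_one_of_nonneg_of_lt_one_left (spectralNorm_nonneg _) h3 h4
    have h6 : (1 : ℝ) = spectralNorm ℚ_[p] F (p : F) * spectralNorm ℚ_[p] F (v : F) := h2
    linarith
  have hc : ringChar (IsLocalRing.ResidueField (padicIntegers p F)) ≠ 2 := by
    intro h
    have h1 := (ringChar.spec (IsLocalRing.ResidueField (padicIntegers p F)) p).1 hp0
    rw [h] at h1
    exact hp ((Nat.prime_dvd_prime_iff_eq Nat.prime_two Fact.out).1 h1).symm
  rw [Nat.odd_iff, residueCard, Nat.card_eq_fintype_card]
  exact FiniteField.odd_card_of_char_ne_two hc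

theorem IsFrobeniusLift.pow_apply {x : AlgebraicClosure F} (hx : absBar p F x ≤ 1) (k : ℕ) :
    absBar p F ((WeilGroup.toGal p F Fr ^ k) x - x ^ residueCard p F ^ k) < 1 := by
  induction k with
  | zero => simp [absBar_zero]
  | succ k ih =>
    rw [pow_succ', AlgEquiv.mul_apply, pow_succ, pow_mul]
    have h1 : absBar p F ((WeilGroup.toGal p F Fr ^ k) x) ≤ 1 := by rwa [absBar_galois]
    exact absBar_sub_trans (hFr _ h1) (absBar_pow_sub_pow_lt h1 (absBar_pow_le_one hx _) ih _)

/-- The element a has finitely many conjugates over F, so some positive power of Frobenius fixes it;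
that power acts on residue classes as x ↦ x^(q^r). -/
theorem IsFrobeniusLift.exists_pow_sub_lt {a : AlgebraicClosure F} (ha : absBar p F a ≤ 1) :
    ∃ r, 0 < r ∧ absBar p F (a ^ residueCard p F ^ r - a) < 1 := by
  set φ := WeilGroup.toGal p F Fr
  have hint : IsIntegral F a := Algebra.IsIntegral.isIntegral a
  have hfin : ((minpoly F a).rootSet (AlgebraicClosure F)).Finite := Polynomial.rootSet_finite _ _
  have hmem : ∀ k : ℕ, (φ ^ k) a ∈ (minpoly F a).rootSet (AlgebraicClosure F) := by
    intro k
    rw [Polynomial.mem_rootSet_of_ne (minpoly.ne_zero hint)]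
    have : Polynomial.aeval ((φ ^ k) a) (minpoly F a) =
        (φ ^ k) (Polynomial.aeval a (minpoly F a)) :=
      Polynomial.aeval_algHom_apply (φ ^ k).toAlgHom a _
    rw [this, minpoly.aeval, map_zero]
  have hkey : ∃ i j : ℕ, i < j ∧ (φ ^ i) a = (φ ^ j) a := by
    obtain ⟨i, -, j, -, hij, h⟩ :=
      Set.infinite_univ.exists_ne_map_eq_of_mapsTo (fun k _ => hmem k) hfin
    rcases lt_or_gt_of_ne hij with h' | h'
    · exact ⟨i, j, h', h⟩
    · exact ⟨j, i, h', h.symm⟩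
  obtain ⟨i, j, hij, h⟩ := hkey
  refine ⟨j - i, by omega, ?_⟩
  have h1 : (φ ^ (j - i)) a = a := by
    apply (φ ^ i).injective
    rw [h, ← AlgEquiv.mul_apply, ← pow_add, Nat.add_sub_cancel' hij.le]
  have h2 := hFr.pow_apply ha (j - i)
  change absBar p F ((φ ^ (j - i)) a - _) < 1 at h2
  rwa [h1, absBar_sub_comm] at h2

/-- An element acting on residue classes like the power b - a of Frobenius differs from that power
by inertia; a conjugation brings the inertial factor to the left. -/
theorem IsFrobeniusLift.exists_mem_inertiaGroup_mul (w : WeilGroup p F) :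
    ∃ (i : inertiaGroup p F) (k : ℤ), w = inertiaToWeil p F i * Fr ^ k := by
  obtain ⟨a, b, h⟩ := w.2
  set φ := WeilGroup.toGal p F Fr
  set σ := WeilGroup.toGal p F w
  have h1 : φ ^ (-(b : ℤ)) * φ ^ a * σ ∈ inertiaGroup p F := by
    intro x hx
    have hσx : absBar p F (σ x) ≤ 1 := by rwa [absBar_galois]
    have h2 : absBar p F ((φ ^ a) (σ x) - (φ ^ b) x) < 1 :=
      absBar_sub_trans (hFr.pow_apply hσx a)
        (absBar_sub_trans (h x hx) (by rw [absBar_sub_comm]; exact hFr.pow_apply hx b))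
    rw [← absBar_galois (φ ^ (-(b : ℤ))), map_sub, ← AlgEquiv.mul_apply, ← AlgEquiv.mul_apply,
      ← AlgEquiv.mul_apply, ← zpow_natCast φ b, ← _root_.zpow_add, neg_add_cancel,
      zpow_zero, AlgEquiv.one_apply] at h2
    exact h2
  have h2 := conj_mem_inertiaGroup (φ ^ ((b : ℤ) - a)) h1
  refine ⟨⟨_, h2⟩, (b : ℤ) - a, Subtype.ext ?_⟩
  change σ = φ ^ ((b : ℤ) - a) * (φ ^ (-(b : ℤ)) * φ ^ a * σ) * (φ ^ ((b : ℤ) - a))⁻¹ *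
    WeilGroup.toGal p F (Fr ^ ((b : ℤ) - a))
  rw [map_zpow, inv_mul_cancel_right, ← mul_assoc, ← mul_assoc, ← zpow_natCast φ a, ← _root_.zpow_add,
    ← _root_.zpow_add, show (b : ℤ) - a + -b + a = 0 by ring, zpow_zero, one_mul]

/-- If the k-th power of Frobenius were inertial for some k > 0, then all integral x would satisfy
x^Q ≡ x with Q = q^k. A root of X^Q - X - 1, which is integral, contradicts this. -/
theorem IsFrobeniusLift.zpow_mem_inertiaGroup {k : ℤ}
    (hk : WeilGroup.toGal p F Fr ^ k ∈ inertiaGroup p F) : k = 0 := by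
  set φ := WeilGroup.toGal p F Fr
  have hnat : ∀ k : ℕ, φ ^ k ∈ inertiaGroup p F → k = 0 := by
    intro k hk
    by_contra hk0
    set Q := residueCard p F ^ k with hQ
    have hQ2 : 2 ≤ Q := hFr.two_le_residueCard.trans (Nat.le_self_pow hk0 _)
    obtain ⟨x, hx⟩ : ∃ x : AlgebraicClosure F, x ^ Q - x - 1 = 0 := by
      have hdeg : (Polynomial.X ^ Q + (-Polynomial.X - 1) :
          Polynomial (AlgebraicClosure F)).degree = Q := by
        rw [Polynomial.degree_add_eq_left_of_degree_lt, Polynomial.degree_X_pow]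
        refine lt_of_le_of_lt (Polynomial.degree_sub_le _ _) ?_
        rw [Polynomial.degree_neg, Polynomial.degree_X, Polynomial.degree_one,
          Polynomial.degree_X_pow]
        exact max_lt (by exact_mod_cast hQ2) (by exact_mod_cast (by omega : 0 < Q))
      obtain ⟨x, hx⟩ := IsAlgClosed.exists_root _ (show
        (Polynomial.X ^ Q + (-Polynomial.X - 1) : Polynomial (AlgebraicClosure F)).degree ≠ 0 by
          rw [hdeg]; exact_mod_cast (by omega : Q ≠ 0))
      refine ⟨x, ?_⟩
      simp [Polynomial.IsRoot] at hx
      rw [← hx]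
      ring
    have hx1 : absBar p F x ≤ 1 := by
      by_contra hlt
      push Not at hlt
      have h1 : absBar p F (x ^ Q) ≤ absBar p F x := by
        have : x ^ Q = x + 1 := by linear_combination hx
        rw [this]
        refine (isNonarchimedean_spectralNorm x 1).trans (max_le le_rfl ?_)
        rw [spectralNorm_one]
        exact hlt.le
      rw [absBar_pow] at h1
      have h2 : absBar p F x ^ 1 < absBar p F x ^ Q := pow_lt_pow_right₀ hlt (by omega)
      rw [pow_one] at h2
      linarith
    have h1 := absBar_sub_trans (by rw [absBar_sub_comm]; exact hFr.pow_apply hx1 k) (hk x hx1)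
    have h2 : x ^ residueCard p F ^ k - x = 1 := by linear_combination hx
    rw [h2, absBar_one] at h1
    exact lt_irrefl _ h1
  obtain ⟨m, rfl | rfl⟩ := k.eq_nat_or_neg
  · rw [zpow_natCast] at hk
    exact_mod_cast hnat m hk
  · rw [_root_.zpow_neg, zpow_natCast, inv_mem_iff] at hk
    simpa using hnat m hk

end Frobenius

end Arithmetic

/-! ### Finite order of the image of a tame generator. -/

theorem eq_zero_of_tendsto_natCast_mul {N : ℕ → ℕ} (hN : ∀ k, 1 ≤ N k) {c : ℂ}
    (h : Filter.Tendsto (fun k => (N k : ℂ) * c) Filter.atTop (nhds 0)) : c = 0 := by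
  have h1 : ‖c‖ ≤ ‖(0 : ℂ)‖ := ge_of_tendsto' h.norm fun k => by
    rw [norm_mul, Complex.norm_natCast]
    exact le_mul_of_one_le_left (norm_nonneg _) (by exact_mod_cast hN k)
  simpa using h1

/-- A generalized eigenvector that is not an eigenvector would yield a Jordan chain of length two.
-/
theorem eigenspace_eq_top_of_sq {V : Type*} [AddCommGroup V] [Module ℂ V] [FiniteDimensional ℂ V]
    (A : Module.End ℂ V) (h : ∀ (u : ℂ) (v w : V), A v = u • v + w → A w = u • w → w = 0) :
    ⨆ u, A.eigenspace u = ⊤ := by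
  rw [eq_top_iff, ← Module.End.iSup_maxGenEigenspace_eq_top A]
  refine iSup_mono fun u v hv => ?_
  obtain ⟨k, hk⟩ := (Module.End.mem_maxGenEigenspace A u v).1 hv
  have hsub : ∀ x, (A - u • (1 : Module.End ℂ V)) x = A x - u • x := fun x => rfl
  have key : ∀ (k : ℕ) (v : V), ((A - u • (1 : Module.End ℂ V)) ^ (k + 1)) v = 0 →
      (A - u • (1 : Module.End ℂ V)) v = 0 := by
    intro k
    induction k with
    | zero => intro v hv; simpa using hv
    | succ k ih =>
      intro v hv
      rw [pow_succ, Module.End.mul_apply] at hv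
      have h1 := ih _ hv
      refine h u v _ (by rw [hsub]; abel) ?_
      rw [← sub_eq_zero, ← hsub]
      exact h1
  rw [Module.End.mem_eigenspace_iff, ← sub_eq_zero, ← hsub]
  refine key k v ?_
  rw [pow_succ', Module.End.mul_apply, hk, map_zero]

theorem pow_eq_one_of_eigenspace {V : Type*} [AddCommGroup V] [Module ℂ V] (A : Module.End ℂ V)
    (h : ⨆ u, A.eigenspace u = ⊤) (N : ℕ) (hN : ∀ u, A.HasEigenvalue u → u ^ N = 1) :
    A ^ N = 1 := by
  ext v
  have hv : v ∈ ⨆ u, A.eigenspace u := by rw [h]; trivial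
  induction hv using Submodule.iSup_induction' with
  | zero => simp
  | add x y _ _ hx hy => rw [map_add, hx, hy, map_add]
  | mem u x hx =>
    rcases eq_or_ne x 0 with rfl | hx0
    · simp
    have h1 : ∀ N : ℕ, (A ^ N) x = u ^ N • x := by
      intro N
      induction N with
      | zero => simp
      | succ N ih =>
        rw [pow_succ, Module.End.mul_apply, Module.End.mem_eigenspace_iff.1 hx, map_smul, ih,
          smul_smul, pow_succ']
    rw [h1, hN u (Module.End.hasEigenvalue_of_hasEigenvector ⟨hx, hx0⟩)]
    simp

/-- Let N_k = q^(k!) - 1. On an eigenvector, u^(N_k) → 1, so u^(q^(k!)) tends to u within the finite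
set of eigenvalues and equals u from some k on. On a Jordan chain v, w the power N_k then sends v to
v + N_k u⁻¹ w, which converges only if w = 0. So g is diagonalizable, and some power g^(N_k) is the
identity. -/
theorem Sp.exists_pow_eq_one_of_tendsto {n : ℕ} (g : Sp n) {q : ℕ} (hq : 2 ≤ q)
    (hVP : ∀ u ∈ VP g, u ^ q ∈ VP g)
    (h : Filter.Tendsto (fun k : ℕ => g ^ (q ^ k.factorial - 1)) Filter.atTop (nhds 1)) :
    ∃ M, 0 < M ∧ g ^ (q ^ M - 1) = 1 := by
  set N : ℕ → ℕ := fun k => q ^ k.factorial - 1 with hNdef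
  have hN1 : ∀ k, N k + 1 = q ^ k.factorial := fun k =>
    Nat.sub_add_cancel (Nat.one_le_pow _ _ (by omega))
  have hN : ∀ k, 1 ≤ N k := fun k => by
    have : 2 ≤ q ^ k.factorial := hq.trans (Nat.le_self_pow (Nat.factorial_ne_zero k) _)
    have := hN1 k
    omega
  have hlim : ∀ (v : Fin n ⊕ Fin n → ℂ) (i), Filter.Tendsto (fun k => (g.toEnd ^ N k) v i)
      Filter.atTop (nhds (v i)) := by
    intro v i
    have hc : Continuous fun x : Sp n => ((x : Matrix _ _ ℂ) *ᵥ v) i :=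
      (continuous_apply i).comp (continuous_subtype_val.matrix_mulVec continuous_const)
    have h1 := (hc.tendsto 1).comp h
    have h2 : ((1 : Sp n) : Matrix _ _ ℂ) *ᵥ v = v := by simp
    rw [h2] at h1
    refine h1.congr fun k => ?_
    rw [← Sp.toEnd_pow]
    rfl
  -- Multiplied by u in order to avoid the exponent m - 1 in the coefficient of w.
  have hpow : ∀ (u : ℂ) (v w), g.toEnd v = u • v + w → g.toEnd w = u • w → ∀ m : ℕ,
      u • (g.toEnd ^ m) v = u ^ (m + 1) • v + ((m : ℂ) * u ^ m) • w := by
    intro u v w hv hw m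
    induction m with
    | zero => simp
    | succ m ih =>
      rw [pow_succ', Module.End.mul_apply, ← map_smul, ih, map_add, map_smul, map_smul, hv, hw]
      push_cast
      module
  have hinf : ∀ u ∈ VP g, Filter.Tendsto (fun k => u ^ N k) Filter.atTop (nhds 1) := by
    intro u hu
    obtain ⟨v, hv⟩ := Module.End.HasEigenvalue.exists_hasEigenvector hu
    obtain ⟨i, hi⟩ := Function.ne_iff.1 hv.2
    have hu0 : u ≠ 0 := by
      rintro rfl
      have h1 := hv.apply_eq_smul
      rw [zero_smul] at h1
      exact hv.2 (Sp.toEnd_injective_apply g (by rw [h1, map_zero]))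
    have h1 := (hlim v i).div_const (v i)
    rw [div_self hi] at h1
    refine h1.congr fun k => ?_
    have h2 := hpow u v 0 (by rw [hv.apply_eq_smul, add_zero]) (by simp) (N k)
    rw [smul_zero, add_zero, pow_succ', mul_smul] at h2
    rw [smul_right_injective _ hu0 h2, Pi.smul_apply, smul_eq_mul, mul_div_cancel_right₀ _ hi]
  have hfin : (VP g).Finite := Module.End.finite_hasEigenvalue g.toEnd
  have hev : ∀ᶠ k in Filter.atTop, ∀ u ∈ VP g, u ^ N k = 1 := by
    rw [Set.Finite.eventually_all hfin]
    intro u hu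
    have h1 : Filter.Tendsto (fun k => u ^ N k * u) Filter.atTop (nhds (1 * u)) :=
      (hinf u hu).mul_const u
    have h2 : IsOpen (VP g \ {u})ᶜ := (hfin.subset Set.sdiff_subset).isClosed.isOpen_compl
    have h3 : 1 * u ∈ (VP g \ {u})ᶜ := by simp
    filter_upwards [h1.eventually (h2.mem_nhds h3)] with k hk
    have h4 : u ^ N k * u ∈ VP g := by
      rw [← pow_succ, hN1]
      induction k.factorial with
      | zero => simpa using hu
      | succ m ih => rw [pow_succ, pow_mul]; exact hVP _ ih
    have h5 : u ^ N k * u = u := by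
      by_contra hne
      exact hk ⟨h4, hne⟩
    have hu0 : u ≠ 0 := by
      rintro rfl
      have h6 := hinf 0 hu
      have h7 : (fun k => (0 : ℂ) ^ N k) = fun _ => 0 :=
        funext fun k => zero_pow (by have := hN k; omega)
      rw [h7] at h6
      exact zero_ne_one (tendsto_nhds_unique tendsto_const_nhds h6)
    exact mul_right_cancel₀ hu0 (by rw [h5, one_mul])
  have htop : ⨆ u, g.toEnd.eigenspace u = ⊤ := by
    refine eigenspace_eq_top_of_sq _ fun u v w hv hw => ?_
    by_contra hw0
    have hu : u ∈ VP g :=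
      Module.End.hasEigenvalue_of_hasEigenvector ⟨Module.End.mem_eigenspace_iff.2 hw, hw0⟩
    refine hw0 (funext fun i => eq_zero_of_tendsto_natCast_mul hN (N := N) ?_)
    have h1 := ((hlim v i).const_mul u).sub_const (u * v i)
    rw [sub_self] at h1
    refine h1.congr' ?_
    filter_upwards [hev] with k hk
    have h2 := congrFun (hpow u v w hv hw (N k)) i
    rw [pow_succ, hk u hu] at h2
    simp only [Pi.smul_apply, Pi.add_apply, smul_eq_mul, one_mul, mul_one] at h2
    rw [h2, add_sub_cancel_left]
  obtain ⟨k, hk⟩ := hev.exists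
  refine ⟨k.factorial, Nat.factorial_pos k, Sp.toEnd_injective ?_⟩
  rw [Sp.toEnd_pow, Sp.toEnd_one]
  exact pow_eq_one_of_eigenspace _ htop _ fun u hu => hk u hu

/-! ### Level zero homomorphisms of inertia and their extension to the Weil group. -/

section Arithmetic

variable {p : ℕ} [Fact p.Prime] {F : Type*} [Field F] [Algebra ℚ_[p] F] [FiniteDimensional ℚ_[p] F]

theorem IsTameGenerator.isClosed {s : inertiaGroup p F} (hs : IsTameGenerator s) :
    IsClosed (inertiaGroup p F : Set Gal(AlgebraicClosure F/F)) := by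
  rw [← show _ = inertiaGroup p F from hs]
  exact Subgroup.isClosed_topologicalClosure _

theorem isGalois_algebraicClosure_padic (p : ℕ) [Fact p.Prime] (F : Type*) [Field F]
    [Algebra ℚ_[p] F] : IsGalois F (AlgebraicClosure F) := by
  have : CharZero F := charZero_of_injective_algebraMap (algebraMap ℚ_[p] F).injective
  infer_instance

/-- Since I_F is compact, it is enough that every accumulation point τ of the powers σ^(q^(k!) - 1)
lies in wild inertia, where χ is trivial. The value a = σ y / y of a tame character satisfies
a^(q^r) ≡ a for some r > 0, so a^(q^(k!) - 1) ≡ 1 as soon as r divides k!. -/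
theorem IsFrobeniusLift.tendsto_pow {Fr : WeilGroup p F} (hFr : IsFrobeniusLift Fr)
    (hI : IsClosed (inertiaGroup p F : Set Gal(AlgebraicClosure F/F)))
    {H : Type*} [Group H] [TopologicalSpace H] (χ : inertiaGroup p F →* H) (hχ : Continuous χ)
    (hχP : ∀ i : inertiaGroup p F, (i : Gal(AlgebraicClosure F/F)) ∈ wildInertiaGroup p F → χ i = 1)
    (σ : inertiaGroup p F) :
    Filter.Tendsto (fun k : ℕ => χ σ ^ (residueCard p F ^ k.factorial - 1)) Filter.atTop
      (nhds 1) := by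
  have := isGalois_algebraicClosure_padic p F
  have : CompactSpace (inertiaGroup p F) := isCompact_iff_compactSpace.1 hI.isCompact
  set N : ℕ → ℕ := fun k => residueCard p F ^ k.factorial - 1 with hNdef
  have hN1 : ∀ k, N k + 1 = residueCard p F ^ k.factorial := fun k =>
    Nat.sub_add_cancel (Nat.one_le_pow _ _ (Nat.pos_of_ne_zero hFr.residueCard_ne_zero))
  rw [tendsto_nhds]
  intro U hU h1U
  by_contra hne
  have hfr : ∃ᶠ k in Filter.atTop, σ ^ N k ∈ (χ ⁻¹' U)ᶜ := by
    refine fun h => hne (h.mono fun k hk => ?_)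
    have h2 := not_not.1 hk
    rw [Set.mem_preimage, map_pow] at h2
    exact h2
  obtain ⟨τ, hτU, hτ⟩ := ((hU.preimage hχ).isClosed_compl.isCompact).exists_mapClusterPt_of_frequently
    hfr
  apply hτU
  rw [Set.mem_preimage, hχP τ ?_]
  · exact h1U
  intro y hy
  -- Agreement with τ at y is an open condition, so it holds for arbitrarily large k.
  have hopen : IsOpen {σ' : inertiaGroup p F | (σ' : Gal(AlgebraicClosure F/F)) y = τ.1 y} := by
    have h2 := (stabilizer_isOpen_of_isIntegral (K := F) y).preimage
      (show Continuous fun σ' : inertiaGroup p F => (τ⁻¹ * σ' : inertiaGroup p F).1 by fun_prop)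
    convert h2 using 1
    ext σ'
    rw [Set.mem_preimage, SetLike.mem_coe, MulAction.mem_stabilizer_iff, Set.mem_ofPred_eq]
    change _ ↔ (τ.1⁻¹ * σ'.1) y = y
    rw [AlgEquiv.mul_apply]
    constructor
    · intro h
      rw [h, ← AlgEquiv.mul_apply, inv_mul_cancel, AlgEquiv.one_apply]
    · intro h
      conv_rhs => rw [← h]
      rw [← AlgEquiv.mul_apply, mul_inv_cancel, AlgEquiv.one_apply]
  have hf := hτ.frequently (hopen.mem_nhds rfl)
  set a := σ.1 y / y with ha
  have ha1 : absBar p F a = 1 := absBar_galois_div σ.1 hy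
  obtain ⟨r, hr, har⟩ := hFr.exists_pow_sub_lt ha1.le
  have hpow : ∀ m : ℕ, absBar p F (a ^ residueCard p F ^ (r * m) - a) < 1 := by
    intro m
    induction m with
    | zero => simp [absBar_zero]
    | succ m ih =>
      rw [mul_add, mul_one, pow_add, pow_mul]
      exact absBar_sub_trans (absBar_pow_sub_pow_lt (absBar_pow_le_one ha1.le _) ha1.le ih _) har
  obtain ⟨k, hk, hkr⟩ := (hf.and_eventually (Filter.eventually_ge_atTop r)).exists
  -- The factorial in the exponent serves this divisibility, simultaneously for all y.
  obtain ⟨m, hm⟩ := Nat.dvd_factorial hr hkr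
  have h3 : absBar p F (a ^ N k - 1) < 1 := by
    have h4 := hpow m
    rw [← hm, ← hN1 k, pow_succ, ← sub_one_mul, absBar_mul, ha1, mul_one] at h4
    exact h4
  have h5 := absBar_sub_trans (absBar_pow_div_lt σ.2 hy (N k)) h3
  have h6 : (σ.1 ^ N k) y = τ.1 y := hk
  rwa [h6, ← div_self hy, ← sub_div, absBar_div _ hy, div_lt_one (absBar_pos hy)] at h5

/-- As χ(s) has finite order, the preimage of the group it generates is closed; it contains s and
P_F, hence all of I_F. -/
theorem IsTameGenerator.exists_pow_eq {s : inertiaGroup p F} (hs : IsTameGenerator s)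
    {H : Type*} [Group H] [TopologicalSpace H] [T1Space H] (χ : inertiaGroup p F →* H)
    (hχ : Continuous χ)
    (hχP : ∀ i : inertiaGroup p F, (i : Gal(AlgebraicClosure F/F)) ∈ wildInertiaGroup p F → χ i = 1)
    (hfin : IsOfFinOrder (χ s)) (i : inertiaGroup p F) : ∃ j : ℕ, χ i = χ s ^ j := by
  have hfin' : (Subgroup.zpowers (χ s) : Set H).Finite := by
    rw [finite_zpowers]
    exact hfin
  let S : Subgroup Gal(AlgebraicClosure F/F) :=
    ((Subgroup.zpowers (χ s)).comap χ).map (inertiaGroup p F).subtype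
  have hS : IsClosed (S : Set Gal(AlgebraicClosure F/F)) := by
    have h1 : IsClosed (((Subgroup.zpowers (χ s)).comap χ : Subgroup (inertiaGroup p F)) :
        Set (inertiaGroup p F)) := hfin'.isClosed.preimage hχ
    exact (hs.isClosed.isClosedEmbedding_subtypeVal.isClosedMap) _ h1
  have hle : (Subgroup.zpowers (s : Gal(AlgebraicClosure F/F)) ⊔
      wildInertiaGroup p F).topologicalClosure ≤ S := by
    refine Subgroup.topologicalClosure_minimal _ (sup_le ?_ ?_) hS
    · rw [Subgroup.zpowers_le]
      exact ⟨s, Subgroup.mem_zpowers _, rfl⟩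
    · intro σ hσ
      refine ⟨⟨σ, wildInertiaGroup_le_inertiaGroup hσ⟩, ?_, rfl⟩
      change χ _ ∈ Subgroup.zpowers (χ s)
      rw [hχP ⟨σ, wildInertiaGroup_le_inertiaGroup hσ⟩ hσ]
      exact one_mem _
  rw [show _ = inertiaGroup p F from hs] at hle
  obtain ⟨i', hi', h⟩ := Subgroup.mem_map.1 (hle i.2)
  have h3 : i' = i := Subtype.ext h
  subst h3
  have h2 : χ i' ∈ Submonoid.powers (χ s) := by
    rw [hfin.mem_powers_iff_mem_zpowers]
    exact hi'
  obtain ⟨j, hj⟩ := h2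
  exact ⟨j, hj.symm⟩

/-- Conjugation of the inertia group by elements of the Weil group. -/
def WeilGroup.conjInertia (w : WeilGroup p F) (i : inertiaGroup p F) : inertiaGroup p F :=
  ⟨_, conj_mem_inertiaGroup (WeilGroup.toGal p F w) i.2⟩

theorem WeilGroup.toGal_injective : Function.Injective (WeilGroup.toGal p F) :=
  Subtype.val_injective

theorem inertiaToWeil_injective : Function.Injective (inertiaToWeil p F) := fun _ _ h =>
  Subtype.ext (congrArg (WeilGroup.toGal p F) h)

theorem WeilGroup.inertiaToWeil_conjInertia (w : WeilGroup p F) (i : inertiaGroup p F) :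
    inertiaToWeil p F (w.conjInertia i) = w * inertiaToWeil p F i * w⁻¹ :=
  WeilGroup.toGal_injective (by rw [map_mul, map_mul, map_inv]; rfl)

/-- A homomorphism trivial on wild inertia turns conjugation by Frobenius into the power `q`. -/
theorem IsFrobeniusLift.map_conjInertia {Fr : WeilGroup p F} (hFr : IsFrobeniusLift Fr)
    {H : Type*} [Group H] (χ : inertiaGroup p F →* H)
    (hχP : ∀ i : inertiaGroup p F, (i : Gal(AlgebraicClosure F/F)) ∈ wildInertiaGroup p F → χ i = 1)
    (i : inertiaGroup p F) : χ (Fr.conjInertia i) = χ i ^ residueCard p F := by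
  rw [← map_pow, ← mul_inv_eq_one, ← map_inv, ← map_mul]
  exact hχP _ (hFr.conj_mul_inv_mem i.2)

theorem IsFrobeniusLift.eq_of_mul_zpow_eq {Fr : WeilGroup p F} (hFr : IsFrobeniusLift Fr)
    {i j : inertiaGroup p F} {k l : ℤ}
    (h : inertiaToWeil p F i * Fr ^ k = inertiaToWeil p F j * Fr ^ l) : i = j ∧ k = l := by
  have h1 : inertiaToWeil p F (j⁻¹ * i) = Fr ^ (l - k) := by
    rw [map_mul, map_inv, _root_.zpow_sub, eq_mul_inv_iff_mul_eq, mul_assoc, h, inv_mul_cancel_left]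
  have h2 : l - k = 0 := hFr.zpow_mem_inertiaGroup (by
    rw [← map_zpow, ← h1]
    exact (j⁻¹ * i).2)
  rw [h2, zpow_zero] at h1
  have h3 : j⁻¹ * i = 1 := inertiaToWeil_injective (by rw [h1, map_one])
  exact ⟨(inv_mul_eq_one.1 h3).symm, by omega⟩

/-- Extension of a homomorphism from the inertia group to the Weil group. -/
theorem IsFrobeniusLift.exists_extension {Fr : WeilGroup p F} (hFr : IsFrobeniusLift Fr)
    {H : Type*} [Group H] [TopologicalSpace H] [ContinuousMul H] (χ : inertiaGroup p F →* H)
    (hχ : Continuous χ) (Φ : H) (hΦ : ∀ i, χ (Fr.conjInertia i) = Φ * χ i * Φ⁻¹) :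
    ∃ ψ : WeilGroup p F →* H, Continuous ψ ∧ (∀ i, ψ (inertiaToWeil p F i) = χ i) ∧ ψ Fr = Φ := by
  have hconj : ∀ (k : ℤ) (i), χ ((Fr ^ k).conjInertia i) = Φ ^ k * χ i * (Φ ^ k)⁻¹ := by
    have hstep : ∀ (k : ℤ) (i), χ ((Fr ^ (k + 1)).conjInertia i) =
        Φ * χ ((Fr ^ k).conjInertia i) * Φ⁻¹ := by
      intro k i
      rw [← hΦ]
      congr 1
      apply inertiaToWeil_injective
      simp only [WeilGroup.inertiaToWeil_conjInertia]
      rw [add_comm, _root_.zpow_add, zpow_one]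
      simp only [_root_.mul_inv_rev, mul_assoc]
    intro k i
    induction k with
    | zero =>
      rw [zpow_zero, zpow_zero, one_mul, inv_one, mul_one]
      congr 1
    | succ k ih =>
      rw [hstep, ih, add_comm, _root_.zpow_add, zpow_one]
      group
    | pred k ih =>
      have h1 := hstep (-k - 1) i
      rw [sub_add_cancel, ih, eq_mul_inv_iff_mul_eq, ← inv_mul_eq_iff_eq_mul] at h1
      rw [← h1, sub_eq_add_neg, add_comm, _root_.zpow_add, _root_.zpow_neg_one]
      group
  choose ι κ hικ using hFr.exists_mem_inertiaGroup_mul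
  have hval : ∀ (i : inertiaGroup p F) (k : ℤ), χ (ι (inertiaToWeil p F i * Fr ^ k)) *
      Φ ^ κ (inertiaToWeil p F i * Fr ^ k) = χ i * Φ ^ k := by
    intro i k
    obtain ⟨h1, h2⟩ := hFr.eq_of_mul_zpow_eq (hικ (inertiaToWeil p F i * Fr ^ k))
    rw [← h1, ← h2]
  have hone : χ (ι 1) * Φ ^ κ 1 = 1 := by
    have h1 := hval 1 0
    rwa [map_one, map_one, zpow_zero, zpow_zero, mul_one, mul_one] at h1
  let ψ : WeilGroup p F →* H :=
    { toFun := fun w => χ (ι w) * Φ ^ κ w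
      map_one' := hone
      map_mul' := fun w w' => by
        have h1 : w * w' = inertiaToWeil p F (ι w * (Fr ^ κ w).conjInertia (ι w')) *
            Fr ^ (κ w + κ w') := by
          rw [map_mul, WeilGroup.inertiaToWeil_conjInertia, _root_.zpow_add]
          conv_lhs => rw [hικ w, hικ w']
          group
        rw [h1, hval, map_mul, hconj, _root_.zpow_add]
        group }
  have hψI : ∀ i, ψ (inertiaToWeil p F i) = χ i := fun i => by
    have h1 := hval i 0
    rwa [zpow_zero, mul_one, zpow_zero, mul_one] at h1
  have hψFr : ψ Fr = Φ := by
    have h1 := hval 1 1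
    rwa [map_one, one_mul, zpow_one, map_one, one_mul, zpow_one] at h1
  refine ⟨ψ, continuous_iff_continuousAt.2 fun w₀ => ?_, hψI, hψFr⟩
  have hmk : Continuous fun w : WeilGroup p F =>
      WeilGroup.toGal p F w :=
    continuous_iff_le_induced.2 inf_le_left
  -- Continuity is local: on the open coset of w₀ modulo inertia, ψ is a translate of χ.
  let S : Set (WeilGroup p F) := {w | w₀⁻¹ * w ∈ (inertiaToWeil p F).range}
  have hS : IsOpen S := by
    have h1 : @Continuous _ _ _ ⊥ fun w : WeilGroup p F =>
        (QuotientGroup.mk w : WeilGroup p F ⧸ (inertiaToWeil p F).range) :=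
      continuous_iff_le_induced.2 inf_le_right
    have h2 := @IsOpen.preimage _ _ _ ⊥ _ h1 {QuotientGroup.mk w₀} (by trivial)
    convert h2 using 1
    ext w
    rw [Set.mem_preimage, Set.mem_singleton_iff, eq_comm, QuotientGroup.eq]
    rfl
  refine ContinuousOn.continuousAt (s := S) ?_ (hS.mem_nhds ?_)
  · rw [continuousOn_iff_continuous_domRestrict]
    have hmem : ∀ w : S, (WeilGroup.toGal p F w₀)⁻¹ * WeilGroup.toGal p F w.1 ∈
        inertiaGroup p F := by
      rintro ⟨w, i, hi⟩
      rw [← map_inv, ← map_mul, ← hi]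
      exact i.2
    have h1 : S.domRestrict ψ = fun w : S => ψ w₀ * χ ⟨_, hmem w⟩ := by
      funext w
      rw [Set.domRestrict_apply, ← hψI, ← map_mul]
      congr 1
      apply WeilGroup.toGal_injective
      rw [map_mul]
      exact (mul_inv_cancel_left _ _).symm
    rw [h1]
    refine continuous_const.mul (hχ.comp (Continuous.subtype_mk ?_ _))
    exact continuous_const.mul (hmk.comp continuous_subtype_val)
  · rw [Set.mem_ofPred_eq, inv_mul_cancel]
    exact one_mem _

end Arithmetic

/-! ### Stable subspaces of representations of SL(2, ℂ). -/

section StableSubspaces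

open Module

variable {X : Type*} [AddCommGroup X] [Module ℂ X] {ρ : SL2C →* End ℂ X}

theorem isAlgebraicRep_of_injective {ι : Type*} [Finite ι] (f : X →ₗ[ℂ] (ι → ℂ))
    (hf : Function.Injective f)
    (h : ∀ x i, ∃ P : MvPolynomial (Fin 2 × Fin 2) ℂ, ∀ g : SL2C,
      f (ρ g x) i = MvPolynomial.eval (fun k => g.1 k.1 k.2) P) : IsAlgebraicRep ρ := by
  classical
  have := Fintype.ofFinite ι
  intro ξ x
  obtain ⟨r, hr⟩ := f.exists_leftInverse_of_injective (LinearMap.ker_eq_bot.2 hf)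
  choose P hP using h x
  refine ⟨∑ i, MvPolynomial.C (ξ (r (Pi.single i 1))) * P i, fun g => ?_⟩
  have h1 : r (f (ρ g x)) = ρ g x := LinearMap.congr_fun hr _
  rw [← h1, pi_eq_sum_univ' (f (ρ g x)), map_sum, map_sum, map_sum]
  refine Finset.sum_congr rfl fun i _ => ?_
  rw [map_mul, MvPolynomial.eval_C, ← hP, map_smul, map_smul, smul_eq_mul, mul_comm]

theorem exists_eval_symRep (k : ℕ) (c : Fin (k + 1) → ℂ) (i : Fin (k + 1)) :
    ∃ P : MvPolynomial (Fin 2 × Fin 2) ℂ, ∀ g : SL2C,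
      symRep k g c i = MvPolynomial.eval (fun k => g.1 k.1 k.2) P := by
  choose P hP using fun j => exists_mvPolynomial_symMatrix k i j
  refine ⟨∑ j, P j * MvPolynomial.C (c j), fun g => ?_⟩
  rw [symRep_apply, Matrix.mulVec, dotProduct, map_sum]
  refine Finset.sum_congr rfl fun j _ => ?_
  rw [map_mul, MvPolynomial.eval_C, hP]

theorem isAlgebraicRep_symRep (k : ℕ) : IsAlgebraicRep (symRep k) :=
  isAlgebraicRep_of_injective LinearMap.id Function.injective_id fun c i => exists_eval_symRep k c i

theorem IsAlgebraicRep.exists_upper_fixed [FiniteDimensional ℂ X] (hρ : IsAlgebraicRep ρ)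
    {Y : Submodule ℂ X} (hY : ∀ g, ∀ y ∈ Y, ρ g y ∈ Y) (hne : Y ≠ ⊥) :
    ∃ (k : ℕ), ∃ x ∈ Y, x ≠ 0 ∧ HasWeight ρ k x ∧ ∀ t, ρ (sl2Upper t) x = x := by
  have := Submodule.nontrivial_iff_ne_bot.2 hne
  obtain ⟨k, x, hx0, hx, hk⟩ := exists_highest_weight (hρ.subRep Y hY)
  refine ⟨k, x, x.2, fun h => hx0 (Subtype.ext h), fun z => congrArg Subtype.val (hx z), fun t => ?_⟩
  exact congrArg Subtype.val
    (upper_fixes_of_highest (hρ.subRep Y hY) (fun m hm => hk m (Or.inl hm)) hx t)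

/-- The symmetric powers are irreducible. -/
theorem symRep_irreducible {k : ℕ} {Y : Submodule ℂ (Fin (k + 1) → ℂ)}
    (hY : ∀ g, ∀ y ∈ Y, symRep k g y ∈ Y) (hne : Y ≠ ⊥) : Y = ⊤ := by
  -- A stable subspace contains a vector fixed by the upper unipotents, hence the point (1, 0) of
  -- the curve. Lower unipotents move this point over the whole chart, which spans.
  obtain ⟨-, x, hxY, hx0, -, hx⟩ := (isAlgebraicRep_symRep k).exists_upper_fixed hY hne
  have h1 := eq_smul_of_upper_fixed hx
  have hc : x 0 ≠ 0 := fun h => hx0 (by rw [h1, h, zero_smul])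
  have htop : veronese k ![1, 0] ∈ Y := by
    have := Y.smul_mem (x 0)⁻¹ hxY
    rwa [h1, smul_smul, ← h1, inv_mul_cancel₀ hc, one_smul] at this
  by_contra hlt
  obtain ⟨f, hf0, hf⟩ := Y.exists_le_ker_of_lt_top (lt_top_iff_ne_top.2 hlt)
  refine hf0 (linearMap_ext_veronese Set.finite_empty fun t _ => ?_)
  have h2 := hf (hY (sl2Lower t) _ htop)
  rw [symRep_veronese _ _ (by simp), sl2Lower_val] at h2
  have h3 : !![1, 0; t, 1] *ᵥ ![1, 0] = ![1, t] := by
    ext i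
    fin_cases i <;> simp [Matrix.mulVec, dotProduct, Fin.sum_univ_two]
  rw [h3] at h2
  exact h2

/-- Complete reducibility of algebraic representations of `SL(2, ℂ)`. -/
theorem IsAlgebraicRep.exists_isCompl [FiniteDimensional ℂ X] (hρ : IsAlgebraicRep ρ)
    {W : Submodule ℂ X} (hW : ∀ g, ∀ w ∈ W, ρ g w ∈ W) :
    ∃ Z : Submodule ℂ X, (∀ g, ∀ z ∈ Z, ρ g z ∈ Z) ∧ IsCompl W Z := by
  classical
  obtain ⟨I, _, k, e, he⟩ := hρ.exists_equiv_pi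
  let f : ∀ i, (Fin (k i + 1) → ℂ) →ₗ[ℂ] X := fun i =>
    e.toLinearMap ∘ₗ LinearMap.single ℂ (fun i => Fin (k i + 1) → ℂ) i
  have hf : ∀ i g c, f i (symRep (k i) g c) = ρ g (f i c) := by
    intro i g c
    change e (Pi.single i _) = ρ g (e (Pi.single i c))
    rw [← he, symRep_single]
  have hrange : ∀ i g, ∀ x ∈ LinearMap.range (f i), ρ g x ∈ LinearMap.range (f i) := by
    rintro i g _ ⟨c, rfl⟩
    exact ⟨_, hf i g c⟩
  have hsup : ∀ {Y Z : Submodule ℂ X}, (∀ g, ∀ y ∈ Y, ρ g y ∈ Y) → (∀ g, ∀ y ∈ Z, ρ g y ∈ Z) →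
      ∀ g, ∀ y ∈ Y ⊔ Z, ρ g y ∈ Y ⊔ Z := by
    intro Y Z hY hZ g y hy
    obtain ⟨a, ha, b, hb, rfl⟩ := Submodule.mem_sup.1 hy
    rw [map_add]
    exact Submodule.add_mem_sup (hY g a ha) (hZ g b hb)
  -- Build Z one constituent at a time: by irreducibility each constituent either meets W + Z in 0,
  -- and is added to Z, or already lies in W + Z.
  have key : ∀ J : Finset I, ∃ Z : Submodule ℂ X, (∀ g, ∀ z ∈ Z, ρ g z ∈ Z) ∧ Disjoint W Z ∧
      ∀ i ∈ J, LinearMap.range (f i) ≤ W ⊔ Z := by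
    intro J
    induction J using Finset.induction_on with
    | empty => exact ⟨⊥, by simp, disjoint_bot_right, by simp⟩
    | insert i J _ ih =>
      obtain ⟨Z, hZ, hWZ, hJ⟩ := ih
      by_cases hi : ((W ⊔ Z).comap (f i)) = ⊥
      · refine ⟨Z ⊔ LinearMap.range (f i), hsup hZ (hrange i), ?_, ?_⟩
        · rw [Submodule.disjoint_def]
          intro w hw hw'
          obtain ⟨z, hz, _, ⟨c, rfl⟩, h⟩ := Submodule.mem_sup.1 hw'
          have hc : c ∈ (W ⊔ Z).comap (f i) := by
            rw [Submodule.mem_comap, show f i c = w + -z by rw [← h]; abel]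
            exact Submodule.add_mem_sup hw (Z.neg_mem hz)
          rw [hi, Submodule.mem_bot] at hc
          rw [hc, map_zero, add_zero] at h
          exact (Submodule.disjoint_def.1 hWZ) w hw (h ▸ hz)
        · intro j hj
          rcases Finset.mem_insert.1 hj with rfl | hj
          · exact le_sup_right.trans le_sup_right
          · exact (hJ j hj).trans (sup_le_sup_left le_sup_left _)
      · refine ⟨Z, hZ, hWZ, fun j hj => ?_⟩
        rcases Finset.mem_insert.1 hj with rfl | hj
        · have h := symRep_irreducible (fun g c hc => by
            rw [Submodule.mem_comap] at hc ⊢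
            rw [hf]
            exact hsup hW hZ g _ hc) hi
          rintro _ ⟨c, rfl⟩
          have : c ∈ (W ⊔ Z).comap (f j) := by rw [h]; trivial
          exact this
        · exact hJ j hj
  obtain ⟨Z, hZ, hWZ, hJ⟩ := key Finset.univ
  refine ⟨Z, hZ, hWZ, codisjoint_iff.2 (eq_top_iff.2 fun x _ => ?_)⟩
  obtain ⟨c, rfl⟩ := e.surjective x
  have h1 : e c = ∑ i, f i (c i) := by
    change _ = ∑ i, e (Pi.single i (c i))
    rw [← map_sum, Finset.univ_sum_single]
  rw [h1]
  exact Submodule.sum_mem _ fun i _ => hJ i (Finset.mem_univ i) ⟨_, rfl⟩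

theorem IsAlgebraicRep.exists_projection [FiniteDimensional ℂ X] (hρ : IsAlgebraicRep ρ)
    {W : Submodule ℂ X} (hW : ∀ g, ∀ w ∈ W, ρ g w ∈ W) :
    ∃ P : End ℂ X, (∀ v, P v ∈ W) ∧ (∀ v ∈ W, P v = v) ∧ ∀ g, Commute P (ρ g) := by
  obtain ⟨Z, hZ, hWZ⟩ := hρ.exists_isCompl hW
  refine ⟨W.projection Z hWZ, fun v => Submodule.projection_apply_mem hWZ v,
    fun v hv => Submodule.projection_apply_of_mem_left hWZ hv, fun g => ?_⟩
  ext v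
  obtain ⟨w, hw, z, hz, rfl⟩ := Submodule.mem_sup.1 (hWZ.sup_eq_top ▸ Submodule.mem_top (x := v))
  rw [End.mul_apply, End.mul_apply, map_add, map_add, map_add, map_add,
    Submodule.projection_apply_of_mem_left hWZ (hW g w hw),
    Submodule.projection_apply_of_mem_left hWZ hw,
    (Submodule.projection_apply_eq_zero_iff hWZ).2 (hZ g z hz),
    (Submodule.projection_apply_eq_zero_iff hWZ).2 hz, map_zero]

/-- A stable subspace of a multiplicity free representation contains a highest weight vector of one
of its constituents. -/
theorem exists_single_mem_of_stable {I : Type*} [Fintype I] [DecidableEq I] {k : I → ℕ}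
    (hk : Function.Injective k) [FiniteDimensional ℂ X] (hρ : IsAlgebraicRep ρ)
    {e : X →ₗ[ℂ] (∀ i, Fin (k i + 1) → ℂ)} (he : ∀ g x, e (ρ g x) = fun i => symRep (k i) g (e x i))
    (hinj : Function.Injective e) {Y : Submodule ℂ X} (hY : ∀ g, ∀ y ∈ Y, ρ g y ∈ Y) (hne : Y ≠ ⊥) :
    ∃ i, ∃ x ∈ Y, e x = Pi.single i (veronese (k i) ![1, 0]) := by
  obtain ⟨m, x, hxY, hx0, hm, hx⟩ := hρ.exists_upper_fixed hY hne
  have h1 : ∀ i, e x i = e x i 0 • veronese (k i) ![1, 0] := fun i =>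
    eq_smul_of_upper_fixed fun t => by
      conv_rhs => rw [← hx t, he]
  -- Each nonzero component of x is a highest weight vector of its constituent and has the weight m
  -- of x. Since k is injective, only one component is nonzero.
  have h2 : ∀ i, e x i ≠ 0 → k i = m := by
    intro i hi
    have h3 : HasWeight (symRep (k i)) m (e x i) := by
      intro z
      have h4 := congrFun (congrArg e (hm z)) i
      rw [he, map_smul] at h4
      exact h4
    have h5 : HasWeight (symRep (k i)) (k i) (e x i) := by
      rw [h1]
      exact (hasWeight_veronese (k i)).smul _
    exact_mod_cast h5.eq_of_ne_zero h3 hi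
  obtain ⟨i, hi⟩ := Function.ne_iff.1 fun h : e x = 0 => hx0 (hinj (by rw [h, map_zero]))
  have hc : e x i 0 ≠ 0 := fun h => hi (by rw [h1, h, zero_smul]; rfl)
  refine ⟨i, (e x i 0)⁻¹ • x, Y.smul_mem _ hxY, funext fun j => ?_⟩
  rw [map_smul, Pi.smul_apply]
  by_cases hj : j = i
  · subst hj
    rw [Pi.single_eq_same, h1, smul_smul, ← h1, inv_mul_cancel₀ hc, one_smul]
  · rw [Pi.single_eq_of_ne hj]
    have : e x j = 0 := by
      by_contra hne
      exact hj (hk ((h2 j hne).trans (h2 i hi).symm))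
    rw [this, smul_zero]

end StableSubspaces

/-! ### Cycles of eigenvalues under u ↦ u^q. -/

section Cycles

/-- The exponent of Frobenius defining the operator `F_u`. -/
def cycleLength (q : ℕ) (u : ℂ) : ℕ :=
  open Classical in if u = 1 ∨ u = -1 then 1 else 2 * ell q u

/-- The orbit of `u` under `u ↦ u ^ q` is a cycle containing `u⁻¹`. -/
structure IsSelfDual (q : ℕ) (u : ℂ) : Prop where
  ne_zero : u ≠ 0
  odd : Odd q
  periodic : ∃ M, 0 < M ∧ u ^ q ^ M = u
  inv : ∃ l, u⁻¹ = u ^ q ^ l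

variable {q : ℕ} {u : ℂ}

theorem eq_one_or_neg_one_pow (hq : Odd q) (hu : u = 1 ∨ u = -1) (j : ℕ) : u ^ q ^ j = u := by
  rcases hu with rfl | rfl
  · exact one_pow _
  · exact (hq.pow).neg_one_pow

theorem eq_one_or_neg_one_of_inv_eq (hu0 : u ≠ 0) (hu : u⁻¹ = u) : u = 1 ∨ u = -1 := by
  refine mul_self_eq_one_iff.1 ?_
  nth_rewrite 1 [← hu]
  exact inv_mul_cancel₀ hu0

namespace IsSelfDual

variable (h : IsSelfDual q u)
include h

theorem inv_eq : u⁻¹ = u ^ q ^ ell q u := Nat.sInf_mem (s := {l | u⁻¹ = u ^ q ^ l}) h.inv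

theorem pow_eq_pow_iff_minimalPeriod (i j : ℕ) : u ^ q ^ i = u ^ q ^ j ↔
    i % Function.minimalPeriod (fun x : ℂ => x ^ q) u =
      j % Function.minimalPeriod (fun x : ℂ => x ^ q) u := by
  set f := fun x : ℂ => x ^ q
  have hf : ∀ j : ℕ, f^[j] u = u ^ q ^ j := fun j => congrFun (pow_iterate q j) u
  have hpos : 0 < Function.minimalPeriod f u := by
    obtain ⟨M, hM, h1⟩ := h.periodic
    exact Function.IsPeriodicPt.minimalPeriod_pos hM ((hf M).trans h1)
  rw [← hf, ← hf, ← Function.iterate_mod_minimalPeriod_eq (n := i),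
    ← Function.iterate_mod_minimalPeriod_eq (n := j)]
  exact Function.iterate_eq_iterate_iff_of_lt_minimalPeriod (Nat.mod_lt _ hpos) (Nat.mod_lt _ hpos)

theorem cases : ((u = 1 ∨ u = -1) ∧ cycleLength q u = 1 ∧ ell q u = 0) ∨
    ((u ≠ 1 ∧ u ≠ -1) ∧ cycleLength q u = 2 * ell q u ∧ 0 < ell q u) := by
  by_cases hu : u = 1 ∨ u = -1
  · refine Or.inl ⟨hu, if_pos hu, Nat.sInf_eq_zero.2 (Or.inl ?_)⟩
    change u⁻¹ = u ^ q ^ 0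
    rcases hu with rfl | rfl <;> norm_num
  · refine Or.inr ⟨not_or.1 hu, if_neg hu, Nat.pos_of_ne_zero fun h0 => hu ?_⟩
    have h1 := h.inv_eq
    rw [h0, pow_zero, pow_one] at h1
    exact eq_one_or_neg_one_of_inv_eq h.ne_zero h1

/-- For u ≠ ±1 the period divides 2ℓ, because inverting twice is the identity, and exceeds ℓ by
minimality of ℓ; so it equals 2ℓ. For u = ±1 it is 1, as q is odd. Thus the exponent of Frobenius in
F_u is exactly the length of the cycle. -/
theorem minimalPeriod_eq :
    Function.minimalPeriod (fun x : ℂ => x ^ q) u = cycleLength q u := by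
  set r := Function.minimalPeriod (fun x : ℂ => x ^ q) u with hr
  have hpos : 0 < r := by
    obtain ⟨M, hM, h1⟩ := h.periodic
    exact Function.IsPeriodicPt.minimalPeriod_pos hM ((congrFun (pow_iterate q M) u).trans h1)
  rcases h.cases with ⟨hu, h1, -⟩ | ⟨hu, h1, h2⟩
  · rw [h1, hr, Function.minimalPeriod_eq_one_iff_isFixedPt]
    have := eq_one_or_neg_one_pow h.odd hu 1
    rwa [pow_one] at this
  · have h3 : ell q u < r := by
      have h4 : u⁻¹ = u ^ q ^ (ell q u % r) := by
        rw [h.inv_eq, h.pow_eq_pow_iff_minimalPeriod]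
        exact (Nat.mod_mod _ _).symm
      exact (Nat.sInf_le (show ell q u % r ∈ {l | u⁻¹ = u ^ q ^ l} from h4)).trans_lt
        (Nat.mod_lt _ hpos)
    have h4 : r ∣ 2 * ell q u := by
      have h5 : u ^ q ^ (2 * ell q u) = u ^ q ^ 0 := by
        rw [two_mul, pow_add, pow_mul, ← h.inv_eq, inv_pow, ← h.inv_eq, inv_inv, pow_zero, pow_one]
      rw [h.pow_eq_pow_iff_minimalPeriod, Nat.zero_mod] at h5
      exact Nat.dvd_of_mod_eq_zero h5
    obtain ⟨c, hc⟩ := h4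
    have hc1 : c = 1 := by
      have h6 : c < 2 := by
        by_contra hc2
        have : r * 2 ≤ r * c := Nat.mul_le_mul_left _ (by omega)
        omega
      have h7 : c ≠ 0 := by
        rintro rfl
        omega
      omega
    rw [h1, hc, hc1, mul_one]

theorem cycleLength_pos : 0 < cycleLength q u := by
  rcases h.cases with ⟨-, h1, -⟩ | ⟨-, h1, h2⟩ <;> omega

theorem ell_lt : ell q u < cycleLength q u := by
  rcases h.cases with ⟨-, h1, h2⟩ | ⟨-, h1, h2⟩ <;> omega

theorem pow_eq_pow_iff (i j : ℕ) :
    u ^ q ^ i = u ^ q ^ j ↔ i % cycleLength q u = j % cycleLength q u := by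
  rw [h.pow_eq_pow_iff_minimalPeriod, h.minimalPeriod_eq]

theorem pow_cycleLength_mul (t : ℕ) : u ^ q ^ (cycleLength q u * t) = u := by
  conv_rhs => rw [← pow_one u, ← pow_zero q]
  rw [h.pow_eq_pow_iff, Nat.mul_mod_right, Nat.zero_mod]

theorem pow_cycleLength : u ^ q ^ cycleLength q u = u := by
  simpa using h.pow_cycleLength_mul 1

/-- The exponent needed to return to `u` from `u ^ q ^ j`. -/
theorem exists_add_eq (j : ℕ) : ∃ k t, j + k = cycleLength q u * t :=
  ⟨(cycleLength q u - 1) * j, j, by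
    have := h.cycleLength_pos
    nth_rewrite 1 [← one_mul j]
    rw [← add_mul]
    congr 1
    omega⟩

theorem exists_pow_pow_eq (j : ℕ) : ∃ k, (u ^ q ^ j) ^ q ^ k = u := by
  obtain ⟨k, t, hkt⟩ := h.exists_add_eq j
  exact ⟨k, by rw [← pow_mul, ← pow_add, hkt, h.pow_cycleLength_mul]⟩

theorem pow (j : ℕ) : IsSelfDual q (u ^ q ^ j) where
  ne_zero := pow_ne_zero _ h.ne_zero
  odd := h.odd
  periodic := ⟨cycleLength q u, h.cycleLength_pos, by
    rw [← pow_mul, mul_comm, pow_mul, h.pow_cycleLength]⟩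
  inv := ⟨ell q u, by rw [← inv_pow, h.inv_eq, ← pow_mul, ← pow_mul, mul_comm]⟩

theorem ell_pow (j : ℕ) : ell q (u ^ q ^ j) = ell q u := by
  have : {l : ℕ | (u ^ q ^ j)⁻¹ = (u ^ q ^ j) ^ q ^ l} = {l : ℕ | u⁻¹ = u ^ q ^ l} := by
    ext l
    rw [Set.mem_ofPred_eq, Set.mem_ofPred_eq, ← inv_pow, h.inv_eq, ← pow_mul, ← pow_mul, ← pow_add,
      ← pow_add, h.pow_eq_pow_iff, h.pow_eq_pow_iff, add_comm]
    exact ⟨fun h => Nat.ModEq.add_left_cancel' j h, fun h => Nat.ModEq.add_left j h⟩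
  rw [ell, ell, this]

theorem pow_eq_one_or_iff (j : ℕ) : u ^ q ^ j = 1 ∨ u ^ q ^ j = -1 ↔ u = 1 ∨ u = -1 := by
  constructor
  · intro h1
    obtain ⟨k, hk⟩ := h.exists_pow_pow_eq j
    rw [eq_one_or_neg_one_pow h.odd h1] at hk
    rwa [hk] at h1
  · intro h1
    rwa [eq_one_or_neg_one_pow h.odd h1]

theorem cycleLength_pow (j : ℕ) : cycleLength q (u ^ q ^ j) = cycleLength q u := by
  rw [cycleLength, cycleLength, h.ell_pow]
  simp only [h.pow_eq_one_or_iff]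

end IsSelfDual

end Cycles

/-! ### Anisotropic symplectic representations of the tame Weil group times SL(2, ℂ). -/

open Module in
/-- A symplectic representation of the product of the tame Weil group and `SL(2, ℂ)`: `A` is the
action of a generator of tame inertia, `Φ` the action of Frobenius and `Ψ` its inverse. -/
structure TameRep (q : ℕ) (V : Type*) [AddCommGroup V] [Module ℂ V] where
  /-- the symplectic form -/
  ω : V →ₗ[ℂ] V →ₗ[ℂ] ℂ
  /-- the generator of tame inertia -/
  A : End ℂ V
  /-- Frobenius -/
  Φ : End ℂ V
  /-- the inverse of Frobenius -/
  Ψ : End ℂ V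
  /-- the action of `SL(2, ℂ)` -/
  ρ : SL2C →* End ℂ V
  skew : ∀ x y, ω y x = -ω x y
  nondegenerate : ∀ x, (∀ y, ω x y = 0) → x = 0
  Φ_Ψ : ∀ x, Φ (Ψ x) = x
  Ψ_Φ : ∀ x, Ψ (Φ x) = x
  A_Ψ : ∀ x, A (Ψ x) = Ψ ((A ^ q) x)
  A_ρ : ∀ g x, A (ρ g x) = ρ g (A x)
  Ψ_ρ : ∀ g x, Ψ (ρ g x) = ρ g (Ψ x)
  ω_A : ∀ x y, ω (A x) (A y) = ω x y
  ω_Ψ : ∀ x y, ω (Ψ x) (Ψ y) = ω x y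
  ω_ρ : ∀ g x y, ω (ρ g x) (ρ g y) = ω x y
  algebraic : IsAlgebraicRep ρ

namespace TameRep

open Module

variable {q : ℕ} {V : Type*} [AddCommGroup V] [Module ℂ V] (X : TameRep q V)

/-- The joint eigenspaces of `A` and the power of `Ψ` attached to `u`. -/
def space (u μ : ℂ) : Submodule ℂ V :=
  X.A.eigenspace u ⊓ (X.Ψ ^ cycleLength q u).eigenspace μ

/-- There is no nonzero stable isotropic subspace. -/
def Anisotropic : Prop :=
  ∀ W : Submodule ℂ V, (∀ v ∈ W, X.A v ∈ W) → (∀ v ∈ W, X.Ψ v ∈ W) →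
    (∀ g, ∀ v ∈ W, X.ρ g v ∈ W) → (∀ v ∈ W, ∀ w ∈ W, X.ω v w = 0) → W = ⊥

variable {X}

theorem mem_space {u μ : ℂ} {x : V} :
    x ∈ X.space u μ ↔ X.A x = u • x ∧ (X.Ψ ^ cycleLength q u) x = μ • x := by
  rw [space, Submodule.mem_inf, End.mem_eigenspace_iff, End.mem_eigenspace_iff]

theorem pow_apply_of_eigen {W : Type*} [AddCommGroup W] [Module ℂ W] {f : End ℂ W} {u : ℂ} {x : W}
    (hx : f x = u • x) (m : ℕ) : (f ^ m) x = u ^ m • x := by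
  induction m with
  | zero => simp
  | succ m ih => rw [pow_succ, End.mul_apply, hx, map_smul, ih, smul_smul, pow_succ']

/-- The reason for working with the inverse of Frobenius: Ψ raises eigenvalues to the power q, while
Φ would require q-th roots. -/
theorem A_Ψ_pow {u : ℂ} {x : V} (hx : X.A x = u • x) (j : ℕ) :
    X.A ((X.Ψ ^ j) x) = u ^ q ^ j • (X.Ψ ^ j) x := by
  induction j with
  | zero => simpa using hx
  | succ j ih =>
    rw [pow_succ', End.mul_apply, X.A_Ψ, pow_apply_of_eigen ih, map_smul, ← pow_mul, ← pow_succ]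

theorem Ψ_pow_ρ (j : ℕ) (g : SL2C) (x : V) : (X.Ψ ^ j) (X.ρ g x) = X.ρ g ((X.Ψ ^ j) x) := by
  induction j with
  | zero => rfl
  | succ j ih => rw [pow_succ', End.mul_apply, ih, X.Ψ_ρ, End.mul_apply]

theorem Φ_ρ (g : SL2C) (x : V) : X.Φ (X.ρ g x) = X.ρ g (X.Φ x) := by
  rw [← X.Ψ_Φ x, ← X.Ψ_ρ, X.Φ_Ψ, X.Ψ_Φ]

theorem ω_Ψ_pow (j : ℕ) (x y : V) : X.ω ((X.Ψ ^ j) x) ((X.Ψ ^ j) y) = X.ω x y := by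
  induction j with
  | zero => rfl
  | succ j ih => rw [pow_succ', End.mul_apply, End.mul_apply, X.ω_Ψ, ih]

theorem Ψ_pow_injective (j : ℕ) : Function.Injective (X.Ψ ^ j) := by
  rw [End.coe_pow]
  exact (Function.LeftInverse.injective X.Φ_Ψ).iterate j

theorem ω_eq_zero {u v : ℂ} {x y : V} (hx : X.A x = u • x) (hy : X.A y = v • y) (huv : u * v ≠ 1) :
    X.ω x y = 0 := by
  have h := X.ω_A x y
  rw [hx, hy, map_smul, map_smul, LinearMap.smul_apply, smul_smul, smul_eq_mul, mul_comm v] at h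
  have h1 : (u * v - 1) * X.ω x y = 0 := by rw [sub_mul, h, one_mul, sub_self]
  exact (mul_eq_zero.1 h1).resolve_left (sub_ne_zero.2 huv)

theorem ρ_mem_space {u μ : ℂ} (g : SL2C) {x : V} (hx : x ∈ X.space u μ) : X.ρ g x ∈ X.space u μ := by
  rw [mem_space] at hx ⊢
  rw [X.A_ρ, hx.1, Ψ_pow_ρ, hx.2, map_smul, map_smul]
  exact ⟨rfl, rfl⟩

theorem Ψ_pow_mem_space {u μ : ℂ} (hu : IsSelfDual q u) (j : ℕ) {x : V} (hx : x ∈ X.space u μ) :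
    (X.Ψ ^ j) x ∈ X.space (u ^ q ^ j) μ := by
  rw [mem_space] at hx ⊢
  refine ⟨A_Ψ_pow hx.1 j, ?_⟩
  rw [hu.cycleLength_pow, ← End.mul_apply, ← pow_add, add_comm, pow_add, End.mul_apply, hx.2,
    map_smul]

theorem exists_Ψ_pow_eq {u μ : ℂ} (hu : IsSelfDual q u) (hμ : μ ≠ 0) (j : ℕ) {y : V}
    (hy : y ∈ X.space (u ^ q ^ j) μ) : ∃ x ∈ X.space u μ, (X.Ψ ^ j) x = y := by
  obtain ⟨k, t, hkt⟩ := hu.exists_add_eq j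
  have h1 := Ψ_pow_mem_space (hu.pow j) k hy
  rw [← pow_mul, ← pow_add, hkt, hu.pow_cycleLength_mul] at h1
  refine ⟨(μ ^ t)⁻¹ • (X.Ψ ^ k) y, Submodule.smul_mem _ _ h1, ?_⟩
  have h2 := (mem_space.1 hy).2
  rw [hu.cycleLength_pow] at h2
  rw [map_smul, ← End.mul_apply, ← pow_add, hkt, pow_mul, pow_apply_of_eigen h2, smul_smul,
    inv_mul_cancel₀ (pow_ne_zero _ hμ), one_smul]

/-- In an anisotropic representation the twisted form on a joint eigenspace has no stable isotropic
subspace. -/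
theorem Anisotropic.eq_bot (hX : X.Anisotropic) {u μ : ℂ} (hu : IsSelfDual q u)
    {Y : Submodule ℂ V} (hYρ : ∀ g, ∀ y ∈ Y, X.ρ g y ∈ Y) (hY : Y ≤ X.space u μ)
    (hb : ∀ x ∈ Y, ∀ y ∈ Y, X.ω x ((X.Ψ ^ ell q u) y) = 0) : Y = ⊥ := by
  -- The span of the Ψ-translates of Y is stable under everything, so anisotropy applies once it is
  -- known to be isotropic.
  set W : Submodule ℂ V := ⨆ j : ℕ, Y.map (X.Ψ ^ j) with hWdef
  have hmem : ∀ (j : ℕ), ∀ y ∈ Y, (X.Ψ ^ j) y ∈ W := fun j y hy =>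
    Submodule.mem_iSup_of_mem j ⟨y, hy, rfl⟩
  have hle : ∀ {Z : Submodule ℂ V}, (∀ (j : ℕ), ∀ y ∈ Y, (X.Ψ ^ j) y ∈ Z) → W ≤ Z := by
    intro Z hZ
    refine iSup_le fun j => ?_
    rintro _ ⟨y, hy, rfl⟩
    exact hZ j y hy
  have hW : W = ⊥ := by
    refine hX W ?_ ?_ ?_ ?_
    · refine hle (Z := W.comap X.A) fun j y hy => ?_
      rw [Submodule.mem_comap, A_Ψ_pow (mem_space.1 (hY hy)).1]
      exact W.smul_mem _ (hmem j y hy)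
    · refine hle (Z := W.comap X.Ψ) fun j y hy => ?_
      rw [Submodule.mem_comap, ← End.mul_apply, ← pow_succ']
      exact hmem (j + 1) y hy
    · intro g
      refine hle (Z := W.comap (X.ρ g)) fun j y hy => ?_
      rw [Submodule.mem_comap, ← Ψ_pow_ρ]
      exact hmem j _ (hYρ g y hy)
    -- The eigenvalues make the pairing vanish unless u · u^(q^d) = 1, that is, unless d ≡ ℓ modulo
    -- the cycle length. In that case Ψ^d y is a power of μ times Ψ^ℓ y and the hypothesis on the
    -- twisted form applies.
    · have key : ∀ (d : ℕ), ∀ x ∈ Y, ∀ y ∈ Y, X.ω x ((X.Ψ ^ d) y) = 0 := by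
        intro d x hx y hy
        by_cases h1 : u * u ^ q ^ d = 1
        · have h2 : u ^ q ^ d = u ^ q ^ ell q u := by
            rw [← hu.inv_eq]
            exact eq_inv_of_mul_eq_one_right h1
          rw [hu.pow_eq_pow_iff, Nat.mod_eq_of_lt hu.ell_lt] at h2
          have h3 := Nat.mod_add_div d (cycleLength q u)
          rw [h2] at h3
          rw [← h3, pow_add, End.mul_apply, pow_mul, pow_apply_of_eigen (mem_space.1 (hY hy)).2,
            map_smul, map_smul, hb x hx y hy, smul_zero]
        · exact ω_eq_zero (mem_space.1 (hY hx)).1 (A_Ψ_pow (mem_space.1 (hY hy)).1 d) h1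
      have key2 : ∀ i j : ℕ, i ≤ j → ∀ x ∈ Y, ∀ y ∈ Y, X.ω ((X.Ψ ^ i) x) ((X.Ψ ^ j) y) = 0 := by
        intro i j hij x hx y hy
        obtain ⟨d, rfl⟩ := Nat.exists_eq_add_of_le hij
        rw [pow_add, End.mul_apply, ω_Ψ_pow]
        exact key d x hx y hy
      have key3 : ∀ i j : ℕ, ∀ x ∈ Y, ∀ y ∈ Y, X.ω ((X.Ψ ^ i) x) ((X.Ψ ^ j) y) = 0 := by
        intro i j x hx y hy
        rcases le_total i j with h | h
        · exact key2 i j h x hx y hy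
        · rw [X.skew, key2 j i h y hy x hx, neg_zero]
      intro v hv w hw
      refine hle (Z := LinearMap.ker (X.ω v)) (fun j y hy => ?_) hw
      refine hle (Z := LinearMap.ker (X.ω.flip ((X.Ψ ^ j) y))) (fun i x hx => ?_) hv
      exact key3 i j x hx y hy
  rw [eq_bot_iff, ← hW]
  intro y hy
  exact hmem 0 y hy

/-- Converse to `Anisotropic.eq_bot`. A stable isotropic W ≠ 0 contains an eigenvector of A; some
Ψ^j moves it to the preferred eigenvalue of its cycle, and an eigenvector there of the relevant
power of Ψ shows that W meets a joint eigenspace. The freedom in j means that one eigenvalue per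
cycle has to be checked. -/
theorem anisotropic_of_space [FiniteDimensional ℂ V]
    (h : ∀ u, X.A.HasEigenvalue u → ∃ j : ℕ, ∀ (μ : ℂ) (Y : Submodule ℂ V),
      (∀ g, ∀ y ∈ Y, X.ρ g y ∈ Y) → Y ≤ X.space (u ^ q ^ j) μ →
      (∀ x ∈ Y, ∀ y ∈ Y, X.ω x ((X.Ψ ^ ell q (u ^ q ^ j)) y) = 0) → Y = ⊥)
    (hsd : ∀ u, X.A.HasEigenvalue u → IsSelfDual q u) : X.Anisotropic := by
  intro W hA hΨ hρ hiso
  by_contra hne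
  have hΨpow : ∀ (j : ℕ), ∀ v ∈ W, (X.Ψ ^ j) v ∈ W := by
    intro j
    induction j with
    | zero => exact fun v hv => hv
    | succ j ih =>
      intro v hv
      rw [pow_succ', End.mul_apply]
      exact hΨ _ (ih v hv)
  have hex : ∀ (f : End ℂ V) (Z : Submodule ℂ V), Z ≠ ⊥ → (∀ v ∈ Z, f v ∈ Z) →
      ∃ (c : ℂ), ∃ x ∈ Z, x ≠ 0 ∧ f x = c • x := by
    intro f Z hZ hf
    have := Submodule.nontrivial_iff_ne_bot.2 hZ
    obtain ⟨c, hc⟩ := End.exists_eigenvalue (f.restrict hf)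
    obtain ⟨x, hx⟩ := hc.exists_hasEigenvector
    exact ⟨c, x, x.2, fun h0 => hx.2 (Subtype.ext h0), congrArg Subtype.val hx.apply_eq_smul⟩
  obtain ⟨u, x, hxW, hx0, hx⟩ := hex X.A W hne hA
  have hu : X.A.HasEigenvalue u :=
    End.hasEigenvalue_of_hasEigenvector ⟨End.mem_eigenspace_iff.2 hx, hx0⟩
  obtain ⟨j, hj⟩ := h u hu
  set u' := u ^ q ^ j with hu'
  have hsd' : IsSelfDual q u' := (hsd u hu).pow j
  have hZ : W ⊓ X.A.eigenspace u' ≠ ⊥ := by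
    intro h0
    have h1 : (X.Ψ ^ j) x ∈ W ⊓ X.A.eigenspace u' :=
      ⟨hΨpow j x hxW, End.mem_eigenspace_iff.2 (A_Ψ_pow hx j)⟩
    rw [h0, Submodule.mem_bot] at h1
    exact hx0 (Ψ_pow_injective j (by rw [h1, map_zero]))
  obtain ⟨μ, y, ⟨hyW, hyu⟩, hy0, hy⟩ := hex (X.Ψ ^ cycleLength q u') _ hZ (by
    rintro v ⟨hv, hvu⟩
    refine ⟨hΨpow _ v hv, ?_⟩
    have h1 := A_Ψ_pow (End.mem_eigenspace_iff.1 hvu) (cycleLength q u')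
    rw [hsd'.pow_cycleLength] at h1
    exact End.mem_eigenspace_iff.2 h1)
  have h1 := hj μ (W ⊓ X.space u' μ) (fun g v hv => ⟨hρ g v hv.1, ρ_mem_space g hv.2⟩) inf_le_right
    (fun v hv w hw => hiso v hv.1 _ (hΨpow _ w hw.1))
  have h2 : y ∈ W ⊓ X.space u' μ := ⟨hyW, mem_space.2 ⟨End.mem_eigenspace_iff.1 hyu, hy⟩⟩
  rw [h1, Submodule.mem_bot] at h2
  exact hy0 h2

/-- Applying Ψ^r, with r the cycle length, multiplies the twisted form by μ² and also preserves it.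
If μ² ≠ 1 the form is zero, and the whole joint eigenspace would be isotropic. -/
theorem Anisotropic.space_eq_bot (hX : X.Anisotropic) {u μ : ℂ} (hu : IsSelfDual q u)
    (hμ : μ * μ ≠ 1) : X.space u μ = ⊥ := by
  refine hX.eq_bot hu (fun g y hy => ρ_mem_space g hy) le_rfl fun x hx y hy => ?_
  have h := ω_Ψ_pow (X := X) (cycleLength q u) x ((X.Ψ ^ ell q u) y)
  rw [← End.mul_apply, ← pow_add, add_comm, pow_add, End.mul_apply, (mem_space.1 hx).2,
    (mem_space.1 hy).2, map_smul, LinearMap.smul_apply, map_smul, map_smul, smul_smul,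
    smul_eq_mul] at h
  have h1 : (μ * μ - 1) * X.ω x ((X.Ψ ^ ell q u) y) = 0 := by rw [sub_mul, h, one_mul, sub_self]
  exact (mul_eq_zero.1 h1).resolve_left (sub_ne_zero.2 hμ)

theorem Anisotropic.eigenspace_eq [FiniteDimensional ℂ V] (hX : X.Anisotropic) {u : ℂ}
    (hu : IsSelfDual q u) (hss : X.Ψ.IsSemisimple) :
    X.A.eigenspace u = X.space u 1 ⊔ X.space u (-1) := by
  refine le_antisymm ?_ (sup_le inf_le_left inf_le_left)
  set f := X.Ψ ^ cycleLength q u with hf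
  have hfss : f.IsSemisimple := hss.pow _
  have htop : ⨆ μ, f.genEigenspace μ 1 = ⊤ := by
    rw [eq_top_iff, ← End.iSup_maxGenEigenspace_eq_top f]
    exact iSup_mono fun μ => (hfss.isFinitelySemisimple.maxGenEigenspace_eq_eigenspace μ).le
  have hstab : ∀ x ∈ X.A.eigenspace u, f x ∈ X.A.eigenspace u := by
    intro x hx
    have h1 := A_Ψ_pow (End.mem_eigenspace_iff.1 hx) (cycleLength q u)
    rw [hu.pow_cycleLength] at h1
    exact End.mem_eigenspace_iff.2 h1
  have h1 := Submodule.inf_iSup_genEigenspace hstab 1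
  rw [htop, inf_top_eq] at h1
  rw [h1]
  refine iSup_le fun μ => ?_
  change X.space u μ ≤ _
  by_cases hμ : μ * μ = 1
  · rcases mul_self_eq_one_iff.1 hμ with rfl | rfl
    · exact le_sup_left
    · exact le_sup_right
  · rw [hX.space_eq_bot hu hμ]
    exact bot_le

theorem disjoint_space {u μ ν : ℂ} (h : μ ≠ ν) : Disjoint (X.space u μ) (X.space u ν) := by
  rw [Submodule.disjoint_def]
  intro x hx hy
  have h1 := (mem_space.1 hx).2
  rw [(mem_space.1 hy).2, ← sub_eq_zero, ← sub_smul] at h1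
  exact (smul_eq_zero.1 h1).resolve_left (sub_ne_zero.2 h.symm)

/-- The sign of the twisted form on the joint eigenspaces. -/
def sign (u : ℂ) (ζ : ℤˣ) : ℂ :=
  open Classical in if u = 1 ∨ u = -1 then -1 else -(ζ : ℤ)

/-- For u ≠ ±1, ω(y, Ψ^ℓ x) = -ω(Ψ^ℓ x, y) = -ω(Ψ^(2ℓ) x, Ψ^ℓ y) = -ζ ω(x, Ψ^ℓ y). For u = ±1, ℓ = 0
and the form is ω itself. The distinction between symplectic and orthogonal orbits originates here.
-/
theorem twisted_form_comm {u : ℂ} (hu : IsSelfDual q u) (ζ : ℤˣ) {x y : V}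
    (hx : x ∈ X.space u (ζ : ℤ)) :
    X.ω y ((X.Ψ ^ ell q u) x) = sign u ζ * X.ω x ((X.Ψ ^ ell q u) y) := by
  rcases hu.cases with ⟨h1, -, h2⟩ | ⟨h1, h2, -⟩
  · rw [h2, sign, if_pos h1, X.skew, neg_one_mul]
    rfl
  · rw [X.skew, ← ω_Ψ_pow (ell q u), ← End.mul_apply, ← pow_add, ← two_mul, ← h2,
      (mem_space.1 hx).2, map_smul, LinearMap.smul_apply, smul_eq_mul, sign,
      if_neg (not_or.2 h1), neg_mul]

/-- The representation of `SL(2, ℂ)` on a joint eigenspace. -/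
def spaceRep (X : TameRep q V) (u μ : ℂ) : SL2C →* End ℂ (X.space u μ) :=
  subRep X.ρ (X.space u μ) fun g _ hx => ρ_mem_space g hx

/-- The necessary conditions on the orbits: the twisted form meets the hypotheses of
`injective_and_parity_of_no_isotropic`, with its isotropic subspaces excluded by
`Anisotropic.eq_bot`. -/
theorem Anisotropic.exists_equiv_pi [FiniteDimensional ℂ V] (hX : X.Anisotropic) {u : ℂ}
    (hu : IsSelfDual q u) (ζ : ℤˣ) :
    ∃ (I : Type) (_ : Fintype I) (k : I → ℕ)
      (e : (∀ i, Fin (k i + 1) → ℂ) ≃ₗ[ℂ] X.space u (ζ : ℤ)),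
      (∀ g c, e (fun i => symRep (k i) g (c i)) = X.spaceRep u (ζ : ℤ) g (e c)) ∧
      Function.Injective k ∧ ∀ i, (-1) ^ k i = sign u ζ := by
  obtain ⟨I, hI, k, e, he⟩ := (X.algebraic.subRep (X.space u (ζ : ℤ))
    fun g _ hx => ρ_mem_space g hx).exists_equiv_pi
  let b : X.space u (ζ : ℤ) →ₗ[ℂ] X.space u (ζ : ℤ) →ₗ[ℂ] ℂ :=
    X.ω.compl₁₂ (X.space u (ζ : ℤ)).subtype ((X.Ψ ^ ell q u) ∘ₗ (X.space u (ζ : ℤ)).subtype)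
  have hb : ∀ x y, b x y = X.ω x ((X.Ψ ^ ell q u) y) := fun x y => rfl
  refine ⟨I, hI, k, e, he, injective_and_parity_of_no_isotropic (b := b) (ρ := X.spaceRep u (ζ : ℤ))
    ?_ ?_ ?_ he⟩
  · intro g x y
    rw [hb, hb]
    change X.ω (X.ρ g x) ((X.Ψ ^ ell q u) (X.ρ g y)) = _
    rw [Ψ_pow_ρ, X.ω_ρ]
  · intro x y
    rw [hb, hb, twisted_form_comm hu ζ x.2]
  · intro Y hY hiso
    have h1 : Y.map (X.space u (ζ : ℤ)).subtype = ⊥ := by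
      refine hX.eq_bot (μ := (ζ : ℤ)) hu ?_ ?_ ?_
      · rintro g _ ⟨y, hy, rfl⟩
        exact ⟨_, hY g y hy, rfl⟩
      · rintro _ ⟨y, -, rfl⟩
        exact y.2
      · rintro _ ⟨x, hx, rfl⟩ _ ⟨y, hy, rfl⟩
        exact hiso x hx y hy
    rw [eq_bot_iff]
    intro y hy
    have h2 : (y : V) ∈ Y.map (X.space u (ζ : ℤ)).subtype := ⟨y, hy, rfl⟩
    rw [h1, Submodule.mem_bot] at h2
    exact Subtype.ext h2

end TameRep

/-! ### Gluing equivariant isomorphisms along the cycles. -/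

section

open Module

theorem linearMap_ext_eigenspace {V W : Type*} [AddCommGroup V] [Module ℂ V] [AddCommGroup W]
    [Module ℂ W] {A : End ℂ V} (hA : ⨆ u, A.eigenspace u = ⊤) {f g : V →ₗ[ℂ] W}
    (h : ∀ (v : ℂ) (x : V), A x = v • x → f x = g x) : f = g := by
  rw [← LinearMap.eqLocus_eq_top, eq_top_iff, ← hA]
  exact iSup_le fun v x hx => h v x (End.mem_eigenspace_iff.1 hx)

theorem exists_eigenprojection {V : Type*} [AddCommGroup V] [Module ℂ V] [FiniteDimensional ℂ V]
    (A : End ℂ V) (u : ℂ) :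
    ∃ P : End ℂ V, (∀ x, A x = u • x → P x = x) ∧ ∀ (v : ℂ) (x : V), v ≠ u → A x = v • x → P x = 0 := by
  classical
  have hfin : {v | A.HasEigenvalue v}.Finite := A.finite_hasEigenvalue
  let f : Polynomial ℂ := ∏ w ∈ hfin.toFinset.erase u,
    (Polynomial.C (u - w)⁻¹ * (Polynomial.X - Polynomial.C w))
  have hf : ∀ (v : ℂ) (x : V), A x = v • x → Polynomial.aeval A f x = f.eval v • x := by
    intro v x hx
    rcases eq_or_ne x 0 with rfl | hx0
    · simp
    · exact Module.End.aeval_apply_of_hasEigenvector ⟨End.mem_eigenspace_iff.2 hx, hx0⟩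
  refine ⟨Polynomial.aeval A f, fun x hx => ?_, fun v x hv hx => ?_⟩
  · rw [hf u x hx, Polynomial.eval_prod, Finset.prod_eq_one, one_smul]
    intro w hw
    have h1 : u - w ≠ 0 := sub_ne_zero.2 (Finset.ne_of_mem_erase hw).symm
    simp [h1]
  · rcases eq_or_ne x 0 with rfl | hx0
    · simp
    have hv' : v ∈ hfin.toFinset.erase u := Finset.mem_erase.2 ⟨hv, hfin.mem_toFinset.2
      (End.hasEigenvalue_of_hasEigenvector ⟨End.mem_eigenspace_iff.2 hx, hx0⟩)⟩
    rw [hf v x hx, Polynomial.eval_prod, Finset.prod_eq_zero hv' (by simp), zero_smul]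

namespace TameRep

variable {q : ℕ} {V V' : Type*} [AddCommGroup V] [Module ℂ V] [AddCommGroup V'] [Module ℂ V']
  {X : TameRep q V} {X' : TameRep q V'}

theorem Φ_A (x : V) : X.Φ (X.A x) = (X.A ^ q) (X.Φ x) := by
  conv_lhs => rw [← X.Ψ_Φ x, X.A_Ψ, X.Φ_Ψ]

theorem Φ_pow_A (j : ℕ) (x : V) : (X.Φ ^ j) (X.A x) = (X.A ^ q ^ j) ((X.Φ ^ j) x) := by
  have h1 : ∀ (m : ℕ) (x : V), X.Φ ((X.A ^ m) x) = (X.A ^ (m * q)) (X.Φ x) := by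
    intro m
    induction m with
    | zero => simp
    | succ m ih =>
      intro x
      rw [pow_succ, End.mul_apply, ih, Φ_A, ← End.mul_apply, ← pow_add, add_mul, one_mul]
  induction j with
  | zero => simp
  | succ j ih => rw [pow_succ', End.mul_apply, ih, h1, ← pow_succ, End.mul_apply]

theorem Φ_pow_Ψ_pow (j : ℕ) (x : V) : (X.Φ ^ j) ((X.Ψ ^ j) x) = x := by
  rw [End.coe_pow, End.coe_pow]
  exact Function.LeftInverse.iterate X.Φ_Ψ j x

theorem Φ_pow_ρ (j : ℕ) (g : SL2C) (x : V) : (X.Φ ^ j) (X.ρ g x) = X.ρ g ((X.Φ ^ j) x) := by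
  induction j with
  | zero => rfl
  | succ j ih => rw [pow_succ', End.mul_apply, ih, Φ_ρ, End.mul_apply]

/-- Equivariant projection on a joint eigenspace. -/
theorem exists_space_projection [FiniteDimensional ℂ V] (hA : ⨆ u, X.A.eigenspace u = ⊤)
    (hsd : ∀ v, X.A.HasEigenvalue v → IsSelfDual q v) {u : ℂ} (hu : IsSelfDual q u)
    (hdec : X.A.eigenspace u = X.space u 1 ⊔ X.space u (-1)) {c : ℂ} (hc : c * c = 1) :
    ∃ R : End ℂ V, (∀ x, R x ∈ X.space u c) ∧ (∀ x ∈ X.space u c, R x = x) ∧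
      (∀ x ∈ X.space u (-c), R x = 0) ∧ (∀ x, R (X.A x) = u • R x) ∧
      (∀ x, R ((X.Ψ ^ cycleLength q u) x) = c • R x) ∧ ∀ g x, R (X.ρ g x) = X.ρ g (R x) := by
  classical
  obtain ⟨P, hP, hP0⟩ := exists_eigenprojection X.A u
  set r := cycleLength q u with hr
  have hAP : ∀ x, X.A (P x) = u • P x := by
    refine LinearMap.congr_fun (linearMap_ext_eigenspace hA (f := X.A ∘ₗ P) (g := u • P) ?_)
    intro v x hx
    rw [LinearMap.comp_apply, LinearMap.smul_apply]
    by_cases hv : v = u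
    · subst hv
      rw [hP x hx, hx]
    · rw [hP0 v x hv hx, map_zero, smul_zero]
  have hPA : ∀ x, P (X.A x) = u • P x := by
    refine LinearMap.congr_fun (linearMap_ext_eigenspace hA (f := P ∘ₗ X.A) (g := u • P) ?_)
    intro v x hx
    rw [LinearMap.comp_apply, LinearMap.smul_apply, hx, map_smul]
    by_cases hv : v = u
    · rw [hv]
    · rw [hP0 v x hv hx, smul_zero, smul_zero]
  have hPρ : ∀ g x, P (X.ρ g x) = X.ρ g (P x) := by
    intro g
    refine LinearMap.congr_fun
      (linearMap_ext_eigenspace hA (f := P ∘ₗ X.ρ g) (g := X.ρ g ∘ₗ P) ?_)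
    intro v x hx
    have h1 : X.A (X.ρ g x) = v • X.ρ g x := by rw [X.A_ρ, hx, map_smul]
    rw [LinearMap.comp_apply, LinearMap.comp_apply]
    by_cases hv : v = u
    · subst hv
      rw [hP x hx, hP _ h1]
    · rw [hP0 v x hv hx, hP0 v _ hv h1, map_zero]
  have hPΨ : ∀ x, P ((X.Ψ ^ r) x) = (X.Ψ ^ r) (P x) := by
    refine LinearMap.congr_fun
      (linearMap_ext_eigenspace hA (f := P ∘ₗ (X.Ψ ^ r)) (g := (X.Ψ ^ r) ∘ₗ P) ?_)
    intro v x hx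
    rcases eq_or_ne x 0 with rfl | hx0
    · simp
    have hv' := hsd v (End.hasEigenvalue_of_hasEigenvector ⟨End.mem_eigenspace_iff.2 hx, hx0⟩)
    have h1 := A_Ψ_pow hx r
    rw [LinearMap.comp_apply, LinearMap.comp_apply]
    by_cases hv : v = u
    · subst hv
      rw [hu.pow_cycleLength] at h1
      rw [hP x hx, hP _ h1]
    -- Otherwise v and u lie on one cycle, so r is also the period of v, and v^(q^r) = v ≠ u.
    · have h2 : v ^ q ^ r ≠ u := by
        intro h3
        have h4 := hv'.cycleLength_pow r
        rw [h3] at h4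
        rw [hr, h4, hv'.pow_cycleLength] at h3
        exact hv h3
      rw [hP0 v x hv hx, hP0 _ _ h2 h1, map_zero]
  have hΨΨ : ∀ x, (X.Ψ ^ r) ((X.Ψ ^ r) (P x)) = P x := by
    intro x
    have h1 : P x ∈ X.A.eigenspace u := End.mem_eigenspace_iff.2 (hAP x)
    rw [hdec] at h1
    obtain ⟨a, ha, b, hb, h2⟩ := Submodule.mem_sup.1 h1
    rw [← h2, map_add, map_add, (mem_space.1 ha).2, (mem_space.1 hb).2, map_smul, map_smul,
      (mem_space.1 ha).2, (mem_space.1 hb).2]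
    simp
  -- On the u-eigenspace Ψ^r is an involution and c² = 1, so ½(1 + cΨ^r) projects onto its c-part.
  let R : End ℂ V := (2⁻¹ : ℂ) • (P + c • ((X.Ψ ^ r) ∘ₗ P))
  have hR : ∀ x, R x = (2⁻¹ : ℂ) • (P x + c • (X.Ψ ^ r) (P x)) := fun x => rfl
  refine ⟨R, fun x => mem_space.2 ⟨?_, ?_⟩, fun x hx => ?_, fun x hx => ?_, fun x => ?_, fun x => ?_,
    fun g x => ?_⟩
  · have h1 := A_Ψ_pow (hAP x) r
    rw [hu.pow_cycleLength] at h1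
    rw [hR, map_smul, map_add, map_smul, hAP, h1]
    module
  · rw [← hr, hR, map_smul, map_add, map_smul, hΨΨ]
    have h1 : c • (2⁻¹ : ℂ) • (P x + c • (X.Ψ ^ r) (P x)) =
        (2⁻¹ : ℂ) • ((c * c) • (X.Ψ ^ r) (P x) + c • P x) := by module
    rw [h1, hc, one_smul]
  · obtain ⟨h1, h2⟩ := mem_space.1 hx
    rw [hR, hP x h1, h2, smul_smul, hc, one_smul, ← two_smul ℂ x, smul_smul]
    norm_num
  · obtain ⟨h1, h2⟩ := mem_space.1 hx
    rw [hR, hP x h1, h2, smul_smul, mul_neg, hc, neg_one_smul, add_neg_cancel, smul_zero]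
  · rw [hR, hR, hPA, map_smul]
    module
  · rw [hR, hR, hPΨ, hΨΨ]
    have h1 : c • (2⁻¹ : ℂ) • (P x + c • (X.Ψ ^ r) (P x)) =
        (2⁻¹ : ℂ) • ((c * c) • (X.Ψ ^ r) (P x) + c • P x) := by module
    rw [h1, hc, one_smul]
  · rw [hR, hR, hPρ, Ψ_pow_ρ, map_smul, map_add, map_smul]

/-- Commuting past Ψ shifts the summation index by one. The sum runs over a full period, and the two
end terms agree because E intertwines the r-th powers. -/
theorem sum_conj_intertwines {r : ℕ} {E : V →ₗ[ℂ] V'}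
    (hE : ∀ x, (X'.Ψ ^ r) (E x) = E ((X.Ψ ^ r) x)) (x : V) :
    X'.Ψ (∑ j ∈ Finset.range r, (X'.Ψ ^ j) (E ((X.Φ ^ j) x))) =
      ∑ j ∈ Finset.range r, (X'.Ψ ^ j) (E ((X.Φ ^ j) (X.Ψ x))) := by
  have h1 : ∀ x, ∑ j ∈ Finset.range r, (X'.Ψ ^ (j + 1)) (E ((X.Φ ^ (j + 1)) x)) =
      ∑ j ∈ Finset.range r, (X'.Ψ ^ j) (E ((X.Φ ^ j) x)) := by
    intro x
    have h2 := Finset.sum_range_succ (fun j => (X'.Ψ ^ j) (E ((X.Φ ^ j) x))) r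
    rw [Finset.sum_range_succ' (fun j => (X'.Ψ ^ j) (E ((X.Φ ^ j) x))) r, hE] at h2
    have h3 : (X.Ψ ^ r) ((X.Φ ^ r) x) = x := by
      rw [End.coe_pow, End.coe_pow]
      exact Function.LeftInverse.iterate X.Ψ_Φ r x
    rw [h3] at h2
    exact add_right_cancel h2
  rw [← h1 (X.Ψ x), map_sum]
  refine Finset.sum_congr rfl fun j _ => ?_
  rw [pow_succ', End.mul_apply, pow_succ X.Φ, End.mul_apply, X.Φ_Ψ]

/-- Equivariant isomorphisms between the joint eigenspaces of representatives of the eigenvalues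
extend to the whole space. -/
theorem exists_equivariant_equiv [FiniteDimensional ℂ V] [FiniteDimensional ℂ V']
    (hA : ⨆ u, X.A.eigenspace u = ⊤) (hA' : ⨆ u, X'.A.eigenspace u = ⊤)
    (hsd : ∀ v, X.A.HasEigenvalue v → IsSelfDual q v) {ι : Type*} [Fintype ι] {u : ι → ℂ}
    (hu : ∀ i, IsSelfDual q (u i))
    (hrep : ∀ v, X'.A.HasEigenvalue v → ∃ i j, v = u i ^ q ^ j)
    (hinj : ∀ i i' j, u i' = u i ^ q ^ j → i = i')
    (hdec : ∀ i, X.A.eigenspace (u i) = X.space (u i) 1 ⊔ X.space (u i) (-1))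
    (hdec' : ∀ i, X'.A.eigenspace (u i) = X'.space (u i) 1 ⊔ X'.space (u i) (-1))
    (hdim : finrank ℂ V = finrank ℂ V')
    (S : ∀ (i) (ζ : ℤˣ), X.space (u i) (ζ : ℤ) ≃ₗ[ℂ] X'.space (u i) (ζ : ℤ))
    (hS : ∀ i ζ g x, S i ζ (X.spaceRep (u i) (ζ : ℤ) g x) = X'.spaceRep (u i) (ζ : ℤ) g (S i ζ x)) :
    ∃ T : V ≃ₗ[ℂ] V', (∀ x, T (X.A x) = X'.A (T x)) ∧ (∀ x, T (X.Ψ x) = X'.Ψ (T x)) ∧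
      ∀ g x, T (X.ρ g x) = X'.ρ g (T x) := by
  classical
  have hζ : ∀ ζ : ℤˣ, ((ζ : ℤ) : ℂ) * ((ζ : ℤ) : ℂ) = 1 := fun ζ => by
    rw [← Int.cast_mul, ← Units.val_mul, Int.units_mul_self, Units.val_one, Int.cast_one]
  choose R hRmem hRid hR0 hRA hRΨ hRρ using fun i (ζ : ℤˣ) =>
    exists_space_projection (X := X) hA hsd (hu i) (hdec i) (hζ ζ)
  let E : ι → ℤˣ → V →ₗ[ℂ] V' := fun i ζ => (X'.space (u i) (ζ : ℤ)).subtype ∘ₗ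
    (S i ζ).toLinearMap ∘ₗ (R i ζ).codRestrict _ (hRmem i ζ)
  have hE : ∀ i ζ x, E i ζ x = S i ζ ⟨R i ζ x, hRmem i ζ x⟩ := fun i ζ x => rfl
  have hEmem : ∀ i (ζ : ℤˣ) x, E i ζ x ∈ X'.space (u i) (ζ : ℤ) := fun i ζ x => (S i ζ _).2
  have hEsmul : ∀ i ζ x y (c : ℂ), R i ζ y = c • R i ζ x → E i ζ y = c • E i ζ x := by
    intro i ζ x y c h
    rw [hE, hE, ← Submodule.coe_smul, ← map_smul]
    congr 2
    exact Subtype.ext h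
  have hEA : ∀ i ζ x, E i ζ (X.A x) = u i • E i ζ x := fun i ζ x => hEsmul i ζ _ _ _ (hRA i ζ x)
  have hEΨ : ∀ i ζ x, (X'.Ψ ^ cycleLength q (u i)) (E i ζ x) =
      E i ζ ((X.Ψ ^ cycleLength q (u i)) x) := fun i ζ x => by
    rw [hEsmul i ζ _ _ _ (hRΨ i ζ x), (mem_space.1 (hEmem i ζ x)).2]
  have hEρ : ∀ i ζ g x, E i ζ (X.ρ g x) = X'.ρ g (E i ζ x) := by
    intro i ζ g x
    have h1 := congrArg Subtype.val (hS i ζ g ⟨R i ζ x, hRmem i ζ x⟩)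
    rw [hE, hE]
    refine Eq.trans ?_ h1
    congr 2
    exact Subtype.ext (hRρ i ζ g x)
  -- Bring a vector to the representative eigenspace by Φ^j, apply the given isomorphism there and
  -- carry the result back by Ψ^j.
  let T : V →ₗ[ℂ] V' := ∑ i, ∑ ζ : ℤˣ, ∑ j ∈ Finset.range (cycleLength q (u i)),
    (X'.Ψ ^ j) ∘ₗ E i ζ ∘ₗ (X.Φ ^ j)
  have hT : ∀ x, T x = ∑ i, ∑ ζ : ℤˣ, ∑ j ∈ Finset.range (cycleLength q (u i)),
      (X'.Ψ ^ j) (E i ζ ((X.Φ ^ j) x)) := fun x => by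
    simp only [T, LinearMap.sum_apply, LinearMap.comp_apply]
  have hTA : ∀ x, T (X.A x) = X'.A (T x) := by
    intro x
    rw [hT, hT]
    simp only [map_sum]
    refine Finset.sum_congr rfl fun i _ => Finset.sum_congr rfl fun ζ _ =>
      Finset.sum_congr rfl fun j _ => ?_
    have h1 : ∀ m x, E i ζ ((X.A ^ m) x) = u i ^ m • E i ζ x := by
      intro m
      induction m with
      | zero => simp
      | succ m ih => intro x; rw [pow_succ, End.mul_apply, ih, hEA, smul_smul, pow_succ]
    rw [Φ_pow_A, h1, map_smul, A_Ψ_pow (mem_space.1 (hEmem i ζ _)).1]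
  have hTΨ : ∀ x, T (X.Ψ x) = X'.Ψ (T x) := by
    intro x
    rw [hT, hT, map_sum]
    refine Finset.sum_congr rfl fun i _ => ?_
    rw [map_sum]
    exact Finset.sum_congr rfl fun ζ _ => (sum_conj_intertwines (hEΨ i ζ) x).symm
  have hTΦ : ∀ x, T (X.Φ x) = X'.Φ (T x) := fun x => by
    conv_rhs => rw [← X.Ψ_Φ x, hTΨ, X'.Φ_Ψ]
  have hTρ : ∀ g x, T (X.ρ g x) = X'.ρ g (T x) := by
    intro g x
    rw [hT, hT]
    simp only [map_sum]
    refine Finset.sum_congr rfl fun i _ => Finset.sum_congr rfl fun ζ _ =>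
      Finset.sum_congr rfl fun j _ => ?_
    rw [Φ_pow_ρ, hEρ, Ψ_pow_ρ]
  -- On a representative eigenspace only the term with the same i, the same ζ and j = 0 survives.
  -- Hence the range of T contains the target eigenspaces at the representatives, and their
  -- translates fill the space.
  have hTS : ∀ (i) (ζ : ℤˣ) (x : X.space (u i) (ζ : ℤ)), T x = S i ζ x := by
    intro i ζ x
    have hAx := (mem_space.1 x.2).1
    have hz : ∀ i' ζ' j, u i ≠ u i' ^ q ^ j → E i' ζ' ((X.Φ ^ j) x) = 0 := by
      intro i' ζ' j hne
      have h1 : ∀ m x, E i' ζ' ((X.A ^ m) x) = u i' ^ m • E i' ζ' x := by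
        intro m
        induction m with
        | zero => simp
        | succ m ih => intro x; rw [pow_succ, End.mul_apply, ih, hEA, smul_smul, pow_succ]
      have h2 := h1 (q ^ j) ((X.Φ ^ j) x)
      rw [← Φ_pow_A, hAx, map_smul, map_smul, ← sub_eq_zero, ← sub_smul] at h2
      exact (smul_eq_zero.1 h2).resolve_left (sub_ne_zero.2 hne)
    rw [hT, Finset.sum_eq_single i, Finset.sum_eq_single ζ, Finset.sum_eq_single 0]
    · rw [pow_zero, pow_zero, End.one_apply, End.one_apply, hE]
      congr 2
      exact Subtype.ext (hRid i ζ x x.2)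
    · intro j hj hj0
      rw [hz i ζ j, map_zero]
      intro h1
      conv_lhs at h1 => rw [← pow_one (u i), ← pow_zero q]
      rw [(hu i).pow_eq_pow_iff, Nat.zero_mod, Nat.mod_eq_of_lt (Finset.mem_range.1 hj)] at h1
      exact hj0 h1.symm
    · intro h0
      exact absurd (Finset.mem_range.2 (hu i).cycleLength_pos) h0
    · intro ζ' _ hζ'
      refine Finset.sum_eq_zero fun j hj => ?_
      by_cases h1 : u i = u i ^ q ^ j
      · conv_lhs at h1 => rw [← pow_one (u i), ← pow_zero q]
        rw [(hu i).pow_eq_pow_iff, Nat.zero_mod, Nat.mod_eq_of_lt (Finset.mem_range.1 hj)] at h1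
        rw [← h1, pow_zero, pow_zero, End.one_apply, End.one_apply]
        have h2 : ((ζ : ℤ) : ℂ) = -((ζ' : ℤ) : ℂ) := by
          rcases Int.units_eq_one_or ζ with rfl | rfl <;>
            rcases Int.units_eq_one_or ζ' with rfl | rfl <;> simp at hζ' ⊢
        have h3 : R i ζ' x = 0 := hR0 i ζ' x (by rw [← h2]; exact x.2)
        rw [hEsmul i ζ' 0 x 0 (by rw [h3, zero_smul]), zero_smul]
      · rw [hz i ζ' j h1, map_zero]
    · intro h0
      exact absurd (Finset.mem_univ _) h0
    · intro i' _ hi'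
      refine Finset.sum_eq_zero fun ζ' _ => Finset.sum_eq_zero fun j _ => ?_
      rw [hz i' ζ' j fun h1 => hi' (hinj i' i j h1), map_zero]
    · intro h0
      exact absurd (Finset.mem_univ _) h0
  have hrange : ∀ (i) (ζ : ℤˣ), X'.space (u i) (ζ : ℤ) ≤ LinearMap.range T := by
    intro i ζ y hy
    exact ⟨(S i ζ).symm ⟨y, hy⟩, by rw [hTS, LinearEquiv.apply_symm_apply]⟩
  have hsurj : Function.Surjective T := by
    rw [← LinearMap.range_eq_top, eq_top_iff, ← hA']
    refine iSup_le fun v y hy => ?_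
    rcases eq_or_ne y 0 with rfl | hy0
    · exact Submodule.zero_mem _
    obtain ⟨i, j, rfl⟩ := hrep v (End.hasEigenvalue_of_hasEigenvector ⟨hy, hy0⟩)
    obtain ⟨k, hk⟩ := (hu i).exists_pow_pow_eq j
    have h1 := A_Ψ_pow (End.mem_eigenspace_iff.1 hy) k
    rw [hk] at h1
    have h2 : (X'.Ψ ^ k) y ∈ LinearMap.range T := by
      have h3 := End.mem_eigenspace_iff.2 h1
      rw [hdec' i] at h3
      refine (sup_le ?_ ?_ : X'.space (u i) 1 ⊔ X'.space (u i) (-1) ≤ LinearMap.range T) h3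
      · have := hrange i 1
        rwa [Units.val_one, Int.cast_one] at this
      · have := hrange i (-1)
        rwa [Units.val_neg, Units.val_one, Int.cast_neg, Int.cast_one] at this
    rw [← Φ_pow_Ψ_pow (X := X') k y]
    obtain ⟨x, hx⟩ := h2
    rw [← hx]
    refine ⟨(X.Φ ^ k) x, ?_⟩
    clear hx h1 hk
    induction k with
    | zero => rfl
    | succ k ih => rw [pow_succ', pow_succ', End.mul_apply, End.mul_apply, hTΦ, ih]
  have hbij : Function.Bijective T :=
    ⟨(LinearMap.injective_iff_surjective_of_finrank_eq_finrank hdim).2 hsurj, hsurj⟩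
  exact ⟨LinearEquiv.ofBijective T hbij, hTA, hTΨ, hTρ⟩

end TameRep

end

/-! ### The model: twisted periodic functions with values in symmetric powers. -/

section

open Module

theorem sum_range_shift {F : ℤ → ℂ} {r : ℕ} (h : ∀ j, F (j + r) = F j) (d : ℤ) :
    ∑ j ∈ Finset.range r, F (j + d) = ∑ j ∈ Finset.range r, F j := by
  have hstep : ∀ d : ℤ, ∑ j ∈ Finset.range r, F (j + (d + 1)) = ∑ j ∈ Finset.range r, F (j + d) := by
    intro d
    have h1 := Finset.sum_range_succ (fun j : ℕ => F (j + d)) r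
    rw [Finset.sum_range_succ' (fun j : ℕ => F (j + d)) r] at h1
    have h2 : F ((r : ℤ) + d) = F (((0 : ℕ) : ℤ) + d) := by
      rw [add_comm, h, Nat.cast_zero, zero_add]
    rw [h2] at h1
    rw [← add_right_cancel h1]
    refine Finset.sum_congr rfl fun j _ => ?_
    congr 1
    push_cast
    ring
  induction d with
  | zero => simp
  | succ d ih => rw [hstep, ih]
  | pred d ih => rw [← ih, ← hstep (-d - 1), sub_add_cancel]

/-- The data of a multiplicity free sum of induced representations: for every index an eigenvalue,
a sign and the highest weight of a representation of `SL(2, ℂ)`. -/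
structure ModelData (q : ℕ) where
  /-- the index set -/
  I : Type
  [fintype : Fintype I]
  /-- the eigenvalues -/
  v : I → ℂ
  /-- the signs -/
  ζ : I → ℤˣ
  /-- the highest weights -/
  k : I → ℕ
  selfDual : ∀ a, IsSelfDual q (v a)
  eq_of_pow : ∀ a b j, v b = v a ^ q ^ j → v a = v b
  injective : ∀ a b, v a = v b → ζ a = ζ b → k a = k b → a = b
  parity : ∀ a, (-1) ^ k a = TameRep.sign (v a) (ζ a)

namespace ModelData

variable {q : ℕ} (D : ModelData q)

instance : Fintype D.I := D.fintype

instance : DecidableEq D.I := Classical.decEq _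

/-- The period of an index. -/
def r (a : D.I) : ℕ := cycleLength q (D.v a)

/-- The duality shift of an index. -/
def l (a : D.I) : ℕ := ell q (D.v a)

/-- The sign of an index as a complex number. -/
def z (a : D.I) : ℂ := ((D.ζ a : ℤ) : ℂ)

/-- The eigenvalue of inertia at a position. -/
def w (a : D.I) (j : ℤ) : ℂ := D.v a ^ q ^ (j % D.r a).toNat

variable {D}

theorem r_pos (a : D.I) : 0 < D.r a := (D.selfDual a).cycleLength_pos

theorem z_mul_self (a : D.I) : D.z a * D.z a = 1 := by
  rw [z, ← Int.cast_mul, ← Units.val_mul, Int.units_mul_self, Units.val_one, Int.cast_one]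

theorem z_ne_zero (a : D.I) : D.z a ≠ 0 := left_ne_zero_of_mul_eq_one (z_mul_self a)

theorem exists_eq_add (a : D.I) (j : ℤ) : ∃ (n : ℕ) (t : ℤ), j = n + D.r a * t ∧ n < D.r a := by
  have hr : (0 : ℤ) < D.r a := by exact_mod_cast r_pos a
  have h1 : ((j % D.r a).toNat : ℤ) = j % D.r a := Int.toNat_of_nonneg (Int.emod_nonneg _ hr.ne')
  refine ⟨(j % D.r a).toNat, j / D.r a, ?_, ?_⟩
  · rw [h1, Int.emod_add_mul_ediv]
  · have := Int.emod_lt_of_pos j hr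
    omega

theorem w_natCast_add (a : D.I) (n : ℕ) (t : ℤ) : D.w a (n + D.r a * t) = D.v a ^ q ^ n := by
  rw [w, Int.add_mul_emod_self_left, (D.selfDual a).pow_eq_pow_iff, ← Int.natCast_mod,
    Int.toNat_natCast]
  exact Nat.mod_mod _ _

theorem w_add_r (a : D.I) (j : ℤ) : D.w a (j + D.r a) = D.w a j := by
  rw [w, w, Int.add_emod_right]

theorem w_succ (a : D.I) (j : ℤ) : D.w a (j + 1) = D.w a j ^ q := by
  obtain ⟨n, t, rfl, -⟩ := exists_eq_add a j
  have h : (n : ℤ) + D.r a * t + 1 = ((n + 1 : ℕ) : ℤ) + D.r a * t := by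
    push_cast
    ring
  rw [h, w_natCast_add, w_natCast_add, pow_succ, pow_mul]

theorem w_mul_w_add_l (a : D.I) (j : ℤ) : D.w a j * D.w a (j + D.l a) = 1 := by
  obtain ⟨n, t, rfl, -⟩ := exists_eq_add a j
  have h : (n : ℤ) + D.r a * t + D.l a = ((D.l a + n : ℕ) : ℤ) + D.r a * t := by
    push_cast
    ring
  rw [h, w_natCast_add, w_natCast_add, pow_add, pow_mul, l, ← (D.selfDual a).inv_eq, inv_pow]
  exact mul_inv_cancel₀ (pow_ne_zero _ (D.selfDual a).ne_zero)

theorem eq_of_w_eq {u : ℂ} (hu : ∀ a n, D.v a ^ q ^ n = u → D.v a = u) {a : D.I} {j : ℤ}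
    (h : D.w a j = u) : D.v a = u ∧ (D.r a : ℤ) ∣ j := by
  obtain ⟨n, t, rfl, hn⟩ := exists_eq_add a j
  rw [w_natCast_add] at h
  have h1 := hu a n h
  refine ⟨h1, ?_⟩
  rw [← h1] at h
  conv_rhs at h => rw [← pow_one (D.v a), ← pow_zero q]
  rw [(D.selfDual a).pow_eq_pow_iff, Nat.zero_mod] at h
  rw [(Nat.mod_eq_of_lt hn).symm.trans h, Nat.cast_zero, zero_add]
  exact dvd_mul_right _ _

variable (D) in
/-- The space of the model: twisted periodic functions. -/
def carrier : Submodule ℂ (∀ a : D.I, ℤ → Fin (D.k a + 1) → ℂ) where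
  -- Induction from the subgroup generated by inertia and the r-th power of Frobenius: that power
  -- acts by the sign z, and position j carries the inertia eigenvalue v^(q^j).
  carrier := {f | ∀ a j, f a (j + D.r a) = D.z a • f a j}
  add_mem' {f g} hf hg a j := by
    change f a (j + D.r a) + g a (j + D.r a) = _
    rw [hf, hg, ← smul_add]
    rfl
  zero_mem' a j := (smul_zero _).symm
  smul_mem' c f hf a j := by
    change c • f a (j + D.r a) = _
    rw [hf, smul_comm]
    rfl

variable (D) in
/-- The space of the model. -/
abbrev Space : Type := ↥D.carrier

theorem ext_space {f g : D.Space} (h : ∀ a j, f.1 a j = g.1 a j) : f = g :=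
  Subtype.ext (funext fun a => funext fun j => h a j)

theorem apply_add_r (f : D.Space) (a : D.I) (j : ℤ) : f.1 a (j + D.r a) = D.z a • f.1 a j := f.2 a j

theorem apply_add_r_mul (f : D.Space) (a : D.I) (j t : ℤ) :
    f.1 a (j + D.r a * t) = D.z a ^ t • f.1 a j := by
  induction t with
  | zero => simp
  | succ t ih =>
    rw [mul_add, mul_one, ← add_assoc, apply_add_r, ih, smul_smul, zpow_add_one₀ (z_ne_zero a),
      mul_comm]
  | pred t ih =>
    have h1 := apply_add_r f a (j + D.r a * (-t - 1))
    rw [add_assoc, ← mul_add_one, sub_add_cancel, ih] at h1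
    have h2 : D.z a • f.1 a (j + D.r a * (-t - 1)) = D.z a • D.z a ^ (-(t : ℤ) - 1) • f.1 a j := by
      rw [← h1, smul_smul, ← zpow_one_add₀ (z_ne_zero a)]
      congr 2
      ring
    exact smul_right_injective _ (z_ne_zero a) h2

/-- The function supported on one orbit with a given value. -/
def bump (a : D.I) (j₀ : ℤ) (y : Fin (D.k a + 1) → ℂ) : D.Space :=
  ⟨Pi.single a fun j => if (D.r a : ℤ) ∣ j - j₀ then D.z a ^ ((j - j₀) / D.r a) • y else 0, by
    intro b j
    by_cases hb : b = a
    · subst hb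
      have hr : (D.r b : ℤ) ≠ 0 := by exact_mod_cast (r_pos b).ne'
      rw [Pi.single_eq_same]
      have h1 : j + D.r b - j₀ = j - j₀ + D.r b * 1 := by ring
      rw [h1]
      by_cases h : (D.r b : ℤ) ∣ j - j₀
      · rw [if_pos (h.add (dvd_mul_right _ _)), if_pos h, Int.add_mul_ediv_left _ _ hr, smul_smul,
          zpow_add_one₀ (z_ne_zero b), mul_comm]
      · rw [if_neg h, if_neg, smul_zero]
        rwa [Int.dvd_add_left (dvd_mul_right _ _)]
    · rw [Pi.single_eq_of_ne hb]
      exact (smul_zero _).symm⟩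

theorem bump_self (a : D.I) (j₀ : ℤ) (y : Fin (D.k a + 1) → ℂ) : (bump a j₀ y).1 a j₀ = y := by
  simp [bump]

theorem bump_of_ne {a b : D.I} (h : b ≠ a) (j₀ j : ℤ) (y : Fin (D.k a + 1) → ℂ) :
    (bump a j₀ y).1 b j = 0 := by
  simp only [bump]
  rw [Pi.single_eq_of_ne h]
  rfl

theorem bump_of_not_dvd {a : D.I} {j₀ j : ℤ} (h : ¬ (D.r a : ℤ) ∣ j - j₀)
    (y : Fin (D.k a + 1) → ℂ) : (bump a j₀ y).1 a j = 0 := by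
  simp only [bump]
  rw [Pi.single_eq_same, if_neg h]

variable (D) in
/-- Evaluation. -/
def ev (a : D.I) (j : ℤ) : D.Space →ₗ[ℂ] (Fin (D.k a + 1) → ℂ) where
  toFun f := f.1 a j
  map_add' _ _ := rfl
  map_smul' _ _ := rfl

variable (D) in
/-- Translation, as an operator on the model. -/
def shift (d : ℤ) : End ℂ D.Space where
  toFun f := ⟨fun a j => f.1 a (j + d), fun a j => by
    change f.1 a (j + D.r a + d) = _
    rw [add_right_comm]
    exact apply_add_r f a (j + d)⟩
  map_add' _ _ := rfl
  map_smul' _ _ := rfl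

variable (D) in
/-- The action of inertia on the model. -/
def inertia : End ℂ D.Space where
  toFun f := ⟨fun a j => D.w a j • f.1 a j, fun a j => by
    change D.w a (j + D.r a) • f.1 a (j + D.r a) = _
    rw [w_add_r, apply_add_r, smul_comm]⟩
  map_add' f g := ext_space fun a j => smul_add _ _ _
  map_smul' c f := ext_space fun a j => smul_comm (D.w a j) c (f.1 a j)

variable (D) in
/-- The action of `SL(2, ℂ)` on the model. -/
def sl2 : SL2C →* End ℂ D.Space where
  toFun g :=
    { toFun := fun f => ⟨fun a j => symRep (D.k a) g (f.1 a j), fun a j => by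
        change symRep (D.k a) g (f.1 a (j + D.r a)) = _
        rw [apply_add_r, map_smul]⟩
      map_add' := fun f f' => ext_space fun a j => map_add (symRep (D.k a) g) _ _
      map_smul' := fun c f => ext_space fun a j => map_smul (symRep (D.k a) g) _ _ }
  map_one' := LinearMap.ext fun f => ext_space fun a j => by
    change symRep (D.k a) 1 (f.1 a j) = _
    rw [map_one]
    rfl
  map_mul' g h := LinearMap.ext fun f => ext_space fun a j => by
    change symRep (D.k a) (g * h) (f.1 a j) = _
    rw [map_mul]
    rfl

variable (D) in
/-- The symplectic form of the model. -/
def form : D.Space →ₗ[ℂ] D.Space →ₗ[ℂ] ℂ :=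
  -- Positions j and j + ℓ are paired, because their inertia eigenvalues are inverse to each other.
  ∑ a, ∑ j ∈ Finset.range (D.r a), (symForm (D.k a)).compl₁₂ (D.ev a j) (D.ev a (j + D.l a))

theorem shift_apply (d : ℤ) (f : D.Space) (a : D.I) (j : ℤ) :
    (D.shift d f).1 a j = f.1 a (j + d) := rfl

theorem inertia_apply (f : D.Space) (a : D.I) (j : ℤ) :
    (D.inertia f).1 a j = D.w a j • f.1 a j := rfl

theorem sl2_apply (g : SL2C) (f : D.Space) (a : D.I) (j : ℤ) :
    (D.sl2 g f).1 a j = symRep (D.k a) g (f.1 a j) := rfl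

theorem form_apply (f g : D.Space) : D.form f g =
    ∑ a, ∑ j ∈ Finset.range (D.r a), symForm (D.k a) (f.1 a j) (g.1 a (j + D.l a)) := by
  simp only [form, LinearMap.sum_apply, LinearMap.compl₁₂_apply]
  rfl

theorem shift_pow (d : ℤ) (m : ℕ) (f : D.Space) : (D.shift d ^ m) f = D.shift (m * d) f := by
  induction m with
  | zero => exact ext_space fun a j => by simp [shift_apply]
  | succ m ih =>
    rw [pow_succ', End.mul_apply, ih]
    refine ext_space fun a j => ?_
    rw [shift_apply, shift_apply, shift_apply]
    exact congrArg (f.1 a) (by push_cast; ring)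

theorem inertia_pow (m : ℕ) (f : D.Space) (a : D.I) (j : ℤ) :
    ((D.inertia ^ m) f).1 a j = D.w a j ^ m • f.1 a j := by
  induction m with
  | zero => simp
  | succ m ih => rw [pow_succ', End.mul_apply, inertia_apply, ih, smul_smul, pow_succ']

variable (D) in
/-- All coordinates at the positions in a fundamental domain. -/
def coordinates : D.Space →ₗ[ℂ] ((Σ a, Fin (D.r a) × Fin (D.k a + 1)) → ℂ) where
  toFun f x := f.1 x.1 (x.2.1 : ℕ) x.2.2
  map_add' _ _ := rfl
  map_smul' _ _ := rfl

theorem eq_zero_of_range {f : D.Space} (h : ∀ a, ∀ j < D.r a, f.1 a (j : ℤ) = 0) : f = 0 := by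
  refine ext_space fun a j => ?_
  obtain ⟨n, t, rfl, hn⟩ := exists_eq_add a j
  rw [apply_add_r_mul, h a n hn, smul_zero]
  rfl

theorem coordinates_injective : Function.Injective D.coordinates := by
  rw [← LinearMap.ker_eq_bot, LinearMap.ker_eq_bot']
  intro f hf
  refine eq_zero_of_range fun a j hj => funext fun i => ?_
  exact congrFun hf ⟨a, ⟨j, hj⟩, i⟩

instance : FiniteDimensional ℂ D.Space :=
  FiniteDimensional.of_injective D.coordinates coordinates_injective

theorem symForm_periodic (f g : D.Space) (a : D.I) (j : ℤ) (d : ℤ) :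
    symForm (D.k a) (f.1 a (j + D.r a)) (g.1 a (j + D.r a + d)) =
      symForm (D.k a) (f.1 a j) (g.1 a (j + d)) := by
  rw [add_right_comm j _ d, apply_add_r, apply_add_r, map_smul, map_smul, LinearMap.smul_apply,
    smul_smul, z_mul_self, one_smul]

/-- Exchanging the arguments gives (-1)^k and shifts by ℓ. For v ≠ ±1 a double shift by ℓ is a full
period and gives the sign ζ, while (-1)^k = -ζ; for v = ±1, ℓ = 0 and (-1)^k = -1. In both cases the
total is -1, which is the point of the parity condition. -/
theorem form_skew (f g : D.Space) : D.form g f = -D.form f g := by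
  rw [form_apply, form_apply, ← Finset.sum_neg_distrib]
  refine Finset.sum_congr rfl fun a _ => ?_
  have h1 : ∀ j : ℤ, symForm (D.k a) (f.1 a (j + D.l a + D.l a)) (g.1 a (j + D.l a)) =
      -((-1) ^ D.k a) * symForm (D.k a) (f.1 a j) (g.1 a (j + D.l a)) := by
    intro j
    rw [D.parity a]
    rcases (D.selfDual a).cases with ⟨h1, -, h2⟩ | ⟨h1, h2, -⟩
    · rw [TameRep.sign, if_pos h1, l, h2, neg_neg, one_mul, Nat.cast_zero, add_zero, add_zero]
    · have h3 : j + D.l a + D.l a = j + D.r a := by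
        rw [r, h2, l]
        push_cast
        ring
      rw [h3, apply_add_r, map_smul, LinearMap.smul_apply, TameRep.sign, if_neg (not_or.2 h1),
        neg_neg]
      rfl
  have h2 := sum_range_shift (F := fun j => symForm (D.k a) (f.1 a (j + D.l a)) (g.1 a j))
    (r := D.r a) (fun j => by
      rw [symForm_comm, symForm_comm (D.k a) (g.1 a j), symForm_periodic]) (D.l a)
  simp only [fun j : ℕ => symForm_comm (D.k a) (f.1 a ((j : ℤ) + D.l a)) (g.1 a j)]
  rw [← Finset.mul_sum, ← h2]
  simp only [h1]
  rw [← Finset.mul_sum, ← mul_assoc, mul_neg, ← pow_add, Even.neg_one_pow ⟨_, rfl⟩, neg_one_mul]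

theorem form_nondegenerate (f : D.Space) (h : ∀ g, D.form f g = 0) : f = 0 := by
  refine eq_zero_of_range fun a j hj => symForm_nondegenerate _ _ fun y => ?_
  have h1 := h (bump a (j + D.l a) y)
  rw [form_apply, Finset.sum_eq_single a, Finset.sum_eq_single j, bump_self] at h1
  · exact h1
  · intro j' hj' hne
    rw [bump_of_not_dvd, map_zero]
    intro hdvd
    have h2 : (j' : ℤ) + D.l a - (j + D.l a) = j' - j := by ring
    rw [h2] at hdvd
    have h3 := Finset.mem_range.1 hj'
    have h4 := Int.eq_zero_of_abs_lt_dvd hdvd (by rw [abs_lt]; omega)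
    omega
  · intro h2
    exact absurd (Finset.mem_range.2 hj) h2
  · intro b _ hb
    refine Finset.sum_eq_zero fun j' _ => ?_
    rw [bump_of_ne hb, map_zero]
  · intro h2
    exact absurd (Finset.mem_univ _) h2

variable (D) in
/-- The model as a symplectic representation. -/
def rep : TameRep q D.Space where
  ω := D.form
  A := D.inertia
  Φ := D.shift 1
  Ψ := D.shift (-1)
  ρ := D.sl2
  skew := form_skew
  nondegenerate := form_nondegenerate
  Φ_Ψ f := ext_space fun a j => by
    rw [shift_apply, shift_apply, add_neg_cancel_right]
  Ψ_Φ f := ext_space fun a j => by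
    rw [shift_apply, shift_apply, neg_add_cancel_right]
  A_Ψ f := ext_space fun a j => by
    rw [shift_apply, inertia_pow, inertia_apply, shift_apply, ← w_succ, neg_add_cancel_right]
  A_ρ g f := ext_space fun a j => by
    rw [sl2_apply, inertia_apply, inertia_apply, map_smul, sl2_apply]
  Ψ_ρ g f := rfl
  ω_A f g := by
    rw [form_apply, form_apply]
    refine Finset.sum_congr rfl fun a _ => Finset.sum_congr rfl fun j _ => ?_
    rw [inertia_apply, inertia_apply, map_smul, map_smul, LinearMap.smul_apply, smul_smul,
      mul_comm, w_mul_w_add_l, one_smul]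
  ω_Ψ f g := by
    rw [form_apply, form_apply]
    refine Finset.sum_congr rfl fun a _ => ?_
    have h := sum_range_shift (F := fun j => symForm (D.k a) (f.1 a j) (g.1 a (j + D.l a)))
      (r := D.r a) (fun j => symForm_periodic f g a j _) (-1)
    rw [← h]
    refine Finset.sum_congr rfl fun j _ => ?_
    rw [shift_apply, shift_apply, add_right_comm]
  ω_ρ g f f' := by
    rw [form_apply, form_apply]
    refine Finset.sum_congr rfl fun a _ => Finset.sum_congr rfl fun j _ => ?_
    rw [sl2_apply, sl2_apply, symForm_symRep]
  algebraic := isAlgebraicRep_of_injective D.coordinates coordinates_injective fun f x =>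
    exists_eval_symRep (D.k x.1) (f.1 x.1 (x.2.1 : ℕ)) x.2.2

end ModelData

end

/-! ### Joint eigenspaces and anisotropy of the model. -/

section

open Module

theorem iSup_eigenspace_of_isSemisimple {V : Type*} [AddCommGroup V] [Module ℂ V]
    [FiniteDimensional ℂ V] {f : End ℂ V} (hf : f.IsSemisimple) : ⨆ u, f.eigenspace u = ⊤ := by
  rw [eq_top_iff, ← End.iSup_maxGenEigenspace_eq_top f]
  exact iSup_mono fun μ => (hf.isFinitelySemisimple.maxGenEigenspace_eq_eigenspace μ).le

theorem isSemisimple_of_pow_eq_one {V : Type*} [AddCommGroup V] [Module ℂ V] {f : End ℂ V} {N : ℕ}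
    (hN : 0 < N) (hf : f ^ N = 1) : f.IsSemisimple := by
  refine End.isSemisimple_of_squarefree_aeval_eq_zero (p := Polynomial.X ^ N - 1) ?_ ?_
  · have h : (Polynomial.X ^ N - Polynomial.C (1 : ℂ)).Separable :=
      Polynomial.separable_X_pow_sub_C _ (by exact_mod_cast hN.ne') one_ne_zero
    rw [Polynomial.C_1] at h
    exact h.squarefree
  · simp [hf]

namespace TameRep

variable {q : ℕ} {V : Type*} [AddCommGroup V] [Module ℂ V] {X : TameRep q V}

theorem finrank_eigenspace_pow [FiniteDimensional ℂ V] {u : ℂ} (hu : IsSelfDual q u) (j : ℕ) :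
    finrank ℂ (X.A.eigenspace (u ^ q ^ j)) = finrank ℂ (X.A.eigenspace u) := by
  have hle : ∀ (u : ℂ) (j : ℕ),
      finrank ℂ (X.A.eigenspace u) ≤ finrank ℂ (X.A.eigenspace (u ^ q ^ j)) := by
    intro u j
    refine LinearMap.finrank_le_finrank_of_injective (f := (X.Ψ ^ j).restrict fun x hx =>
      End.mem_eigenspace_iff.2 (A_Ψ_pow (End.mem_eigenspace_iff.1 hx) j)) ?_
    intro x y h
    exact Subtype.ext (Ψ_pow_injective j (congrArg Subtype.val h))
  refine le_antisymm ?_ (hle u j)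
  obtain ⟨k, hk⟩ := hu.exists_pow_pow_eq j
  have := hle (u ^ q ^ j) k
  rwa [hk] at this

theorem eigenspace_eq_of_sq {u : ℂ} (hu : IsSelfDual q u)
    (h : ∀ x, X.A x = u • x → (X.Ψ ^ cycleLength q u) ((X.Ψ ^ cycleLength q u) x) = x) :
    X.A.eigenspace u = X.space u 1 ⊔ X.space u (-1) := by
  refine le_antisymm (fun x hx => ?_) (sup_le inf_le_left inf_le_left)
  rw [End.mem_eigenspace_iff] at hx
  have h1 := A_Ψ_pow hx (cycleLength q u)
  rw [hu.pow_cycleLength] at h1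
  set y := (X.Ψ ^ cycleLength q u) x with hy
  have h2 : (X.Ψ ^ cycleLength q u) y = x := h x hx
  refine Submodule.mem_sup.2 ⟨(2⁻¹ : ℂ) • (x + y), mem_space.2 ⟨?_, ?_⟩, (2⁻¹ : ℂ) • (x - y),
    mem_space.2 ⟨?_, ?_⟩, ?_⟩
  · rw [map_smul, map_add, hx, h1]
    module
  · rw [map_smul, map_add, ← hy, h2]
    module
  · rw [map_smul, map_sub, hx, h1]
    module
  · rw [map_smul, map_sub, ← hy, h2]
    module
  · module

theorem finrank_space_add [FiniteDimensional ℂ V] {u : ℂ}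
    (h : X.A.eigenspace u = X.space u 1 ⊔ X.space u (-1)) :
    finrank ℂ (X.space u 1) + finrank ℂ (X.space u (-1)) = finrank ℂ (X.A.eigenspace u) := by
  rw [h, ← Submodule.finrank_sup_add_finrank_inf_eq,
    (disjoint_space (X := X) (u := u) (show (1 : ℂ) ≠ -1 by norm_num)).eq_bot, finrank_bot, add_zero]

end TameRep

namespace ModelData

variable {q : ℕ} {D : ModelData q}

open TameRep

theorem exists_of_hasEigenvalue {u : ℂ} (hu : D.rep.A.HasEigenvalue u) :
    ∃ a n, u = D.v a ^ q ^ n := by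
  obtain ⟨f, hf, hf0⟩ := hu.exists_hasEigenvector
  rw [End.mem_eigenspace_iff] at hf
  by_contra! hne
  refine hf0 (ext_space fun a j => ?_)
  have h1 : D.w a j • f.1 a j = u • f.1 a j := congrArg (fun f : D.Space => f.1 a j) hf
  rw [← sub_eq_zero, ← sub_smul] at h1
  exact (smul_eq_zero.1 h1).resolve_left (sub_ne_zero.2 (hne a _).symm)

theorem isSelfDual_of_hasEigenvalue {u : ℂ} (hu : D.rep.A.HasEigenvalue u) : IsSelfDual q u := by
  obtain ⟨a, n, rfl⟩ := exists_of_hasEigenvalue hu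
  exact (D.selfDual a).pow n

theorem inertia_pow_eq_one {N : ℕ} (hN : ∀ a, D.v a ^ N = 1) : D.inertia ^ N = 1 := by
  refine LinearMap.ext fun f => ext_space fun a j => ?_
  rw [inertia_pow, w, ← pow_mul, mul_comm, pow_mul, hN, one_pow, one_smul]
  rfl

/-- A common multiple of the periods brings every position back up to signs, and the factor 2
removes the signs. Finite order of Frobenius will yield the semisimplicity required of a parameter.
-/
theorem exists_shift_pow_eq_one : ∃ m, 0 < m ∧ D.shift 1 ^ m = 1 := by
  refine ⟨2 * ∏ a, D.r a, Nat.mul_pos two_pos (Finset.prod_pos fun a _ => r_pos a), ?_⟩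
  refine LinearMap.ext fun f => ext_space fun a j => ?_
  obtain ⟨t, ht⟩ := Finset.dvd_prod_of_mem D.r (Finset.mem_univ a)
  have h : j + ((2 * ∏ a, D.r a : ℕ) : ℤ) * 1 = j + D.r a * (t + t) := by
    rw [ht]
    push_cast
    ring
  rw [shift_pow, shift_apply, h, apply_add_r_mul, _root_.zpow_add₀ (z_ne_zero a),
    ← mul_zpow, z_mul_self, _root_.one_zpow, one_smul]
  rfl

section Space

variable {u : ℂ} (hu : ∀ a n, D.v a ^ q ^ n = u → D.v a = u)
include hu

theorem apply_eq_zero {f : D.Space} (hf : D.rep.A f = u • f) {a : D.I} {j : ℤ}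
    (h : ¬ (D.v a = u ∧ (D.r a : ℤ) ∣ j)) : f.1 a j = 0 := by
  have h1 : D.w a j • f.1 a j = u • f.1 a j := congrArg (fun f : D.Space => f.1 a j) hf
  rw [← sub_eq_zero, ← sub_smul] at h1
  exact (smul_eq_zero.1 h1).resolve_left fun h2 => h (eq_of_w_eq hu (sub_eq_zero.1 h2))

/-- An eigenfunction for a representative eigenvalue is supported on multiples of the period, so by
twisted periodicity its value at 0 determines it. -/
theorem eq_zero_of_apply_zero {f : D.Space} (hf : D.rep.A f = u • f)
    (h : ∀ a, D.v a = u → f.1 a 0 = 0) : f = 0 := by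
  refine ext_space fun a j => ?_
  by_cases hj : D.v a = u ∧ (D.r a : ℤ) ∣ j
  · obtain ⟨hv, t, rfl⟩ := hj
    have h1 := apply_add_r_mul f a 0 t
    rw [zero_add] at h1
    rw [h1, h a hv, smul_zero]
    rfl
  · exact apply_eq_zero hu hf hj

omit hu in
theorem z_eq_of_mem_space {μ : ℂ} {f : D.Space} (hf : f ∈ D.rep.space u μ) {a : D.I}
    (ha : D.v a = u) (h : f.1 a 0 ≠ 0) : D.z a = μ := by
  have h1 := congrArg (fun f : D.Space => f.1 a (D.r a)) (mem_space.1 hf).2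
  change ((D.shift (-1) ^ cycleLength q u) f).1 a (D.r a) = μ • f.1 a (D.r a) at h1
  have h2 := apply_add_r f a 0
  rw [zero_add] at h2
  rw [shift_pow, shift_apply, mul_neg_one, ← ha, ← r, add_neg_cancel, h2, smul_smul] at h1
  have h3 : (μ * D.z a - 1) • f.1 a 0 = 0 := by rw [sub_smul, ← h1, one_smul, sub_self]
  have h4 := sub_eq_zero.1 ((smul_eq_zero.1 h3).resolve_right h)
  calc D.z a = μ * D.z a * D.z a := by rw [h4, one_mul]
    _ = μ := by rw [mul_assoc, z_mul_self, mul_one]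

omit hu in
theorem bump_mem_space (a : D.I) (y : Fin (D.k a + 1) → ℂ) :
    bump a 0 y ∈ D.rep.space (D.v a) (D.z a) := by
  refine mem_space.2 ⟨ext_space fun b j => ?_, ext_space fun b j => ?_⟩
  · change D.w b j • _ = D.v a • (bump a 0 y).1 b j
    by_cases hb : b = a
    · subst hb
      by_cases hj : (D.r b : ℤ) ∣ j
      · obtain ⟨t, rfl⟩ := hj
        have h1 := w_natCast_add b 0 t
        rw [Nat.cast_zero, zero_add, pow_zero, pow_one] at h1
        rw [h1]
      · rw [bump_of_not_dvd (by rwa [sub_zero]), smul_zero, smul_zero]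
    · rw [bump_of_ne hb, smul_zero, smul_zero]
  · change ((D.shift (-1) ^ cycleLength q (D.v a)) _).1 b j = D.z a • (bump a 0 y).1 b j
    rw [shift_pow, shift_apply]
    by_cases hb : b = a
    · subst hb
      have h1 := apply_add_r (bump b 0 y) b (j + (cycleLength q (D.v b) : ℤ) * -1)
      rw [mul_neg_one, r, neg_add_cancel_right] at h1
      rw [h1, smul_smul, z_mul_self, one_smul, mul_neg_one]
    · rw [bump_of_ne hb, bump_of_ne hb, smul_zero]

/-- Evaluation at 0 is injective by the support condition, and functions supported on one orbit give
surjectivity. The joint eigenspace becomes the sum of the Sym^k over the indices with this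
eigenvalue and sign. -/
theorem exists_space_equiv (ζ : ℤˣ) :
    ∃ E : D.rep.space u (ζ : ℤ) ≃ₗ[ℂ]
        (∀ a : {a : D.I // D.v a = u ∧ D.ζ a = ζ}, Fin (D.k a + 1) → ℂ),
      ∀ f a, E f a = f.1.1 a.1 0 := by
  let E : D.rep.space u (ζ : ℤ) →ₗ[ℂ]
      (∀ a : {a : D.I // D.v a = u ∧ D.ζ a = ζ}, Fin (D.k a + 1) → ℂ) :=
    LinearMap.pi fun a => D.ev a.1 0 ∘ₗ Submodule.subtype _
  refine ⟨LinearEquiv.ofBijective E ⟨?_, ?_⟩, fun f a => rfl⟩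
  · intro f g hfg
    have hd : f.1 - g.1 ∈ D.rep.space u (ζ : ℤ) := Submodule.sub_mem _ f.2 g.2
    refine Subtype.ext (sub_eq_zero.1 (eq_zero_of_apply_zero hu (mem_space.1 hd).1 fun a ha => ?_))
    by_contra hne
    have h1 : ((D.ζ a : ℤ) : ℂ) = ((ζ : ℤ) : ℂ) := z_eq_of_mem_space hd ha hne
    have h2 : D.ζ a = ζ := Units.ext (by exact_mod_cast h1)
    exact hne (sub_eq_zero.2 (congrFun hfg ⟨a, ha, h2⟩))
  · intro c
    refine ⟨⟨∑ a, bump a.1 0 (c a), Submodule.sum_mem _ fun a _ => ?_⟩, funext fun b => ?_⟩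
    · have h := bump_mem_space a.1 (c a)
      rw [z, a.2.1, a.2.2] at h
      exact h
    · change D.ev b.1 0 (∑ a, bump a.1 0 (c a)) = c b
      rw [map_sum, Finset.sum_eq_single b]
      · exact bump_self b.1 0 (c b)
      · intro a _ hab
        exact bump_of_ne (fun h => hab (Subtype.ext h.symm)) 0 0 (c a)
      · intro h
        exact absurd (Finset.mem_univ b) h

theorem eigenspace_eq (hsd : IsSelfDual q u) :
    D.rep.A.eigenspace u = D.rep.space u 1 ⊔ D.rep.space u (-1) := by
  refine eigenspace_eq_of_sq hsd fun f hf => ?_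
  have h1 := A_Ψ_pow (A_Ψ_pow hf (cycleLength q u)) (cycleLength q u)
  rw [hsd.pow_cycleLength, hsd.pow_cycleLength] at h1
  refine ext_space fun a j => ?_
  by_cases ha : D.v a = u
  · change ((D.shift (-1) ^ cycleLength q u) ((D.shift (-1) ^ cycleLength q u) f)).1 a j = _
    rw [shift_pow, shift_pow, shift_apply, shift_apply, ← ha]
    have h2 := apply_add_r_mul f a j (-1 + -1)
    rw [_root_.zpow_add₀ (z_ne_zero a), ← mul_zpow, z_mul_self, _root_.one_zpow, one_smul, mul_add,
      ← add_assoc] at h2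
    exact h2
  · rw [apply_eq_zero hu h1 fun h => ha h.1, apply_eq_zero hu hf fun h => ha h.1]

end Space

/-- The model has no stable isotropic subspace. -/
theorem anisotropic : D.rep.Anisotropic := by
  refine anisotropic_of_space (fun v hv => ?_) fun v hv => isSelfDual_of_hasEigenvalue hv
  obtain ⟨b, n, rfl⟩ := exists_of_hasEigenvalue hv
  obtain ⟨j, hj⟩ := (D.selfDual b).exists_pow_pow_eq n
  refine ⟨j, ?_⟩
  rw [hj]
  intro μ Y hYρ hY hb
  by_contra hne
  have hu : ∀ a n, D.v a ^ q ^ n = D.v b → D.v a = D.v b := fun a n h => D.eq_of_pow a b n h.symm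
  obtain ⟨f, hfY, hf0⟩ := Submodule.exists_mem_ne_zero_of_ne_bot hne
  obtain ⟨a₀, ha₀, hfa⟩ : ∃ a, D.v a = D.v b ∧ f.1 a 0 ≠ 0 := by
    by_contra! h
    exact hf0 (eq_zero_of_apply_zero hu (mem_space.1 (hY hfY)).1 h)
  obtain rfl := z_eq_of_mem_space (hY hfY) ha₀ hfa
  change Y ≤ D.rep.space (D.v b) ((D.ζ a₀ : ℤ) : ℂ) at hY
  obtain ⟨E, hE⟩ := exists_space_equiv hu (D.ζ a₀)
  let Y' : Submodule ℂ (D.rep.space (D.v b) ((D.ζ a₀ : ℤ) : ℂ)) := Y.comap (Submodule.subtype _)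
  have hY' : Y' ≠ ⊥ := by
    intro h0
    have h1 : (⟨f, hY hfY⟩ : D.rep.space (D.v b) ((D.ζ a₀ : ℤ) : ℂ)) ∈ Y' := hfY
    rw [h0, Submodule.mem_bot] at h1
    exact hf0 (congrArg Subtype.val h1)
  -- Multiplicity freeness yields in Y a highest weight vector of a single constituent; it is then
  -- paired with its own Weyl translate.
  obtain ⟨a, x, hxY, hx⟩ := exists_single_mem_of_stable (X := D.rep.space (D.v b) ((D.ζ a₀ : ℤ) : ℂ))
    (k := fun a : {a : D.I // D.v a = D.v b ∧ D.ζ a = D.ζ a₀} => D.k a)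
    (ρ := D.rep.spaceRep (D.v b) ((D.ζ a₀ : ℤ) : ℂ))
    (fun a a' h => Subtype.ext (D.injective _ _ (a.2.1.trans a'.2.1.symm)
      (a.2.2.trans a'.2.2.symm) h))
    (D.rep.algebraic.subRep _ _) (e := E.toLinearMap)
    (fun g x => funext fun a => by
      change E _ a = symRep (D.k a) g (E x a)
      rw [hE, hE]
      rfl) E.injective (Y := Y') (fun g y hy => hYρ g y hy) hY'
  have hxa : ∀ a', D.v a' = D.v b → a' ≠ a.1 → x.1.1 a' 0 = 0 := by
    intro a' ha' hne'
    by_contra h0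
    have h1 : ((D.ζ a' : ℤ) : ℂ) = ((D.ζ a₀ : ℤ) : ℂ) := z_eq_of_mem_space x.2 ha' h0
    have h2 : D.ζ a' = D.ζ a₀ := Units.ext (by exact_mod_cast h1)
    have h3 := congrFun hx ⟨a', ha', h2⟩
    rw [Pi.single_eq_of_ne (fun h => hne' (congrArg Subtype.val h))] at h3
    exact h0 ((hE x _).symm.trans h3)
  have hxa' : x.1.1 a.1 0 = veronese (D.k a.1) ![1, 0] := by
    have h3 := congrFun hx a
    rw [Pi.single_eq_same] at h3
    exact (hE x _).symm.trans h3
  have h1 := hb x.1 hxY (D.rep.ρ sl2Weyl x.1) (hYρ _ _ hxY)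
  have h2 : D.rep.ω x.1 ((D.rep.Ψ ^ ell q (D.v b)) (D.rep.ρ sl2Weyl x.1)) =
      symForm (D.k a.1) (x.1.1 a.1 0) (symRep (D.k a.1) sl2Weyl (x.1.1 a.1 0)) := by
    have hAx := (mem_space.1 x.2).1
    change D.form x.1 ((D.shift (-1) ^ ell q (D.v b)) (D.sl2 sl2Weyl x.1)) = _
    rw [form_apply, Finset.sum_eq_single a.1, Finset.sum_eq_single 0]
    · rw [shift_pow, shift_apply, sl2_apply, l, a.2.1, mul_neg_one, add_neg_cancel_right]
      rfl
    · intro j hj hj0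
      have h0 : x.1.1 a.1 (j : ℤ) = 0 := apply_eq_zero hu hAx fun h => by
        have h3 := Finset.mem_range.1 hj
        have h4 := Nat.le_of_dvd (Nat.pos_of_ne_zero hj0) (by exact_mod_cast h.2)
        omega
      rw [h0, map_zero, LinearMap.zero_apply]
    · intro h
      exact absurd (Finset.mem_range.2 (r_pos a.1)) h
    · intro a' _ hne'
      refine Finset.sum_eq_zero fun j _ => ?_
      have h0 : x.1.1 a' (j : ℤ) = 0 := by
        by_cases h : D.v a' = D.v b ∧ (D.r a' : ℤ) ∣ j
        · obtain ⟨t, ht⟩ := h.2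
          have h3 := apply_add_r_mul x.1 a' 0 t
          rw [zero_add, ← ht, hxa a' h.1 hne', smul_zero] at h3
          exact h3
        · exact apply_eq_zero hu hAx h
      rw [h0, map_zero, LinearMap.zero_apply]
    · intro h
      exact absurd (Finset.mem_univ _) h
  -- The twisted form takes the value (-1)^k on the vector and its Weyl translate, which contradicts
  -- isotropy.
  rw [h2, hxa', symRep_veronese _ _ (by simp), symForm_veronese, sl2Weyl_val] at h1
  simp [Matrix.mulVec, dotProduct, Fin.sum_univ_two] at h1

end ModelData

end

section

open Module

/-! ### Properties of the fixed restriction to inertia -/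

section Setup

variable {p : ℕ} [Fact p.Prime] {F : Type*} [Field F] [Algebra ℚ_[p] F]
  [FiniteDimensional ℚ_[p] F] {n : ℕ}

/-- The hypotheses on a generator of tame inertia, a lift of Frobenius and a restriction to
inertia. -/
structure IsInertialType (s : ↥(inertiaGroup p F)) (Fr : WeilGroup p F)
    (χ : ↥(inertiaGroup p F) →* Sp n) : Prop where
  ne_two : p ≠ 2
  generator : IsTameGenerator s
  frobenius : IsFrobeniusLift Fr
  continuous : Continuous χ
  tame : ∀ i : ↥(inertiaGroup p F),
    (i : Gal(AlgebraicClosure F/F)) ∈ wildInertiaGroup p F → χ i = 1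
  frob : ∀ u ∈ VP (χ s), u ^ residueCard p F ∈ VP (χ s) ∧
    eigMult (χ s) (u ^ residueCard p F) = eigMult (χ s) u
  inv : ∀ u : VP (χ s), ∃ v : VP (χ s), (v : ℂ) = (u : ℂ)⁻¹ ∧
    VPClass.mk (residueCard p F) (χ s) v = VPClass.mk (residueCard p F) (χ s) u

theorem finrank_eigenspace_eq_of_equiv {V V' : Type*} [AddCommGroup V] [Module ℂ V]
    [AddCommGroup V'] [Module ℂ V'] {f : End ℂ V} {f' : End ℂ V'} (T : V ≃ₗ[ℂ] V')
    (hT : ∀ x, T (f x) = f' (T x)) (u : ℂ) :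
    finrank ℂ (f.eigenspace u) = finrank ℂ (f'.eigenspace u) := by
  have h : (f.eigenspace u).map T.toLinearMap = f'.eigenspace u := by
    ext y
    rw [Submodule.mem_map, End.mem_eigenspace_iff]
    constructor
    · rintro ⟨x, hx, rfl⟩
      rw [End.mem_eigenspace_iff] at hx
      change f' (T x) = u • T x
      rw [← hT, hx, map_smul]
    · intro hy
      refine ⟨T.symm y, End.mem_eigenspace_iff.2 (T.injective ?_), T.apply_symm_apply y⟩
      rw [hT, map_smul, T.apply_symm_apply, hy]
  rw [← h]
  exact (LinearEquiv.finrank_map_eq T (f.eigenspace u)).symm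

theorem hasEigenvalue_iff_finrank_pos {V : Type*} [AddCommGroup V] [Module ℂ V]
    [FiniteDimensional ℂ V] {f : End ℂ V} {u : ℂ} :
    f.HasEigenvalue u ↔ 0 < finrank ℂ (f.eigenspace u) := by
  rw [Nat.pos_iff_ne_zero, ne_eq, Submodule.finrank_eq_zero]
  rfl

/-- The linear automorphism given by a symplectic matrix. -/
def Sp.toLinearEquiv (g : Sp n) : (Fin n ⊕ Fin n → ℂ) ≃ₗ[ℂ] (Fin n ⊕ Fin n → ℂ) :=
  LinearEquiv.ofLinearMap g.toEnd (g⁻¹).toEnd (LinearMap.ext g.toEnd_apply_inv)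
    (LinearMap.ext g.toEnd_inv_apply)

theorem Sp.eigMult_conj (g A : Sp n) (u : ℂ) : eigMult (g * A * g⁻¹) u = eigMult A u := by
  refine (finrank_eigenspace_eq_of_equiv (Sp.toLinearEquiv g) (fun x => ?_) u).symm
  change g.toEnd (A.toEnd x) = (g * A * g⁻¹).toEnd (g.toEnd x)
  rw [Sp.toEnd_mul, Sp.toEnd_mul, End.mul_apply, End.mul_apply, Sp.toEnd_inv_apply]

theorem mem_VP_iff_eigMult_pos {A : Sp n} {u : ℂ} : u ∈ VP A ↔ 0 < eigMult A u :=
  hasEigenvalue_iff_finrank_pos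

namespace IsInertialType

variable {s : ↥(inertiaGroup p F)} {Fr : WeilGroup p F} {χ : ↥(inertiaGroup p F) →* Sp n}
  (h : IsInertialType s Fr χ)

include h

theorem exists_pow_eq_one : ∃ M, 0 < M ∧ χ s ^ (residueCard p F ^ M - 1) = 1 :=
  Sp.exists_pow_eq_one_of_tendsto _ h.frobenius.two_le_residueCard (fun u hu => (h.frob u hu).1)
    (h.frobenius.tendsto_pow h.generator.isClosed χ h.continuous h.tame s)

theorem one_le_pow (M : ℕ) : 1 ≤ residueCard p F ^ M :=
  Nat.one_le_pow _ _ (by have := h.frobenius.two_le_residueCard; omega)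

theorem exists_pow_pos : ∃ N, 0 < N ∧ χ s ^ N = 1 := by
  obtain ⟨M, hM, h1⟩ := h.exists_pow_eq_one
  refine ⟨_, ?_, h1⟩
  have h2 := Nat.one_lt_pow hM.ne' (show 1 < residueCard p F from h.frobenius.two_le_residueCard)
  omega

theorem isSemisimple : (χ s).toEnd.IsSemisimple := by
  obtain ⟨N, hN, h1⟩ := h.exists_pow_pos
  exact isSemisimple_of_pow_eq_one hN (by rw [← Sp.toEnd_pow, h1, Sp.toEnd_one])

theorem exists_pow_eq (i : ↥(inertiaGroup p F)) : ∃ j : ℕ, χ i = χ s ^ j := by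
  obtain ⟨N, hN, h1⟩ := h.exists_pow_pos
  exact h.generator.exists_pow_eq χ h.continuous h.tame (isOfFinOrder_iff_pow_eq_one.2 ⟨N, hN, h1⟩) i

theorem pow_eq_one_of_mem {N : ℕ} (hN : χ s ^ N = 1) {u : ℂ} (hu : u ∈ VP (χ s)) : u ^ N = 1 := by
  obtain ⟨x, hx⟩ := End.HasEigenvalue.exists_hasEigenvector hu
  have h1 := TameRep.pow_apply_of_eigen hx.apply_eq_smul N
  rw [← Sp.toEnd_pow, hN, Sp.toEnd_one, End.one_apply] at h1
  have h2 : (u ^ N - 1) • x = 0 := by rw [sub_smul, ← h1, one_smul, sub_self]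
  exact sub_eq_zero.1 ((smul_eq_zero.1 h2).resolve_right hx.2)

theorem exists_periodic : ∃ M, 0 < M ∧ ∀ u ∈ VP (χ s), u ^ residueCard p F ^ M = u := by
  obtain ⟨M, hM, h1⟩ := h.exists_pow_eq_one
  refine ⟨M, hM, fun u hu => ?_⟩
  rw [← Nat.sub_add_cancel (h.one_le_pow M), pow_add, h.pow_eq_one_of_mem h1 hu, one_mul, pow_one]

theorem pow_mem {u : ℂ} (hu : u ∈ VP (χ s)) (j : ℕ) : u ^ residueCard p F ^ j ∈ VP (χ s) ∧
    eigMult (χ s) (u ^ residueCard p F ^ j) = eigMult (χ s) u := by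
  induction j with
  | zero => simpa using hu
  | succ j ih =>
    rw [pow_succ, pow_mul]
    exact ⟨(h.frob _ ih.1).1, (h.frob _ ih.1).2.trans ih.2⟩

/-- Two eigenvalues are in the same class if and only if one is an iterated `q`-th power of the
other. -/
theorem mk_eq_mk_iff {u v : VP (χ s)} :
    VPClass.mk (residueCard p F) (χ s) u = VPClass.mk (residueCard p F) (χ s) v ↔
      ∃ j : ℕ, (v : ℂ) = (u : ℂ) ^ residueCard p F ^ j := by
  obtain ⟨M, hM, hper⟩ := h.exists_periodic
  have hpow : ∀ u ∈ VP (χ s), ∀ t : ℕ, u ^ residueCard p F ^ (M * t) = u := by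
    intro u hu t
    induction t with
    | zero => simp
    | succ t ih => rw [mul_add, mul_one, pow_add, pow_mul, ih, hper u hu]
  constructor
  · intro huv
    have h1 := Quot.eqvGen_exact huv
    induction h1 with
    | rel x y hxy => exact ⟨1, by rw [pow_one]; exact hxy⟩
    | refl x => exact ⟨0, by simp⟩
    | symm x y hxy ih =>
      obtain ⟨j, hj⟩ := ih (Quot.eqvGen_sound hxy)
      -- Going forward returns to the start, since j + (M - 1) j is a multiple of the common period
      -- M.
      refine ⟨(M - 1) * j, ?_⟩
      rw [hj, ← pow_mul, ← pow_add]
      have h2 : j + (M - 1) * j = M * j := by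
        nth_rewrite 1 [← one_mul j]
        rw [← add_mul]
        congr 1
        omega
      rw [h2, hpow x x.2]
    | trans x y z hxy hyz ih ih' =>
      obtain ⟨j, hj⟩ := ih (Quot.eqvGen_sound hxy)
      obtain ⟨k, hk⟩ := ih' (Quot.eqvGen_sound hyz)
      exact ⟨j + k, by rw [hk, hj, ← pow_mul, ← pow_add]⟩
  · rintro ⟨j, hj⟩
    induction j generalizing v with
    | zero =>
      rw [pow_zero, pow_one] at hj
      rw [Subtype.ext hj]
    | succ j ih =>
      have h1 : VPClass.mk (residueCard p F) (χ s) ⟨_, (h.pow_mem u.2 j).1⟩ =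
          VPClass.mk (residueCard p F) (χ s) v :=
        Quot.sound (by rw [hj, pow_succ, pow_mul])
      rw [← h1]
      exact ih rfl

theorem isSelfDual {u : ℂ} (hu : u ∈ VP (χ s)) : IsSelfDual (residueCard p F) u where
  ne_zero := by
    rintro rfl
    obtain ⟨N, hN, h1⟩ := h.exists_pow_pos
    have h2 := h.pow_eq_one_of_mem h1 hu
    rw [zero_pow hN.ne'] at h2
    exact zero_ne_one h2
  odd := h.frobenius.odd_residueCard h.ne_two
  periodic := by
    obtain ⟨M, hM, h1⟩ := h.exists_periodic
    exact ⟨M, hM, h1 u hu⟩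
  inv := by
    obtain ⟨v, hv, h1⟩ := h.inv ⟨u, hu⟩
    obtain ⟨j, hj⟩ := h.mk_eq_mk_iff.1 h1.symm
    exact ⟨j, by rw [← hv, hj]⟩

end IsInertialType

/-! ### Symplectic representations attached to parameters -/

/-- The representation attached to elements of the symplectic group. -/
def Sp.tameRep {q : ℕ} (A Φ : Sp n) (ρ : SL2C →* Sp n) (hAΦ : Φ * A * Φ⁻¹ = A ^ q)
    (hAρ : ∀ g, A * ρ g = ρ g * A) (hΦρ : ∀ g, Φ * ρ g = ρ g * Φ)
    (halg : ∃ P : Fin n ⊕ Fin n → Fin n ⊕ Fin n → MvPolynomial (Fin 2 × Fin 2) ℂ,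
      ∀ (g : SL2C) (i j : Fin n ⊕ Fin n),
        (ρ g : Matrix (Fin n ⊕ Fin n) (Fin n ⊕ Fin n) ℂ) i j =
          MvPolynomial.eval (fun k => (g : Matrix (Fin 2) (Fin 2) ℂ) k.1 k.2) (P i j)) :
    TameRep q (Fin n ⊕ Fin n → ℂ) where
  ω := sympBilin n
  A := A.toEnd
  Φ := Φ.toEnd
  Ψ := (Φ⁻¹).toEnd
  ρ :=
    { toFun := fun g => (ρ g).toEnd
      map_one' := by rw [map_one, Sp.toEnd_one]
      map_mul' := fun g g' => by rw [map_mul, Sp.toEnd_mul] }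
  skew := sympBilin_skew
  nondegenerate := sympBilin_nondegenerate
  Φ_Ψ := Φ.toEnd_apply_inv
  Ψ_Φ := Φ.toEnd_inv_apply
  A_Ψ x := by
    rw [← Sp.toEnd_pow, ← End.mul_apply, ← End.mul_apply, ← Sp.toEnd_mul, ← Sp.toEnd_mul, ← hAΦ]
    congr 2
    group
  A_ρ g x := by
    change A.toEnd ((ρ g).toEnd x) = (ρ g).toEnd (A.toEnd x)
    rw [← End.mul_apply, ← End.mul_apply, ← Sp.toEnd_mul, ← Sp.toEnd_mul, hAρ]
  Ψ_ρ g x := by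
    change (Φ⁻¹).toEnd ((ρ g).toEnd x) = (ρ g).toEnd ((Φ⁻¹).toEnd x)
    rw [← End.mul_apply, ← End.mul_apply, ← Sp.toEnd_mul, ← Sp.toEnd_mul]
    congr 2
    rw [inv_mul_eq_iff_eq_mul, ← mul_assoc, hΦρ, mul_inv_cancel_right]
  ω_A := sympBilin_toEnd A
  ω_Ψ := sympBilin_toEnd Φ⁻¹
  ω_ρ g := sympBilin_toEnd (ρ g)
  algebraic := by
    obtain ⟨P, hP⟩ := halg
    refine isAlgebraicRep_of_injective (LinearMap.id (R := ℂ) (M := Fin n ⊕ Fin n → ℂ))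
      Function.injective_id fun x i =>
      ⟨∑ j : Fin n ⊕ Fin n, MvPolynomial.C (x j) * P i j, fun g => ?_⟩
    have h : MvPolynomial.eval (fun k => (g : Matrix (Fin 2) (Fin 2) ℂ) k.1 k.2)
        (∑ j : Fin n ⊕ Fin n, MvPolynomial.C (x j) * P i j) =
        ∑ j : Fin n ⊕ Fin n, (ρ g : Matrix (Fin n ⊕ Fin n) (Fin n ⊕ Fin n) ℂ) i j * x j := by
      rw [map_sum]
      refine Finset.sum_congr rfl fun j _ => ?_
      rw [hP, map_mul, MvPolynomial.eval_C, mul_comm]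
    exact h.symm

end Setup

end

/-! ### Parameters as symplectic representations. -/

section

open Module

section Parameter

variable {p : ℕ} [Fact p.Prime] {F : Type*} [Field F] [Algebra ℚ_[p] F]
  [FiniteDimensional ℚ_[p] F] {n : ℕ}

/-- Langlands parameters of level zero with a given restriction to inertia. -/
structure IsTameParameter (χ : ↥(inertiaGroup p F) →* Sp n) (ψ : WeilGroup p F × SL2C →* Sp n) :
    Prop where
  langlands : IsLanglandsParameter ψ
  levelZero : IsLevelZero ψ
  restricts : RestrictsTo ψ χ

theorem Sp.zpow_mem_of_mem {W : Submodule ℂ (Fin n ⊕ Fin n → ℂ)} {g : Sp n}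
    (hg : ∀ v ∈ W, g.toEnd v ∈ W) (k : ℤ) : ∀ v ∈ W, (g ^ k).toEnd v ∈ W :=
  ((stabilizerPair W W).zpow_mem (show g ∈ stabilizerPair W W from ⟨hg, hg⟩) k).1

theorem DiscreteParameter.isTameParameter {χ : ↥(inertiaGroup p F) →* Sp n}
    (ψ : DiscreteParameter χ) : IsTameParameter χ ψ.1 :=
  ⟨ψ.2.1, ψ.2.2.1, ψ.2.2.2.2⟩

theorem mk_one_mul (ψ : WeilGroup p F × SL2C →* Sp n) (w : WeilGroup p F) (g : SL2C) :
    ψ (w, 1) * ψ (1, g) = ψ (1, g) * ψ (w, 1) := by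
  rw [← map_mul, ← map_mul, Prod.mk_mul_mk, Prod.mk_mul_mk, mul_one, one_mul, mul_one, one_mul]

namespace IsTameParameter

variable {s : ↥(inertiaGroup p F)} {Fr : WeilGroup p F} {χ : ↥(inertiaGroup p F) →* Sp n}
  {ψ : WeilGroup p F × SL2C →* Sp n} (t : IsTameParameter χ ψ) (h : IsInertialType s Fr χ)

include t h

theorem map_frob : ψ (Fr, 1) * ψ (inertiaToWeil p F s, 1) * (ψ (Fr, 1))⁻¹ =
    ψ (inertiaToWeil p F s, 1) ^ residueCard p F := by
  have h1 := h.frobenius.map_conjInertia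
    (ψ.comp ((MonoidHom.inl _ _).comp (inertiaToWeil p F))) t.levelZero s
  change ψ (inertiaToWeil p F (Fr.conjInertia s), 1) = ψ (inertiaToWeil p F s, 1) ^ _ at h1
  rw [← h1, WeilGroup.inertiaToWeil_conjInertia, ← map_inv, ← map_mul, ← map_mul, Prod.inv_mk,
    Prod.mk_mul_mk, Prod.mk_mul_mk, inv_one, mul_one, mul_one]

/-- The symplectic representation attached to a parameter. -/
def rep : TameRep (residueCard p F) (Fin n ⊕ Fin n → ℂ) :=
  Sp.tameRep (ψ (inertiaToWeil p F s, 1)) (ψ (Fr, 1)) (ψ.comp (MonoidHom.inr _ _)) (t.map_frob h)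
    (fun g => mk_one_mul ψ _ g) (fun g => mk_one_mul ψ _ g) t.langlands.algebraic

omit t in
-- The exponents depend on w but not on ψ. Hence two parameters whose values at s, at Fr and on
-- SL(2, ℂ) are simultaneously conjugate are conjugate.
theorem exists_factor (w : WeilGroup p F) : ∃ (j : ℕ) (k : ℤ),
    ∀ ψ : WeilGroup p F × SL2C →* Sp n, IsTameParameter χ ψ → ∀ g,
      ψ (w, g) = ψ (inertiaToWeil p F s, 1) ^ j * ψ (Fr, 1) ^ k * ψ (1, g) := by
  obtain ⟨i, k, rfl⟩ := h.frobenius.exists_mem_inertiaGroup_mul w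
  obtain ⟨j, hj⟩ := h.exists_pow_eq i
  refine ⟨j, k, fun ψ t g => ?_⟩
  obtain ⟨a, ha⟩ := t.restricts
  have h1 : ψ (inertiaToWeil p F i, 1) = ψ (inertiaToWeil p F s, 1) ^ j := by
    rw [ha, ha, hj, conj_pow]
  rw [← h1, ← map_zpow, ← map_mul, ← map_mul]
  congr 1
  ext1
  · simp
  · simp

omit h in
theorem eigMult_eq (s : ↥(inertiaGroup p F)) (u : ℂ) :
    eigMult (ψ (inertiaToWeil p F s, 1)) u = eigMult (χ s) u := by
  obtain ⟨a, ha⟩ := t.restricts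
  rw [ha, Sp.eigMult_conj]

theorem mem_VP_iff {u : ℂ} : (t.rep h).A.HasEigenvalue u ↔ u ∈ VP (χ s) := by
  rw [mem_VP_iff_eigMult_pos, ← t.eigMult_eq s]
  exact hasEigenvalue_iff_finrank_pos

theorem stable {W : Submodule ℂ (Fin n ⊕ Fin n → ℂ)} (hA : ∀ v ∈ W, (t.rep h).A v ∈ W)
    (hΨ : ∀ v ∈ W, (t.rep h).Ψ v ∈ W) (hρ : ∀ g, ∀ v ∈ W, (t.rep h).ρ g v ∈ W) :
    ∀ g ∈ ψ.range, ∀ v ∈ W, g.toEnd v ∈ W := by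
  rintro _ ⟨⟨w, g⟩, rfl⟩ v hv
  obtain ⟨j, k, hjk⟩ := exists_factor h w
  rw [hjk ψ t, Sp.toEnd_mul, Sp.toEnd_mul, End.mul_apply, End.mul_apply, ← zpow_natCast, ← neg_neg k,
    ← _root_.inv_zpow']
  exact Sp.zpow_mem_of_mem hA _ _ (Sp.zpow_mem_of_mem hΨ _ _ (hρ g v hv))

omit h in
theorem isSemisimple_inv (w : WeilGroup p F) : ((ψ (w, 1))⁻¹).toEnd.IsSemisimple := by
  rw [← map_inv, Prod.inv_mk, inv_one]
  exact t.langlands.semisimple _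

/-- Begin with a projection onto W commuting with SL(2, ℂ) and make it commute with A, then with Φ,
by `exists_invariant_projection`; each improvement keeps the earlier ones. The kernel of the last
projection is a stable complement. -/
theorem exists_isCompl (W : Submodule ℂ (Fin n ⊕ Fin n → ℂ))
    (hW : ∀ g ∈ ψ.range, ∀ v ∈ W, g.toEnd v ∈ W) :
    ∃ C : Submodule ℂ (Fin n ⊕ Fin n → ℂ), (∀ g ∈ ψ.range, ∀ v ∈ C, g.toEnd v ∈ C) ∧
      IsCompl W C := by
  set X := t.rep h with hX
  set A := ψ (inertiaToWeil p F s, 1)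
  set Φ := ψ (Fr, 1)
  have hW' : ∀ x, ∀ v ∈ W, (ψ x).toEnd v ∈ W := fun x => hW _ ⟨x, rfl⟩
  have hWinv : ∀ x, ∀ v ∈ W, ((ψ x)⁻¹).toEnd v ∈ W := fun x => hW _ ⟨x⁻¹, map_inv _ _⟩
  have hA : ∀ g, Commute A.toEnd (X.ρ g) := fun g => LinearMap.ext (X.A_ρ g)
  have hΨ : ∀ g, Commute (Φ⁻¹).toEnd (X.ρ g) := fun g => LinearMap.ext (X.Ψ_ρ g)
  have hΦ : ∀ g, Commute Φ.toEnd (X.ρ g) := fun g => LinearMap.ext (TameRep.Φ_ρ (X := X) g)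
  have hA' : ∀ g, Commute (A⁻¹).toEnd (X.ρ g) := fun g => by
    change (A⁻¹).toEnd * (ψ (1, g)).toEnd = (ψ (1, g)).toEnd * (A⁻¹).toEnd
    rw [← Sp.toEnd_mul, ← Sp.toEnd_mul]
    congr 1
    rw [inv_mul_eq_iff_eq_mul, ← mul_assoc, mk_one_mul, mul_inv_cancel_right]
  obtain ⟨P, hP, hP', hPρ⟩ := X.algebraic.exists_projection (W := W) fun g => hW' (1, g)
  obtain ⟨Q, hQ, hQ', hQρ, hQA⟩ := exists_invariant_projection (W := W) (Set.range X.ρ)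
    (t.langlands.semisimple _) (t.isSemisimple_inv _) A.toEnd_mul_inv A.toEnd_inv_mul
    (by
      rintro P hP _ ⟨g, rfl⟩
      exact ((hA' g).mul_left (hP _ ⟨g, rfl⟩)).mul_left (hA g))
    (hW' _) (hWinv _) hP hP' (by
      rintro _ ⟨g, rfl⟩
      exact hPρ g)
  obtain ⟨R, hR, hR', hRS, hRΦ⟩ := exists_invariant_projection (W := W)
    (insert A.toEnd (Set.range X.ρ)) (t.langlands.semisimple _) (t.isSemisimple_inv _)
    Φ.toEnd_mul_inv Φ.toEnd_inv_mul
    (by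
      rintro P hP a (rfl | ⟨g, rfl⟩)
      -- Conjugation by Frobenius preserves commutation with A: what commutes with A commutes with
      -- A^q, and Φ⁻¹A^qΦ = A.
      · have h1 : Φ.toEnd * A.toEnd = A.toEnd ^ residueCard p F * Φ.toEnd := by
          rw [← Sp.toEnd_pow, ← t.map_frob h, ← Sp.toEnd_mul, ← Sp.toEnd_mul, inv_mul_cancel_right]
        have h2 : (Φ⁻¹).toEnd * A.toEnd ^ residueCard p F = A.toEnd * (Φ⁻¹).toEnd := by
          rw [← Sp.toEnd_pow, ← t.map_frob h, ← Sp.toEnd_mul, ← Sp.toEnd_mul]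
          congr 1
          change Φ⁻¹ * (Φ * A * Φ⁻¹) = A * Φ⁻¹
          group
        have h3 := (hP A.toEnd (Set.mem_insert _ _)).pow_right (residueCard p F)
        change (Φ⁻¹).toEnd * P * Φ.toEnd * A.toEnd = A.toEnd * ((Φ⁻¹).toEnd * P * Φ.toEnd)
        rw [mul_assoc, h1, ← mul_assoc, mul_assoc _ P, h3.eq, ← mul_assoc, h2]
        simp only [mul_assoc]
      · exact ((hΨ g).mul_left (hP _ (Set.mem_insert_of_mem _ ⟨g, rfl⟩))).mul_left (hΦ g))
    (hW' _) (hWinv _) hQ hQ' (by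
      rintro a (rfl | ha)
      · exact hQA
      · exact hQρ a ha)
  have hker : ∀ a : End ℂ (Fin n ⊕ Fin n → ℂ), Commute R a → ∀ v ∈ LinearMap.ker R,
      a v ∈ LinearMap.ker R := by
    intro a ha v hv
    rw [LinearMap.mem_ker] at hv ⊢
    rw [← End.mul_apply, ha.eq, End.mul_apply, hv, map_zero]
  refine ⟨LinearMap.ker R, t.stable h (hker _ (hRS _ (Set.mem_insert _ _)))
    (Sp.mem_of_inv_mem (hker _ hRΦ)) (fun g => hker _ (hRS _ (Set.mem_insert_of_mem _ ⟨g, rfl⟩))), ?_⟩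
  rw [← LinearMap.ker_codRestrict W R hR]
  exact LinearMap.isCompl_of_proj fun x => Subtype.ext (hR' x x.2)

theorem isDiscreteParameter_iff : IsDiscreteParameter ψ ↔ (t.rep h).Anisotropic := by
  constructor
  · intro hdisc W hA hΨ hρ hiso
    exact eq_bot_of_isotropic_of_discrete hdisc (t.exists_isCompl h) W (t.stable h hA hΨ hρ) hiso
  · intro hX H hH hle
    refine eq_top_of_isLeviSubgroup (fun W hW hiso => ?_) H hH hle
    have hW' : ∀ x, ∀ v ∈ W, (ψ x).toEnd v ∈ W := fun x => hW _ ⟨x, rfl⟩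
    exact hX W (hW' _) (Sp.mem_of_inv_mem (hW' _)) (fun g => hW' (1, g)) hiso

/-- F_u is a power of Φ, whereas the abstract joint eigenspace uses the same power of Ψ = Φ⁻¹. For
the eigenvalues ±1, which are their own inverses, this makes no difference. -/
theorem jointEigenspace_eq (u : ℂ) (ζ : ℤˣ) :
    jointEigenspace ψ s Fr u ζ = (t.rep h).space u (ζ : ℤ) := by
  have hζ : ((ζ : ℤ) : ℂ) * ((ζ : ℤ) : ℂ) = 1 := by
    rw [← Int.cast_mul, Int.units_coe_mul_self, Int.cast_one]
  have key : ∀ (a b : Sp n), a * b = 1 → ∀ x,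
      a.toEnd x = ((ζ : ℤ) : ℂ) • x → b.toEnd x = ((ζ : ℤ) : ℂ) • x := by
    intro a b hab x hx
    rw [eq_inv_of_mul_eq_one_right hab]
    refine a.toEnd_injective_apply ?_
    rw [Sp.toEnd_apply_inv, map_smul, hx, smul_smul, hζ, one_smul]
  ext x
  rw [jointEigenspace, TameRep.space, Submodule.mem_inf, Submodule.mem_inf, End.mem_eigenspace_iff,
    End.mem_eigenspace_iff, End.mem_eigenspace_iff, End.mem_eigenspace_iff]
  refine and_congr_right fun _ => ?_
  change ((ψ (Fr, 1)).toEnd ^ cycleLength (residueCard p F) u) x = _ ↔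
    (((ψ (Fr, 1))⁻¹).toEnd ^ cycleLength (residueCard p F) u) x = _
  rw [← Sp.toEnd_pow, ← Sp.toEnd_pow]
  constructor
  · exact key _ _ (by rw [inv_pow, mul_inv_cancel]) x
  · exact key _ _ (by rw [inv_pow, inv_mul_cancel]) x

end IsTameParameter

end Parameter

end

/-! ### Orbits of the unipotent element in representations of SL(2, ℂ). -/

section

open Module

section Orbits

variable {Y Y' : Type*} [AddCommGroup Y] [Module ℂ Y] [AddCommGroup Y'] [Module ℂ Y']
  {σ : SL2C →* End ℂ Y} {σ' : SL2C →* End ℂ Y'} {M M' : ℕ}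

/-- `U` is the orbit of the standard unipotent element in a representation of `SL(2, ℂ)`. -/
def IsOrbitOfRep (σ : SL2C →* End ℂ Y) (U : UnipotentOrbit M) : Prop :=
  ∃ (T : (Fin M → ℂ) ≃ₗ[ℂ] Y) (x : GL (Fin M) ℂ), ConjClasses.mk x = U.1 ∧
    ∀ v, σ unipotentSL2 (T v) = T (x.1 *ᵥ v)

theorem piUnipotent_sub_one_isNilpotent {I : Type*} [Fintype I] (k : I → ℕ) :
    IsNilpotent (piUnipotent k - 1) := by
  refine ⟨∑ i, (k i + 1), LinearMap.ker_eq_top.1 (Submodule.eq_top_of_finrank_eq ?_)⟩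
  rw [finrank_ker_piUnipotent, finrank_pi_fintype]
  refine Finset.sum_congr rfl fun i _ => ?_
  rw [finrank_fin_fun]
  exact min_eq_right (Finset.single_le_sum (f := fun i => k i + 1) (fun _ _ => Nat.zero_le _)
    (Finset.mem_univ i))

/-- The orbit attached to a sum of symmetric powers. -/
theorem exists_isOrbitOfRep {I : Type} [Fintype I] {k : I → ℕ}
    (e : (∀ i, Fin (k i + 1) → ℂ) ≃ₗ[ℂ] Y)
    (he : ∀ g c, e (fun i => symRep (k i) g (c i)) = σ g (e c)) :
    ∃ U : UnipotentOrbit (finrank ℂ Y), IsOrbitOfRep σ U := by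
  have : FiniteDimensional ℂ Y := e.finiteDimensional
  let T : (Fin (finrank ℂ Y) → ℂ) ≃ₗ[ℂ] Y := (finBasis ℂ Y).equivFun.symm
  let E := ((e.trans T.symm).conjAlgEquiv ℂ).trans LinearMap.toMatrixAlgEquiv'
  have hn : IsNilpotent (E (piUnipotent k) - 1) := by
    rw [← map_one E, ← map_sub]
    exact (piUnipotent_sub_one_isNilpotent k).map E
  have hu : IsUnit (E (piUnipotent k)) := by
    have h := hn.isUnit_add_one
    rwa [sub_add_cancel] at h
  obtain ⟨x, hx⟩ := hu
  refine ⟨⟨ConjClasses.mk x, x, rfl, by rw [hx]; exact hn⟩, T, x, rfl, fun v => ?_⟩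
  have h1 : x.1 *ᵥ v = T.symm (e (piUnipotent k (e.symm (T v)))) := by
    rw [hx]
    exact LinearMap.toMatrix'_mulVec ((e.trans T.symm).conjAlgEquiv ℂ (piUnipotent k)) v
  rw [h1, LinearEquiv.apply_symm_apply]
  obtain ⟨c, hc⟩ := e.surjective (T v)
  rw [← hc, LinearEquiv.symm_apply_apply, ← he]
  rfl

theorem IsOrbitOfRep.hasJordanBlocks {I : Type} [Fintype I] {k : I → ℕ}
    {e : (∀ i, Fin (k i + 1) → ℂ) ≃ₗ[ℂ] Y}
    (he : ∀ g c, e (fun i => symRep (k i) g (c i)) = σ g (e c)) {U : UnipotentOrbit M}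
    (hU : IsOrbitOfRep σ U) : U.HasJordanBlocks (Finset.univ.val.map fun i => k i + 1) := by
  obtain ⟨T, x, hx, hT⟩ := hU
  refine (hasJordanBlocks_iff _ _).2 ⟨I, inferInstance, k, x, e.trans T.symm, rfl, hx, fun c => ?_⟩
  rw [LinearEquiv.trans_apply, LinearEquiv.trans_apply, LinearEquiv.symm_apply_eq, ← hT,
    LinearEquiv.apply_symm_apply, ← he]
  rfl

theorem IsOrbitOfRep.trans {U : UnipotentOrbit M} (hU : IsOrbitOfRep σ U) (S : Y ≃ₗ[ℂ] Y')
    (hS : ∀ y, S (σ unipotentSL2 y) = σ' unipotentSL2 (S y)) : IsOrbitOfRep σ' U := by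
  obtain ⟨T, x, hx, hT⟩ := hU
  exact ⟨T.trans S, x, hx, fun v => by
    rw [LinearEquiv.trans_apply, LinearEquiv.trans_apply, ← hS, hT]⟩

theorem IsOrbitOfRep.finrank_eq {U : UnipotentOrbit M} (hU : IsOrbitOfRep σ U) :
    finrank ℂ Y = M := by
  obtain ⟨T, -⟩ := hU
  rw [← T.finrank_eq, finrank_fin_fun]

/-- Two bases of the same space give conjugate matrices. The sigma type is needed because M and M'
agree only through the dimension of the space. -/
theorem IsOrbitOfRep.sigma_eq {U : UnipotentOrbit M} {U' : UnipotentOrbit M'}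
    (hU : IsOrbitOfRep σ U) (hU' : IsOrbitOfRep σ U') :
    (⟨M, U⟩ : Σ M, UnipotentOrbit M) = ⟨M', U'⟩ := by
  obtain rfl : M = M' := hU.finrank_eq.symm.trans hU'.finrank_eq
  obtain ⟨T, x, hx, hT⟩ := hU
  obtain ⟨T', x', hx', hT'⟩ := hU'
  obtain ⟨y, hy, hyx⟩ := exists_conj_of_linearEquiv (T.trans T'.symm) x x'.1 fun v => by
    rw [LinearEquiv.trans_apply, LinearEquiv.trans_apply, ← hT, LinearEquiv.symm_apply_eq, ← hT',
      LinearEquiv.apply_symm_apply]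
  obtain rfl : y = x' := Units.ext hy
  have h : U = U' := Subtype.ext (hx.symm.trans (hyx.symm.trans hx'))
  rw [h]

/-- Representations of `SL(2, ℂ)` with the same unipotent orbit are isomorphic. -/
theorem IsOrbitOfRep.exists_equiv {I I' : Type} [Fintype I] [Fintype I'] {k : I → ℕ} {k' : I' → ℕ}
    {e : (∀ i, Fin (k i + 1) → ℂ) ≃ₗ[ℂ] Y} {e' : (∀ i, Fin (k' i + 1) → ℂ) ≃ₗ[ℂ] Y'}
    (he : ∀ g c, e (fun i => symRep (k i) g (c i)) = σ g (e c))
    (he' : ∀ g c, e' (fun i => symRep (k' i) g (c i)) = σ' g (e' c))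
    {U : UnipotentOrbit M} (hU : IsOrbitOfRep σ U) (hU' : IsOrbitOfRep σ' U) :
    ∃ S : Y ≃ₗ[ℂ] Y', ∀ g y, S (σ g y) = σ' g (S y) := by
  have h1 := (hU.hasJordanBlocks he).unique (hU'.hasJordanBlocks he')
  obtain ⟨τ, hτ⟩ : ∃ τ : I ≃ I', ∀ i, k' (τ i) = k i := by
    classical
    have hcard : ∀ d, Fintype.card {i // k i = d} = Fintype.card {i // k' i = d} := fun d => by
      have h2 := congrArg (Multiset.count (d + 1)) h1
      rw [Multiset.count_map, Multiset.count_map] at h2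
      rw [Fintype.card_subtype, Fintype.card_subtype, Finset.card_def, Finset.card_def,
        Finset.filter_val, Finset.filter_val]
      simpa [eq_comm] using h2
    let τ : ∀ d, {i // k i = d} ≃ {i // k' i = d} := fun d => Fintype.equivOfCardEq (hcard d)
    exact ⟨(Equiv.sigmaFiberEquiv k).symm.trans
      ((Equiv.sigmaCongrRight τ).trans (Equiv.sigmaFiberEquiv k')), fun i => (τ (k i) ⟨i, rfl⟩).2⟩
  obtain ⟨S, hS⟩ := exists_pi_symRep_equiv τ hτ
  refine ⟨(e.symm.trans S).trans e', fun g y => ?_⟩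
  obtain ⟨c, rfl⟩ := e.surjective y
  simp only [LinearEquiv.trans_apply]
  rw [← he, LinearEquiv.symm_apply_apply, LinearEquiv.symm_apply_apply, hS, he']

end Orbits

section

variable {p : ℕ} [Fact p.Prime] {F : Type*} [Field F] [Algebra ℚ_[p] F]
  [FiniteDimensional ℚ_[p] F] {n : ℕ}

theorem IsTameParameter.isOrbitOf_iff {s : ↥(inertiaGroup p F)} {Fr : WeilGroup p F}
    {χ : ↥(inertiaGroup p F) →* Sp n} {ψ : WeilGroup p F × SL2C →* Sp n} (t : IsTameParameter χ ψ)
    (h : IsInertialType s Fr χ) (u : ℂ) (ζ : ℤˣ) {M : ℕ} (U : UnipotentOrbit M) :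
    IsOrbitOf ψ s Fr u ζ U ↔ IsOrbitOfRep ((t.rep h).spaceRep u (ζ : ℤ)) U := by
  rw [IsOrbitOf, t.jointEigenspace_eq h]
  constructor
  · rintro ⟨f, x, hf, hr, hx, hfx⟩
    refine ⟨(LinearEquiv.ofInjective f hf).trans (LinearEquiv.ofEq _ _ hr), x, hx, fun v => ?_⟩
    exact Subtype.ext (hfx v)
  · rintro ⟨T, x, hx, hT⟩
    refine ⟨Submodule.subtype _ ∘ₗ T.toLinearMap, x, Subtype.val_injective.comp T.injective, ?_, hx,
      fun v => congrArg Subtype.val (hT v)⟩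
    rw [LinearMap.range_comp, LinearEquiv.range, Submodule.map_top, Submodule.range_subtype]

end

end

/-! ### From parameters to collections of orbits, and uniqueness. -/

section

open Module

section

/-- The orbit has distinct blocks, of the parity prescribed by `u` and `ζ`. -/
def UnipotentOrbit.IsAdmissible {M : ℕ} (U : UnipotentOrbit M) (u : ℂ) (ζ : ℤˣ) : Prop :=
  -- A block of size d belongs to Sym^(d-1); hence the minus sign.
  ∃ D, U.HasJordanBlocks D ∧ D.Nodup ∧ ∀ d ∈ D, (-1) ^ d = -TameRep.sign u ζ

namespace UnipotentOrbit.IsAdmissible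

variable {M : ℕ} {U : UnipotentOrbit M} {u : ℂ} {ζ : ℤˣ}

theorem isDiscrete (hU : U.IsAdmissible u ζ) : U.IsDiscrete := by
  obtain ⟨D, hD, h1, -⟩ := hU
  exact ⟨D, hD, h1⟩

theorem isSymplectic (hU : U.IsAdmissible u ζ) (h : TameRep.sign u ζ = -1) : U.IsSymplectic := by
  obtain ⟨D, hD, -, h1⟩ := hU
  refine ⟨D, hD, fun d hd => ?_⟩
  have h2 := h1 d hd
  rw [h, neg_neg] at h2
  exact (neg_one_pow_eq_one_iff_even (by norm_num)).1 h2

theorem isOrthogonal (hU : U.IsAdmissible u ζ) (h : TameRep.sign u ζ = 1) : U.IsOrthogonal := by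
  obtain ⟨D, hD, -, h1⟩ := hU
  refine ⟨D, hD, fun d hd => ?_⟩
  have h2 := h1 d hd
  rw [h] at h2
  exact (neg_one_pow_eq_neg_one_iff_odd (by norm_num)).1 h2

theorem of_isSymplectic (hU : U.IsDiscrete) (hU' : U.IsSymplectic) (h : TameRep.sign u ζ = -1) :
    U.IsAdmissible u ζ := by
  obtain ⟨D, hD, h1⟩ := hU
  obtain ⟨D', hD', h2⟩ := hU'
  obtain rfl := hD.unique hD'
  exact ⟨D, hD, h1, fun d hd => by rw [(h2 d hd).neg_one_pow, h, neg_neg]⟩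

theorem of_isOrthogonal (hU : U.IsDiscrete) (hU' : U.IsOrthogonal) (h : TameRep.sign u ζ = 1) :
    U.IsAdmissible u ζ := by
  obtain ⟨D, hD, h1⟩ := hU
  obtain ⟨D', hD', h2⟩ := hU'
  obtain rfl := hD.unique hD'
  exact ⟨D, hD, h1, fun d hd => by rw [(h2 d hd).neg_one_pow, h]⟩

end UnipotentOrbit.IsAdmissible

theorem IsOrbitOfRep.isAdmissible {Y : Type*} [AddCommGroup Y] [Module ℂ Y] {σ : SL2C →* End ℂ Y}
    {I : Type} [Fintype I] {k : I → ℕ} {e : (∀ i, Fin (k i + 1) → ℂ) ≃ₗ[ℂ] Y}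
    (he : ∀ g c, e (fun i => symRep (k i) g (c i)) = σ g (e c)) {M : ℕ} {U : UnipotentOrbit M}
    (hU : IsOrbitOfRep σ U) {u : ℂ} {ζ : ℤˣ} (hk : Function.Injective k)
    (hs : ∀ i, (-1) ^ k i = TameRep.sign u ζ) : U.IsAdmissible u ζ := by
  refine ⟨_, hU.hasJordanBlocks he, Finset.univ.nodup.map fun i j hij => hk (Nat.succ_injective hij),
    fun d hd => ?_⟩
  obtain ⟨i, -, rfl⟩ := Multiset.mem_map.1 hd
  rw [pow_succ, hs, mul_neg_one]

theorem TameRep.sign_one {u : ℂ} : sign u 1 = -1 := by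
  rw [sign, Units.val_one, Int.cast_one, ite_self]

theorem TameRep.sign_of_eq {u : ℂ} (hu : u = 1 ∨ u = -1) (ζ : ℤˣ) : sign u ζ = -1 := if_pos hu

theorem TameRep.sign_neg_one {u : ℂ} (hu : u ≠ 1) (hu' : u ≠ -1) : sign u (-1) = 1 := by
  rw [sign, if_neg (not_or.2 ⟨hu, hu'⟩)]
  norm_num

theorem OrbitCollection.isAdmissible {n q : ℕ} {A : Sp n} (C : OrbitCollection q A) (u : VP A)
    (ζ : ℤˣ) : (C.U (VPClass.mk q A u) ζ).IsAdmissible u ζ := by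
  by_cases hu : (u : ℂ) = 1 ∨ (u : ℂ) = -1
  · exact .of_isSymplectic (C.discrete _ _) (C.symplectic_pm_one u hu ζ) (TameRep.sign_of_eq hu ζ)
  · obtain ⟨h1, h2⟩ := not_or.1 hu
    rcases Int.units_eq_one_or ζ with rfl | rfl
    · exact .of_isSymplectic (C.discrete _ _) (C.symplectic_pos u h1 h2) TameRep.sign_one
    · exact .of_isOrthogonal (C.discrete _ _) (C.orthogonal_neg u h1 h2) (TameRep.sign_neg_one h1 h2)

theorem OrbitCollection.ext_sigma {n q : ℕ} {A : Sp n} {C C' : OrbitCollection q A}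
    (h : ∀ c ζ, (⟨C.m c ζ, C.U c ζ⟩ : Σ M, UnipotentOrbit M) = ⟨C'.m c ζ, C'.U c ζ⟩) : C = C' := by
  obtain ⟨m, U, _, _, _, _, _⟩ := C
  obtain ⟨m', U', _, _, _, _, _⟩ := C'
  obtain rfl : m = m' := funext fun c => funext fun ζ => congrArg Sigma.fst (h c ζ)
  obtain rfl : U = U' := funext fun c => funext fun ζ => sigma_mk_injective (h c ζ)
  rfl

/-- Powers of Frobenius identify the joint eigenspaces. -/
theorem TameRep.exists_spaceRep_equiv {q : ℕ} {V : Type*} [AddCommGroup V] [Module ℂ V]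
    (X : TameRep q V) {u μ : ℂ} (hu : IsSelfDual q u) (hμ : μ ≠ 0) (j : ℕ) :
    ∃ S : X.space u μ ≃ₗ[ℂ] X.space (u ^ q ^ j) μ,
      ∀ g x, S (X.spaceRep u μ g x) = X.spaceRep (u ^ q ^ j) μ g (S x) := by
  refine ⟨LinearEquiv.ofBijective ((X.Ψ ^ j).restrict fun x hx => Ψ_pow_mem_space hu j hx)
    ⟨fun x y hxy => Subtype.ext (Ψ_pow_injective (X := X) j (congrArg Subtype.val hxy)),
      fun y => ?_⟩, fun g x => Subtype.ext (Ψ_pow_ρ j g x.1)⟩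
  obtain ⟨x, hx, hxy⟩ := exists_Ψ_pow_eq hu hμ j y.2
  exact ⟨⟨x, hx⟩, Subtype.ext hxy⟩

end

section Correspondence

variable {p : ℕ} [Fact p.Prime] {F : Type*} [Field F] [Algebra ℚ_[p] F]
  [FiniteDimensional ℚ_[p] F] {n : ℕ} {s : ↥(inertiaGroup p F)} {Fr : WeilGroup p F}
  {χ : ↥(inertiaGroup p F) →* Sp n}

/-- The orbits of a collection are those attached to a parameter. -/
def Corresponds (s : ↥(inertiaGroup p F)) (Fr : WeilGroup p F) (χ : ↥(inertiaGroup p F) →* Sp n)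
    (ψ : WeilGroup p F × SL2C →* Sp n) (C : OrbitCollection (residueCard p F) (χ s)) : Prop :=
  ∀ (u : VP (χ s)) (ζ : ℤˣ),
    IsOrbitOf ψ s Fr u ζ (C.U (VPClass.mk (residueCard p F) (χ s) u) ζ)

/-- A representative of a class of eigenvalues. -/
def VPClass.rep {q : ℕ} {A : Sp n} (c : VPClass q A) : VP A := Quot.out c

theorem VPClass.mk_rep {q : ℕ} {A : Sp n} (c : VPClass q A) : VPClass.mk q A c.rep = c :=
  Quot.out_eq c

theorem units_ne_zero (ζ : ℤˣ) : ((ζ : ℤ) : ℂ) ≠ 0 := by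
  exact_mod_cast ζ.ne_zero

variable (h : IsInertialType s Fr χ)

include h

theorem IsInertialType.exists_eq_pow (u : VP (χ s)) :
    ∃ j : ℕ, (u : ℂ) = (VPClass.mk (residueCard p F) (χ s) u).rep ^ residueCard p F ^ j :=
  h.mk_eq_mk_iff.1 (VPClass.mk_rep _)

variable {ψ : WeilGroup p F × SL2C →* Sp n} (t : IsTameParameter χ ψ)

include t

/-- Powers of Ψ identify the joint eigenspaces along a cycle as representations of SL(2, ℂ), so one
representative per class is enough. -/
theorem corresponds_iff {C : OrbitCollection (residueCard p F) (χ s)} :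
    Corresponds s Fr χ ψ C ↔ ∀ c (ζ : ℤˣ), IsOrbitOfRep ((t.rep h).spaceRep c.rep (ζ : ℤ)) (C.U c ζ) := by
  constructor
  · intro hC c ζ
    have h1 := (t.isOrbitOf_iff h _ _ _).1 (hC c.rep ζ)
    rwa [VPClass.mk_rep] at h1
  · intro hC u ζ
    obtain ⟨j, hj⟩ := h.exists_eq_pow u
    obtain ⟨S, hS⟩ := (t.rep h).exists_spaceRep_equiv
      (h.isSelfDual (VPClass.mk (residueCard p F) (χ s) u).rep.2) (units_ne_zero ζ) j
    have h1 := (hC (VPClass.mk _ _ u) ζ).trans S fun y => hS _ y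
    rw [← hj] at h1
    exact (t.isOrbitOf_iff h _ _ _).2 h1

theorem IsTameParameter.eigenspace_eq (hX : (t.rep h).Anisotropic) {u : ℂ} (hu : u ∈ VP (χ s)) :
    (t.rep h).A.eigenspace u = (t.rep h).space u 1 ⊔ (t.rep h).space u (-1) :=
  hX.eigenspace_eq (h.isSelfDual hu) (t.isSemisimple_inv Fr)

/-- The orbits are taken at representatives. The conditions at the other eigenvalues follow because
multiplicity and the property of being ±1 are constant on a class. -/
theorem exists_corresponds (hX : (t.rep h).Anisotropic) : ∃ C, Corresponds s Fr χ ψ C := by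
  choose I hI k e he hk hs using fun (c : VPClass (residueCard p F) (χ s)) (ζ : ℤˣ) =>
    hX.exists_equiv_pi (h.isSelfDual c.rep.2) ζ
  choose U hU using fun c ζ => exists_isOrbitOfRep (e c ζ) (he c ζ)
  have hadm : ∀ c ζ, (U c ζ).IsAdmissible c.rep ζ := fun c ζ =>
    (hU c ζ).isAdmissible (he c ζ) (hk c ζ) (hs c ζ)
  have hpm : ∀ u : VP (χ s), ((VPClass.mk (residueCard p F) (χ s) u).rep : ℂ) = 1 ∨
      ((VPClass.mk (residueCard p F) (χ s) u).rep : ℂ) = -1 ↔ (u : ℂ) = 1 ∨ (u : ℂ) = -1 := by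
    intro u
    obtain ⟨j, hj⟩ := h.exists_eq_pow u
    rw [hj, (h.isSelfDual (VPClass.mk (residueCard p F) (χ s) u).rep.2).pow_eq_one_or_iff]
  refine ⟨⟨_, U, fun u => ?_, fun c ζ => (hadm c ζ).isDiscrete, fun u h1 h2 =>
    (hadm _ _).isSymplectic TameRep.sign_one, fun u h1 h2 => ?_, fun u hu ζ =>
    (hadm _ _).isSymplectic (TameRep.sign_of_eq ((hpm u).2 hu) ζ)⟩, (corresponds_iff h t).2 hU⟩
  · obtain ⟨j, hj⟩ := h.exists_eq_pow u
    set v := (VPClass.mk (residueCard p F) (χ s) u).rep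
    have h1 := TameRep.finrank_space_add (t.eigenspace_eq h hX v.2)
    have h2 : finrank ℂ ((t.rep h).A.eigenspace v) = eigMult (χ s) v := t.eigMult_eq s v
    have h3 : (((1 : ℤˣ) : ℤ) : ℂ) = 1 := by norm_num
    have h4 : (((-1 : ℤˣ) : ℤ) : ℂ) = -1 := by norm_num
    rw [hj, (h.pow_mem v.2 j).2, ← h2, ← h1, ← h4, ← h3]
  · obtain ⟨h3, h4⟩ := not_or.1 fun h3 => not_or.2 ⟨h1, h2⟩ ((hpm u).1 h3)
    exact (hadm _ _).isOrthogonal (TameRep.sign_neg_one h3 h4)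

theorem Corresponds.unique {C C' : OrbitCollection (residueCard p F) (χ s)}
    (hC : Corresponds s Fr χ ψ C) (hC' : Corresponds s Fr χ ψ C') : C = C' :=
  OrbitCollection.ext_sigma fun c ζ =>
    ((corresponds_iff h t).1 hC c ζ).sigma_eq ((corresponds_iff h t).1 hC' c ζ)

omit h t in
theorem Corresponds.conj {C : OrbitCollection (residueCard p F) (χ s)}
    (hC : Corresponds s Fr χ ψ C) {ψ' : WeilGroup p F × SL2C →* Sp n} {g : Sp n}
    (hg : ∀ x, ψ' x = g * ψ x * g⁻¹) : Corresponds s Fr χ ψ' C := by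
  intro u ζ
  obtain ⟨f, x, hf, hr, hx, hfx⟩ := hC u ζ
  have hg' : ∀ x v, (ψ' x).toEnd (g.toEnd v) = g.toEnd ((ψ x).toEnd v) := fun x v => by
    rw [hg, Sp.toEnd_mul, Sp.toEnd_mul, End.mul_apply, End.mul_apply, Sp.toEnd_inv_apply]
  have hg'' : ∀ x v (m : ℕ), ((ψ' x).toEnd ^ m) (g.toEnd v) = g.toEnd (((ψ x).toEnd ^ m) v) :=
    fun x v m => by
      induction m with
      | zero => rfl
      | succ m ih => rw [pow_succ', pow_succ', End.mul_apply, End.mul_apply, ih, hg']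
  refine ⟨g.toEnd ∘ₗ f, x, g.toEnd_injective_apply.comp hf, ?_, hx, fun v => ?_⟩
  · rw [LinearMap.range_comp, hr]
    have hmem : ∀ v, g.toEnd v ∈ jointEigenspace ψ' s Fr u ζ ↔ v ∈ jointEigenspace ψ s Fr u ζ := by
      intro v
      rw [jointEigenspace, jointEigenspace, Submodule.mem_inf, Submodule.mem_inf,
        End.mem_eigenspace_iff, End.mem_eigenspace_iff, End.mem_eigenspace_iff,
        End.mem_eigenspace_iff, frobOperator, frobOperator, hg', hg'', ← map_smul, ← map_smul,
        g.toEnd_injective_apply.eq_iff, g.toEnd_injective_apply.eq_iff]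
    ext w
    rw [Submodule.mem_map]
    constructor
    · rintro ⟨v, hv, rfl⟩
      exact (hmem v).2 hv
    · intro hw
      refine ⟨(g⁻¹).toEnd w, ?_, g.toEnd_apply_inv w⟩
      rwa [← hmem, g.toEnd_apply_inv]
  · change (ψ' _).toEnd (g.toEnd (f v)) = g.toEnd (f _)
    rw [hg', hfx]

omit t in
theorem finite_VPClass : Finite (VPClass (residueCard p F) (χ s)) := by
  have : Finite (VP (χ s)) := (χ s).toEnd.finite_hasEigenvalue
  exact Finite.of_surjective (Quot.mk _) Quot.mk_surjective

/-- A parameter is determined up to conjugation by its orbits. -/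
theorem Corresponds.exists_conj (hX : (t.rep h).Anisotropic)
    {ψ' : WeilGroup p F × SL2C →* Sp n} (t' : IsTameParameter χ ψ') (hX' : (t'.rep h).Anisotropic)
    {C : OrbitCollection (residueCard p F) (χ s)}
    (hC : Corresponds s Fr χ ψ C) (hC' : Corresponds s Fr χ ψ' C) :
    ∃ g : Sp n, ∀ x, ψ' x = g * ψ x * g⁻¹ := by
  have := finite_VPClass h
  have := Fintype.ofFinite (VPClass (residueCard p F) (χ s))
  have hS : ∀ (c : VPClass (residueCard p F) (χ s)) (ζ : ℤˣ),
      ∃ S : (t.rep h).space c.rep (ζ : ℤ) ≃ₗ[ℂ] (t'.rep h).space c.rep (ζ : ℤ),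
        ∀ g x, S ((t.rep h).spaceRep c.rep (ζ : ℤ) g x) =
          (t'.rep h).spaceRep c.rep (ζ : ℤ) g (S x) := by
    intro c ζ
    obtain ⟨I, _, k, e, he, -⟩ := hX.exists_equiv_pi (h.isSelfDual c.rep.2) ζ
    obtain ⟨I', _, k', e', he', -⟩ := hX'.exists_equiv_pi (h.isSelfDual c.rep.2) ζ
    exact ((corresponds_iff h t).1 hC c ζ).exists_equiv he he' ((corresponds_iff h t').1 hC' c ζ)
  choose S hS using hS
  -- Equal orbits give isomorphic representations of SL(2, ℂ) at the representatives, and these are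
  -- glued along the cycles.
  obtain ⟨T, hTA, hTΨ, hTρ⟩ := TameRep.exists_equivariant_equiv (X := t.rep h) (X' := t'.rep h)
    (iSup_eigenspace_of_isSemisimple (t.langlands.semisimple _))
    (iSup_eigenspace_of_isSemisimple (t'.langlands.semisimple _))
    (fun v hv => h.isSelfDual ((t.mem_VP_iff h).1 hv))
    (u := fun c : VPClass (residueCard p F) (χ s) => (c.rep : ℂ)) (fun c => h.isSelfDual c.rep.2)
    (fun v hv => by
      obtain ⟨j, hj⟩ := h.exists_eq_pow ⟨v, (t'.mem_VP_iff h).1 hv⟩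
      exact ⟨_, j, hj⟩)
    (fun c c' j hj => by
      rw [← VPClass.mk_rep c, ← VPClass.mk_rep c']
      exact h.mk_eq_mk_iff.2 ⟨j, hj⟩)
    (fun c => t.eigenspace_eq h hX c.rep.2) (fun c => t'.eigenspace_eq h hX' c.rep.2) rfl S hS
  -- The index type collects A, Ψ and all ρ(g) into one family, so that the correction to an
  -- isometry respects all of them at once.
  obtain ⟨T', hT', hω⟩ := exists_isometry_of_equivariant (t.rep h).skew (t'.rep h).skew
    (t.rep h).nondegenerate (t'.rep h).nondegenerate
    (Sum.elim (fun b : Bool => if b then (t.rep h).A else (t.rep h).Ψ) (t.rep h).ρ)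
    (Sum.elim (fun b : Bool => if b then (t'.rep h).A else (t'.rep h).Ψ) (t'.rep h).ρ)
    (by
      rintro ((_ | _) | g)
      · exact (t.rep h).ω_Ψ
      · exact (t.rep h).ω_A
      · exact (t.rep h).ω_ρ g)
    (by
      rintro ((_ | _) | g)
      · exact (t'.rep h).ω_Ψ
      · exact (t'.rep h).ω_A
      · exact (t'.rep h).ω_ρ g) T
    (by
      rintro ((_ | _) | g)
      · exact hTΨ
      · exact hTA
      · exact hTρ g)
  obtain ⟨g, hg⟩ := exists_toEnd_eq T'.toLinearMap hω
  have hconj : ∀ a b : Sp n, (∀ x, T' (a.toEnd x) = b.toEnd (T' x)) → b = g * a * g⁻¹ := by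
    intro a b hab
    rw [eq_mul_inv_iff_mul_eq]
    refine Sp.toEnd_injective ?_
    rw [Sp.toEnd_mul, Sp.toEnd_mul, hg]
    exact LinearMap.ext fun x => (hab x).symm
  have hA := hconj (ψ (inertiaToWeil p F s, 1)) (ψ' (inertiaToWeil p F s, 1)) (hT' (Sum.inl true))
  have hΨ := hconj (ψ (Fr, 1))⁻¹ (ψ' (Fr, 1))⁻¹ (hT' (Sum.inl false))
  have hρ := fun x => hconj (ψ (1, x)) (ψ' (1, x)) (hT' (Sum.inr x))
  have hΦ : ψ' (Fr, 1) = g * ψ (Fr, 1) * g⁻¹ := by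
    rw [← inv_inv (ψ' (Fr, 1)), hΨ]
    group
  refine ⟨g, fun ⟨w, x⟩ => ?_⟩
  obtain ⟨j, k, hjk⟩ := IsTameParameter.exists_factor h w
  rw [hjk ψ t, hjk ψ' t', hA, hΦ, hρ, conj_pow, conj_zpow]
  group

end Correspondence

end

/-! ### Models with prescribed orbits. -/

section

open Module

namespace TameRep

variable {q : ℕ} {V V' : Type*} [AddCommGroup V] [Module ℂ V] [AddCommGroup V'] [Module ℂ V']
  {X : TameRep q V} {X' : TameRep q V'} (T : V ≃ₗ[ℂ] V') (hA : ∀ x, T (X.A x) = X'.A (T x))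
  (hΨ : ∀ x, T (X.Ψ x) = X'.Ψ (T x)) (hρ : ∀ g x, T (X.ρ g x) = X'.ρ g (T x))

include hA hΨ hρ

theorem Anisotropic.of_equiv (hω : ∀ x y, X'.ω (T x) (T y) = X.ω x y) (hX : X.Anisotropic) :
    X'.Anisotropic := by
  intro W hWA hWΨ hWρ hiso
  have h1 : W.comap T.toLinearMap = ⊥ := by
    refine hX _ (fun v hv => ?_) (fun v hv => ?_) (fun g v hv => ?_) fun v hv w hw => ?_
    · change T (X.A v) ∈ W
      rw [hA]
      exact hWA _ hv
    · change T (X.Ψ v) ∈ W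
      rw [hΨ]
      exact hWΨ _ hv
    · change T (X.ρ g v) ∈ W
      rw [hρ]
      exact hWρ g _ hv
    · rw [← hω]
      exact hiso _ hv _ hw
  rw [eq_bot_iff]
  intro w hw
  have h2 : T.symm w ∈ W.comap T.toLinearMap := by
    change T (T.symm w) ∈ W
    rwa [T.apply_symm_apply]
  rw [h1, Submodule.mem_bot, LinearEquiv.map_eq_zero_iff] at h2
  exact h2

theorem exists_spaceRep_equiv_of_equiv (u μ : ℂ) : ∃ S : X.space u μ ≃ₗ[ℂ] X'.space u μ,
    ∀ g x, S (X.spaceRep u μ g x) = X'.spaceRep u μ g (S x) := by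
  have hΨ' : ∀ (m : ℕ) x, T ((X.Ψ ^ m) x) = (X'.Ψ ^ m) (T x) := by
    intro m x
    induction m with
    | zero => rfl
    | succ m ih => rw [pow_succ', pow_succ', End.mul_apply, End.mul_apply, hΨ, ih]
  have hmem : ∀ x, T x ∈ X'.space u μ ↔ x ∈ X.space u μ := by
    intro x
    rw [mem_space, mem_space, ← hA, ← hΨ', ← map_smul, ← map_smul, T.injective.eq_iff,
      T.injective.eq_iff]
  have hmap : (X.space u μ).map T.toLinearMap = X'.space u μ := by
    ext y
    rw [Submodule.mem_map]
    constructor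
    · rintro ⟨x, hx, rfl⟩
      exact (hmem x).2 hx
    · intro hy
      refine ⟨T.symm y, (hmem _).1 ?_, T.apply_symm_apply y⟩
      rwa [T.apply_symm_apply]
  exact ⟨T.ofSubmodules _ _ hmap, fun g x => Subtype.ext (hρ g x.1)⟩

end TameRep

theorem UnipotentOrbit.IsAdmissible.exists_data {M : ℕ} {U : UnipotentOrbit M} {u : ℂ} {ζ : ℤˣ}
    (hU : U.IsAdmissible u ζ) : ∃ (I : Type) (_ : Fintype I) (k : I → ℕ) (x : GL (Fin M) ℂ)
      (T : (∀ i, Fin (k i + 1) → ℂ) ≃ₗ[ℂ] (Fin M → ℂ)), ConjClasses.mk x = U.1 ∧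
        (∀ c, T (piUnipotent k c) = x.1 *ᵥ T c) ∧ Function.Injective k ∧
        ∀ i, (-1) ^ k i = TameRep.sign u ζ := by
  obtain ⟨D, hD, hnd, hpar⟩ := hU
  obtain ⟨I, hI, k, x, T, rfl, hx, hT⟩ := (hasJordanBlocks_iff U D).1 hD
  refine ⟨I, hI, k, x, T, hx, hT, fun i j hij => ?_, fun i => ?_⟩
  · exact Multiset.inj_on_of_nodup_map hnd i (Finset.mem_univ_val i) j (Finset.mem_univ_val j)
      (by rw [hij])
  · have h1 := hpar _ (Multiset.mem_map_of_mem _ (Finset.mem_univ_val i))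
    rw [pow_succ, mul_neg_one, neg_inj] at h1
    exact h1

namespace ModelData

section Family

variable {q : ℕ} {ι : Type} [Fintype ι] {u : ι → ℂ} (hsd : ∀ c, IsSelfDual q (u c))
  (hu : ∀ c c' j, u c' = u c ^ q ^ j → c = c') {I : ι → ℤˣ → Type} [∀ c ζ, Fintype (I c ζ)]
  {k : ∀ c ζ, I c ζ → ℕ} (hk : ∀ c ζ, Function.Injective (k c ζ))
  (hs : ∀ c ζ i, (-1) ^ k c ζ i = TameRep.sign (u c) ζ)

/-- The model with given highest weights for every representative eigenvalue and sign. -/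
def ofFamily : ModelData q where
  I := Σ x : ι × ℤˣ, I x.1 x.2
  v a := u a.1.1
  ζ a := a.1.2
  k a := k a.1.1 a.1.2 a.2
  selfDual a := hsd a.1.1
  eq_of_pow a b j hj := by rw [hu _ _ j hj]
  injective := by
    rintro ⟨⟨c, ζ⟩, i⟩ ⟨⟨c', ζ'⟩, i'⟩ h1 h2 h3
    obtain rfl : c = c' := hu c c' 0 (by simpa using h1.symm)
    obtain rfl : ζ = ζ' := h2
    obtain rfl : i = i' := hk c ζ h3
    rfl
  parity a := hs _ _ _

/-- The indices of a family with given eigenvalue and sign. -/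
def ofFamilyEquiv (c : ι) (ζ : ℤˣ) : I c ζ ≃
    {a : (ofFamily hsd hu hk hs).I // (ofFamily hsd hu hk hs).v a = u c ∧
      (ofFamily hsd hu hk hs).ζ a = ζ} :=
  Equiv.ofBijective (fun i => ⟨⟨(c, ζ), i⟩, rfl, rfl⟩)
    ⟨fun i i' hii' => hk c ζ (congrArg (ofFamily hsd hu hk hs).k (congrArg Subtype.val hii')), by
      rintro ⟨⟨⟨c', ζ'⟩, i⟩, h1, h2⟩
      obtain rfl : c = c' := hu c c' 0 (by rw [pow_zero, pow_one]; exact h1)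
      obtain rfl : ζ' = ζ := h2
      exact ⟨i, rfl⟩⟩

theorem exists_ofFamily_equiv (c : ι) (ζ : ℤˣ) :
    ∃ e : (∀ i, Fin (k c ζ i + 1) → ℂ) ≃ₗ[ℂ] (ofFamily hsd hu hk hs).rep.space (u c) (ζ : ℤ),
      ∀ g x, e (fun i => symRep (k c ζ i) g (x i)) =
        (ofFamily hsd hu hk hs).rep.spaceRep (u c) (ζ : ℤ) g (e x) := by
  have hu' : ∀ a n, (ofFamily hsd hu hk hs).v a ^ q ^ n = u c →
      (ofFamily hsd hu hk hs).v a = u c := fun a n ha =>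
    congrArg u (hu a.1.1 c n ha.symm)
  obtain ⟨E, hE⟩ := exists_space_equiv hu' ζ
  obtain ⟨S, hS⟩ := exists_pi_symRep_equiv (k := k c ζ)
    (k' := fun a : {a : (ofFamily hsd hu hk hs).I // (ofFamily hsd hu hk hs).v a = u c ∧
      (ofFamily hsd hu hk hs).ζ a = ζ} => (ofFamily hsd hu hk hs).k a.1)
    (ofFamilyEquiv hsd hu hk hs c ζ) fun i => rfl
  refine ⟨S.trans E.symm, fun g x => ?_⟩
  rw [LinearEquiv.trans_apply, LinearEquiv.trans_apply, hS, LinearEquiv.symm_apply_eq]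
  funext a
  have h1 : ∀ y, E ((ofFamily hsd hu hk hs).rep.spaceRep (u c) (ζ : ℤ) g y) a =
      symRep ((ofFamily hsd hu hk hs).k a.1) g (E y a) := by
    intro y
    rw [hE, hE]
    rfl
  rw [h1, LinearEquiv.apply_symm_apply]

include hsd hu hk hs in
theorem exists_of_family : ∃ D : ModelData q, (∀ a, ∃ c, D.v a = u c) ∧ ∀ c (ζ : ℤˣ),
    ∃ e : (∀ i, Fin (k c ζ i + 1) → ℂ) ≃ₗ[ℂ] D.rep.space (u c) (ζ : ℤ),
      ∀ g x, e (fun i => symRep (k c ζ i) g (x i)) = D.rep.spaceRep (u c) (ζ : ℤ) g (e x) :=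
  ⟨ofFamily hsd hu hk hs, fun a => ⟨a.1.1, rfl⟩, exists_ofFamily_equiv hsd hu hk hs⟩

end Family

end ModelData

theorem isOrbitOfRep_of_equiv {Y : Type*} [AddCommGroup Y] [Module ℂ Y] {σ : SL2C →* End ℂ Y}
    {I : Type} {k : I → ℕ} (e : (∀ i, Fin (k i + 1) → ℂ) ≃ₗ[ℂ] Y)
    (he : ∀ g c, e (fun i => symRep (k i) g (c i)) = σ g (e c)) {M : ℕ} {U : UnipotentOrbit M}
    {x : GL (Fin M) ℂ} {T : (∀ i, Fin (k i + 1) → ℂ) ≃ₗ[ℂ] (Fin M → ℂ)}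
    (hx : ConjClasses.mk x = U.1) (hT : ∀ c, T (piUnipotent k c) = x.1 *ᵥ T c) :
    IsOrbitOfRep σ U := by
  refine ⟨T.symm.trans e, x, hx, fun v => ?_⟩
  obtain ⟨c, rfl⟩ := T.surjective v
  rw [← hT, LinearEquiv.trans_apply, LinearEquiv.trans_apply, LinearEquiv.symm_apply_apply,
    LinearEquiv.symm_apply_apply, ← he]
  rfl

section Existence

variable {p : ℕ} [Fact p.Prime] {F : Type*} [Field F] [Algebra ℚ_[p] F]
  [FiniteDimensional ℚ_[p] F] {n : ℕ} {s : ↥(inertiaGroup p F)} {Fr : WeilGroup p F}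
  {χ : ↥(inertiaGroup p F) →* Sp n} (h : IsInertialType s Fr χ)

include h

/-- A model with prescribed orbits. -/
theorem exists_modelData (C : OrbitCollection (residueCard p F) (χ s)) :
    ∃ D : ModelData (residueCard p F),
      (∀ a, ∃ c : VPClass (residueCard p F) (χ s), D.v a = c.rep) ∧
      ∀ (c : VPClass (residueCard p F) (χ s)) (ζ : ℤˣ),
        IsOrbitOfRep (D.rep.spaceRep c.rep (ζ : ℤ)) (C.U c ζ) := by
  have := finite_VPClass h
  have := Fintype.ofFinite (VPClass (residueCard p F) (χ s))
  have hadm : ∀ c ζ, (C.U c ζ).IsAdmissible c.rep ζ := fun c ζ => by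
    have h1 := C.isAdmissible c.rep ζ
    rwa [VPClass.mk_rep] at h1
  choose I hI k x T hx hT hk hs using fun c ζ => (hadm c ζ).exists_data
  have heq : ∀ (c c' : VPClass (residueCard p F) (χ s)) (j : ℕ),
      (c'.rep : ℂ) = (c.rep : ℂ) ^ residueCard p F ^ j → c = c' := by
    intro c c' j hj
    rw [← VPClass.mk_rep c, ← VPClass.mk_rep c']
    exact h.mk_eq_mk_iff.2 ⟨j, hj⟩
  obtain ⟨D, hD, hD'⟩ := ModelData.exists_of_family
    (u := fun c : VPClass (residueCard p F) (χ s) => (c.rep : ℂ))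
    (fun c => h.isSelfDual c.rep.2) heq hk hs
  refine ⟨D, hD, fun c ζ => ?_⟩
  obtain ⟨e, he⟩ := hD' c ζ
  exact isOrbitOfRep_of_equiv e he (hx c ζ) (hT c ζ)

/-- The model is isometric to the standard symplectic space, compatibly with inertia. -/
theorem exists_model_isometry {C : OrbitCollection (residueCard p F) (χ s)}
    {D : ModelData (residueCard p F)}
    (hD : ∀ a, ∃ c : VPClass (residueCard p F) (χ s), D.v a = c.rep)
    (hU : ∀ (c : VPClass (residueCard p F) (χ s)) (ζ : ℤˣ),
      IsOrbitOfRep (D.rep.spaceRep c.rep (ζ : ℤ)) (C.U c ζ)) :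
    ∃ T : D.Space ≃ₗ[ℂ] (Fin n ⊕ Fin n → ℂ), (∀ x, T (D.rep.A x) = (χ s).toEnd (T x)) ∧
      ∀ x y, sympBilin n (T x) (T y) = D.rep.ω x y := by
  -- At a representative this is the condition on m([u], +) + m([u], -); on both sides the dimension
  -- is constant along a cycle.
  have hmult : ∀ μ, finrank ℂ (D.rep.A.eigenspace μ) = finrank ℂ ((χ s).toEnd.eigenspace μ) := by
    intro μ
    by_cases hμ : μ ∈ VP (χ s)
    · obtain ⟨j, hj⟩ := h.exists_eq_pow ⟨μ, hμ⟩
      set c := VPClass.mk (residueCard p F) (χ s) ⟨μ, hμ⟩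
      change μ = c.rep ^ residueCard p F ^ j at hj
      have hsd := h.isSelfDual c.rep.2
      have hu : ∀ a n, D.v a ^ residueCard p F ^ n = c.rep → D.v a = c.rep := fun a n ha => by
        obtain ⟨c', hc'⟩ := hD a
        rw [hc'] at ha ⊢
        have h1 := h.mk_eq_mk_iff.2 ⟨n, ha.symm⟩
        rw [VPClass.mk_rep, VPClass.mk_rep] at h1
        rw [h1]
      have h1 := TameRep.finrank_space_add (ModelData.eigenspace_eq hu hsd)
      have h2 := (hU c 1).finrank_eq
      have h3 := (hU c (-1)).finrank_eq
      have h4 := C.m_add c.rep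
      have h5 : (((1 : ℤˣ) : ℤ) : ℂ) = 1 := by norm_num
      have h6 : (((-1 : ℤˣ) : ℤ) : ℂ) = -1 := by norm_num
      rw [VPClass.mk_rep] at h4
      rw [h5] at h2
      rw [h6] at h3
      rw [h2, h3, h4, ← (h.pow_mem c.rep.2 j).2, ← hj] at h1
      rw [hj, TameRep.finrank_eigenspace_pow hsd, ← h1, ← hj]
      rfl
    · have h1 : ¬ D.rep.A.HasEigenvalue μ := by
        intro h1
        obtain ⟨a, m, rfl⟩ := ModelData.exists_of_hasEigenvalue h1
        obtain ⟨c, hc⟩ := hD a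
        exact hμ (by rw [hc]; exact (h.pow_mem c.rep.2 m).1)
      rw [hasEigenvalue_iff_finrank_pos] at h1
      change ¬ (χ s).toEnd.HasEigenvalue μ at hμ
      rw [hasEigenvalue_iff_finrank_pos] at hμ
      omega
  have htop : ⨆ μ, D.rep.A.eigenspace μ = ⊤ := by
    obtain ⟨N, hN, h1⟩ := h.exists_pow_pos
    refine iSup_eigenspace_of_isSemisimple (isSemisimple_of_pow_eq_one hN
      (ModelData.inertia_pow_eq_one fun a => ?_))
    obtain ⟨c, hc⟩ := hD a
    rw [hc, h.pow_eq_one_of_mem h1 c.rep.2]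
  obtain ⟨T, hT⟩ := exists_linearEquiv_of_finrank_eigenspace_eq htop
    (iSup_eigenspace_of_isSemisimple h.isSemisimple) hmult
  -- Only inertia has to be respected here: Frobenius and SL(2, ℂ) will be defined on ℂ^(2n) by
  -- transport from the model.
  obtain ⟨T', hT', hω⟩ := exists_isometry_of_equivariant D.rep.skew sympBilin_skew
    D.rep.nondegenerate sympBilin_nondegenerate (fun _ : Unit => D.rep.A)
    (fun _ : Unit => (χ s).toEnd) (fun _ => D.rep.ω_A) (fun _ => sympBilin_toEnd (χ s)) T
    fun _ => hT
  exact ⟨T', hT' (), hω⟩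

end Existence

end

/-! ### Construction of a parameter with prescribed orbits. -/

section

open Module

section Existence

variable {p : ℕ} [Fact p.Prime] {F : Type*} [Field F] [Algebra ℚ_[p] F]
  [FiniteDimensional ℚ_[p] F] {n : ℕ} {s : ↥(inertiaGroup p F)} {Fr : WeilGroup p F}
  {χ : ↥(inertiaGroup p F) →* Sp n}

theorem Sp.eq_of_toEnd {V : Type*} [AddCommGroup V] [Module ℂ V]
    (T : V ≃ₗ[ℂ] (Fin n ⊕ Fin n → ℂ)) {a b : Sp n} (h : ∀ x, a.toEnd (T x) = b.toEnd (T x)) :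
    a = b :=
  Sp.toEnd_injective (LinearMap.ext fun y => by
    obtain ⟨x, rfl⟩ := T.surjective y
    exact h x)

theorem TameRep.ω_Φ {q : ℕ} {V : Type*} [AddCommGroup V] [Module ℂ V] (X : TameRep q V) (x y : V) :
    X.ω (X.Φ x) (X.Φ y) = X.ω x y := by
  rw [← X.ω_Ψ, X.Ψ_Φ, X.Ψ_Φ]

/-- Transport of a symplectic representation to the standard symplectic space. -/
theorem TameRep.exists_symplectic {q : ℕ} {V : Type*} [AddCommGroup V] [Module ℂ V]
    (X : TameRep q V) (T : V ≃ₗ[ℂ] (Fin n ⊕ Fin n → ℂ)) {A : Sp n}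
    (hA : ∀ x, T (X.A x) = A.toEnd (T x)) (hω : ∀ x y, sympBilin n (T x) (T y) = X.ω x y) :
    ∃ (Φ : Sp n) (ρ : SL2C →* Sp n), (∀ x, T (X.Φ x) = Φ.toEnd (T x)) ∧
      (∀ g x, T (X.ρ g x) = (ρ g).toEnd (T x)) ∧ Φ * A * Φ⁻¹ = A ^ q ∧
      (∀ g, A * ρ g = ρ g * A) ∧ ∀ g, Φ * ρ g = ρ g * Φ := by
  have key : ∀ f : End ℂ V, (∀ x y, X.ω (f x) (f y) = X.ω x y) →
      ∃ g : Sp n, ∀ x, T (f x) = g.toEnd (T x) := by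
    intro f hf
    obtain ⟨g, hg⟩ := exists_toEnd_eq (T.toLinearMap ∘ₗ f ∘ₗ T.symm.toLinearMap) (by
      intro v w
      obtain ⟨x, rfl⟩ := T.surjective v
      obtain ⟨y, rfl⟩ := T.surjective w
      change sympBilin n (T (f (T.symm (T x)))) (T (f (T.symm (T y)))) = _
      rw [T.symm_apply_apply, T.symm_apply_apply, hω, hω, hf])
    refine ⟨g, fun x => ?_⟩
    rw [hg]
    change _ = T (f (T.symm (T x)))
    rw [T.symm_apply_apply]
  obtain ⟨Φ, hΦ⟩ := key X.Φ X.ω_Φ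
  choose r hr using fun g => key (X.ρ g) (X.ω_ρ g)
  have hApow : ∀ (m : ℕ) x, T ((X.A ^ m) x) = (A ^ m).toEnd (T x) := by
    intro m x
    induction m with
    | zero => rw [pow_zero, pow_zero, Sp.toEnd_one]; rfl
    | succ m ih => rw [pow_succ', pow_succ', End.mul_apply, hA, ih, Sp.toEnd_mul, End.mul_apply]
  refine ⟨Φ, ⟨⟨r, Sp.eq_of_toEnd T fun x => ?_⟩, fun g g' => Sp.eq_of_toEnd T fun x => ?_⟩, hΦ, hr,
    ?_, fun g => Sp.eq_of_toEnd T fun x => ?_, fun g => Sp.eq_of_toEnd T fun x => ?_⟩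
  · rw [← hr, map_one, Sp.toEnd_one, End.one_apply, End.one_apply]
  · rw [← hr, map_mul, Sp.toEnd_mul, End.mul_apply, End.mul_apply, hr, hr]
  · rw [mul_inv_eq_iff_eq_mul]
    refine Sp.eq_of_toEnd T fun x => ?_
    rw [Sp.toEnd_mul, Sp.toEnd_mul, End.mul_apply, End.mul_apply, ← hA, ← hΦ, ← hΦ, TameRep.Φ_A,
      hApow]
  · change (A * r g).toEnd (T x) = (r g * A).toEnd (T x)
    rw [Sp.toEnd_mul, Sp.toEnd_mul, End.mul_apply, End.mul_apply, ← hr, ← hA, ← hA, ← hr, X.A_ρ]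
  · change (Φ * r g).toEnd (T x) = (r g * Φ).toEnd (T x)
    rw [Sp.toEnd_mul, Sp.toEnd_mul, End.mul_apply, End.mul_apply, ← hr, ← hΦ, ← hΦ, ← hr,
      TameRep.Φ_ρ]

/-- An algebraic representation with values in the symplectic group has polynomial coefficients. -/
theorem IsAlgebraicRep.exists_coeff {V : Type*} [AddCommGroup V] [Module ℂ V]
    {σ : SL2C →* End ℂ V} (hσ : IsAlgebraicRep σ) (T : V ≃ₗ[ℂ] (Fin n ⊕ Fin n → ℂ))
    {ρ : SL2C →* Sp n} (hρ : ∀ g x, T (σ g x) = (ρ g).toEnd (T x)) :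
    ∃ P : Fin n ⊕ Fin n → Fin n ⊕ Fin n → MvPolynomial (Fin 2 × Fin 2) ℂ,
      ∀ (g : SL2C) (i j : Fin n ⊕ Fin n),
        (ρ g : Matrix (Fin n ⊕ Fin n) (Fin n ⊕ Fin n) ℂ) i j =
          MvPolynomial.eval (fun k => (g : Matrix (Fin 2) (Fin 2) ℂ) k.1 k.2) (P i j) := by
  choose P hP using fun i j : Fin n ⊕ Fin n =>
    hσ (LinearMap.proj i ∘ₗ T.toLinearMap) (T.symm (Pi.single j 1))
  refine ⟨P, fun g i j => ?_⟩
  rw [← hP]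
  change _ = T (σ g (T.symm (Pi.single j 1))) i
  rw [hρ, T.apply_symm_apply]
  change _ = ((ρ g : Matrix (Fin n ⊕ Fin n) (Fin n ⊕ Fin n) ℂ) *ᵥ Pi.single j 1) i
  rw [mulVec_single_one, col_apply]

theorem continuous_of_coeff {ρ : SL2C →* Sp n}
    (hρ : ∃ P : Fin n ⊕ Fin n → Fin n ⊕ Fin n → MvPolynomial (Fin 2 × Fin 2) ℂ,
      ∀ (g : SL2C) (i j : Fin n ⊕ Fin n),
        (ρ g : Matrix (Fin n ⊕ Fin n) (Fin n ⊕ Fin n) ℂ) i j =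
          MvPolynomial.eval (fun k => (g : Matrix (Fin 2) (Fin 2) ℂ) k.1 k.2) (P i j)) :
    Continuous ρ := by
  obtain ⟨P, hP⟩ := hρ
  refine continuous_induced_rng.2 (continuous_matrix fun i j => ?_)
  have h1 : (fun g : SL2C => (ρ g : Matrix (Fin n ⊕ Fin n) (Fin n ⊕ Fin n) ℂ) i j) = fun g : SL2C =>
      MvPolynomial.eval (fun k => (g : Matrix (Fin 2) (Fin 2) ℂ) k.1 k.2) (P i j) :=
    funext fun g => hP g i j
  change Continuous fun g : SL2C => (ρ g : Matrix (Fin n ⊕ Fin n) (Fin n ⊕ Fin n) ℂ) i j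
  rw [h1]
  exact (MvPolynomial.continuous_eval _).comp (continuous_pi fun k =>
    continuous_subtype_val.matrix_elem k.1 k.2)

theorem exists_inertia_pow_mul (i : ↥(inertiaGroup p F)) (k : ℤ) (m : ℕ) :
    ∃ i' : ↥(inertiaGroup p F), (inertiaToWeil p F i * Fr ^ k) ^ m =
      inertiaToWeil p F i' * Fr ^ (k * m) := by
  induction m with
  | zero => exact ⟨1, by simp⟩
  | succ m ih =>
    obtain ⟨i', hi'⟩ := ih
    refine ⟨i' * (Fr ^ (k * m)).conjInertia i, ?_⟩
    rw [pow_succ, hi', map_mul, WeilGroup.inertiaToWeil_conjInertia, Nat.cast_succ, mul_add, mul_one,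
      _root_.zpow_add]
    group

variable (h : IsInertialType s Fr χ)

include h

/-- Construction of a parameter from its restriction to inertia, the image of Frobenius and the
representation of `SL(2, ℂ)`. -/
theorem exists_tameParameter {Φ : Sp n} {ρ : SL2C →* Sp n}
    (hΦ : Φ * χ s * Φ⁻¹ = χ s ^ residueCard p F) (hAρ : ∀ g, χ s * ρ g = ρ g * χ s)
    (hΦρ : ∀ g, Φ * ρ g = ρ g * Φ) {m : ℕ} (hm : 0 < m) (hΦm : Φ ^ m = 1)
    (hρ : ∃ P : Fin n ⊕ Fin n → Fin n ⊕ Fin n → MvPolynomial (Fin 2 × Fin 2) ℂ,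
      ∀ (g : SL2C) (i j : Fin n ⊕ Fin n),
        (ρ g : Matrix (Fin n ⊕ Fin n) (Fin n ⊕ Fin n) ℂ) i j =
          MvPolynomial.eval (fun k => (g : Matrix (Fin 2) (Fin 2) ℂ) k.1 k.2) (P i j)) :
    ∃ ψ : WeilGroup p F × SL2C →* Sp n, IsTameParameter χ ψ ∧
      ψ (inertiaToWeil p F s, 1) = χ s ∧ ψ (Fr, 1) = Φ ∧ ∀ g, ψ (1, g) = ρ g := by
  -- Every χ(i) is a power of χ(s), so compatibility with Frobenius needs to be known only at s.
  obtain ⟨ψ₀, hcont, hi, hFr⟩ := h.frobenius.exists_extension χ h.continuous Φ (fun i => by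
    obtain ⟨j, hj⟩ := h.exists_pow_eq i
    rw [h.frobenius.map_conjInertia χ h.tame, hj, ← conj_pow, hΦ, ← pow_mul, ← pow_mul, mul_comm])
  have hcomm : ∀ w g, Commute (ψ₀ w) (ρ g) := by
    intro w g
    obtain ⟨i, k, rfl⟩ := h.frobenius.exists_mem_inertiaGroup_mul w
    obtain ⟨j, hj⟩ := h.exists_pow_eq i
    rw [map_mul, map_zpow, hi, hFr, hj]
    exact (Commute.pow_left (hAρ g) j).mul_left (Commute.zpow_left (hΦρ g) k)
  let ψ : WeilGroup p F × SL2C →* Sp n := MonoidHom.noncommCoprod ψ₀ ρ hcomm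
  have hψ : ∀ w g, ψ (w, g) = ψ₀ w * ρ g := fun w g => rfl
  have hψ1 : ∀ w, ψ (w, 1) = ψ₀ w := fun w => by rw [hψ, map_one, mul_one]
  have hψ2 : ∀ g, ψ (1, g) = ρ g := fun g => by rw [hψ, map_one, one_mul]
  refine ⟨ψ, ⟨⟨?_, fun w => ?_, ?_⟩, fun i hiP => ?_, 1, fun i => ?_⟩, ?_, ?_, hψ2⟩
  · exact (hcont.comp continuous_fst).mul ((continuous_of_coeff hρ).comp continuous_snd)
  · obtain ⟨i, k, rfl⟩ := h.frobenius.exists_mem_inertiaGroup_mul w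
    -- Semisimplicity comes from finite order: the m-th power of w is inertial up to a power of
    -- Fr^m, the latter maps to 1, and the image of inertia consists of powers of χ(s).
    obtain ⟨i', hi'⟩ := exists_inertia_pow_mul (Fr := Fr) i k m
    obtain ⟨j, hj⟩ := h.exists_pow_eq i'
    obtain ⟨N, hN, h1⟩ := h.exists_pow_pos
    refine isSemisimple_of_pow_eq_one (N := m * N) (Nat.mul_pos hm hN) ?_
    rw [hψ1, ← Sp.toEnd_pow, pow_mul, ← map_pow, hi', map_mul, map_zpow, hi, hFr, mul_comm k,
      _root_.zpow_mul, zpow_natCast, hΦm, _root_.one_zpow, mul_one, hj, ← pow_mul, mul_comm, pow_mul,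
      h1, one_pow, Sp.toEnd_one]
  · simp only [hψ2]
    exact hρ
  · rw [hψ1, hi, h.tame i hiP]
  · rw [hψ1, hi, one_mul, inv_one, mul_one]
  · rw [hψ1, hi]
  · rw [hψ1, hFr]

/-- Every collection of orbits comes from a parameter. -/
theorem exists_parameter (C : OrbitCollection (residueCard p F) (χ s)) :
    ∃ (ψ : WeilGroup p F × SL2C →* Sp n) (t : IsTameParameter χ ψ),
      (t.rep h).Anisotropic ∧ Corresponds s Fr χ ψ C := by
  obtain ⟨D, hD, hU⟩ := exists_modelData h C
  obtain ⟨T, hTA, hTω⟩ := exists_model_isometry h hD hU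
  obtain ⟨Φ, ρ, hTΦ, hTρ, hΦA, hAρ, hΦρ⟩ := D.rep.exists_symplectic T hTA hTω
  obtain ⟨m, hm, hmΦ⟩ := D.exists_shift_pow_eq_one
  have hΦm : Φ ^ m = 1 := by
    have h1 : ∀ (m : ℕ) x, T ((D.rep.Φ ^ m) x) = (Φ ^ m).toEnd (T x) := by
      intro m x
      induction m with
      | zero => rw [pow_zero, pow_zero, Sp.toEnd_one]; rfl
      | succ m ih => rw [pow_succ', pow_succ', End.mul_apply, hTΦ, ih, Sp.toEnd_mul, End.mul_apply]
    refine Sp.eq_of_toEnd T fun x => ?_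
    rw [← h1, Sp.toEnd_one, End.one_apply]
    exact congrArg T (LinearMap.congr_fun hmΦ x)
  obtain ⟨ψ, t, hψs, hψFr, hψρ⟩ := exists_tameParameter h hΦA hAρ hΦρ hm hΦm
    (D.rep.algebraic.exists_coeff T hTρ)
  have hA : ∀ x, T (D.rep.A x) = (t.rep h).A (T x) := by
    intro x
    change _ = (ψ (inertiaToWeil p F s, 1)).toEnd (T x)
    rw [hψs, hTA]
  have hΨ : ∀ x, T (D.rep.Ψ x) = (t.rep h).Ψ (T x) := by
    intro x
    change _ = ((ψ (Fr, 1))⁻¹).toEnd (T x)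
    refine (ψ (Fr, 1)).toEnd_injective_apply ?_
    rw [Sp.toEnd_apply_inv, hψFr, ← hTΦ, D.rep.Φ_Ψ]
  have hρ : ∀ g x, T (D.rep.ρ g x) = (t.rep h).ρ g (T x) := by
    intro g x
    change _ = (ψ (1, g)).toEnd (T x)
    rw [hψρ, hTρ]
  refine ⟨ψ, t, TameRep.Anisotropic.of_equiv T hA hΨ hρ hTω D.anisotropic,
    (corresponds_iff h t).2 fun c ζ => ?_⟩
  obtain ⟨S, hS⟩ := TameRep.exists_spaceRep_equiv_of_equiv T hA hΨ hρ c.rep (ζ : ℤ)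
  exact (hU c ζ).trans S fun y => hS _ y

end Existence

end

end

theorem mainTheorem4 (p : ℕ) [Fact p.Prime] (hp : p ≠ 2)
    (F : Type*) [Field F] [Algebra ℚ_[p] F] [FiniteDimensional ℚ_[p] F] (n : ℕ)
    -- a generator of tame inertia and a lift of Frobenius
    (s : ↥(inertiaGroup p F)) (hs : IsTameGenerator s)
    (Fr : WeilGroup p F) (hFr : IsFrobeniusLift Fr)
    -- the fixed restriction to inertia
    (χ : ↥(inertiaGroup p F) →* Sp n) (hχ_cont : Continuous χ)
    (hχ_tame : ∀ i : ↥(inertiaGroup p F),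
      (i : Gal(AlgebraicClosure F/F)) ∈ wildInertiaGroup p F → χ i = 1)
    -- the multiplicities are stable under Frobenius
    (hχ_frob : ∀ u ∈ VP (χ s), u ^ residueCard p F ∈ VP (χ s) ∧
      eigMult (χ s) (u ^ residueCard p F) = eigMult (χ s) u)
    -- the inverse of any eigenvalue `u` lies in the class `[u]`
    (hχ_inv : ∀ u : VP (χ s), ∃ v : VP (χ s), (v : ℂ) = (u : ℂ)⁻¹ ∧
      VPClass.mk (residueCard p F) (χ s) v = VPClass.mk (residueCard p F) (χ s) u) :
    ∃ Φ : DiscreteParameterClass χ ≃ OrbitCollection (residueCard p F) (χ s),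
      ∀ (ψ : DiscreteParameter χ) (u : VP (χ s)) (ζ : ℤˣ),
        IsOrbitOf ψ.1 s Fr u ζ
          ((Φ (Quotient.mk (DiscreteParameter.setoid χ) ψ)).U
            (VPClass.mk (residueCard p F) (χ s) u) ζ) := by
  have h : IsInertialType s Fr χ := ⟨hp, hs, hFr, hχ_cont, hχ_tame, hχ_frob, hχ_inv⟩
  have hX : ∀ ψ : DiscreteParameter χ, (ψ.isTameParameter.rep h).Anisotropic := fun ψ =>
    (ψ.isTameParameter.isDiscreteParameter_iff h).1 ψ.2.2.2.1
  choose C hC using fun ψ : DiscreteParameter χ => exists_corresponds h ψ.isTameParameter (hX ψ)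
  -- Conjugation transports the joint eigenspaces, and a parameter has only one collection of
  -- orbits, so the choice is constant on conjugacy classes.
  let f : DiscreteParameterClass χ → OrbitCollection (residueCard p F) (χ s) :=
    Quotient.lift C (by
      rintro ψ ψ' ⟨g, hg⟩
      exact ((hC ψ).conj hg).unique h ψ'.isTameParameter (hC ψ'))
  refine ⟨Equiv.ofBijective f ⟨?_, fun D => ?_⟩, fun ψ => hC ψ⟩
  · rintro ⟨ψ⟩ ⟨ψ'⟩ hψ
    have hψ' : C ψ = C ψ' := hψ
    exact Quotient.sound ((hC ψ).exists_conj h ψ.isTameParameter (hX ψ) ψ'.isTameParameter (hX ψ')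
      (hψ' ▸ hC ψ'))
  · obtain ⟨ψ, t, ht, hD⟩ := exists_parameter h D
    let ψ' : DiscreteParameter χ :=
      ⟨ψ, t.langlands, t.levelZero, (t.isDiscreteParameter_iff h).2 ht, t.restricts⟩
    exact ⟨Quotient.mk _ ψ', (hC ψ').unique h t hD⟩
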